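/- Let $\mathbb K$ be an algebraically closed field of characteristic zero, $Q$ a finite quiver with vertex set $Q_0$ and arrow set $Q_1$ (sources $s$, targets $t$), $\overline Q$ its double, obtained by adding a reversed arrow $a^*$ for each $a\in Q_1$, and $\mathbf d\in\mathbb N^{Q_0}$ a dimension vector. Paths are composed like maps: $a_1a_2$ is a path if $s(a_1)=t(a_2)$. **Classical side.** Put $\mathbf w=\sum_{a\in Q_1}(aa^*-a^*a)\in\mathbb K\overline Q$, $\Pi Q=\mathbb K\overline Q/(\mathbf w)$ and $(\Pi Q)_\natural=\Pi Q/[\Pi Q,\Pi Q]$. For $a\in\overline Q$ let $[a]$ be the matrix of coordinate functions of $a$ on $\mathrm{Rep}(\overline Q,\mathbf d)=T^*\mathrm{Rep}(Q,\mathbf d)$; the Poisson bracket is normalized by $\{[a^*]_{ji},[a]_{ij}\}=1$ for $a\in Q_1$, all other brackets of coordinates being $0$. Let $\mu=\sum_{a\in Q_1}([a][a^*]-[a^*][a])$ be the moment map, whose values lie in $\mathfrak{gl}_{\mathbf d}^0=\{\xi\in\mathfrak{gl}_{\mathbf d}:\sum_k\mathrm{tr}\,\xi_k=0\}$; let $\mathbb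 K[\mathcal M_{\mathbf d}(Q)]=\mathbb K[\mu^{-1}(0)]^{\mathrm{GL}_{\mathbf d}}$ ($\mu^{-1}(0)$ being the scheme-theoretic fibre), and let $\mathrm{Tr}:(\Pi Q)_\natural\to\mathbb K[\mathcal M_{\mathbf d}(Q)]$ be $x\mapsto(\rho\mapsto\mathrm{tr}\,\rho(x))$. **Noncommutative quantum side.** $\mathbf N(Q)_\hbar$ is the $\mathbb K[\hbar]$-module generated by symmetric products of closed paths of positive length in $\overline Q$, whose arrows carry pairwise distinct heights in $\mathbb N$, and of vertices, where only the order of the heights matters, modulo the following skein relations. If the arrow $b$ has the next greater height after that of $a$ in the product $X$, and $X'$ is $X$ with these two heights exchanged, then $X=X'+\hbar\,\varepsilon(a,b)X''$. Here $\varepsilon(c^*,c)=1$ and $\varepsilon(c,c^*)=-1$ for $c\in Q_1$, and $\varepsilon=0$ otherwise. $X''$ arises by replacing two distinct components $au$ and $bv$ by the single component $uv$, and one component $aubv$ by the two components $u$ and $v$ (an empty cyclic word being read as the vertex at which it is based). The product $X*Y$ places $Y$ above $X$. Let $\mathcal R_q(\mathbf N(Q)_\hbar,\widehat{\mathbf w})$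 be the quotient of $\mathbf N(Q)_\hbar$ by the two-sided ideal generated by the elements $$\sum_{t(a)=k}\widehat{x_1\cdots x_r\,a\,a^*}-\sum_{s(a)=k}\widehat{x_1\cdots x_r\,a^*a}$$ for $k\in Q_0$ and closed paths $x_1\cdots x_r$ at $k$ ($r\ge 0$), where the hat means heights increasing from left to right. A lifting of $x\in(\Pi Q)_\natural$ is the class in $\mathcal R_q(\mathbf N(Q)_\hbar,\widehat{\mathbf w})$ of a $\mathbb K$-linear combination of vertices and of single closed paths with some distinct heights such that the same combination of the underlying vertices and paths represents $x$. **Quantum side.** $\mathcal D_\hbar=\mathcal D_\hbar(\mathrm{Rep}(Q,\mathbf d))$ is the $\mathbb K[\hbar]$-algebra of homogeneous differential operators, generated by functions $f$ and vector fields $X$ with $f*g=fg$, $f*X=fX$, $X*f=fX+\hbar X(f)$, $X*Y-Y*X=\hbar[X,Y]$. Let $\tau(\xi)$ be the vector field of the infinitesimal action of $\xi\in\mathfrak{gl}_{\mathbf d}$ on functions, $\tau(\xi)[a]=[a]\xi_{s(a)}-\xi_{t(a)}[a]$, let $\chi_0=-\sum_{k}\big(\sum_{s(a)=k}d_{t(a)}\big)\mathrm{tr}_k$,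 and put $$\mathcal B_\hbar=\frac{\mathcal D_\hbar^{\mathrm{GL}_{\mathbf d}}}{\big(\mathcal D_\hbar(\tau-\hbar\chi_0)(\mathfrak{gl}_{\mathbf d})\big)^{\mathrm{GL}_{\mathbf d}}}.$$ **Theorem (quantizations commute with trace maps: after reduction).** Assume that $\mu:T^*\mathrm{Rep}(Q,\mathbf d)\to\mathfrak{gl}^0_{\mathbf d}$ is flat. Then: 1. There is a homomorphism of $\mathbb K[\hbar]$-algebras $\mathrm{Tr}^q:\mathbf N(Q)_\hbar\to\mathcal D_\hbar^{\mathrm{GL}_{\mathbf d}}$, the quantum trace, which maps a product with arrows $a_1,\dots,a_N$ at the heights $1,\dots,N$ and vertices $v_1,\dots,v_m$ to $$d_{v_1}\cdots d_{v_m}\sum_{\kappa}\ \prod_{h=1}^{N}[a_h]_{\kappa(h),\kappa(h^+)},$$ where the factors are ordered by increasing $h$, $h^+$ is the height of the arrow that follows $a_h$ in its cyclic word, $\kappa(h)$ runs over the indices of the block of $t(a_h)$, and $[a^*]_{ij}=\partial/\partial[a]_{ji}$ for $a\in Q_1$. It induces a homomorphism of $\mathbb K[\hbar]$-algebras $\mathrm{Tr}^q:\mathcal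 R_q(\mathbf N(Q)_\hbar,\widehat{\mathbf w})\to\mathcal B_\hbar$. 2. The subspace $\big(\mathcal D_\hbar(\tau-\hbar\chi_0)(\mathfrak{gl}_{\mathbf d})\big)^{\mathrm{GL}_{\mathbf d}}$ is a two-sided ideal of $\mathcal D_\hbar^{\mathrm{GL}_{\mathbf d}}$; the Poisson bracket of $T^*\mathrm{Rep}(Q,\mathbf d)$ induces a bracket $\{-,-\}$ on $\mathbb K[\mathcal M_{\mathbf d}(Q)]$; and taking symbols, $[a]_{ij}\mapsto[a]_{ij}$, $\partial/\partial[a]_{ij}\mapsto[a^*]_{ji}$, $\hbar\mapsto0$, induces an isomorphism of $\mathbb K$-algebras $$\Phi:\mathcal B_\hbar/\hbar\mathcal B_\hbar\xrightarrow{\ \sim\ }\mathbb K[\mathcal M_{\mathbf d}(Q)]$$ such that $\Phi\big(\tfrac1\hbar(A*B-B*A)\big)=\{\Phi(A),\Phi(B)\}$ for all $A,B\in\mathcal D_\hbar^{\mathrm{GL}_{\mathbf d}}$, where $\tfrac1\hbar(A*B-B*A)$ is formed in $\mathcal D_\hbar^{\mathrm{GL}_{\mathbf d}}$. 3. Every element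 of $(\Pi Q)_\natural$ has a lifting. Let $x,y\in(\Pi Q)_\natural$, and let $\widehat x,\widehat y\in\mathbf N(Q)_\hbar$ be elements whose classes in $\mathcal R_q(\mathbf N(Q)_\hbar,\widehat{\mathbf w})$ are liftings of $x$ and $y$. Then $\Phi(\mathrm{Tr}^q(\widehat x))=\mathrm{Tr}(x)$, the commutator $\widehat x*\widehat y-\widehat y*\widehat x$ is divisible by $\hbar$ in $\mathbf N(Q)_\hbar$, and $$\Phi\Big(\mathrm{Tr}^q\big(\tfrac1\hbar(\widehat x*\widehat y-\widehat y*\widehat x)\big)\Big)=\{\mathrm{Tr}(x),\mathrm{Tr}(y)\},$$ where $\tfrac1\hbar(\widehat x*\widehat y-\widehat y*\widehat x)$ stands for any $Z\in\mathbf N(Q)_\hbar$ with $\hbar Z=\widehat x*\widehat y-\widehat y*\widehat x$. -/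

import Mathlib

open scoped Matrix Polynomial

noncomputable section

namespace QuiverQuantization

universe u v w

/-! ### Doubled quivers -/

section Arrows

variable (V : Type v) [Quiver.{w} V]

/-- The set `Q₁` of all arrows of the quiver `Q` on the vertex set `V`. -/
abbrev Arr : Type (max v w) := Σ i : V, Σ j : V, (i ⟶ j)

/-- The arrows of the double: `Sum.inl a` is `a`, and `Sum.inr a` is the reversed arrow `a*`. -/
abbrev DArr : Type (max v w) := Arr V ⊕ Arr V

end Arrows

section ArrowMaps

variable {V : Type v} [Quiver.{w} V]

def Arr.src (a : Arr V) : V := a.1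

def Arr.tgt (a : Arr V) : V := a.2.1

def DArr.src : DArr V → V := Sum.elim Arr.src Arr.tgt

def DArr.tgt : DArr V → V := Sum.elim Arr.tgt Arr.src

open Classical in
/-- The pairing of arrows of the double: `{a*, a} = 1`, `{a, a*} = -1`, all others vanish. -/
def pairing (K : Type u) [Field K] : DArr V → DArr V → K
  | Sum.inr a, Sum.inl b => if a = b then 1 else 0
  | Sum.inl a, Sum.inr b => if a = b then -1 else 0
  | _, _ => 0

end ArrowMaps

/-! ### The path algebra of the double and the preprojective algebra -/

section PathAlgebra

variable (K : Type u) [Field K] (V : Type v) [Quiver.{w} V] [Fintype V]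

/-- Relations of the path algebra of the double. Paths compose like maps: the product
`a₁ a₂` is a path when the source of `a₁` is the target of `a₂`. -/
inductive PathRel : FreeAlgebra K (V ⊕ DArr V) → FreeAlgebra K (V ⊕ DArr V) → Prop
  | idem (i : V) : PathRel
      (FreeAlgebra.ι K (Sum.inl i) * FreeAlgebra.ι K (Sum.inl i)) (FreeAlgebra.ι K (Sum.inl i))
  | orth (i j : V) : i ≠ j → PathRel
      (FreeAlgebra.ι K (Sum.inl i) * FreeAlgebra.ι K (Sum.inl j)) 0
  | unit : PathRel (∑ i : V, FreeAlgebra.ι K (Sum.inl i)) 1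
  | tgt (a : DArr V) : PathRel
      (FreeAlgebra.ι K (Sum.inl (DArr.tgt a)) * FreeAlgebra.ι K (Sum.inr a))
      (FreeAlgebra.ι K (Sum.inr a))
  | src (a : DArr V) : PathRel
      (FreeAlgebra.ι K (Sum.inr a) * FreeAlgebra.ι K (Sum.inl (DArr.src a)))
      (FreeAlgebra.ι K (Sum.inr a))

/-- The path algebra of the double of the quiver. -/
def DoublePathAlg : Type (max u v w) := RingQuot (PathRel K V)

instance : Ring (DoublePathAlg K V) := inferInstanceAs (Ring (RingQuot (PathRel K V)))

instance : Algebra K (DoublePathAlg K V) := inferInstanceAs (Algebra K (RingQuot (PathRel K V)))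

variable {V} in
def vertexElt (i : V) : DoublePathAlg K V :=
  RingQuot.mkAlgHom K (PathRel K V) (FreeAlgebra.ι K (Sum.inl i))

variable {V} in
def arrowElt (a : DArr V) : DoublePathAlg K V :=
  RingQuot.mkAlgHom K (PathRel K V) (FreeAlgebra.ι K (Sum.inr a))

variable [∀ i j : V, Fintype (i ⟶ j)]

/-- The noncommutative moment map `w = ∑ (a a* - a* a)`. -/
def ncMoment : DoublePathAlg K V :=
  ∑ a : Arr V, (arrowElt K (Sum.inl a) * arrowElt K (Sum.inr a)
    - arrowElt K (Sum.inr a) * arrowElt K (Sum.inl a))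

/-- The relation `w = 0`. -/
def PreprojRel (x y : DoublePathAlg K V) : Prop := x = ncMoment K V ∧ y = 0

/-- The preprojective algebra: the path algebra of the double modulo the two-sided ideal
generated by `w`. -/
def Preproj : Type (max u v w) := RingQuot (PreprojRel K V)

instance : Ring (Preproj K V) := inferInstanceAs (Ring (RingQuot (PreprojRel K V)))

instance : Algebra K (Preproj K V) := inferInstanceAs (Algebra K (RingQuot (PreprojRel K V)))

def Preproj.mk : DoublePathAlg K V →ₐ[K] Preproj K V := RingQuot.mkAlgHom K (PreprojRel K V)

/-- The span of all commutators of the preprojective algebra. -/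
def commutatorSpan : Submodule K (Preproj K V) :=
  Submodule.span K {z | ∃ a b : Preproj K V, z = a * b - b * a}

/-- The quotient of the preprojective algebra by the span of its commutators. -/
abbrev PreprojCyc : Type (max u v w) := Preproj K V ⧸ commutatorSpan K V

/-- The class in `PreprojCyc` of an element of the path algebra. -/
def toCyc : DoublePathAlg K V →ₗ[K] PreprojCyc K V :=
  (commutatorSpan K V).mkQ ∘ₗ (Preproj.mk K V).toLinearMap

end PathAlgebra

/-! ### The quantized necklace algebra -/

section Necklace

variable (V : Type v) [Quiver.{w} V]

/-- A symmetric product of cyclic words in arrows with heights and of vertices. -/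
@[ext]
structure HeightMonomial where
  cycles : Multiset (Cycle (DArr V × ℕ))
  verts : Multiset V

variable {V}

namespace HeightMonomial

def heights (X : HeightMonomial V) : Multiset ℕ :=
  X.cycles.bind fun c => c.toMultiset.map Prod.snd

/-- Every cyclic word is a nonempty closed path, and all the heights are distinct. -/
def Valid (X : HeightMonomial V) : Prop :=
  (∀ c ∈ X.cycles, c ≠ Cycle.nil ∧ c.Chain fun p q => DArr.src p.1 = DArr.tgt q.1) ∧
    X.heights.Nodup

/-- The symmetric product. -/
def mul (X Y : HeightMonomial V) : HeightMonomial V :=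
  ⟨X.cycles + Y.cycles, X.verts + Y.verts⟩

def mapHeights (f : ℕ → ℕ) (X : HeightMonomial V) : HeightMonomial V :=
  ⟨X.cycles.map fun c => c.map fun p => (p.1, f p.2), X.verts⟩

/-- `X & w`, where an empty word `w` is read as the vertex `i`. -/
def addWord (X : HeightMonomial V) (i : V) : List (DArr V × ℕ) → HeightMonomial V
  | [] => ⟨X.cycles, i ::ₘ X.verts⟩
  | p :: l => ⟨((p :: l : List (DArr V × ℕ)) : Cycle (DArr V × ℕ)) ::ₘ X.cycles, X.verts⟩

/-- `X & w` for a nonempty word `w`. -/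
def addCycle (X : HeightMonomial V) (l : List (DArr V × ℕ)) : HeightMonomial V :=
  ⟨(l : Cycle (DArr V × ℕ)) ::ₘ X.cycles, X.verts⟩

/-- The empty product. -/
def empty : HeightMonomial V := ⟨0, 0⟩

/-- No arrow of `X` has a height strictly between `m` and `n`. -/
def NoneBetween (X : HeightMonomial V) (m n : ℕ) : Prop :=
  ∀ h ∈ X.heights, ¬ (m < h ∧ h < n)

end HeightMonomial

open HeightMonomial

variable (K : Type u) [Field K]

open Classical in
/-- The generator attached to a monomial (`0` if the monomial is not admissible). -/
def preSym (X : HeightMonomial V) : FreeAlgebra K[X] {X : HeightMonomial V // X.Valid} :=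
  if h : X.Valid then FreeAlgebra.ι K[X] ⟨X, h⟩ else 0

/-- The relations of the quantized necklace algebra, with `ħ = Polynomial.X`. The product
`X * Y` places `Y` above `X`; only the order of the heights matters; and two arrows at
consecutive heights are exchanged by the skein relations, where the higher arrow is either on a
different component or on the same component as the lower one. -/
inductive NecklaceRel :
    FreeAlgebra K[X] {X : HeightMonomial V // X.Valid} →
      FreeAlgebra K[X] {X : HeightMonomial V // X.Valid} → Prop
  | one : NecklaceRel (preSym K HeightMonomial.empty) 1
  | mul (X Y : HeightMonomial V) : X.Valid → Y.Valid →
      (∀ m ∈ X.heights, ∀ n ∈ Y.heights, m < n) →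
      NecklaceRel (preSym K X * preSym K Y) (preSym K (X.mul Y))
  | relabel (X : HeightMonomial V) (f : ℕ → ℕ) : X.Valid → StrictMono f →
      NecklaceRel (preSym K X) (preSym K (X.mapHeights f))
  | skein_diff (X : HeightMonomial V) (a b : DArr V) (m n : ℕ) (r s : List (DArr V × ℕ)) :
      m < n →
      ((X.addCycle ((a, m) :: r)).addCycle ((b, n) :: s)).Valid →
      ((X.addCycle ((a, m) :: r)).addCycle ((b, n) :: s)).NoneBetween m n →
      NecklaceRel
        (preSym K ((X.addCycle ((a, m) :: r)).addCycle ((b, n) :: s)))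
        (preSym K ((X.addCycle ((a, n) :: r)).addCycle ((b, m) :: s))
          + (Polynomial.X * Polynomial.C (pairing K a b) : K[X]) •
            preSym K (X.addWord (DArr.src a) (r ++ s)))
  | skein_same (X : HeightMonomial V) (a b : DArr V) (m n : ℕ) (r s : List (DArr V × ℕ)) :
      m < n →
      (X.addCycle ((a, m) :: r ++ (b, n) :: s)).Valid →
      (X.addCycle ((a, m) :: r ++ (b, n) :: s)).NoneBetween m n →
      NecklaceRel
        (preSym K (X.addCycle ((a, m) :: r ++ (b, n) :: s)))
        (preSym K (X.addCycle ((a, n) :: r ++ (b, m) :: s))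
          + (Polynomial.X * Polynomial.C (pairing K a b) : K[X]) •
            preSym K ((X.addWord (DArr.src b) s).addWord (DArr.src a) r))

variable (V) in
/-- The quantized necklace algebra `N(Q)_ħ` over `K[ħ]`. By the relations `one`, `mul` and
`relabel` it is spanned by the classes of monomials, so it is the module of monomials modulo the
skein relations, together with its product. -/
def Necklace : Type (max u v w) := RingQuot (NecklaceRel (V := V) K)

instance : Ring (Necklace V K) := inferInstanceAs (Ring (RingQuot (NecklaceRel (V := V) K)))

instance : Algebra K[X] (Necklace V K) :=
  inferInstanceAs (Algebra K[X] (RingQuot (NecklaceRel (V := V) K)))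

/-- The class of a monomial in `N(Q)_ħ`. -/
def sym (X : HeightMonomial V) : Necklace V K :=
  RingQuot.mkAlgHom K[X] (NecklaceRel K) (preSym K X)

/-- The lifting of a word whose heights increase from left to right
(`0` if the word is not a nonempty closed path). -/
def wordLift (l : List (DArr V)) : Necklace V K :=
  sym K (HeightMonomial.empty.addCycle l.zipIdx)

variable [DecidableEq V] [Fintype V] [∀ i j : V, Fintype (i ⟶ j)]

/-- The lifting of `x₁ ⋯ xᵣ w`, for a closed path `x₁ ⋯ xᵣ` at the vertex `k`. -/
def momentLift (k : V) (l : List (DArr V)) : Necklace V K :=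
  ∑ a : Arr V with Arr.tgt a = k, wordLift K (l ++ [Sum.inl a, Sum.inr a])
    - ∑ a : Arr V with Arr.src a = k, wordLift K (l ++ [Sum.inr a, Sum.inl a])

variable (V) in
/-- The relations saying that the liftings of the cyclic words `x₁ ⋯ xᵣ w` vanish. -/
def QReductionRel (x y : Necklace V K) : Prop := (∃ k l, x = momentLift K k l) ∧ y = 0

variable (V) in
/-- The noncommutative quantum reduction: `N(Q)_ħ` modulo the two-sided ideal generated by the
liftings of the cyclic words `x₁ ⋯ xᵣ w`. -/
def QReduction : Type (max u v w) := RingQuot (QReductionRel V K)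

instance : Ring (QReduction V K) := inferInstanceAs (Ring (RingQuot (QReductionRel V K)))

instance : Algebra K[X] (QReduction V K) :=
  inferInstanceAs (Algebra K[X] (RingQuot (QReductionRel V K)))

variable (V) in
def QReduction.mk : Necklace V K →ₐ[K[X]] QReduction V K :=
  RingQuot.mkAlgHom K[X] (QReductionRel V K)

/-- `IsLifting ξ x`: the element `ξ` of the noncommutative quantum reduction is a lifting of
`x`, i.e. for some way of writing `x` as a linear combination of classes of closed paths, `ξ` is
the same combination of the same cyclic words with (distinct) heights. -/
inductive IsLifting : QReduction V K → PreprojCyc K V → Prop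
  | zero : IsLifting 0 0
  | vertex (i : V) : IsLifting (QReduction.mk V K (sym K ⟨0, {i}⟩)) (toCyc K V (vertexElt K i))
  | word (l : List (DArr V × ℕ)) : (HeightMonomial.empty.addCycle l).Valid →
      IsLifting (QReduction.mk V K (sym K (HeightMonomial.empty.addCycle l)))
        (toCyc K V (l.map fun p => arrowElt K p.1).prod)
  | add (ξ η : QReduction V K) (x y : PreprojCyc K V) :
      IsLifting ξ x → IsLifting η y → IsLifting (ξ + η) (x + y)
  | smul (c : K) (ξ : QReduction V K) (x : PreprojCyc K V) :
      IsLifting ξ x → IsLifting ((Polynomial.C c : K[X]) • ξ) (c • x)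

end Necklace

/-! ### Representation spaces -/

section Rep

/-- The index set `{1, …, |d|}`, split into the blocks of sizes `d k`. -/
abbrev Idx {V : Type v} (d : V → ℕ) : Type v := Σ k : V, Fin (d k)

/-- The group `GL_d`. -/
abbrev GLd (K : Type u) [Field K] {V : Type v} (d : V → ℕ) : Type (max u v) :=
  (k : V) → GL (Fin (d k)) K

set_option linter.unusedSectionVars false

variable (K : Type u) [Field K] {V : Type v} {E : Type w} (s t : E → V) (d : V → ℕ)

/-- The coordinates `[a]_{ij}` on the space of representations of dimension `d` of the quiver
with arrows `E`, sources `s` and targets `t`: `i` is in the block of the target of `a`, and `j`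
in that of its source. -/
abbrev Coord : Type (max v w) :=
  {c : E × Idx d × Idx d // c.2.1.1 = t c.1 ∧ c.2.2.1 = s c.1}

/-- The coordinate ring of the representation space. -/
abbrev RepRing : Type (max u v w) := MvPolynomial (Coord s t d) K

variable [DecidableEq V]

/-- The matrix `[a]` of coordinate functions of the arrow `a`. -/
def genMat (a : E) : Matrix (Idx d) (Idx d) (RepRing K s t d) :=
  Matrix.of fun i j =>
    if h : i.1 = t a ∧ j.1 = s a then MvPolynomial.X ⟨(a, i, j), h⟩ else 0

variable {K d} in
/-- An element of `GL_d` as a block diagonal matrix. -/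
def glMat (g : GLd K d) : Matrix (Idx d) (Idx d) K :=
  Matrix.blockDiagonal' fun k => (g k : Matrix (Fin (d k)) (Fin (d k)) K)

variable [Fintype V]

variable {K d} in
/-- The action of `GL_d` on functions, `(g f)(ρ) = f(g⁻¹ ρ)`; it maps the matrix `[a]` to
`g⁻¹ [a] g`. -/
def repAct (g : GLd K d) : RepRing K s t d →ₐ[K] RepRing K s t d :=
  MvPolynomial.aeval fun c =>
    ((glMat g⁻¹).map MvPolynomial.C * genMat K s t d c.1.1 * (glMat g).map MvPolynomial.C :
      Matrix (Idx d) (Idx d) (RepRing K s t d)) c.1.2.1 c.1.2.2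

theorem glMat_one : glMat (1 : GLd K d) = 1 := by
  simp [glMat]
  exact Matrix.blockDiagonal'_one

theorem glMat_mul (g h : GLd K d) : glMat (g * h) = glMat g * glMat h := by
  simp [glMat, Matrix.blockDiagonal'_mul]

theorem map_repAct_genMat (g : GLd K d) (a : E) :
    (genMat K s t d a).map (repAct s t g) =
      (glMat g⁻¹).map MvPolynomial.C * genMat K s t d a * (glMat g).map MvPolynomial.C := by
  ext1 i j
  by_cases h : i.1 = t a ∧ j.1 = s a
  · simp [genMat, h, repAct]
  · have h0 : genMat K s t d a i j = 0 := by simp [genMat, h]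
    rw [Matrix.map_apply, h0, map_zero, Matrix.mul_apply]
    symm
    refine Finset.sum_eq_zero fun l _ => ?_
    rw [Matrix.mul_apply, Finset.sum_mul]
    refine Finset.sum_eq_zero fun k _ => ?_
    by_cases hi : i.1 = k.1
    · by_cases hj : l.1 = j.1
      · have : genMat K s t d a k l = 0 := by
          rw [genMat, Matrix.of_apply, dif_neg]
          rw [← hi, hj]
          exact h
        rw [this]; simp
      · have : glMat g l j = 0 := Matrix.blockDiagonal'_apply_ne _ _ _ hj
        simp [this]
    · have : glMat g⁻¹ i k = 0 := Matrix.blockDiagonal'_apply_ne _ _ _ hi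
      simp [this]

theorem repAct_comp (g h : GLd K d) :
    (repAct s t g).comp (repAct s t h) = repAct s t (g * h) := by
  refine MvPolynomial.algHom_ext fun c => ?_
  have key : ((genMat K s t d c.1.1).map (repAct s t h)).map (repAct s t g) =
      (genMat K s t d c.1.1).map (repAct s t (g * h)) := by
    have hC : ∀ M : Matrix (Idx d) (Idx d) K,
        (M.map (MvPolynomial.C (σ := Coord s t d))).map (repAct s t g) =
          M.map MvPolynomial.C := by
      intro M
      ext1 i j
      simp only [Matrix.map_apply]
      exact (repAct s t g).commutes _
    rw [map_repAct_genMat, Matrix.map_mul, Matrix.map_mul, hC, hC, map_repAct_genMat,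
      map_repAct_genMat, mul_inv_rev, glMat_mul, glMat_mul, Matrix.map_mul, Matrix.map_mul]
    simp only [Matrix.mul_assoc]
  have := congrFun (congrFun key c.1.2.1) c.1.2.2
  simpa [genMat, c.2] using this

theorem repAct_one : repAct s t (1 : GLd K d) = AlgHom.id K (RepRing K s t d) := by
  refine MvPolynomial.algHom_ext fun c => ?_
  have h : (1 : Matrix (Idx d) (Idx d) K).map (MvPolynomial.C (σ := Coord s t d)) = 1 :=
    Matrix.map_one _ (map_zero _) (map_one _)
  rw [repAct, MvPolynomial.aeval_X, inv_one, glMat_one, h, Matrix.one_mul, Matrix.mul_one]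
  simp [genMat, c.2]

variable {K d} in
/-- The action of an element of `GL_d` as an automorphism. -/
def repActEquiv (g : GLd K d) : RepRing K s t d ≃ₐ[K] RepRing K s t d :=
  AlgEquiv.ofAlgHom (repAct s t g) (repAct s t g⁻¹)
    (by rw [repAct_comp, mul_inv_cancel, repAct_one])
    (by rw [repAct_comp, inv_mul_cancel, repAct_one])

end Rep

/-! ### Homogeneous differential operators -/

section DiffOp

variable (K : Type u) [Field K] (T : Type v) [CommRing T] [Algebra K T]

/-- The relations of the homogeneous differential operators, with `ħ = Polynomial.X`;
`Sum.inl` marks functions and `Sum.inr` vector fields. -/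
inductive DiffOpRel :
    FreeAlgebra K[X] (T ⊕ Derivation K T T) → FreeAlgebra K[X] (T ⊕ Derivation K T T) → Prop
  | const (c : K) : DiffOpRel (FreeAlgebra.ι K[X] (Sum.inl (algebraMap K T c)))
      (algebraMap K[X] _ (Polynomial.C c))
  | fun_add (f g : T) : DiffOpRel (FreeAlgebra.ι K[X] (Sum.inl (f + g)))
      (FreeAlgebra.ι K[X] (Sum.inl f) + FreeAlgebra.ι K[X] (Sum.inl g))
  | der_add (D D' : Derivation K T T) : DiffOpRel (FreeAlgebra.ι K[X] (Sum.inr (D + D')))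
      (FreeAlgebra.ι K[X] (Sum.inr D) + FreeAlgebra.ι K[X] (Sum.inr D'))
  | fun_mul (f g : T) : DiffOpRel
      (FreeAlgebra.ι K[X] (Sum.inl f) * FreeAlgebra.ι K[X] (Sum.inl g))
      (FreeAlgebra.ι K[X] (Sum.inl (f * g)))
  | fun_der (f : T) (D : Derivation K T T) : DiffOpRel
      (FreeAlgebra.ι K[X] (Sum.inl f) * FreeAlgebra.ι K[X] (Sum.inr D))
      (FreeAlgebra.ι K[X] (Sum.inr (f • D)))
  | der_fun (D : Derivation K T T) (f : T) : DiffOpRel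
      (FreeAlgebra.ι K[X] (Sum.inr D) * FreeAlgebra.ι K[X] (Sum.inl f))
      (FreeAlgebra.ι K[X] (Sum.inr (f • D))
        + (Polynomial.X : K[X]) • FreeAlgebra.ι K[X] (Sum.inl (D f)))
  | der_der (D D' : Derivation K T T) : DiffOpRel
      (FreeAlgebra.ι K[X] (Sum.inr D) * FreeAlgebra.ι K[X] (Sum.inr D'))
      (FreeAlgebra.ι K[X] (Sum.inr D') * FreeAlgebra.ι K[X] (Sum.inr D)
        + (Polynomial.X : K[X]) • FreeAlgebra.ι K[X] (Sum.inr ⁅D, D'⁆))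

/-- The `K[ħ]`-algebra of homogeneous differential operators on the affine variety with
coordinate ring `T`. -/
def DiffOp : Type (max u v) := RingQuot (DiffOpRel K T)

instance : Ring (DiffOp K T) := inferInstanceAs (Ring (RingQuot (DiffOpRel K T)))

instance : Algebra K[X] (DiffOp K T) := inferInstanceAs (Algebra K[X] (RingQuot (DiffOpRel K T)))

/-- The quotient map from the free algebra. -/
def DiffOp.mk : FreeAlgebra K[X] (T ⊕ Derivation K T T) →ₐ[K[X]] DiffOp K T :=
  RingQuot.mkAlgHom K[X] (DiffOpRel K T)

variable {K T} in
theorem DiffOp.mk_rel {x y : FreeAlgebra K[X] (T ⊕ Derivation K T T)} (h : DiffOpRel K T x y) :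
    DiffOp.mk K T x = DiffOp.mk K T y :=
  RingQuot.mkAlgHom_rel _ h

variable {T}

/-- A function as a differential operator of degree `0`. -/
def DiffOp.ofFun (f : T) : DiffOp K T := DiffOp.mk K T (FreeAlgebra.ι K[X] (Sum.inl f))

variable {K}

/-- A vector field as a differential operator of degree `1`. -/
def DiffOp.ofDer (D : Derivation K T T) : DiffOp K T :=
  DiffOp.mk K T (FreeAlgebra.ι K[X] (Sum.inr D))

/-- The universal property of the algebra of homogeneous differential operators. -/
def DiffOp.lift {A : Type*} [Ring A] [Algebra K[X] A] (φ : T → A) (ψ : Derivation K T T → A)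
    (const : ∀ c : K, φ (algebraMap K T c) = algebraMap K[X] A (Polynomial.C c))
    (fun_add : ∀ f g, φ (f + g) = φ f + φ g)
    (der_add : ∀ D D', ψ (D + D') = ψ D + ψ D')
    (fun_mul : ∀ f g, φ f * φ g = φ (f * g))
    (fun_der : ∀ f D, φ f * ψ D = ψ (f • D))
    (der_fun : ∀ D f, ψ D * φ f = ψ (f • D) + (Polynomial.X : K[X]) • φ (D f))
    (der_der : ∀ D D', ψ D * ψ D' = ψ D' * ψ D + (Polynomial.X : K[X]) • ψ ⁅D, D'⁆) :
    DiffOp K T →ₐ[K[X]] A :=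
  RingQuot.liftAlgHom K[X] ⟨FreeAlgebra.lift K[X] (fun x => Sum.casesOn x φ ψ), by
    intro x y h
    cases h with
    | const c => simpa using const c
    | fun_add f g => simpa using fun_add f g
    | der_add D D' => simpa using der_add D D'
    | fun_mul f g => simpa using fun_mul f g
    | fun_der f D => simpa using fun_der f D
    | der_fun D f => simpa using der_fun D f
    | der_der D D' => simpa using der_der D D'⟩

/-- The vector field `e ∘ D ∘ e⁻¹`. -/
def conjDer (e : T ≃ₐ[K] T) (D : Derivation K T T) : Derivation K T T :=
  Derivation.mk' (e.toLinearMap ∘ₗ (D : T →ₗ[K] T) ∘ₗ e.symm.toLinearMap) (by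
    intro a b
    simp [Derivation.leibniz])

@[simp]
theorem conjDer_apply (e : T ≃ₐ[K] T) (D : Derivation K T T) (f : T) :
    conjDer e D f = e (D (e.symm f)) := rfl

/-- Conjugation of differential operators by an automorphism of the coordinate ring. -/
def DiffOp.conj (e : T ≃ₐ[K] T) : DiffOp K T →ₐ[K[X]] DiffOp K T :=
  DiffOp.lift (fun f => DiffOp.ofFun K (e f)) (fun D => DiffOp.ofDer (conjDer e D))
    (fun c => by simpa [DiffOp.ofFun] using DiffOp.mk_rel (.const (T := T) c))
    (fun f g => by simpa [DiffOp.ofFun] using DiffOp.mk_rel (.fun_add (e f) (e g)))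
    (fun D D' => by
      have : conjDer e (D + D') = conjDer e D + conjDer e D' := by ext; simp
      simpa [DiffOp.ofDer, this] using DiffOp.mk_rel (.der_add (conjDer e D) (conjDer e D')))
    (fun f g => by simpa [DiffOp.ofFun] using DiffOp.mk_rel (.fun_mul (e f) (e g)))
    (fun f D => by
      have : conjDer e (f • D) = e f • conjDer e D := by ext; simp
      simpa [DiffOp.ofFun, DiffOp.ofDer, this] using
        DiffOp.mk_rel (.fun_der (e f) (conjDer e D)))
    (fun D f => by
      have : conjDer e (f • D) = e f • conjDer e D := by ext; simp
      simpa [DiffOp.ofFun, DiffOp.ofDer, this] using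
        DiffOp.mk_rel (.der_fun (conjDer e D) (e f)))
    (fun D D' => by
      have : conjDer e ⁅D, D'⁆ = ⁅conjDer e D, conjDer e D'⁆ := by
        ext; simp [Derivation.commutator_apply]
      simpa [DiffOp.ofDer, this] using
        DiffOp.mk_rel (.der_der (conjDer e D) (conjDer e D')))

end DiffOp

/-! ### The quiver variety and its quantization -/

section Reduction

set_option linter.unusedSectionVars false

variable (K : Type u) [Field K] {V : Type v} [Quiver.{w} V] [Fintype V] [DecidableEq V]
  (d : V → ℕ)

/-- The coordinate ring of `Rep(Q, d)`. -/
abbrev FunRep : Type (max u v w) := RepRing K (Arr.src (V := V)) Arr.tgt d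

/-- The coordinate ring of `T*Rep(Q, d)`, which is the representation space of the double. -/
abbrev FunCot : Type (max u v w) := RepRing K (DArr.src (V := V)) DArr.tgt d

variable {d} in
/-- The coordinate `[a]_{ij}` as a coordinate on the cotangent space. -/
def posCoord (c : Coord (Arr.src (V := V)) Arr.tgt d) : Coord (DArr.src (V := V)) DArr.tgt d :=
  ⟨(Sum.inl c.1.1, c.1.2.1, c.1.2.2), c.2⟩

variable {d} in
/-- The coordinate `[a*]_{ji}`, which is the momentum dual to `[a]_{ij}`. -/
def momCoord (c : Coord (Arr.src (V := V)) Arr.tgt d) : Coord (DArr.src (V := V)) DArr.tgt d :=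
  ⟨(Sum.inr c.1.1, c.1.2.2, c.1.2.1), c.2.symm⟩

variable [∀ i j : V, Fintype (i ⟶ j)]

variable {K d} in
/-- The Poisson bracket on the cotangent space, normalized by `{[a*]_{ji}, [a]_{ij}} = 1`, that
is, a vector field and a function have the bracket `{D, f} = D f`. -/
def poisson (f g : FunCot K d) : FunCot K d :=
  ∑ c : Coord (Arr.src (V := V)) Arr.tgt d,
    (MvPolynomial.pderiv (momCoord c) f * MvPolynomial.pderiv (posCoord c) g
      - MvPolynomial.pderiv (posCoord c) f * MvPolynomial.pderiv (momCoord c) g)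

/-- The moment map `μ = ∑ ([a][a*] - [a*][a])`, as a block diagonal matrix of functions. -/
def momentMat : Matrix (Idx d) (Idx d) (FunCot K d) :=
  ∑ a : Arr V,
    (genMat K DArr.src DArr.tgt d (Sum.inl a) * genMat K DArr.src DArr.tgt d (Sum.inr a)
      - genMat K DArr.src DArr.tgt d (Sum.inr a) * genMat K DArr.src DArr.tgt d (Sum.inl a))

/-- The ideal of functions on `gl_d` that vanish on the trace zero part
`{ξ | ∑ k, tr ξ_k = 0}`, where `X (k, p, q)` is the `(p, q)` entry of the block `k`. -/
def traceIdeal : Ideal (MvPolynomial (Σ k : V, Fin (d k) × Fin (d k)) K) :=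
  Ideal.span {∑ k : V, ∑ p : Fin (d k), MvPolynomial.X ⟨k, p, p⟩}

/-- The pullback of functions on `gl_d` along the moment map. -/
def momentPullback : MvPolynomial (Σ k : V, Fin (d k) × Fin (d k)) K →ₐ[K] FunCot K d :=
  MvPolynomial.aeval fun c => momentMat K d ⟨c.1, c.2.1⟩ ⟨c.1, c.2.2⟩

theorem traceIdeal_le : ∀ f ∈ traceIdeal K d, momentPullback K d f = 0 := by
  have : traceIdeal K d ≤ RingHom.ker (momentPullback K d) := by
    rw [traceIdeal, Ideal.span_le, Set.singleton_subset_iff]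
    have h : Matrix.trace (momentMat K d) = 0 := by
      simp only [momentMat, Matrix.trace_sum, Matrix.trace_sub]
      refine Finset.sum_eq_zero fun a _ => ?_
      rw [Matrix.trace_mul_comm, sub_self]
    simpa [momentPullback, Matrix.trace, Fintype.sum_sigma] using h
  exact fun f hf => this hf

/-- The moment map takes its values in the trace zero part of `gl_d`; this says that it is flat
as a morphism from `T*Rep(Q, d)` to that space. -/
def MomentFlat : Prop :=
  RingHom.Flat (Ideal.Quotient.lift (traceIdeal K d) (momentPullback K d : _ →+* FunCot K d)
    (traceIdeal_le K d))

/-- The ideal of the zero fibre of the moment map. -/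
def momentIdeal : Ideal (FunCot K d) :=
  Ideal.span {f | ∃ i j, f = momentMat K d i j}

theorem map_repAct_momentMat (g : GLd K d) :
    (momentMat K d).map (repAct DArr.src DArr.tgt g) =
      (glMat g⁻¹).map MvPolynomial.C * momentMat K d * (glMat g).map MvPolynomial.C := by
  have hg : (glMat g).map (MvPolynomial.C (σ := Coord (DArr.src (V := V)) DArr.tgt d)) *
      (glMat g⁻¹).map MvPolynomial.C = 1 := by
    rw [← Matrix.map_mul, ← glMat_mul, mul_inv_cancel, glMat_one]
    exact Matrix.map_one _ (map_zero _) (map_one _)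
  have hp : ∀ a b : DArr V,
      (genMat K DArr.src DArr.tgt d a * genMat K DArr.src DArr.tgt d b).map
          (repAct DArr.src DArr.tgt g) =
        (glMat g⁻¹).map MvPolynomial.C *
          (genMat K DArr.src DArr.tgt d a * genMat K DArr.src DArr.tgt d b) *
          (glMat g).map MvPolynomial.C := by
    intro a b
    rw [Matrix.map_mul, map_repAct_genMat, map_repAct_genMat]
    calc _ = (glMat g⁻¹).map MvPolynomial.C * genMat K DArr.src DArr.tgt d a *
          ((glMat g).map MvPolynomial.C * (glMat g⁻¹).map MvPolynomial.C) *
          genMat K DArr.src DArr.tgt d b * (glMat g).map MvPolynomial.C := by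
            simp only [Matrix.mul_assoc]
      _ = _ := by rw [hg]; simp only [Matrix.mul_assoc, Matrix.one_mul]
  change (repAct DArr.src DArr.tgt g).toRingHom.mapMatrix (momentMat K d) = _
  rw [momentMat, map_sum, Matrix.mul_sum, Matrix.sum_mul]
  refine Finset.sum_congr rfl fun a _ => ?_
  rw [map_sub, Matrix.mul_sub, Matrix.sub_mul]
  exact congrArg₂ _ (hp _ _) (hp _ _)

theorem momentIdeal_le (g : GLd K d) :
    momentIdeal K d ≤ (momentIdeal K d).comap (repAct DArr.src DArr.tgt g) := by
  rw [momentIdeal, Ideal.span_le]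
  rintro _ ⟨i, j, rfl⟩
  have h := congrFun (congrFun (map_repAct_momentMat K d g) i) j
  rw [Matrix.map_apply] at h
  change repAct DArr.src DArr.tgt g (momentMat K d i j) ∈ momentIdeal K d
  rw [momentIdeal, h, Matrix.mul_apply]
  refine Ideal.sum_mem _ fun l _ => Ideal.mul_mem_right _ _ ?_
  rw [Matrix.mul_apply]
  exact Ideal.sum_mem _ fun k _ => Ideal.mul_mem_left _ _ (Ideal.subset_span ⟨k, l, rfl⟩)

/-- The coordinate ring of the zero fibre of the moment map. -/
def FunFibre : Type (max u v w) := FunCot K d ⧸ momentIdeal K d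

instance : CommRing (FunFibre K d) := inferInstanceAs (CommRing (FunCot K d ⧸ momentIdeal K d))

instance : Algebra K (FunFibre K d) := inferInstanceAs (Algebra K (FunCot K d ⧸ momentIdeal K d))

/-- Restriction of functions to the zero fibre. -/
def toFibre : FunCot K d →ₐ[K] FunFibre K d := Ideal.Quotient.mkₐ K (momentIdeal K d)

variable {K d} in
/-- The action of `GL_d` on the coordinate ring of the zero fibre. -/
def fibreAct (g : GLd K d) : FunFibre K d →ₐ[K] FunFibre K d :=
  Ideal.quotientMapₐ _ (repAct DArr.src DArr.tgt g) (momentIdeal_le K d g)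

/-- The coordinate ring of the quiver variety `μ⁻¹(0) // GL_d`. -/
def FunVariety : Subalgebra K (FunFibre K d) :=
  ⨅ g : GLd K d, AlgHom.equalizer (fibreAct g) (AlgHom.id K (FunFibre K d))

/-- `br` is the Poisson bracket on the coordinate ring of the quiver variety induced by
Hamiltonian reduction: the bracket of the restrictions of `f` and `g` is the restriction
of `{f, g}`. -/
def IsReducedBracket (br : FunVariety K d →ₗ[K] FunVariety K d →ₗ[K] FunVariety K d) : Prop :=
  ∀ (f g : FunCot K d) (hf : toFibre K d f ∈ FunVariety K d) (hg : toFibre K d g ∈ FunVariety K d),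
    (br ⟨toFibre K d f, hf⟩ ⟨toFibre K d g, hg⟩ : FunFibre K d) = toFibre K d (poisson f g)

/-! #### The classical trace -/

/-- The universal representation of dimension `d` of the path algebra of the double. -/
def univRep : DoublePathAlg K V →ₐ[K] Matrix (Idx d) (Idx d) (FunCot K d) :=
  RingQuot.liftAlgHom K
    ⟨FreeAlgebra.lift K (Sum.elim
      (fun k => Matrix.diagonal fun i => if i.1 = k then 1 else 0)
      (genMat K DArr.src DArr.tgt d)), by
      intro x y h
      cases h with
      | idem i =>
        simp only [map_mul, FreeAlgebra.lift_ι_apply, Sum.elim_inl, Matrix.diagonal_mul_diagonal]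
        congr 1; ext1 p; split_ifs <;> simp
      | orth i j hij =>
        simp only [map_mul, FreeAlgebra.lift_ι_apply, Sum.elim_inl, Matrix.diagonal_mul_diagonal,
          map_zero]
        rw [← Matrix.diagonal_zero]
        congr 1; ext1 p; split_ifs with h1 h2 <;> simp_all
      | unit =>
        simp only [map_sum, FreeAlgebra.lift_ι_apply, Sum.elim_inl, map_one]
        ext1 p q
        rw [Matrix.sum_apply]
        by_cases hpq : p = q
        · subst hpq; simp
        · simp [Matrix.diagonal_apply_ne _ hpq, Matrix.one_apply_ne hpq]
      | tgt a =>
        simp only [map_mul, FreeAlgebra.lift_ι_apply, Sum.elim_inl, Sum.elim_inr]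
        ext1 p q
        rw [Matrix.diagonal_mul]
        simp only [genMat, Matrix.of_apply]
        split_ifs with h1 h2 h2 <;> simp_all
      | src a =>
        simp only [map_mul, FreeAlgebra.lift_ι_apply, Sum.elim_inl, Sum.elim_inr]
        ext1 p q
        rw [Matrix.mul_diagonal]
        simp only [genMat, Matrix.of_apply]
        split_ifs with h1 h2 h2 <;> simp_all⟩

theorem univRep_arrow (a : DArr V) :
    univRep K d (arrowElt K a) = genMat K DArr.src DArr.tgt d a := by
  refine (RingQuot.liftAlgHom_mkAlgHom_apply K _ _ _).trans ?_
  simp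

theorem univRep_vertex (k : V) : univRep K d (vertexElt K k) =
    Matrix.diagonal fun i => if i.1 = k then 1 else 0 := by
  refine (RingQuot.liftAlgHom_mkAlgHom_apply K _ _ _).trans ?_
  simp

theorem univRep_ncMoment : univRep K d (ncMoment K V) = momentMat K d := by
  simp [ncMoment, momentMat, univRep_arrow]

/-- The universal representation of dimension `d` of the preprojective algebra. -/
def univRepPreproj : Preproj K V →ₐ[K] Matrix (Idx d) (Idx d) (FunFibre K d) :=
  RingQuot.liftAlgHom K
    ⟨(toFibre K d).mapMatrix.comp (univRep K d), by
      rintro x y ⟨rfl, rfl⟩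
      rw [map_zero, AlgHom.comp_apply, univRep_ncMoment]
      ext1 i j
      exact Ideal.Quotient.eq_zero_iff_mem.2 (Ideal.subset_span ⟨i, j, rfl⟩)⟩

theorem univRepPreproj_mk (x : DoublePathAlg K V) :
    univRepPreproj K d (Preproj.mk K V x) = (toFibre K d).mapMatrix (univRep K d x) := by
  exact RingQuot.liftAlgHom_mkAlgHom_apply K _ _ _

/-- The trace map on the preprojective algebra modulo commutators, as a function on the zero
fibre: `x ↦ (ρ ↦ tr ρ(x))`. -/
def fibreTrace : PreprojCyc K V →ₗ[K] FunFibre K d :=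
  (commutatorSpan K V).liftQ
    ((Matrix.traceLinearMap (Idx d) K (FunFibre K d)) ∘ₗ (univRepPreproj K d).toLinearMap) (by
      rw [commutatorSpan, Submodule.span_le]
      rintro _ ⟨a, b, rfl⟩
      simp [Matrix.trace_mul_comm (univRepPreproj K d a)])

/-- Conjugation of matrices by an invertible matrix of scalars. -/
def glConj (g : GLd K d) (A : Type*) [CommRing A] [Algebra K A] :
    Matrix (Idx d) (Idx d) A →ₐ[K] Matrix (Idx d) (Idx d) A :=
  AlgHom.ofLinearMap
    { toFun := fun M => (glMat g⁻¹).map (algebraMap K A) * M * (glMat g).map (algebraMap K A)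
      map_add' := fun M N => by rw [Matrix.mul_add, Matrix.add_mul]
      map_smul' := fun c M => by simp }
    (by
      change (glMat g⁻¹).map (algebraMap K A) * 1 * (glMat g).map (algebraMap K A) = 1
      rw [mul_one, ← Matrix.map_mul, ← glMat_mul, inv_mul_cancel, glMat_one]
      simp)
    (fun M N => by
      have h : (glMat g).map (algebraMap K A) * (glMat g⁻¹).map (algebraMap K A) = 1 := by
        rw [← Matrix.map_mul, ← glMat_mul, mul_inv_cancel, glMat_one]
        simp
      change _ * (M * N) * _ = (_ * M * _) * (_ * N * _)
      calc _ = (glMat g⁻¹).map (algebraMap K A) * M *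
            ((glMat g).map (algebraMap K A) * (glMat g⁻¹).map (algebraMap K A)) *
            N * (glMat g).map (algebraMap K A) := by rw [h]; simp only [mul_assoc, one_mul]
        _ = _ := by simp only [mul_assoc])

theorem trace_glConj (g : GLd K d) (A : Type*) [CommRing A] [Algebra K A]
    (M : Matrix (Idx d) (Idx d) A) : Matrix.trace (glConj K d g A M) = Matrix.trace M := by
  change Matrix.trace (_ * M * _) = _
  rw [Matrix.trace_mul_comm, ← mul_assoc, ← Matrix.map_mul, ← glMat_mul, mul_inv_cancel, glMat_one]
  simp

theorem repAct_univRep (g : GLd K d) :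
    (repAct DArr.src DArr.tgt g).mapMatrix.comp (univRep K d) =
      (glConj K d g (FunCot K d)).comp (univRep K d) := by
  apply RingQuot.ringQuot_ext'
  apply FreeAlgebra.hom_ext
  funext x
  rcases x with k | a
  · change (repAct DArr.src DArr.tgt g).mapMatrix (univRep K d (vertexElt K k)) =
      glConj K d g _ (univRep K d (vertexElt K k))
    rw [univRep_vertex]
    change _ = (glMat g⁻¹).map (algebraMap K (FunCot K d)) * _ *
      (glMat g).map (algebraMap K (FunCot K d))
    have hc : (glMat g⁻¹).map (algebraMap K (FunCot K d)) *
        Matrix.diagonal (fun i => if i.1 = k then 1 else 0) =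
        Matrix.diagonal (fun i => if i.1 = k then 1 else 0) *
          (glMat g⁻¹).map (algebraMap K (FunCot K d)) := by
      ext1 i j
      rw [Matrix.mul_diagonal, Matrix.diagonal_mul]
      by_cases hij : i.1 = j.1
      · rw [hij, mul_comm]
      · have : glMat g⁻¹ i j = 0 := Matrix.blockDiagonal'_apply_ne _ _ _ hij
        simp [this]
    rw [hc, mul_assoc, ← Matrix.map_mul, ← glMat_mul, inv_mul_cancel, glMat_one]
    ext1 i j
    by_cases hij : i = j
    · subst hij
      by_cases hk : i.1 = k <;> simp [hk]
    · simp [Matrix.diagonal_apply_ne _ hij, Matrix.one_apply_ne hij]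
  · change (repAct DArr.src DArr.tgt g).mapMatrix (univRep K d (arrowElt K a)) =
      glConj K d g _ (univRep K d (arrowElt K a))
    rw [univRep_arrow]
    exact map_repAct_genMat K DArr.src DArr.tgt d g a

theorem fibreTrace_mem (x : PreprojCyc K V) : fibreTrace K d x ∈ FunVariety K d := by
  rw [FunVariety, Algebra.mem_iInf]
  intro g
  obtain ⟨y, rfl⟩ := (commutatorSpan K V).mkQ_surjective x
  obtain ⟨z, rfl⟩ := RingQuot.mkAlgHom_surjective K _ y
  have h1 : fibreTrace K d ((commutatorSpan K V).mkQ (Preproj.mk K V z)) =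
      toFibre K d (Matrix.trace (univRep K d z)) := by
    simp only [fibreTrace, Submodule.mkQ_apply, Submodule.liftQ_apply, LinearMap.comp_apply,
      AlgHom.toLinearMap_apply, univRepPreproj_mk]
    exact (AddMonoidHom.map_trace (toFibre K d) _).symm
  have h2 : repAct DArr.src DArr.tgt g (Matrix.trace (univRep K d z)) =
      Matrix.trace (univRep K d z) := by
    have := congrArg Matrix.trace (DFunLike.congr_fun (repAct_univRep K d g) z)
    simp only [AlgHom.comp_apply, trace_glConj] at this
    refine Eq.trans ?_ this
    exact AddMonoidHom.map_trace (repAct DArr.src DArr.tgt g) (univRep K d z)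
  change fibreAct g (fibreTrace K d ((commutatorSpan K V).mkQ (Preproj.mk K V z))) =
    fibreTrace K d ((commutatorSpan K V).mkQ (Preproj.mk K V z))
  rw [h1]
  change toFibre K d (repAct DArr.src DArr.tgt g _) = _
  rw [h2]

/-- The classical trace map from the preprojective algebra modulo commutators to the coordinate
ring of the quiver variety. -/
def classicalTrace : PreprojCyc K V →ₗ[K] FunVariety K d :=
  (fibreTrace K d).codRestrict (Subalgebra.toSubmodule (FunVariety K d)) (fibreTrace_mem K d)

/-! #### The quantum side -/

/-- The algebra of homogeneous differential operators on `Rep(Q, d)`. -/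
abbrev DRep : Type (max u v w) := DiffOp K (FunRep K d)

/-- The invariants of `GL_d` in the differential operators. -/
def DInv : Subalgebra K[X] (DRep K d) :=
  ⨅ g : GLd K d, AlgHom.equalizer (DiffOp.conj (repActEquiv Arr.src Arr.tgt g))
    (AlgHom.id K[X] (DRep K d))

variable {K d} in
/-- The infinitesimal action `τ` of `gl_d` on `Rep(Q, d)`: the vector field that maps the matrix
`[a]` to `[a] ξ - ξ [a]`. -/
def infAct (ξ : (k : V) → Matrix (Fin (d k)) (Fin (d k)) K) :
    Derivation K (FunRep K d) (FunRep K d) :=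
  MvPolynomial.mkDerivation K fun c =>
    (genMat K Arr.src Arr.tgt d c.1.1 * (Matrix.blockDiagonal' ξ).map MvPolynomial.C
      - (Matrix.blockDiagonal' ξ).map MvPolynomial.C * genMat K Arr.src Arr.tgt d c.1.1 :
      Matrix (Idx d) (Idx d) (FunRep K d)) c.1.2.1 c.1.2.2

variable {K d} in
/-- The character `χ₀ = - ∑ₖ (∑_{s(a) = k} d_{t(a)}) trₖ` of `gl_d`. -/
def chiZero (ξ : (k : V) → Matrix (Fin (d k)) (Fin (d k)) K) : K :=
  - ∑ k : V, (∑ a : Arr V with Arr.src a = k, (d (Arr.tgt a) : K)) * (ξ k).trace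

/-- The left ideal of the differential operators that is generated by all
`τ(ξ) - ħ χ₀(ξ)`. -/
def momentLeftIdeal : Ideal (DRep K d) :=
  Ideal.span (Set.range fun ξ : (k : V) → Matrix (Fin (d k)) (Fin (d k)) K =>
    DiffOp.ofDer (infAct ξ)
      - algebraMap K[X] (DRep K d) (Polynomial.X * Polynomial.C (chiZero ξ)))

/-- The relation that the invariant elements of `momentLeftIdeal` vanish. -/
def HamRel (D D' : DInv K d) : Prop := (D : DRep K d) ∈ momentLeftIdeal K d ∧ D' = 0

/-- The quantum Hamiltonian reduction: the invariant differential operators modulo the invariant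
elements of `momentLeftIdeal` (which form a two-sided ideal). -/
def HamReduction : Type (max u v w) := RingQuot (HamRel K d)

instance : Ring (HamReduction K d) := inferInstanceAs (Ring (RingQuot (HamRel K d)))

instance : Algebra K[X] (HamReduction K d) :=
  inferInstanceAs (Algebra K[X] (RingQuot (HamRel K d)))

def HamReduction.mk : DInv K d →ₐ[K[X]] HamReduction K d := RingQuot.mkAlgHom K[X] (HamRel K d)

instance : Algebra K (HamReduction K d) :=
  Algebra.compHom (HamReduction K d) (Polynomial.C : K →+* K[X])

/-- The relation `ħ = 0`. -/
def HamZeroRel (D D' : HamReduction K d) : Prop :=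
  D = algebraMap K[X] (HamReduction K d) Polynomial.X ∧ D' = 0

/-- The quantum Hamiltonian reduction modulo `ħ`. -/
def HamReductionZero : Type (max u v w) := RingQuot (HamZeroRel K d)

instance : Ring (HamReductionZero K d) := inferInstanceAs (Ring (RingQuot (HamZeroRel K d)))

instance : Algebra K (HamReductionZero K d) :=
  inferInstanceAs (Algebra K (RingQuot (HamZeroRel K d)))

def HamReductionZero.mk : HamReduction K d →ₐ[K] HamReductionZero K d :=
  RingQuot.mkAlgHom K (HamZeroRel K d)

/-- The algebra map from differential operators to functions on the cotangent space that sends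
`ħ` to `0`, a function to itself and a vector field to its symbol, so that
`[a]_{ij} ↦ [a]_{ij}` and `∂/∂[a]_{ij} ↦ [a*]_{ji}`. -/
def symbol : DRep K d →+* FunCot K d :=
  letI : Algebra K[X] (FunCot K d) :=
    ((algebraMap K (FunCot K d)).comp (Polynomial.evalRingHom 0)).toAlgebra
  have hX : algebraMap K[X] (FunCot K d) Polynomial.X = 0 := by
    simp [RingHom.algebraMap_toAlgebra]
  have hC : ∀ c : K, algebraMap K[X] (FunCot K d) (Polynomial.C c) = MvPolynomial.C c := by
    intro c
    simp [RingHom.algebraMap_toAlgebra, MvPolynomial.algebraMap_eq]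
  (DiffOp.lift (A := FunCot K d)
    (fun f => MvPolynomial.rename posCoord f)
    (fun D => ∑ c, MvPolynomial.rename posCoord (D (MvPolynomial.X c)) *
      MvPolynomial.X (momCoord c))
    (fun c => by rw [hC, MvPolynomial.algebraMap_eq, MvPolynomial.rename_C])
    (fun f g => by rw [map_add])
    (fun D D' => by
      simp only [Derivation.add_apply, map_add, add_mul, Finset.sum_add_distrib])
    (fun f g => by rw [map_mul])
    (fun f D => by
      simp only [Derivation.smul_apply, smul_eq_mul, map_mul, Finset.mul_sum, mul_assoc])
    (fun D f => by
      rw [Algebra.smul_def, hX, zero_mul, add_zero, mul_comm]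
      simp only [Derivation.smul_apply, smul_eq_mul, map_mul, Finset.mul_sum, mul_assoc])
    (fun D D' => by rw [Algebra.smul_def, hX, zero_mul, add_zero, mul_comm])).toRingHom

/-- The matrix `[x]` of differential operators of an arrow `x` of the double: coordinate
functions for an arrow of the quiver, and `[a*]_{ij} = ∂/∂[a]_{ji}`. -/
def opMat : DArr V → Matrix (Idx d) (Idx d) (DRep K d)
  | Sum.inl a => (genMat K Arr.src Arr.tgt d a).map (DiffOp.ofFun K)
  | Sum.inr a => Matrix.of fun i j =>
      if h : j.1 = Arr.tgt a ∧ i.1 = Arr.src a then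
        DiffOp.ofDer (MvPolynomial.pderiv ⟨(a, j, i), h⟩) else 0

variable {K d} in
/-- `F` is the quantum trace: if the heights of a monomial are `0, …, N - 1`, and the arrow with
height `h` is `arr h` and is followed in its cyclic word by the arrow with height `nxt h`, then
`F` maps the monomial to the product of the `d_v` over its vertices `v` and of
`∑_κ ∏_h [arr h]_{κ(h), κ(nxt h)}`, where the factors are ordered by increasing height. -/
def IsQuantumTrace (F : Necklace V K → DRep K d) : Prop :=
  ∀ (X : HeightMonomial V) (N : ℕ) (arr : Fin N → DArr V) (nxt : Fin N → Fin N),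
    X.Valid → X.heights = Multiset.range N →
    (∀ c ∈ X.cycles, c.Chain fun p q => ∃ h : Fin N,
      p = (arr h, (h : ℕ)) ∧ q = (arr (nxt h), (nxt h : ℕ))) →
    F (sym K X) = (((X.verts.map d).prod : ℕ) : DRep K d) *
      ∑ κ : Fin N → Idx d, (List.ofFn fun h => opMat K d (arr h) (κ h) (κ (nxt h))).prod

end Reduction

end QuiverQuantization

end

open scoped Matrix Polynomial

noncomputable section

set_option linter.unusedSectionVars false

namespace QuiverQuantization

universe u v w

/-! ### Homogeneous differential operators on an affine space -/

section DiffOpBasics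

variable {K : Type u} [Field K] {T : Type v} [CommRing T] [Algebra K T]

namespace DiffOp

/-! Normal ordering, $x^\alpha p^\beta \mapsto x^\alpha\partial^\beta$, is a $\mathrm{GL}_{\mathbf
d}$-equivariant $\mathbb K[\hbar]$-linear bijection from polynomials on $T^*\mathrm{Rep}$ with
coefficients in $\mathbb K[\hbar]$ onto $\mathcal D_\hbar$ (`normalOrder_injective`,
`normalOrder_surjective`, `conj_normalOrder`). Hence $\hbar$ can be cancelled in $\mathcal D_\hbar$,
the kernel of the symbol map is $\hbar\mathcal D_\hbar$, and the symbol of a commutator divided by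
$\hbar$ is the Poisson bracket of the symbols (`symbol_of_commutator`); the last point is checked on
generators, as both sides are biderivations.

For the reduction, let $\hat\mu=\sum([a][a^*]-[a^*][a])$ be formed with operators (`momentOp`).
Bringing $\tau(\xi)$ into this order produces exactly the scalar $\hbar\chi_0(\xi)$, so the left
ideal $J$ of the theorem is generated by the entries of $\hat\mu$ (`momentLeftIdeal_eq`).
Commutators with these entries are $\hbar$ times the infinitesimal action (`momentOp_commutator`),
so they commute with invariants; therefore the invariants of $J$ form a two-sided ideal. The symbols
of $J$ are the whole moment ideal.

What remains is to lift invariants modulo an invariant subspace to invariants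
(`exists_invariant_lift`). The Lie algebra acts by linear vector fields whose matrices are closed
under transposition. For the Fischer inner product on rational polynomials the transpose is the
adjoint, so the Casimir operator $C=\sum L_i^{T}L_i$ is positive semidefinite and its kernel
consists of the invariants. A polynomial $r$ with $r(0)=1$ makes $r(C)f$ invariant, and $r(C)f\equiv
f$ modulo any invariant subspace modulo which $f$ is invariant. Applied to functions vanishing on
the fibre this gives surjectivity of $\Phi$. Applied to elements of $J$ of symbol zero it shows that
an invariant operator whose symbol vanishes on the fibre lies in $J^{\mathrm{GL}}+\hbar\mathcal
D_\hbar^{\mathrm{GL}}$, which is injectivity.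

For the trace, each arrow with a height gets its own matrix of commuting variables. A monomial
becomes a product of ordinary traces, and the quantum trace replaces the variables by operators
sorted by height. The skein relations are then the canonical commutation relations summed over
matrix indices: the indices glue two cycles into one or cut one into two (`quantTrace_skein_diff`,
`quantTrace_skein_same`). In a moment relation the letters $a,a^*$ have the two greatest heights, so
an entry of $\hat\mu$ stands on the far right and the image lies in $J$.

Modulo $\hbar$ the skein relations allow any rearrangement of heights, so the necklace algebra is
commutative modulo $\hbar$ (`commutator_mem_hbarMultiples`). The bracket formula follows by applying
the quantum trace to $\hbar Z=\hat x*\hat y-\hat y*\hat x$. -/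

theorem ofFun_algebraMap (c : K) :
    ofFun K (algebraMap K T c) = algebraMap K[X] (DiffOp K T) (Polynomial.C c) := by
  simpa [ofFun] using mk_rel (.const (T := T) c)

theorem ofFun_one : ofFun K (1 : T) = 1 := by
  simpa using ofFun_algebraMap (K := K) (T := T) 1

theorem ofFun_add (f g : T) : ofFun K (f + g) = ofFun K f + ofFun K g := by
  simpa [ofFun] using mk_rel (.fun_add (K := K) f g)

theorem ofFun_mul (f g : T) : ofFun K (f * g) = ofFun K f * ofFun K g := by
  simpa [ofFun] using (mk_rel (.fun_mul (K := K) f g)).symm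

theorem ofDer_add (D D' : Derivation K T T) : ofDer (D + D') = ofDer D + ofDer D' := by
  simpa [ofDer] using mk_rel (.der_add D D')

theorem ofDer_smul (f : T) (D : Derivation K T T) : ofDer (f • D) = ofFun K f * ofDer D := by
  simpa [ofDer, ofFun] using (mk_rel (.fun_der f D)).symm

theorem ofDer_mul_ofFun (D : Derivation K T T) (f : T) :
    ofDer D * ofFun K f = ofFun K f * ofDer D + (Polynomial.X : K[X]) • ofFun K (D f) := by
  rw [← ofDer_smul]
  simpa [ofDer, ofFun] using mk_rel (.der_fun D f)

theorem ofDer_mul_ofDer (D D' : Derivation K T T) :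
    ofDer D * ofDer D' = ofDer D' * ofDer D + (Polynomial.X : K[X]) • ofDer ⁅D, D'⁆ := by
  simpa [ofDer] using mk_rel (.der_der D D')

variable (K T) in
def ofFunHom : T →+* DiffOp K T where
  toFun := ofFun K
  map_one' := ofFun_one
  map_mul' := ofFun_mul
  map_zero' := by simpa using ofFun_algebraMap (K := K) (T := T) 0
  map_add' := ofFun_add

variable (K T) in
def ofDerHom : Derivation K T T →+ DiffOp K T :=
  AddMonoidHom.mk' ofDer ofDer_add

theorem ofFun_zero : ofFun K (0 : T) = 0 := map_zero (ofFunHom K T)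

theorem ofDer_zero : ofDer (0 : Derivation K T T) = 0 := map_zero (ofDerHom K T)

theorem ofFun_sub (f g : T) : ofFun K (f - g) = ofFun K f - ofFun K g :=
  map_sub (ofFunHom K T) f g

theorem ofDer_sum {ι : Type*} (s : Finset ι) (f : ι → Derivation K T T) :
    ofDer (∑ i ∈ s, f i) = ∑ i ∈ s, ofDer (f i) := map_sum (ofDerHom K T) f s

theorem ofFun_comm (f g : T) : ofFun K f * ofFun K g = ofFun K g * ofFun K f := by
  rw [← ofFun_mul, mul_comm, ofFun_mul]

section Lift

variable {A : Type*} [Ring A] [Algebra K[X] A] {φ : T → A} {ψ : Derivation K T T → A}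
  {h1 : ∀ c : K, φ (algebraMap K T c) = algebraMap K[X] A (Polynomial.C c)}
  {h2 : ∀ f g, φ (f + g) = φ f + φ g}
  {h3 : ∀ D D', ψ (D + D') = ψ D + ψ D'}
  {h4 : ∀ f g, φ f * φ g = φ (f * g)}
  {h5 : ∀ f D, φ f * ψ D = ψ (f • D)}
  {h6 : ∀ D f, ψ D * φ f = ψ (f • D) + (Polynomial.X : K[X]) • φ (D f)}
  {h7 : ∀ D D', ψ D * ψ D' = ψ D' * ψ D + (Polynomial.X : K[X]) • ψ ⁅D, D'⁆}

theorem lift_ofFun (f : T) : DiffOp.lift φ ψ h1 h2 h3 h4 h5 h6 h7 (ofFun K f) = φ f := by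
  refine (RingQuot.liftAlgHom_mkAlgHom_apply _ _ _ _).trans ?_
  simp

theorem lift_ofDer (D : Derivation K T T) :
    DiffOp.lift φ ψ h1 h2 h3 h4 h5 h6 h7 (ofDer D) = ψ D := by
  refine (RingQuot.liftAlgHom_mkAlgHom_apply _ _ _ _).trans ?_
  simp

end Lift

theorem conj_ofFun (e : T ≃ₐ[K] T) (f : T) : conj e (ofFun K f) = ofFun K (e f) := lift_ofFun f

theorem conj_ofDer (e : T ≃ₐ[K] T) (D : Derivation K T T) :
    conj e (ofDer D) = ofDer (conjDer e D) := lift_ofDer D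

theorem subalgebra_eq_top (S : Subalgebra K[X] (DiffOp K T)) (hf : ∀ f, ofFun K f ∈ S)
    (hD : ∀ D, ofDer D ∈ S) : S = ⊤ := by
  rw [eq_top_iff]
  rintro x -
  obtain ⟨y, rfl⟩ := RingQuot.mkAlgHom_surjective K[X] (DiffOpRel K T) x
  change DiffOp.mk K T y ∈ S
  induction y using FreeAlgebra.induction with
  | grade0 r => rw [AlgHom.commutes]; exact S.algebraMap_mem r
  | grade1 z => rcases z with f | D; exacts [hf f, hD D]
  | mul a b ha hb => rw [map_mul]; exact S.mul_mem ha hb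
  | add a b ha hb => rw [map_add]; exact S.add_mem ha hb

section Affine

variable {σ : Type w}

theorem der_eq_sum [Fintype σ] {R : Type*} [CommRing R] {S : Type*} [CommRing S] [Algebra R S]
    [Module (MvPolynomial σ R) S] [IsScalarTower R (MvPolynomial σ R) S]
    (D : Derivation R (MvPolynomial σ R) S) (f : MvPolynomial σ R) :
    D f = ∑ c, MvPolynomial.pderiv c f • D (MvPolynomial.X c) := by
  classical
  induction f using MvPolynomial.induction_on with
  | C a => simp
  | add f g hf hg => simp only [map_add, hf, hg, add_smul, Finset.sum_add_distrib]
  | mul_X f c hf =>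
    simp only [Derivation.leibniz, hf, add_smul, Finset.sum_add_distrib, MvPolynomial.pderiv_X,
      smul_eq_mul, mul_smul, Finset.smul_sum]
    congr 1
    rw [Finset.sum_eq_single c (fun b _ hb => by simp [Pi.single_eq_of_ne hb.symm])
      (by simp)]
    simp

theorem sum_der_apply {ι R A M : Type*} [CommSemiring R] [CommSemiring A] [Algebra R A]
    [AddCommMonoid M] [Module A M] [Module R M] (s : Finset ι) (D : ι → Derivation R A M) (f : A) :
    (∑ i ∈ s, D i) f = ∑ i ∈ s, D i f := by
  have := congrFun (map_sum (Derivation.coeFnAddMonoidHom (R := R) (A := A) (M := M)) D s) f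
  rwa [Finset.sum_apply] at this

theorem ofDer_eq_sum [Fintype σ] (D : Derivation K (MvPolynomial σ K) (MvPolynomial σ K)) :
    ofDer D = ∑ c, ofFun K (D (MvPolynomial.X c)) * ofDer (MvPolynomial.pderiv c) := by
  classical
  have : D = ∑ c, D (MvPolynomial.X c) • MvPolynomial.pderiv c := by
    refine MvPolynomial.derivation_ext fun i => ?_
    rw [sum_der_apply, Finset.sum_eq_single i]
    · simp
    · intro b _ hb; simp [MvPolynomial.pderiv_X_of_ne hb.symm]
    · simp
  conv_lhs => rw [this]
  rw [ofDer_sum]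
  exact Finset.sum_congr rfl fun c _ => ofDer_smul _ _

/-- Vector fields are combinations of the partial derivatives with functions as coefficients. A
property that cuts out a subalgebra therefore needs checking only on coordinates and partial
derivatives. -/
theorem affine_subalgebra_eq_top [Fintype σ] (S : Subalgebra K[X] (DiffOp K (MvPolynomial σ K)))
    (hf : ∀ c, ofFun K (MvPolynomial.X c) ∈ S) (hD : ∀ c, ofDer (MvPolynomial.pderiv c) ∈ S) :
    S = ⊤ := by
  have hf' : ∀ f : MvPolynomial σ K, ofFun K f ∈ S := by
    intro f
    induction f using MvPolynomial.induction_on with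
    | C a =>
      rw [← MvPolynomial.algebraMap_eq, ofFun_algebraMap]; exact S.algebraMap_mem _
    | add f g hf hg => rw [ofFun_add]; exact S.add_mem hf hg
    | mul_X f c h => rw [ofFun_mul]; exact S.mul_mem h (hf c)
  refine subalgebra_eq_top S hf' fun D => ?_
  rw [ofDer_eq_sum]
  exact S.sum_mem fun c _ => S.mul_mem (hf' _) (hD c)

theorem ofDer_pderiv_comm (c c' : σ) :
    (ofDer (MvPolynomial.pderiv (R := K) c) * ofDer (MvPolynomial.pderiv c') :
      DiffOp K (MvPolynomial σ K)) =
    ofDer (MvPolynomial.pderiv c') * ofDer (MvPolynomial.pderiv c) := by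
  classical
  have : (⁅MvPolynomial.pderiv (R := K) c, MvPolynomial.pderiv (R := K) c'⁆ :
      Derivation K (MvPolynomial σ K) (MvPolynomial σ K)) = 0 := by
    refine MvPolynomial.derivation_ext fun i => ?_
    simp only [Derivation.commutator_apply, MvPolynomial.pderiv_X, Pi.single_apply, Derivation.zero_apply]
    split_ifs <;> simp
  rw [ofDer_mul_ofDer, this, ofDer_zero, smul_zero, add_zero]

end Affine

end DiffOp

end DiffOpBasics

/-! ### Normal ordering and the symbol map -/

section NormalOrdering

variable (K : Type u) [Field K] {V : Type v} [Quiver.{w} V] [DecidableEq V]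
  (d : V → ℕ)

/-- Functions on the cotangent space with a formal parameter `ħ`. -/
abbrev HCot : Type (max u v w) := MvPolynomial (Coord (DArr.src (V := V)) DArr.tgt d) K[X]

variable {d} in
theorem coord_cases (c : Coord (DArr.src (V := V)) DArr.tgt d) :
    (∃ c', c = posCoord c') ∨ ∃ c', c = momCoord c' := by
  obtain ⟨⟨a | a, i, j⟩, h⟩ := c
  · exact Or.inl ⟨⟨(a, i, j), h⟩, rfl⟩
  · exact Or.inr ⟨⟨(a, j, i), h.symm⟩, rfl⟩

variable {d} in
theorem posCoord_injective : Function.Injective (posCoord (V := V) (d := d)) := by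
  rintro ⟨⟨a, i, j⟩, h⟩ ⟨⟨a', i', j'⟩, h'⟩ e
  have := congrArg Subtype.val e
  simp only [posCoord, Prod.mk.injEq, Sum.inl.injEq] at this
  exact Subtype.ext (Prod.ext this.1 (Prod.ext this.2.1 this.2.2))

variable {d} in
theorem momCoord_injective : Function.Injective (momCoord (V := V) (d := d)) := by
  rintro ⟨⟨a, i, j⟩, h⟩ ⟨⟨a', i', j'⟩, h'⟩ e
  have := congrArg Subtype.val e
  simp only [momCoord, Prod.mk.injEq, Sum.inr.injEq] at this
  exact Subtype.ext (Prod.ext this.1 (Prod.ext this.2.2 this.2.1))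

variable {d} in
theorem posCoord_ne_momCoord (c c' : Coord (Arr.src (V := V)) Arr.tgt d) :
    posCoord c ≠ momCoord c' := by
  intro e
  have := congrArg (fun c => c.1.1) e
  simp [posCoord, momCoord] at this

/-- Functions on the base as functions on the cotangent space. -/
def baseLift : FunRep (V := V) K d →+* HCot (V := V) K d :=
  (MvPolynomial.map Polynomial.C).comp (MvPolynomial.rename posCoord).toRingHom

variable {K d} in
@[simp]
theorem baseLift_X (c : Coord (Arr.src (V := V)) Arr.tgt d) :
    baseLift K d (MvPolynomial.X c) = MvPolynomial.X (posCoord c) := by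
  simp [baseLift]

variable {K d} in
theorem baseLift_C (r : K) :
    baseLift (V := V) K d (MvPolynomial.C r) = MvPolynomial.C (Polynomial.C r) := by
  simp [baseLift]

variable {K d} in
theorem pderiv_baseLift (c : Coord (Arr.src (V := V)) Arr.tgt d) (f : FunRep (V := V) K d) :
    MvPolynomial.pderiv (posCoord c) (baseLift K d f) =
      baseLift K d (MvPolynomial.pderiv c f) := by
  simp only [baseLift, RingHom.comp_apply, AlgHom.toRingHom_eq_coe, RingHom.coe_coe]
  rw [MvPolynomial.pderiv_map, MvPolynomial.pderiv_rename posCoord_injective]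

variable [Fintype V] [∀ i j : V, Fintype (i ⟶ j)]

variable {K d} in
/-- The symbol of a vector field as a function that is linear in the momenta. -/
def vecSym (D : Derivation K (FunRep (V := V) K d) (FunRep K d)) : HCot (V := V) K d :=
  ∑ c, baseLift K d (D (MvPolynomial.X c)) * MvPolynomial.X (momCoord c)

variable {K d} in
/-- The extension of a vector field to the cotangent space that kills the momenta. -/
def vecLift (D : Derivation K (FunRep (V := V) K d) (FunRep K d)) :
    Derivation K[X] (HCot (V := V) K d) (HCot K d) :=
  ∑ c, baseLift K d (D (MvPolynomial.X c)) • MvPolynomial.pderiv (posCoord c)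

variable {K d} in
theorem vecLift_apply (D : Derivation K (FunRep (V := V) K d) (FunRep K d)) (u : HCot K d) :
    vecLift D u = ∑ c, baseLift K d (D (MvPolynomial.X c)) *
      MvPolynomial.pderiv (posCoord c) u := by
  rw [vecLift, DiffOp.sum_der_apply]; rfl

variable {K d} in
theorem vecLift_baseLift (D : Derivation K (FunRep (V := V) K d) (FunRep K d))
    (f : FunRep K d) : vecLift D (baseLift K d f) = baseLift K d (D f) := by
  rw [vecLift_apply, DiffOp.der_eq_sum D f, map_sum]
  refine Finset.sum_congr rfl fun c _ => ?_
  rw [pderiv_baseLift, smul_eq_mul, map_mul, mul_comm]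

variable {K d} in
theorem vecLift_mom (D : Derivation K (FunRep (V := V) K d) (FunRep K d))
    (c : Coord (Arr.src (V := V)) Arr.tgt d) : vecLift D (MvPolynomial.X (momCoord c)) = 0 := by
  rw [vecLift_apply]
  refine Finset.sum_eq_zero fun c' _ => ?_
  rw [MvPolynomial.pderiv_X_of_ne (posCoord_ne_momCoord _ _).symm, mul_zero]

variable {K d} in
theorem vecLift_vecSym (D D' : Derivation K (FunRep (V := V) K d) (FunRep K d)) :
    vecLift D (vecSym D') = ∑ c, baseLift K d (D (D' (MvPolynomial.X c))) *
      MvPolynomial.X (momCoord c) := by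
  rw [vecSym, map_sum]
  refine Finset.sum_congr rfl fun c _ => ?_
  rw [Derivation.leibniz, vecLift_mom, smul_zero, zero_add, vecLift_baseLift, smul_eq_mul,
    mul_comm]

variable {K d} in
theorem vecSym_add (D D' : Derivation K (FunRep (V := V) K d) (FunRep K d)) :
    vecSym (D + D') = vecSym D + vecSym D' := by
  simp only [vecSym, Derivation.add_apply, map_add, add_mul, Finset.sum_add_distrib]

variable {K d} in
theorem vecSym_smul (f : FunRep K d) (D : Derivation K (FunRep (V := V) K d) (FunRep K d)) :
    vecSym (f • D) = baseLift K d f * vecSym D := by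
  simp only [vecSym, Derivation.smul_apply, smul_eq_mul, map_mul, Finset.mul_sum, mul_assoc]

variable {K d} in
theorem vecSym_pderiv (c : Coord (Arr.src (V := V)) Arr.tgt d) :
    vecSym (MvPolynomial.pderiv (R := K) c) = MvPolynomial.X (momCoord c) := by
  classical
  rw [vecSym, Finset.sum_eq_single c]
  · simp
  · intro b _ hb; simp [MvPolynomial.pderiv_X_of_ne hb]
  · simp

variable {K d} in
-- `vecLift` does not differentiate momenta, so it acts only on the coefficients of a symbol. The
-- difference is the cross term in the commutation relation of two vector fields under `regRep`.
theorem vecSym_commutator (D D' : Derivation K (FunRep (V := V) K d) (FunRep K d)) :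
    vecSym ⁅D, D'⁆ = vecLift D (vecSym D') - vecLift D' (vecSym D) := by
  rw [vecLift_vecSym, vecLift_vecSym, vecSym, ← Finset.sum_sub_distrib]
  refine Finset.sum_congr rfl fun c _ => ?_
  rw [Derivation.commutator_apply, map_sub, sub_mul]

variable {K d} in
theorem vecLift_add (D D' : Derivation K (FunRep (V := V) K d) (FunRep K d)) :
    vecLift (D + D') = vecLift D + vecLift D' := by
  simp only [vecLift, Derivation.add_apply, map_add, add_smul, Finset.sum_add_distrib]

variable {K d} in
theorem vecLift_smul (f : FunRep K d) (D : Derivation K (FunRep (V := V) K d) (FunRep K d))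
    (u : HCot K d) : vecLift (f • D) u = baseLift K d f * vecLift D u := by
  simp only [vecLift_apply, Derivation.smul_apply, smul_eq_mul, map_mul, Finset.mul_sum, mul_assoc]

variable {K d} in
theorem vecLift_commutator (D D' : Derivation K (FunRep (V := V) K d) (FunRep K d)) :
    vecLift ⁅D, D'⁆ = ⁅vecLift D, vecLift D'⁆ := by
  refine MvPolynomial.derivation_ext fun c => ?_
  rcases coord_cases c with ⟨c, rfl⟩ | ⟨c, rfl⟩
  · rw [Derivation.commutator_apply, ← baseLift_X]
    simp only [vecLift_baseLift]
    rw [Derivation.commutator_apply, map_sub]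
  · rw [Derivation.commutator_apply]
    simp only [vecLift_mom, map_zero, sub_zero]

/-- The left regular representation of the differential operators, written in terms of
normally ordered symbols. -/
def regRep : DRep (V := V) K d →ₐ[K[X]] Module.End K[X] (HCot (V := V) K d) :=
  DiffOp.lift (fun f => LinearMap.mulLeft K[X] (baseLift K d f))
    -- In $D\cdot x^\alpha\partial^\beta$ the partial derivatives of $D$ have to pass $x^\alpha$:
    -- this gives the product of the symbols and the correction $\hbar D(x^\alpha)\partial^\beta$.
    -- The momenta stand on the right and are not differentiated.
    (fun D => LinearMap.mulLeft K[X] (vecSym D) +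
      (Polynomial.X : K[X]) • (vecLift D : HCot K d →ₗ[K[X]] HCot K d))
    (fun c => LinearMap.ext fun u => by
      rw [MvPolynomial.algebraMap_eq, baseLift_C, LinearMap.mulLeft_apply,
        Module.algebraMap_end_apply, MvPolynomial.smul_eq_C_mul])
    (fun f g => LinearMap.ext fun u => by
      simp only [map_add, LinearMap.mulLeft_apply, LinearMap.add_apply, add_mul])
    (fun D D' => LinearMap.ext fun u => by
      simp only [vecSym_add, vecLift_add, LinearMap.mulLeft_apply, LinearMap.add_apply,
        LinearMap.smul_apply, Derivation.coeFn_coe, Derivation.add_apply, smul_add, add_mul]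
      abel)
    (fun f g => LinearMap.ext fun u => by
      simp only [map_mul, LinearMap.mulLeft_apply, Module.End.mul_apply, mul_assoc])
    (fun f D => LinearMap.ext fun u => by
      simp only [vecSym_smul, vecLift_smul, LinearMap.mulLeft_apply, Module.End.mul_apply,
        LinearMap.add_apply, LinearMap.smul_apply, Derivation.coeFn_coe, mul_add, mul_assoc,
        mul_smul_comm])
    (fun D f => LinearMap.ext fun u => by
      simp only [vecSym_smul, vecLift_smul, LinearMap.mulLeft_apply, Module.End.mul_apply,
        LinearMap.add_apply, LinearMap.smul_apply, Derivation.coeFn_coe, Derivation.leibniz,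
        vecLift_baseLift, MvPolynomial.smul_eq_C_mul, smul_eq_mul]
      ring)
    (fun D D' => LinearMap.ext fun u => by
      simp only [vecLift_commutator, vecSym_commutator, Derivation.commutator_apply,
        LinearMap.mulLeft_apply, Module.End.mul_apply, LinearMap.add_apply, LinearMap.smul_apply,
        Derivation.coeFn_coe, map_add, Derivation.leibniz,
        MvPolynomial.smul_eq_C_mul, smul_eq_mul, MvPolynomial.derivation_C]
      ring)

variable {K d}

theorem regRep_ofFun (f : FunRep (V := V) K d) (u : HCot K d) :
    regRep K d (DiffOp.ofFun K f) u = baseLift K d f * u := by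
  rw [regRep, DiffOp.lift_ofFun]; rfl

theorem regRep_ofDer (D : Derivation K (FunRep (V := V) K d) (FunRep K d)) (u : HCot K d) :
    regRep K d (DiffOp.ofDer D) u = vecSym D * u + (Polynomial.X : K[X]) • vecLift D u := by
  rw [regRep, DiffOp.lift_ofDer]; rfl

/-- The coordinate functions as differential operators. -/
abbrev opX (c : Coord (Arr.src (V := V)) Arr.tgt d) : DRep (V := V) K d :=
  DiffOp.ofFun K (MvPolynomial.X c)

/-- The partial derivatives as differential operators. -/
abbrev opD (c : Coord (Arr.src (V := V)) Arr.tgt d) : DRep (V := V) K d :=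
  DiffOp.ofDer (MvPolynomial.pderiv c)

theorem opD_mul_opX (c c' : Coord (Arr.src (V := V)) Arr.tgt d) [Decidable (c = c')] :
    (opD c * opX c' : DRep K d) = opX c' * opD c + if c = c' then algebraMap K[X] _ Polynomial.X else 0 := by
  classical
  rw [DiffOp.ofDer_mul_ofFun, MvPolynomial.pderiv_X, Pi.single_apply]
  congr 1
  by_cases h : c = c'
  · subst h; simp [DiffOp.ofFun_one, Algebra.algebraMap_eq_smul_one]
  · simp [h, Ne.symm h, DiffOp.ofFun_zero]

variable (K d) in
/-- Operators of left multiplication by coordinates and of right multiplication by partial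
derivatives. -/
def normalOps (c : Coord (DArr.src (V := V)) DArr.tgt d) : Module.End K[X] (DRep (V := V) K d) :=
  match c with
  | ⟨(Sum.inl a, i, j), h⟩ => LinearMap.mulLeft K[X] (opX ⟨(a, i, j), h⟩)
  | ⟨(Sum.inr a, i, j), h⟩ => LinearMap.mulRight K[X] (opD ⟨(a, j, i), h.symm⟩)

theorem normalOps_pos (c : Coord (Arr.src (V := V)) Arr.tgt d) :
    normalOps K d (posCoord c) = LinearMap.mulLeft K[X] (opX c) := rfl

theorem normalOps_mom (c : Coord (Arr.src (V := V)) Arr.tgt d) :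
    normalOps K d (momCoord c) = LinearMap.mulRight K[X] (opD c) := rfl

/-- Positions multiply on the left and momenta on the right, so a position and a momentum commute
here by associativity although the operators themselves do not. This makes normal ordering well
defined on commutative polynomials. -/
theorem normalOps_comm (c c' : Coord (DArr.src (V := V)) DArr.tgt d) :
    normalOps K d c * normalOps K d c' = normalOps K d c' * normalOps K d c := by
  ext1 D
  rcases coord_cases c with ⟨c, rfl⟩ | ⟨c, rfl⟩ <;>
  rcases coord_cases c' with ⟨c', rfl⟩ | ⟨c', rfl⟩ <;>
  simp only [normalOps_pos, normalOps_mom, Module.End.mul_apply, LinearMap.mulLeft_apply,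
    LinearMap.mulRight_apply]
  · rw [← mul_assoc, DiffOp.ofFun_comm, mul_assoc]
  · rw [mul_assoc]
  · rw [mul_assoc]
  · rw [mul_assoc, DiffOp.ofDer_pderiv_comm, mul_assoc]

variable (K d) in
open scoped IsMulCommutative in
/-- Polynomials acting through `normalOps`. -/
def normalAct : HCot (V := V) K d →ₐ[K[X]] Module.End K[X] (DRep (V := V) K d) :=
  -- Polynomials are evaluated in a commutative ring; the endomorphism ring is not one, but the
  -- subalgebra generated by commuting operators is.
  haveI : IsMulCommutative (Algebra.adjoin K[X] (Set.range (normalOps (V := V) K d))) :=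
    Algebra.isMulCommutative_adjoin K[X] (by
      rintro _ ⟨a, rfl⟩ _ ⟨b, rfl⟩; exact normalOps_comm a b)
  (Subalgebra.val _).comp
    (MvPolynomial.aeval (S₁ := Algebra.adjoin K[X] (Set.range (normalOps (V := V) K d)))
      fun c => ⟨normalOps K d c, Algebra.subset_adjoin ⟨c, rfl⟩⟩)

theorem normalAct_X (c : Coord (DArr.src (V := V)) DArr.tgt d) :
    normalAct K d (MvPolynomial.X c) = normalOps K d c := by
  simp [normalAct]

variable (K d) in
/-- Normal ordering: `x^α p^β ↦ x^α ∂^β`. -/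
def normalOrder : HCot (V := V) K d →ₗ[K[X]] DRep (V := V) K d :=
  LinearMap.applyₗ (1 : DRep (V := V) K d) ∘ₗ (normalAct K d).toLinearMap

theorem normalOrder_one : normalOrder (V := V) K d 1 = 1 := by
  simp [normalOrder]

theorem normalOrder_pos (c : Coord (Arr.src (V := V)) Arr.tgt d) (f : HCot K d) :
    normalOrder K d (MvPolynomial.X (posCoord c) * f) = opX c * normalOrder K d f := by
  simp [normalOrder, normalAct_X, normalOps_pos]

theorem normalOrder_mom (c : Coord (Arr.src (V := V)) Arr.tgt d) (f : HCot K d) :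
    normalOrder K d (MvPolynomial.X (momCoord c) * f) = normalOrder K d f * opD c := by
  simp [normalOrder, normalAct_X, normalOps_mom]

/-- Induction for functions on the cotangent space. -/
theorem hCot_induction {p : HCot (V := V) K d → Prop} (h1 : p 1)
    (hadd : ∀ f g, p f → p g → p (f + g)) (hsmul : ∀ (r : K[X]) f, p f → p (r • f))
    (hpos : ∀ c f, p f → p (MvPolynomial.X (posCoord c) * f))
    (hmom : ∀ c f, p f → p (MvPolynomial.X (momCoord c) * f)) (f : HCot (V := V) K d) : p f := by
  induction f using MvPolynomial.induction_on with
  | C a => simpa [MvPolynomial.smul_eq_C_mul] using hsmul a 1 h1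
  | add f g hf hg => exact hadd f g hf hg
  | mul_X f c hf =>
    rw [mul_comm]
    rcases coord_cases c with ⟨c, rfl⟩ | ⟨c, rfl⟩
    exacts [hpos c f hf, hmom c f hf]

/-- On symbols, multiplication by a momentum is right multiplication by a partial derivative, which
commutes with all left multiplications. The operators for which this holds form a subalgebra, so
functions and vector fields suffice. -/
theorem regRep_mom_mul (D : DRep (V := V) K d) (c : Coord (Arr.src (V := V)) Arr.tgt d)
    (u : HCot K d) : regRep K d D (MvPolynomial.X (momCoord c) * u) =
      MvPolynomial.X (momCoord c) * regRep K d D u := by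
  let S : Subalgebra K[X] (DRep (V := V) K d) := (Subalgebra.centralizer K[X]
    {LinearMap.mulLeft K[X] (MvPolynomial.X (momCoord c) : HCot K d)}).comap (regRep K d)
  have hS : S = ⊤ := by
    refine DiffOp.subalgebra_eq_top S ?_ ?_
    · intro f
      change regRep K d (DiffOp.ofFun K f) ∈ Subalgebra.centralizer K[X] _
      rw [Subalgebra.mem_centralizer_iff]
      rintro _ rfl
      refine LinearMap.ext fun u => ?_
      simp only [Module.End.mul_apply, LinearMap.mulLeft_apply, regRep_ofFun]
      ring
    · intro D
      change regRep K d (DiffOp.ofDer D) ∈ Subalgebra.centralizer K[X] _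
      rw [Subalgebra.mem_centralizer_iff]
      rintro _ rfl
      refine LinearMap.ext fun u => ?_
      simp only [Module.End.mul_apply, LinearMap.mulLeft_apply, regRep_ofDer, Derivation.leibniz,
        vecLift_mom, smul_eq_mul, MvPolynomial.smul_eq_C_mul]
      ring
  have hD : regRep K d D ∈ Subalgebra.centralizer K[X]
      {LinearMap.mulLeft K[X] (MvPolynomial.X (momCoord c) : HCot K d)} := by
    change D ∈ S
    rw [hS]; trivial
  rw [Subalgebra.mem_centralizer_iff] at hD
  exact (LinearMap.congr_fun (hD _ rfl) u).symm

/-- The normally ordered symbol of a normally ordered operator. -/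
theorem regRep_normalOrder (f : HCot (V := V) K d) :
    regRep K d (normalOrder K d f) 1 = f := by
  induction f using hCot_induction with
  | h1 => simp [normalOrder_one]
  | hadd f g hf hg => simp [hf, hg]
  | hsmul r f hf => simp [hf]
  | hpos c f hf => rw [normalOrder_pos, map_mul, Module.End.mul_apply, hf, regRep_ofFun, baseLift_X]
  | hmom c f hf =>
    rw [normalOrder_mom, map_mul, Module.End.mul_apply, regRep_ofDer, vecSym_pderiv,
      Derivation.map_one_eq_zero, smul_zero, add_zero, regRep_mom_mul, hf]

/-- The only obstruction is a coordinate dual to the partial derivative, and passing it costs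
$\hbar$ times an operator that is again normally ordered. -/
theorem opD_mul_normalOrder (c : Coord (Arr.src (V := V)) Arr.tgt d) (f : HCot K d) :
    ∃ g, opD c * normalOrder K d f = normalOrder K d g := by
  classical
  induction f using hCot_induction with
  | h1 => exact ⟨MvPolynomial.X (momCoord c) * 1, by
    rw [normalOrder_mom, normalOrder_one, mul_one, one_mul]⟩
  | hadd f g hf hg =>
    obtain ⟨f', hf⟩ := hf
    obtain ⟨g', hg⟩ := hg
    exact ⟨f' + g', by rw [map_add, mul_add, hf, hg, map_add]⟩
  | hsmul r f hf =>
    obtain ⟨f', hf⟩ := hf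
    exact ⟨r • f', by rw [map_smul, mul_smul_comm, hf, map_smul]⟩
  | hpos c' f hf =>
    obtain ⟨f', hf⟩ := hf
    refine ⟨MvPolynomial.X (posCoord c') * f' + if c = c' then (Polynomial.X : K[X]) • f else 0, ?_⟩
    rw [normalOrder_pos, ← mul_assoc, opD_mul_opX, add_mul, mul_assoc, hf, map_add,
      normalOrder_pos]
    congr 1
    split_ifs
    · rw [map_smul, Algebra.smul_def]
    · simp
  | hmom c' f hf =>
    obtain ⟨f', hf⟩ := hf
    refine ⟨MvPolynomial.X (momCoord c') * f', ?_⟩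
    rw [normalOrder_mom, ← mul_assoc, hf, normalOrder_mom]

/-- The operators whose left multiplication preserves the image form a subalgebra that contains the
generators; the image contains $1$. -/
theorem normalOrder_surjective : Function.Surjective (normalOrder (V := V) K d) := by
  let P : Subalgebra K[X] (DRep (V := V) K d) :=
    { carrier := {D | ∀ f, ∃ g, D * normalOrder K d f = normalOrder K d g}
      mul_mem' := by
        intro a b ha hb f
        obtain ⟨g, hg⟩ := hb f
        obtain ⟨k, hk⟩ := ha g
        exact ⟨k, by rw [mul_assoc, hg, hk]⟩
      add_mem' := by
        intro a b ha hb f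
        obtain ⟨g, hg⟩ := ha f
        obtain ⟨k, hk⟩ := hb f
        exact ⟨g + k, by rw [add_mul, hg, hk, map_add]⟩
      algebraMap_mem' := by
        intro r f
        exact ⟨r • f, by rw [map_smul, Algebra.smul_def]⟩ }
  have hP : P = ⊤ := DiffOp.affine_subalgebra_eq_top P
    (fun c f => ⟨MvPolynomial.X (posCoord c) * f, (normalOrder_pos c f).symm⟩)
    (fun c f => opD_mul_normalOrder c f)
  intro D
  have hD : D ∈ P := by rw [hP]; trivial
  obtain ⟨g, hg⟩ := hD 1
  exact ⟨g, by rw [← hg, normalOrder_one, mul_one]⟩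

/-- Acting on $1$ through `regRep` reads the symbol off again. This is the independence half of a
Poincaré–Birkhoff–Witt theorem. -/
theorem normalOrder_injective : Function.Injective (normalOrder (V := V) K d) :=
  Function.LeftInverse.injective (g := fun D => regRep K d D 1) regRep_normalOrder

/-- Normal ordering identifies the operators with a polynomial ring over $\mathbb K[\hbar]$, where
$\hbar$ is not a zero divisor. Every division by $\hbar$ in the differential operators rests on
this. -/
theorem hbar_smul_injective (D D' : DRep (V := V) K d)
    (h : (Polynomial.X : K[X]) • D = (Polynomial.X : K[X]) • D') : D = D' := by
  obtain ⟨f, rfl⟩ := normalOrder_surjective D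
  obtain ⟨g, rfl⟩ := normalOrder_surjective D'
  rw [← map_smul, ← map_smul] at h
  have := normalOrder_injective h
  rw [MvPolynomial.smul_eq_C_mul, MvPolynomial.smul_eq_C_mul] at this
  rw [mul_left_cancel₀ (by simp [Polynomial.X_ne_zero]) this]

variable (K d) in
/-- Setting `ħ = 0`. -/
def hbarZero : HCot (V := V) K d →+* FunCot (V := V) K d :=
  MvPolynomial.map (Polynomial.evalRingHom 0)

theorem symbol_ofFun (f : FunRep (V := V) K d) :
    symbol K d (DiffOp.ofFun K f) = MvPolynomial.rename posCoord f :=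
  letI : Algebra K[X] (FunCot (V := V) K d) :=
    ((algebraMap K (FunCot K d)).comp (Polynomial.evalRingHom 0)).toAlgebra
  DiffOp.lift_ofFun f

theorem symbol_ofDer (D : Derivation K (FunRep (V := V) K d) (FunRep K d)) :
    symbol K d (DiffOp.ofDer D) = ∑ c, MvPolynomial.rename posCoord (D (MvPolynomial.X c)) *
      MvPolynomial.X (momCoord c) :=
  letI : Algebra K[X] (FunCot (V := V) K d) :=
    ((algebraMap K (FunCot K d)).comp (Polynomial.evalRingHom 0)).toAlgebra
  DiffOp.lift_ofDer D

theorem symbol_algebraMap (r : K[X]) :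
    symbol (V := V) K d (algebraMap K[X] (DRep K d) r) = MvPolynomial.C (r.eval 0) := by
  let _ : Algebra K[X] (FunCot (V := V) K d) :=
    ((algebraMap K (FunCot K d)).comp (Polynomial.evalRingHom 0)).toAlgebra
  exact AlgHom.commutes (DiffOp.lift (A := FunCot (V := V) K d) _ _ _ _ _ _ _ _ _) r

theorem symbol_smul (r : K[X]) (D : DRep (V := V) K d) :
    symbol K d (r • D) = MvPolynomial.C (r.eval 0) * symbol K d D := by
  rw [Algebra.smul_def, map_mul, symbol_algebraMap]

theorem symbol_opX (c : Coord (Arr.src (V := V)) Arr.tgt d) :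
    symbol K d (opX c) = MvPolynomial.X (posCoord c) := by
  rw [symbol_ofFun, MvPolynomial.rename_X]

theorem symbol_opD (c : Coord (Arr.src (V := V)) Arr.tgt d) :
    symbol K d (opD c) = MvPolynomial.X (momCoord c) := by
  classical
  rw [symbol_ofDer, Finset.sum_eq_single c]
  · simp
  · intro b _ hb; simp [MvPolynomial.pderiv_X_of_ne hb]
  · simp

theorem symbol_normalOrder (f : HCot (V := V) K d) :
    symbol K d (normalOrder K d f) = hbarZero K d f := by
  induction f using hCot_induction with
  | h1 => rw [normalOrder_one, map_one, map_one]
  | hadd f g hf hg => rw [map_add, map_add, hf, hg, map_add]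
  | hsmul r f hf =>
    rw [map_smul, symbol_smul, hf, MvPolynomial.smul_eq_C_mul, map_mul, hbarZero,
      MvPolynomial.map_C]
    rfl
  | hpos c f hf =>
    rw [normalOrder_pos, map_mul, hf, symbol_opX, map_mul]
    simp [hbarZero]
  | hmom c f hf =>
    rw [normalOrder_mom, map_mul, hf, symbol_opD, map_mul, mul_comm]
    simp [hbarZero]

theorem hbarZero_eq_zero (f : HCot (V := V) K d) (h : hbarZero K d f = 0) :
    ∃ g, f = (Polynomial.X : K[X]) • g := by
  have : MvPolynomial.C (Polynomial.X : K[X]) ∣ f := by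
    rw [MvPolynomial.C_dvd_iff_dvd_coeff]
    intro m
    have := congrArg (MvPolynomial.coeff m) h
    rw [hbarZero, MvPolynomial.coeff_map, MvPolynomial.coeff_zero] at this
    rw [Polynomial.X_dvd_iff, Polynomial.coeff_zero_eq_eval_zero]
    exact this
  obtain ⟨g, hg⟩ := this
  exact ⟨g, by rw [hg, MvPolynomial.smul_eq_C_mul]⟩

theorem hbarZero_map_C (f : FunCot (V := V) K d) :
    hbarZero K d (MvPolynomial.map Polynomial.C f) = f := by
  rw [hbarZero, MvPolynomial.map_map]
  have : (Polynomial.evalRingHom (0 : K)).comp Polynomial.C = RingHom.id K := by ext; simp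
  rw [this, MvPolynomial.map_id]

/-- On normally ordered operators the symbol just sets $\hbar=0$ in the coefficients. -/
theorem symbol_eq_zero (D : DRep (V := V) K d) (h : symbol K d D = 0) :
    ∃ E, D = (Polynomial.X : K[X]) • E := by
  obtain ⟨f, rfl⟩ := normalOrder_surjective D
  rw [symbol_normalOrder] at h
  obtain ⟨g, rfl⟩ := hbarZero_eq_zero f h
  exact ⟨normalOrder K d g, map_smul _ _ _⟩

theorem symbol_surjective : Function.Surjective (symbol (V := V) K d) := fun f =>
  ⟨normalOrder K d (MvPolynomial.map Polynomial.C f), by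
    rw [symbol_normalOrder, hbarZero_map_C]⟩

/-! #### The classical limit of commutators -/

theorem poisson_add_left (f g h : FunCot (V := V) K d) :
    poisson (f + g) h = poisson f h + poisson g h := by
  simp only [poisson, map_add, add_mul, ← Finset.sum_add_distrib]
  exact Finset.sum_congr rfl fun c _ => by ring

theorem poisson_skew (f g : FunCot (V := V) K d) : poisson f g = - poisson g f := by
  simp only [poisson, ← Finset.sum_neg_distrib]
  exact Finset.sum_congr rfl fun c _ => by ring

theorem poisson_mul_left (f g h : FunCot (V := V) K d) :
    poisson (f * g) h = f * poisson g h + poisson f h * g := by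
  simp only [poisson, Derivation.leibniz, smul_eq_mul, Finset.mul_sum, Finset.sum_mul,
    ← Finset.sum_add_distrib]
  exact Finset.sum_congr rfl fun c _ => by ring

theorem poisson_C_left (r : K) (h : FunCot (V := V) K d) : poisson (MvPolynomial.C r) h = 0 := by
  simp [poisson]

theorem poisson_C_mul_left (r : K) (f g : FunCot (V := V) K d) :
    poisson (MvPolynomial.C r * f) g = MvPolynomial.C r * poisson f g := by
  rw [poisson_mul_left, poisson_C_left, zero_mul, add_zero]

/-- The relation between `A` and `B` that the commutator has a classical limit. -/
def HasLimit (A B : DRep (V := V) K d) : Prop :=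
  ∃ C, (Polynomial.X : K[X]) • C = A * B - B * A ∧
    symbol K d C = poisson (symbol K d A) (symbol K d B)

theorem HasLimit.symm {A B : DRep (V := V) K d} (h : HasLimit A B) : HasLimit B A := by
  obtain ⟨C, h1, h2⟩ := h
  exact ⟨-C, by rw [smul_neg, h1]; abel, by rw [map_neg, h2, ← poisson_skew]⟩

/-- The operators whose commutator with `B` has a classical limit. -/
def limitSubalgebra (B : DRep (V := V) K d) : Subalgebra K[X] (DRep (V := V) K d) where
  carrier := {A | HasLimit A B}
  add_mem' := by
    rintro a b ⟨C, h1, h2⟩ ⟨C', h1', h2'⟩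
    refine ⟨C + C', ?_, ?_⟩
    · rw [smul_add, h1, h1']; noncomm_ring
    · rw [map_add, map_add, poisson_add_left, h2, h2']
  mul_mem' := by
    rintro a b ⟨C, h1, h2⟩ ⟨C', h1', h2'⟩
    refine ⟨a * C' + C * b, ?_, ?_⟩
    · rw [smul_add, ← mul_smul_comm, ← smul_mul_assoc, h1, h1']; noncomm_ring
    · rw [map_add, map_mul, map_mul, map_mul, poisson_mul_left, h2, h2']
  algebraMap_mem' := by
    intro r
    refine ⟨0, ?_, ?_⟩
    · rw [smul_zero, Algebra.commutes, sub_self]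
    · rw [map_zero, symbol_algebraMap, poisson_C_left]

theorem poisson_pos_pos (c c' : Coord (Arr.src (V := V)) Arr.tgt d) :
    poisson (MvPolynomial.X (posCoord c) : FunCot K d) (MvPolynomial.X (posCoord c')) = 0 := by
  simp [poisson, MvPolynomial.pderiv_X_of_ne (posCoord_ne_momCoord _ _)]

theorem poisson_mom_mom (c c' : Coord (Arr.src (V := V)) Arr.tgt d) :
    poisson (MvPolynomial.X (momCoord c) : FunCot K d) (MvPolynomial.X (momCoord c')) = 0 := by
  simp [poisson, MvPolynomial.pderiv_X_of_ne (posCoord_ne_momCoord _ _).symm]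

theorem poisson_mom_pos (c c' : Coord (Arr.src (V := V)) Arr.tgt d) [Decidable (c = c')] :
    poisson (MvPolynomial.X (momCoord c) : FunCot K d) (MvPolynomial.X (posCoord c')) =
      if c = c' then 1 else 0 := by
  classical
  rw [poisson, Finset.sum_eq_single c]
  · rw [MvPolynomial.pderiv_X_of_ne (posCoord_ne_momCoord _ _).symm]
    simp only [MvPolynomial.pderiv_X_self, MvPolynomial.pderiv_X, Pi.single_apply,
      posCoord_injective.eq_iff]
    simp [eq_comm]
  · intro b _ hb
    rw [MvPolynomial.pderiv_X_of_ne (posCoord_ne_momCoord _ _).symm,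
      MvPolynomial.pderiv_X_of_ne (momCoord_injective.ne hb.symm)]
    simp
  · simp

theorem hasLimit_opD_opX (c c' : Coord (Arr.src (V := V)) Arr.tgt d) :
    HasLimit (opD c : DRep K d) (opX c') := by
  classical
  refine ⟨if c = c' then 1 else 0, ?_, ?_⟩
  · rw [opD_mul_opX, add_sub_cancel_left]
    split_ifs <;> simp [Algebra.algebraMap_eq_smul_one]
  · rw [symbol_opD, symbol_opX, poisson_mom_pos]
    split_ifs <;> simp

/-- For fixed `B` the operators `A` with a limit form a subalgebra by the Leibniz rules, and the
relation is symmetric. Applying this in both arguments leaves only pairs of generators. -/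
theorem hasLimit (A B : DRep (V := V) K d) : HasLimit A B := by
  have gen : ∀ (B : DRep (V := V) K d), (∀ c, HasLimit (opX c) B) → (∀ c, HasLimit (opD c) B) →
      ∀ A, HasLimit A B := by
    intro B h1 h2 A
    have : limitSubalgebra B = ⊤ := DiffOp.affine_subalgebra_eq_top _ h1 h2
    have hA : A ∈ limitSubalgebra B := by rw [this]; trivial
    exact hA
  refine gen B (fun c => (gen _ ?_ ?_ B).symm) (fun c => (gen _ ?_ ?_ B).symm) A
  · intro c'
    exact ⟨0, by rw [DiffOp.ofFun_comm]; simp, by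
      rw [map_zero, symbol_opX, symbol_opX, poisson_pos_pos]⟩
  · exact fun c' => hasLimit_opD_opX c' c
  · exact fun c' => (hasLimit_opD_opX c c').symm
  · intro c'
    exact ⟨0, by rw [DiffOp.ofDer_pderiv_comm]; simp, by
      rw [map_zero, symbol_opD, symbol_opD, poisson_mom_mom]⟩

/-- Cancelling $\hbar$ makes the quotient unique, so the limit does not depend on its choice. -/
theorem symbol_of_commutator (A B C : DRep (V := V) K d)
    (h : (Polynomial.X : K[X]) • C = A * B - B * A) :
    symbol K d C = poisson (symbol K d A) (symbol K d B) := by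
  obtain ⟨C', h1, h2⟩ := hasLimit A B
  rw [← h2, hbar_smul_injective C C' (h.trans h1.symm)]

end NormalOrdering

/-! ### Reductivity by means of a Casimir operator -/

section Casimir

/-- Semilinearity lets this serve both for restriction to a subspace and for the passage from
rational coefficients to a larger field. -/
theorem aeval_intertwine {k k' M M' : Type*} [Field k] [Field k'] [AddCommGroup M]
    [AddCommGroup M'] [Module k M] [Module k' M'] (ρ : k →+* k') (φ : M →+ M')
    (hs : ∀ (c : k) (x : M), φ (c • x) = ρ c • φ x) (C : Module.End k M) (C' : Module.End k' M')
    (h : ∀ x, φ (C x) = C' (φ x)) (r : k[X]) (x : M) :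
    φ (Polynomial.aeval C r x) = Polynomial.aeval C' (r.map ρ) (φ x) := by
  induction r using Polynomial.induction_on' generalizing x with
  | add p q hp hq => simp [hp, hq]
  | monomial n a =>
    have hn : ∀ x, φ ((C ^ n) x) = (C' ^ n) (φ x) := by
      induction n with
      | zero => simp
      | succ n ih => intro x; rw [pow_succ, pow_succ, Module.End.mul_apply, ih, h]; rfl
    simp [Polynomial.aeval_monomial, Module.algebraMap_end_apply, hs, hn]

theorem exists_annihilating {k M : Type*} [Field k] [AddCommGroup M] [Module k M]
    (C : Module.End k M) (W : Submodule k M) [FiniteDimensional k W] (hW : ∀ x ∈ W, C x ∈ W) :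
    ∃ p : k[X], p ≠ 0 ∧ ∀ x ∈ W, Polynomial.aeval C p x = 0 := by
  refine ⟨minpoly k (C.restrict hW), minpoly.ne_zero (Algebra.IsIntegral.isIntegral _), ?_⟩
  intro x hx
  have h := aeval_intertwine (RingHom.id k) (W.subtype : W →+ M) (fun c x => rfl) (C.restrict hW) C
    (fun x => rfl) (minpoly k (C.restrict hW)) ⟨x, hx⟩
  rw [Polynomial.map_id, minpoly.aeval] at h
  exact h.symm

variable {σ : Type w} [Fintype σ]

/-- The linear vector field with a given matrix. -/
def linDer (A : Type*) [CommRing A] (m : σ → σ → ℤ) :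
    Derivation A (MvPolynomial σ A) (MvPolynomial σ A) :=
  MvPolynomial.mkDerivation A fun c' => ∑ c, (m c c' : MvPolynomial σ A) * MvPolynomial.X c

theorem linDer_X {A : Type*} [CommRing A] (m : σ → σ → ℤ) (c' : σ) :
    linDer A m (MvPolynomial.X c') = ∑ c, (m c c' : MvPolynomial σ A) * MvPolynomial.X c :=
  MvPolynomial.mkDerivation_X _ _ _

theorem linDer_map {A B : Type*} [CommRing A] [CommRing B] (ρ : A →+* B) (m : σ → σ → ℤ)
    (f : MvPolynomial σ A) :
    MvPolynomial.map ρ (linDer A m f) = linDer B m (MvPolynomial.map ρ f) := by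
  induction f using MvPolynomial.induction_on with
  | C a => simp
  | add f g hf hg => simp [hf, hg]
  | mul_X f c hf => simp [hf, linDer_X]

/-- The Casimir operator of a family of linear vector fields. -/
def casimir {ι : Type*} [Fintype ι] (k A : Type*) [CommRing k] [CommRing A] [Algebra k A]
    (m : ι → σ → σ → ℤ) : Module.End k (MvPolynomial σ A) :=
  ∑ i, (linDer A (fun c c' => m i c' c)).toLinearMap.restrictScalars k ∘ₗ
    (linDer A (m i)).toLinearMap.restrictScalars k

theorem casimir_apply {ι : Type*} [Fintype ι] {k A : Type*} [CommRing k] [CommRing A] [Algebra k A]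
    (m : ι → σ → σ → ℤ) (f : MvPolynomial σ A) : casimir k A m f =
      ∑ i, linDer A (fun c c' => m i c' c) (linDer A (m i) f) := by
  simp [casimir, LinearMap.sum_apply]

variable (σ) in
/-- The inner product for which the monomials are orthogonal and multiplication by a variable
is adjoint to the partial derivative. -/
def fischer : MvPolynomial σ ℚ →ₗ[ℚ] MvPolynomial σ ℚ →ₗ[ℚ] ℚ :=
  (MvPolynomial.basisMonomials σ ℚ).constr ℚ fun α =>
    ((∏ c, (α c).factorial : ℕ) : ℚ) • MvPolynomial.lcoeff ℚ α

theorem fischer_monomial (α : σ →₀ ℕ) (a : ℚ) (g : MvPolynomial σ ℚ) :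
    fischer σ (MvPolynomial.monomial α a) g =
      a * (((∏ c, (α c).factorial : ℕ) : ℚ) * MvPolynomial.coeff α g) := by
  have h : MvPolynomial.monomial α a = a • MvPolynomial.basisMonomials σ ℚ α := by
    rw [MvPolynomial.coe_basisMonomials, MvPolynomial.smul_monomial, smul_eq_mul, mul_one]
  rw [h, map_smul, fischer, Module.Basis.constr_basis]
  rfl

theorem fischer_comm (f g : MvPolynomial σ ℚ) : fischer σ f g = fischer σ g f := by
  induction f using MvPolynomial.induction_on' with
  | add p q hp hq => rw [map_add, LinearMap.add_apply, hp, hq, map_add]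
  | monomial u a =>
    induction g using MvPolynomial.induction_on' with
    | add p q hp hq => rw [map_add, hp, hq, map_add, LinearMap.add_apply]
    | monomial v b =>
      classical
      rw [fischer_monomial, fischer_monomial, MvPolynomial.coeff_monomial,
        MvPolynomial.coeff_monomial]
      by_cases h : u = v
      · subst h; simp; ring
      · simp [h, Ne.symm h]

/-- The factorial weights are chosen for this: $(n+1)!=(n+1)\,n!$ supplies the factor that
differentiation produces. -/
theorem fischer_X_mul (c : σ) (f g : MvPolynomial σ ℚ) :
    fischer σ (MvPolynomial.X c * f) g = fischer σ f (MvPolynomial.pderiv c g) := by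
  classical
  induction f using MvPolynomial.induction_on' with
  | add p q hp hq => rw [mul_add, map_add, LinearMap.add_apply, hp, hq, map_add]; rfl
  | monomial u a =>
    have h : MvPolynomial.X c * MvPolynomial.monomial u a =
        MvPolynomial.monomial (u + Finsupp.single c 1) a := by
      rw [MvPolynomial.X, MvPolynomial.monomial_mul, one_mul, add_comm]
    rw [h, fischer_monomial, fischer_monomial, MvPolynomial.coeff_pderiv]
    have h2 : ∏ x, ((u + Finsupp.single c 1 : σ →₀ ℕ) x).factorial = (∏ x, (u x).factorial) * (u c + 1) := by
      rw [← Finset.mul_prod_erase _ _ (Finset.mem_univ c),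
        ← Finset.mul_prod_erase _ (fun x => (u x).factorial) (Finset.mem_univ c)]
      have h3 : ∏ x ∈ Finset.univ.erase c, ((u + Finsupp.single c 1 : σ →₀ ℕ) x).factorial =
          ∏ x ∈ Finset.univ.erase c, (u x).factorial := by
        refine Finset.prod_congr rfl fun x hx => ?_
        rw [Finsupp.add_apply, Finsupp.single_eq_of_ne (Finset.ne_of_mem_erase hx), add_zero]
      rw [h3, Finsupp.add_apply, Finsupp.single_eq_same, Nat.factorial_succ]
      ring
    rw [h2]
    push_cast
    ring

theorem fischer_self (f : MvPolynomial σ ℚ) : fischer σ f f =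
    ∑ α ∈ f.support, ((∏ c, (α c).factorial : ℕ) : ℚ) * (MvPolynomial.coeff α f) ^ 2 := by
  have h : fischer σ f f = fischer σ (∑ α ∈ f.support, MvPolynomial.monomial α (f.coeff α)) f := by
    rw [MvPolynomial.support_sum_monomial_coeff]
  rw [h, map_sum, LinearMap.sum_apply]
  refine Finset.sum_congr rfl fun α _ => ?_
  rw [fischer_monomial]
  ring

theorem fischer_self_nonneg (f : MvPolynomial σ ℚ) : 0 ≤ fischer σ f f := by
  rw [fischer_self]
  exact Finset.sum_nonneg fun α _ => by positivity

/-- Definiteness is an ordered-field argument and the reason for working over $\mathbb Q$ first. -/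
theorem fischer_self_eq_zero (f : MvPolynomial σ ℚ) (h : fischer σ f f = 0) : f = 0 := by
  rw [fischer_self, Finset.sum_eq_zero_iff_of_nonneg (fun α _ => by positivity)] at h
  ext α
  rw [MvPolynomial.coeff_zero]
  by_contra hα
  have h1 := h α (MvPolynomial.mem_support_iff.2 hα)
  have h2 : ((∏ c, (α c).factorial : ℕ) : ℚ) ≠ 0 :=
    Nat.cast_ne_zero.2 (Finset.prod_ne_zero_iff.2 fun c _ => Nat.factorial_ne_zero _)
  rcases mul_eq_zero.1 h1 with h3 | h3
  exacts [h2 h3, hα (pow_eq_zero_iff (two_ne_zero) |>.1 h3)]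

theorem linDer_apply {A : Type*} [CommRing A] (m : σ → σ → ℤ) (f : MvPolynomial σ A) :
    linDer A m f = ∑ c', ∑ c, (m c c' : A) • (MvPolynomial.X c * MvPolynomial.pderiv c' f) := by
  rw [DiffOp.der_eq_sum]
  refine Finset.sum_congr rfl fun c' _ => ?_
  rw [linDer_X, Finset.smul_sum]
  refine Finset.sum_congr rfl fun c _ => ?_
  rw [MvPolynomial.smul_eq_C_mul, map_intCast, smul_eq_mul]
  ring

/-- The adjoint of $x_c\,\partial_{c'}$ is $x_{c'}\,\partial_c$, so adjoints correspond to
transposed matrices. -/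
theorem fischer_linDer (m : σ → σ → ℤ) (f g : MvPolynomial σ ℚ) :
    fischer σ (linDer ℚ m f) g = fischer σ f (linDer ℚ (fun c c' => m c' c) g) := by
  rw [linDer_apply, linDer_apply]
  simp only [map_sum, LinearMap.sum_apply, map_smul, LinearMap.smul_apply]
  rw [Finset.sum_comm]
  refine Finset.sum_congr rfl fun c _ => Finset.sum_congr rfl fun c' _ => ?_
  rw [fischer_X_mul, fischer_comm f, fischer_X_mul, fischer_comm]

variable {ι : Type*} [Fintype ι] (m : ι → σ → σ → ℤ)

/-- The Casimir operator is $\sum L_i^{T}L_i$ with the transpose as adjoint, hence positive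
semidefinite. -/
theorem fischer_casimir (f g : MvPolynomial σ ℚ) : fischer σ f (casimir ℚ ℚ m g) =
    ∑ i, fischer σ (linDer ℚ (m i) f) (linDer ℚ (m i) g) := by
  rw [casimir_apply, map_sum]
  refine Finset.sum_congr rfl fun i _ => ?_
  rw [← fischer_linDer]

theorem casimir_symm (f g : MvPolynomial σ ℚ) : fischer σ f (casimir ℚ ℚ m g) =
    fischer σ (casimir ℚ ℚ m f) g := by
  rw [fischer_comm _ g, fischer_casimir, fischer_casimir]
  exact Finset.sum_congr rfl fun i _ => fischer_comm _ _

/-- From $Cf=0$ follows $0=\langle f,Cf\rangle=\sum\langle L_if,L_if\rangle$, a sum of nonnegative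
terms. -/
theorem linDer_eq_zero_of_casimir (f : MvPolynomial σ ℚ) (h : casimir ℚ ℚ m f = 0) (i : ι) :
    linDer ℚ (m i) f = 0 := by
  have h1 := fischer_casimir m f f
  rw [h, map_zero] at h1
  have h2 := (Finset.sum_eq_zero_iff_of_nonneg
    (fun i _ => fischer_self_nonneg (linDer ℚ (m i) f))).1 h1.symm i (Finset.mem_univ i)
  exact fischer_self_eq_zero _ h2

/-- Self-adjointness gives $\langle Cf,Cf\rangle=\langle C^2f,f\rangle=0$. So the generalized kernel
of $C$ is its kernel. -/
theorem casimir_eq_zero_of_sq (f : MvPolynomial σ ℚ)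
    (h : casimir ℚ ℚ m (casimir ℚ ℚ m f) = 0) : casimir ℚ ℚ m f = 0 := by
  refine fischer_self_eq_zero _ ?_
  rw [← casimir_symm, h, map_zero]

theorem casimir_eq_zero_of_pow (n : ℕ) (f : MvPolynomial σ ℚ)
    (h : (casimir ℚ ℚ m ^ (n + 1)) f = 0) : casimir ℚ ℚ m f = 0 := by
  induction n with
  | zero => simpa using h
  | succ n ih =>
    refine ih ?_
    rw [pow_succ', Module.End.mul_apply]
    refine casimir_eq_zero_of_sq m _ ?_
    rw [← Module.End.mul_apply, ← Module.End.mul_apply, mul_assoc, ← pow_succ', ← pow_succ']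
    exact h

/-- Keeps the Casimir operator inside the finite-dimensional spaces of bounded degree, where it has
an annihilating polynomial. -/
theorem linDer_totalDegree_le (m : σ → σ → ℤ) (f : MvPolynomial σ ℚ) :
    (linDer ℚ m f).totalDegree ≤ f.totalDegree := by
  classical
  rw [linDer_apply]
  refine MvPolynomial.totalDegree_finsetSum_le fun c' _ => ?_
  refine MvPolynomial.totalDegree_finsetSum_le fun c _ => ?_
  refine (MvPolynomial.totalDegree_smul_le _ _).trans ?_
  rw [MvPolynomial.totalDegree, Finset.sup_le_iff]
  intro u hu
  rw [MvPolynomial.mem_support_iff, MvPolynomial.coeff_X_mul'] at hu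
  have hc : c ∈ u.support := by
    by_contra hc
    simp [hc] at hu
  rw [if_pos hc, MvPolynomial.coeff_pderiv] at hu
  have h1 := MvPolynomial.le_totalDegree
    (MvPolynomial.mem_support_iff.2 (left_ne_zero_of_mul hu))
  refine le_trans ?_ h1
  change u.degree ≤ Finsupp.degree _
  have h2 : u = (u - Finsupp.single c 1) + Finsupp.single c 1 := by
    ext x
    by_cases hx : x = c
    · subst hx
      have := Finsupp.mem_support_iff.1 hc
      simp; omega
    · simp [Finsupp.single_eq_of_ne hx]
  conv_lhs => rw [h2]
  simp

/-- Split an annihilating polynomial of $C$ as $X^nq$ with $q(0)\ne0$. Then $C^nq(C)f=0$, so already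
$C\,q(C)f=0$ and $q(C)f$ is invariant; dividing by $q(0)$ gives $r$. -/
theorem exists_invariant_projection_rat (f : MvPolynomial σ ℚ) : ∃ r : ℚ[X], r.coeff 0 = 1 ∧
    ∀ i, linDer ℚ (m i) (Polynomial.aeval (casimir ℚ ℚ m) r f) = 0 := by
  have hfin : FiniteDimensional ℚ (MvPolynomial.restrictTotalDegree σ ℚ f.totalDegree) := by
    infer_instance
  obtain ⟨p, hp, hpf⟩ := exists_annihilating (casimir ℚ ℚ m)
    (MvPolynomial.restrictTotalDegree σ ℚ f.totalDegree) (by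
      intro g hg
      rw [MvPolynomial.mem_restrictTotalDegree] at hg ⊢
      rw [casimir_apply]
      exact MvPolynomial.totalDegree_finsetSum_le fun i _ =>
        ((linDer_totalDegree_le _ _).trans (linDer_totalDegree_le _ _)).trans hg)
  have hpf := hpf f (by rw [MvPolynomial.mem_restrictTotalDegree])
  obtain ⟨q, hq, hq0⟩ := Polynomial.exists_eq_pow_rootMultiplicity_mul_and_not_dvd p hp 0
  rw [map_zero, sub_zero] at hq hq0
  rw [Polynomial.X_dvd_iff] at hq0
  refine ⟨Polynomial.C (q.coeff 0)⁻¹ * q, by simp [hq0], fun i => ?_⟩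
  refine linDer_eq_zero_of_casimir m _ ?_ i
  have h1 : casimir ℚ ℚ m (Polynomial.aeval (casimir ℚ ℚ m) q f) = 0 := by
    refine casimir_eq_zero_of_pow m (p.rootMultiplicity 0) _ ?_
    -- The extra factor $X$ makes the power of $C$ positive even when $0$ is not a root of `p`.
    have h2 : Polynomial.aeval (casimir ℚ ℚ m) (Polynomial.X * p) f = 0 := by
      rw [map_mul, Module.End.mul_apply, hpf, map_zero]
    rw [hq, ← mul_assoc, ← pow_succ', map_mul, map_pow, Polynomial.aeval_X] at h2
    exact h2
  rw [map_mul, Module.End.mul_apply, Polynomial.aeval_C, Module.algebraMap_end_apply, map_smul,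
    h1, smul_zero]

/-- Every function has an invariant projection that is a polynomial in the Casimir operator. -/
theorem exists_invariant_projection {k A : Type*} [Field k] [CharZero k] [CommRing A] [Algebra k A]
    (f : MvPolynomial σ A) : ∃ r : k[X], r.coeff 0 = 1 ∧
    ∀ i, linDer A (m i) (Polynomial.aeval (casimir k A m) r f) = 0 := by
  have hsmul : ∀ (a : A) (f : MvPolynomial σ A) (r : k[X]),
      Polynomial.aeval (casimir k A m) r (a • f) = a • Polynomial.aeval (casimir k A m) r f := by
    intro a f r
    have := aeval_intertwine (RingHom.id k)
      (DistribSMul.toAddMonoidHom (MvPolynomial σ A) a) (fun c x => smul_comm _ _ _)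
      (casimir k A m) (casimir k A m) (fun x => by
        simp [casimir_apply]) r f
    rw [Polynomial.map_id] at this
    exact this.symm
  induction f using MvPolynomial.induction_on' with
  | add f g hf hg =>
    obtain ⟨r, hr, hrf⟩ := hf
    obtain ⟨s, hs, hsg⟩ := hg
    -- An invariant element is killed by $C$ and hence fixed by $s(C)$ when $s(0)=1$. The product of
    -- the polynomials found for the two summands therefore works for both.
    have key : ∀ (h : MvPolynomial σ A) (r s : k[X]), s.coeff 0 = 1 →
        (∀ i, linDer A (m i) (Polynomial.aeval (casimir k A m) r h) = 0) → ∀ i,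
        linDer A (m i) (Polynomial.aeval (casimir k A m) (s * r) h) = 0 := by
      intro h r s hs hr i
      have hC : casimir k A m (Polynomial.aeval (casimir k A m) r h) = 0 := by
        rw [casimir_apply]
        exact Finset.sum_eq_zero fun i _ => by rw [hr i, map_zero]
      have hs' : s = s.divX * Polynomial.X + 1 := by
        conv_lhs => rw [← Polynomial.divX_mul_X_add s, hs, map_one]
      rw [hs', map_mul, Module.End.mul_apply, map_add, map_mul, LinearMap.add_apply,
        Module.End.mul_apply, Polynomial.aeval_X, hC, map_zero, zero_add, map_one,
        Module.End.one_apply, hr i]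
    refine ⟨s * r, by simp [hr, hs], fun i => ?_⟩
    rw [map_add, map_add, key f r s hs hrf i, mul_comm, key g s r hr hsg i, add_zero]
  | monomial u a =>
    let _ : Algebra ℚ A := ((algebraMap k A).comp (algebraMap ℚ k)).toAlgebra
    -- The matrices are integral, so for a monomial the polynomial can be found over $\mathbb Q$ and
    -- transported; the coefficient `a` is a scalar for all operators involved.
    obtain ⟨r, hr, h⟩ := exists_invariant_projection_rat m (MvPolynomial.monomial u 1)
    refine ⟨r.map (algebraMap ℚ k), by simp [hr], fun i => ?_⟩
    have hu : MvPolynomial.monomial u a =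
        a • MvPolynomial.map (algebraMap ℚ A) (MvPolynomial.monomial u 1) := by
      rw [MvPolynomial.map_monomial, map_one, MvPolynomial.smul_monomial, smul_eq_mul, mul_one]
    have h2 := aeval_intertwine (algebraMap ℚ k)
      (MvPolynomial.map (σ := σ) (algebraMap ℚ A) : _ →+ _) (fun c x => by
        change MvPolynomial.map _ _ = _ • MvPolynomial.map _ _
        rw [MvPolynomial.smul_eq_C_mul, map_mul, MvPolynomial.map_C, ← MvPolynomial.smul_eq_C_mul]
        exact algebraMap_smul A (algebraMap ℚ k c) (MvPolynomial.map (algebraMap ℚ A) x))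
      (casimir ℚ ℚ m) (casimir k A m) (fun x => by
        change MvPolynomial.map _ _ = casimir k A m (MvPolynomial.map _ _)
        simp only [casimir_apply, map_sum, linDer_map]) r (MvPolynomial.monomial u 1)
    change MvPolynomial.map (algebraMap ℚ A) _ =
      Polynomial.aeval (casimir k A m) _ (MvPolynomial.map (algebraMap ℚ A) _) at h2
    rw [hu, hsmul, Derivation.map_smul, ← h2, ← linDer_map, h i, map_zero, smul_zero]

end Casimir

/-! ### The action of the general linear group and of its Lie algebra -/

section PolynomialFamilies

/-- Modulo `W` the hypothesis is a Laurent polynomial in $u$ that vanishes at every unit of an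
infinite field, hence identically. Its derivative at $u=1$ is the asserted sum. Linear functionals
on the quotient reduce this to scalar polynomials. -/
theorem coeff_mem_of_eval_mem {K M : Type*} [Field K] [Infinite K] [AddCommGroup M] [Module K M]
    (W : Submodule K M) {ι : Type*} (s : Finset ι) (e : ι → ℤ) (m : ι → M)
    (h : ∀ u : Kˣ, ∑ i ∈ s, (((u : K) ^ e i) • m i - m i) ∈ W) :
    ∑ i ∈ s, (e i : K) • m i ∈ W := by
  rw [← Submodule.Quotient.mk_eq_zero, ← Module.forall_dual_apply_eq_zero_iff K]
  intro φ
  -- Multiplication by $u^B$ clears the negative exponents. In the derivative at $1$ the shift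
  -- cancels between the two powers of $X$, leaving $e_i$.
  obtain ⟨B, hB⟩ : ∃ B : ℕ, ∀ i ∈ s, 0 ≤ (B : ℤ) + e i := by
    refine ⟨∑ i ∈ s, (e i).natAbs, fun i hi => ?_⟩
    have := Finset.single_le_sum (f := fun i => (e i).natAbs) (fun _ _ => Nat.zero_le _) hi
    omega
  set c : ι → K := fun i => φ (W.mkQ (m i))
  set P : K[X] := ∑ i ∈ s, Polynomial.C (c i) *
    (Polynomial.X ^ ((B : ℤ) + e i).toNat - Polynomial.X ^ B)
  have hP : P = 0 := by
    refine Polynomial.eq_zero_of_infinite_isRoot P ?_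
    refine Set.Infinite.mono (s := {0}ᶜ) ?_ (Set.finite_singleton (0 : K)).infinite_compl
    intro u hu
    have h1 := congrArg φ ((Submodule.Quotient.mk_eq_zero W).2 (h (Units.mk0 u hu)))
    change φ (W.mkQ _) = φ 0 at h1
    simp only [map_sum, map_sub, map_smul, map_zero] at h1
    change Polynomial.IsRoot P u
    simp only [Polynomial.IsRoot, P, Polynomial.eval_finsetSum]
    rw [← mul_zero (u ^ B), ← h1, Finset.mul_sum]
    refine Finset.sum_congr rfl fun i hi => ?_
    have : u ^ ((B : ℤ) + e i).toNat = u ^ B * u ^ e i := by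
      rw [← zpow_natCast, Int.toNat_of_nonneg (hB i hi), zpow_add₀ hu, zpow_natCast]
    simp only [Polynomial.eval_mul, Polynomial.eval_C, Polynomial.eval_sub, Polynomial.eval_pow,
      Polynomial.eval_X, this, smul_eq_mul, c]
    change _ = u ^ B * (u ^ e i * _ - _)
    ring
  have h2 := congrArg (fun P => Polynomial.eval 1 (Polynomial.derivative P)) hP
  simp only [P, Polynomial.derivative_sum, Polynomial.eval_finsetSum, Polynomial.derivative_zero,
    Polynomial.eval_zero] at h2
  change φ (W.mkQ _) = 0
  rw [map_sum, map_sum, ← h2]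
  refine Finset.sum_congr rfl fun i hi => ?_
  have h3 : ((((B : ℤ) + e i).toNat : ℕ) : K) = B + e i := by
    have := congrArg (Int.cast : ℤ → K) (Int.toNat_of_nonneg (hB i hi))
    push_cast at this
    exact this
  simp [Polynomial.derivative_X_pow, h3, c, mul_comm]

/-- The polynomial analogue: modulo `W` the family is constant in $u$, so over an infinite field its
linear coefficient vanishes there. -/
theorem coeff_one_mem_of_eval_mem {K R : Type*} [Field K] [Infinite K] [CommRing R] [Algebra K R]
    (W : Submodule K R) (P : R[X])
    (h : ∀ u : K, Polynomial.eval (algebraMap K R u) P - P.coeff 0 ∈ W) : P.coeff 1 ∈ W := by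
  rw [← Submodule.Quotient.mk_eq_zero, ← Module.forall_dual_apply_eq_zero_iff K]
  intro φ
  -- The bound exceeds the degree by two so that the index $1$ always occurs in the sum.
  set Q : K[X] := ∑ i ∈ Finset.range (P.natDegree + 2),
    Polynomial.C (φ (W.mkQ (P.coeff i))) * Polynomial.X ^ i -
      Polynomial.C (φ (W.mkQ (P.coeff 0)))
  have hQ : Q = 0 := by
    refine Polynomial.funext fun u => ?_
    have h1 := congrArg φ ((Submodule.Quotient.mk_eq_zero W).2 (h u))
    change φ (W.mkQ _) = φ 0 at h1
    rw [Polynomial.eval_eq_sum_range' (n := P.natDegree + 2) (by omega)] at h1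
    have h2 : ∀ i, P.coeff i * algebraMap K R u ^ i = u ^ i • P.coeff i := fun i => by
      rw [Algebra.smul_def, map_pow, mul_comm]
    simp only [h2, map_sum, map_sub, map_smul, map_zero] at h1
    rw [Polynomial.eval_zero, ← h1, Polynomial.eval_sub, Polynomial.eval_C,
      Polynomial.eval_finsetSum]
    congr 1
    refine Finset.sum_congr rfl fun i _ => ?_
    rw [Polynomial.eval_mul, Polynomial.eval_C, Polynomial.eval_pow, Polynomial.eval_X, mul_comm,
      smul_eq_mul]
  have h2 := congrArg (fun P => Polynomial.coeff P 1) hQ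
  simp only [Q, Polynomial.coeff_sub, Polynomial.finsetSum_coeff, Polynomial.coeff_C_mul,
    Polynomial.coeff_X_pow, Polynomial.coeff_zero, Polynomial.coeff_C, one_ne_zero, if_false,
    sub_zero] at h2
  rw [Finset.sum_eq_single 1 (fun b _ hb => by rw [if_neg (Ne.symm hb), mul_zero])
    (fun h => absurd (Finset.mem_range.2 (by omega)) h)] at h2
  simpa using h2

end PolynomialFamilies

theorem zpow_finset_sum {G ι : Type*} [CommGroup G] (a : G) (f : ι → ℤ) (s : Finset ι) :
    a ^ (∑ i ∈ s, f i) = ∏ i ∈ s, a ^ f i := by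
  classical
  induction s using Finset.induction_on with
  | empty => simp
  | insert i s hi ih => rw [Finset.sum_insert hi, Finset.prod_insert hi, zpow_add, ih]

/-! ### One-parameter subgroups and linear vector fields over a coefficient algebra -/

section LinearAction

variable {K : Type u} [Field K] {V : Type v} {E : Type w}
  {A : Type*} [CommRing A] [Algebra K A] {s t : E → V} {d : V → ℕ} [DecidableEq V] [Fintype V]

section CoordMat

variable (A s t d)

/-- The matrix of coordinates of an arrow with coefficients in a commutative ring. -/
def coordMat (a : E) : Matrix (Idx d) (Idx d) (MvPolynomial (Coord s t d) A) :=
  Matrix.of fun i j =>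
    if h : i.1 = t a ∧ j.1 = s a then MvPolynomial.X ⟨(a, i, j), h⟩ else 0

variable {A s t d}

theorem coordMat_coord (c : Coord s t d) :
    coordMat A s t d c.1.1 c.1.2.1 c.1.2.2 = MvPolynomial.X c := by
  simp [coordMat, c.2]

theorem coordMat_eq_zero {a : E} {i j : Idx d} (h : ¬ (i.1 = t a ∧ j.1 = s a)) :
    coordMat A s t d a i j = 0 := by
  simp [coordMat, h]

/-- Scalar matrices in the ring of functions. -/
abbrev scalarMat (M : Matrix (Idx d) (Idx d) K) :
    Matrix (Idx d) (Idx d) (MvPolynomial (Coord s t d) A) :=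
  M.map (algebraMap K _)

theorem scalarMat_mul (M N : Matrix (Idx d) (Idx d) K) :
    (scalarMat (M * N) : Matrix (Idx d) (Idx d) (MvPolynomial (Coord s t d) A)) =
      scalarMat M * scalarMat N := Matrix.map_mul

theorem scalarMat_one :
    (scalarMat (1 : Matrix (Idx d) (Idx d) K) :
      Matrix (Idx d) (Idx d) (MvPolynomial (Coord s t d) A)) = 1 :=
  Matrix.map_one _ (map_zero _) (map_one _)

variable (A s t) in
/-- The matrix `g⁻¹ [a] g`. -/
def conjMat (g : GLd K d) (a : E) : Matrix (Idx d) (Idx d) (MvPolynomial (Coord s t d) A) :=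
  scalarMat (glMat g⁻¹) * coordMat A s t d a * scalarMat (glMat g)

variable (A s t) in
/-- The action of `GL_d` on functions with coefficients in a commutative ring. -/
def glAct (g : GLd K d) : MvPolynomial (Coord s t d) A →ₐ[A] MvPolynomial (Coord s t d) A :=
  MvPolynomial.aeval fun c =>
    conjMat A s t g c.1.1 c.1.2.1 c.1.2.2

theorem glAct_X (g : GLd K d) (c : Coord s t d) : glAct A s t g (MvPolynomial.X c) =
    conjMat A s t g c.1.1 c.1.2.1 c.1.2.2 :=
  MvPolynomial.aeval_X _ _

theorem conjMat_eq_zero (g : GLd K d) {a : E} {i j : Idx d} (h : ¬ (i.1 = t a ∧ j.1 = s a)) :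
    conjMat A s t g a i j = 0 := by
  rw [conjMat, Matrix.mul_apply]
  refine Finset.sum_eq_zero fun l _ => ?_
  rw [Matrix.mul_apply, Finset.sum_mul]
  refine Finset.sum_eq_zero fun k _ => ?_
  by_cases hi : i.1 = k.1
  · by_cases hj : l.1 = j.1
    · rw [coordMat_eq_zero (by rw [← hi, hj]; exact h)]; simp
    · have : glMat g l j = 0 := Matrix.blockDiagonal'_apply_ne _ _ _ hj
      simp [this]
  · have : glMat g⁻¹ i k = 0 := Matrix.blockDiagonal'_apply_ne _ _ _ hi
    simp [this]

theorem map_glAct_coordMat (g : GLd K d) (a : E) :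
    (coordMat A s t d a).map (glAct A s t g) = conjMat A s t g a := by
  ext1 i j
  by_cases h : i.1 = t a ∧ j.1 = s a
  · rw [Matrix.map_apply]
    have := coordMat_coord (A := A) (⟨(a, i, j), h⟩ : Coord s t d)
    rw [this, glAct_X]
  · rw [Matrix.map_apply, coordMat_eq_zero h, map_zero, conjMat_eq_zero g h]

theorem map_glAct_scalarMat (g : GLd K d) (M : Matrix (Idx d) (Idx d) K) :
    (scalarMat M : Matrix (Idx d) (Idx d) (MvPolynomial (Coord s t d) A)).map (glAct A s t g) =
      scalarMat M := by
  ext1 i j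
  simp only [Matrix.map_apply, IsScalarTower.algebraMap_apply K A (MvPolynomial _ A)]
  exact (glAct A s t g).commutes _

theorem glAct_comp (g h : GLd K d) :
    (glAct A s t g).comp (glAct A s t h) = glAct A s t (g * h) := by
  refine MvPolynomial.algHom_ext fun c => ?_
  have key : ((coordMat A s t d c.1.1).map (glAct A s t h)).map (glAct A s t g) =
      (coordMat A s t d c.1.1).map (glAct A s t (g * h)) := by
    rw [map_glAct_coordMat, conjMat, Matrix.map_mul, Matrix.map_mul, map_glAct_scalarMat,
      map_glAct_scalarMat, map_glAct_coordMat,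
      map_glAct_coordMat, conjMat, conjMat, mul_inv_rev, glMat_mul, glMat_mul,
      scalarMat_mul, scalarMat_mul]
    simp only [Matrix.mul_assoc]
  have := congrFun (congrFun key c.1.2.1) c.1.2.2
  simp only [Matrix.map_apply, coordMat_coord] at this
  exact this

theorem glAct_one : glAct A s t (1 : GLd K d) = AlgHom.id A _ := by
  refine MvPolynomial.algHom_ext fun c => ?_
  rw [glAct_X, conjMat, inv_one, glMat_one, scalarMat_one, one_mul, mul_one, coordMat_coord]
  rfl

end CoordMat

variable [Fintype E]

/-- The matrix of the vector field `[a] ↦ [a] E_{pq} - E_{pq} [a]`. -/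
def elemVec (p q : Idx d) : Coord s t d → Coord s t d → ℤ := by
  classical
  exact fun c c' =>
    (if c.1 = (c'.1.1, c'.1.2.1, p) ∧ c'.1.2.2 = q then 1 else 0) -
      if c.1 = (c'.1.1, q, c'.1.2.2) ∧ c'.1.2.1 = p then 1 else 0

/-- The transpose of $E_{pq}$ is $E_{qp}$: the adjoint of a vector field of the Lie algebra belongs
to the Lie algebra again, so the Casimir operator preserves every subspace stable under it. -/
theorem elemVec_transpose (p q : Idx d) (c c' : Coord s t d) :
    elemVec p q c' c = elemVec q p c c' := by
  classical
  obtain ⟨⟨a, i, j⟩, h⟩ := c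
  obtain ⟨⟨a', i', j'⟩, h'⟩ := c'
  simp only [elemVec, Prod.mk.injEq]
  congr 1
  · refine if_congr ?_ rfl rfl
    constructor <;> rintro ⟨⟨rfl, rfl, rfl⟩, rfl⟩ <;> simp
  · refine if_congr ?_ rfl rfl
    constructor <;> rintro ⟨⟨rfl, rfl, rfl⟩, rfl⟩ <;> simp

theorem sum_coord_eq_coordMat (a : E) (i j : Idx d) [DecidablePred fun c : Coord s t d =>
    c.1 = (a, i, j)] : (∑ c : Coord s t d, if c.1 = (a, i, j) then
      (MvPolynomial.X c : MvPolynomial (Coord s t d) A) else 0) = coordMat A s t d a i j := by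
  by_cases h : i.1 = t a ∧ j.1 = s a
  · rw [Finset.sum_eq_single ⟨(a, i, j), h⟩]
    · simp [coordMat, h]
    · intro b _ hb
      rw [if_neg]
      exact fun hb' => hb (Subtype.ext hb')
    · simp
  · rw [coordMat_eq_zero h]
    refine Finset.sum_eq_zero fun c _ => if_neg ?_
    intro hc
    have := c.2
    rw [hc] at this
    exact h this

variable (A) in
/-- The vector field `[a] ↦ [a] E_{pq} - E_{pq} [a]`. -/
abbrev elemDer (p q : Idx d) :
    Derivation A (MvPolynomial (Coord s t d) A) (MvPolynomial (Coord s t d) A) :=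
  linDer A (elemVec p q)

theorem elemDer_X (p q : Idx d) (c : Coord s t d) : elemDer A p q (MvPolynomial.X c) =
    (if c.1.2.2 = q then coordMat A s t d c.1.1 c.1.2.1 p else 0) -
      if c.1.2.1 = p then coordMat A s t d c.1.1 q c.1.2.2 else 0 := by
  classical
  rw [linDer_X]
  simp only [elemVec, Int.cast_sub, sub_mul, Finset.sum_sub_distrib]
  congr 1
  · split_ifs with h
    · rw [← sum_coord_eq_coordMat]
      refine Finset.sum_congr rfl fun c' _ => ?_
      simp [h]
    · exact Finset.sum_eq_zero fun c' _ => by simp [h]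
  · split_ifs with h
    · rw [← sum_coord_eq_coordMat]
      refine Finset.sum_congr rfl fun c' _ => ?_
      simp [h]
    · exact Finset.sum_eq_zero fun c' _ => by simp [h]

/-- When `p` and `q` lie in one block, $E_{pq}$ preserves the zero pattern of $[a]$, so the formula
needs no condition on `i` and `j`. -/
theorem elemDer_coordMat {p q : Idx d} (hpq : p.1 = q.1) (a : E) (i j : Idx d) :
    elemDer A p q (coordMat A s t d a i j) =
    (if j = q then coordMat A s t d a i p else 0) -
      if i = p then coordMat A s t d a q j else 0 := by
  by_cases h : i.1 = t a ∧ j.1 = s a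
  · have := coordMat_coord (A := A) (⟨(a, i, j), h⟩ : Coord s t d)
    rw [this, elemDer_X]
  · rw [coordMat_eq_zero h, map_zero]
    split_ifs with h1 h2 h2
    · subst h1 h2
      rw [coordMat_eq_zero (by rwa [← hpq] at h), coordMat_eq_zero (by rwa [hpq] at h), sub_zero]
    · subst h1
      rw [coordMat_eq_zero (by rwa [← hpq] at h), sub_zero]
    · subst h2
      rw [coordMat_eq_zero (by rwa [hpq] at h), sub_zero]
    · rw [sub_zero]

/-! #### Transvections -/

section Transvection

/-- Conjugation by $1+uE_{pq}$ is quadratic in $u$. The hypotheses say that differentiating in $u$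
and applying the derivation to the coefficients agree, that is, that the polynomial is a flow. -/
theorem derivative_quadratic {S : Type*} [CommRing S] [Differential S] (x y z : S)
    (hx : Differential.deriv x = y) (hy : Differential.deriv y = -2 * z)
    (hz : Differential.deriv z = 0) :
    Polynomial.derivative (Polynomial.monomial 0 x + Polynomial.monomial 1 y -
      Polynomial.monomial 2 z) = Differential.mapCoeffs (Polynomial.monomial 0 x +
        Polynomial.monomial 1 y - Polynomial.monomial 2 z) := by
  rw [Polynomial.derivative_sub, Polynomial.derivative_add, Derivation.map_sub, Derivation.map_add]
  simp only [Polynomial.derivative_monomial, Differential.mapCoeffs_monomial, hx, hy, hz]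
  simp [sub_eq_add_neg, mul_comm]

theorem derivative_eq_mapCoeffs_mul {S : Type*} [CommRing S] [Differential S] {P Q : S[X]}
    (hP : Polynomial.derivative P = Differential.mapCoeffs P)
    (hQ : Polynomial.derivative Q = Differential.mapCoeffs Q) :
    Polynomial.derivative (P * Q) = Differential.mapCoeffs (P * Q) := by
  rw [Polynomial.derivative_mul, Derivation.leibniz, hP, hQ, smul_eq_mul, smul_eq_mul]
  ring

open Polynomial in
variable (A s t) in
/-- The one-parameter group of a transvection. -/
def transvecFamily (p q : Idx d) :
    MvPolynomial (Coord s t d) A →ₐ[A] (MvPolynomial (Coord s t d) A)[X] :=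
  MvPolynomial.aeval fun c =>
    Polynomial.monomial 0 (MvPolynomial.X c) +
      Polynomial.monomial 1 (elemDer A p q (MvPolynomial.X c)) - Polynomial.monomial 2
        (if c.1.2.1 = p ∧ c.1.2.2 = q then coordMat A s t d c.1.1 q p else 0)

theorem eval_transvecFamily {p q : Idx d} (g : GLd K d) (u : K)
    (hg : glMat g = 1 + Matrix.single p q u) (hg' : glMat g⁻¹ = 1 - Matrix.single p q u)
    (f : MvPolynomial (Coord s t d) A) :
    Polynomial.eval (algebraMap K _ u) (transvecFamily A s t p q f) = glAct A s t g f := by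
  induction f using MvPolynomial.induction_on with
  | C a =>
    rw [← MvPolynomial.algebraMap_eq, AlgHom.commutes, AlgHom.commutes]
    simp [Polynomial.algebraMap_apply]
  | add f g hf hg => rw [map_add, map_add, Polynomial.eval_add, hf, hg]
  | mul_X f c hf =>
    rw [map_mul, map_mul, Polynomial.eval_mul, hf]
    congr 1
    have hs : (scalarMat (1 + Matrix.single p q u) :
        Matrix (Idx d) (Idx d) (MvPolynomial (Coord s t d) A)) =
        1 + Matrix.single p q (algebraMap K _ u) := by
      rw [scalarMat, Matrix.map_add _ (map_add _), Matrix.map_one _ (map_zero _) (map_one _),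
        Matrix.map_single]
    have hs' : (scalarMat (1 - Matrix.single p q u) :
        Matrix (Idx d) (Idx d) (MvPolynomial (Coord s t d) A)) =
        1 - Matrix.single p q (algebraMap K _ u) := by
      rw [scalarMat, Matrix.map_sub _ (map_sub _), Matrix.map_one _ (map_zero _) (map_one _),
        Matrix.map_single]
    rw [glAct_X, conjMat, hg, hg', hs, hs', transvecFamily, MvPolynomial.aeval_X]
    simp only [sub_mul, one_mul, mul_add, mul_one, Matrix.add_apply, Matrix.sub_apply,
      coordMat_coord, Polynomial.eval_sub, Polynomial.eval_add, Polynomial.eval_monomial,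
      elemDer_X]
    by_cases h1 : c.1.2.1 = p <;> by_cases h2 : c.1.2.2 = q
    · simp only [h1, h2, if_true, and_self, Matrix.mul_single_apply_same,
        Matrix.single_mul_apply_same]
      ring
    · simp only [h1, h2, if_true, if_false, and_false, Matrix.single_mul_apply_same]
      rw [Matrix.mul_single_apply_of_ne _ _ _ _ _ h2, Matrix.mul_single_apply_of_ne _ _ _ _ _ h2]
      ring
    · simp only [h1, h2, if_true, if_false, false_and, Matrix.mul_single_apply_same]
      rw [Matrix.single_mul_apply_of_ne _ _ _ _ _ h1, Matrix.single_mul_apply_of_ne _ _ _ _ _ h1]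
      ring
    · simp only [h1, h2, if_false, false_and]
      rw [Matrix.mul_single_apply_of_ne _ _ _ _ _ h2, Matrix.mul_single_apply_of_ne _ _ _ _ _ h2,
        Matrix.single_mul_apply_of_ne _ _ _ _ _ h1]
      ring

theorem coeff_transvecFamily_zero (p q : Idx d) (f : MvPolynomial (Coord s t d) A) :
    (transvecFamily A s t p q f).coeff 0 = f := by
  induction f using MvPolynomial.induction_on with
  | C a =>
    rw [← MvPolynomial.algebraMap_eq, AlgHom.commutes]
    simp [Polynomial.algebraMap_apply]
  | add f g hf hg => rw [map_add, Polynomial.coeff_add, hf, hg]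
  | mul_X f c hf =>
    rw [map_mul, Polynomial.mul_coeff_zero, hf, transvecFamily, MvPolynomial.aeval_X]
    simp [Polynomial.coeff_monomial]

/-- The family is the exponential of the vector field, stated here without dividing by factorials.
The flow equation passes to sums and products, so only the variables have to be checked. -/
theorem coeff_transvecFamily_succ {p q : Idx d} (hpq : p.1 = q.1) (hne : p ≠ q)
    (f : MvPolynomial (Coord s t d) A) (n : ℕ) :
    ((n : MvPolynomial (Coord s t d) A) + 1) * (transvecFamily A s t p q f).coeff (n + 1) =
      elemDer A p q ((transvecFamily A s t p q f).coeff n) := by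
  let _ : Differential (MvPolynomial (Coord s t d) A) := ⟨(elemDer A p q).restrictScalars ℤ⟩
  suffices h : Polynomial.derivative (transvecFamily A s t p q f) =
      Differential.mapCoeffs (transvecFamily A s t p q f) by
    have := congrArg (fun P => Polynomial.coeff P n) h
    simp only [Polynomial.coeff_derivative, Differential.coeff_mapCoeffs] at this
    rw [mul_comm, this]; rfl
  induction f using MvPolynomial.induction_on with
  | C a =>
    rw [← MvPolynomial.algebraMap_eq, AlgHom.commutes, Polynomial.algebraMap_apply,
      Polynomial.derivative_C, Differential.mapCoeffs_C]
    have : Differential.deriv (algebraMap A (MvPolynomial (Coord s t d) A) a) = 0 :=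
      Derivation.map_algebraMap (elemDer A p q) a
    rw [this, map_zero]
  | add f g hf hg => rw [map_add, map_add, map_add, hf, hg]
  | mul_X f c hf =>
    rw [map_mul]
    refine derivative_eq_mapCoeffs_mul hf ?_
    have hδ : ∀ x : MvPolynomial (Coord s t d) A, Differential.deriv x = elemDer A p q x := fun _ => rfl
    have h0 : elemDer A p q (if c.1.2.1 = p ∧ c.1.2.2 = q then coordMat A s t d c.1.1 q p
        else 0) = 0 := by
      split_ifs
      · rw [elemDer_coordMat hpq, if_neg hne, if_neg hne.symm, sub_zero]
      · rw [map_zero]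
    -- Since $p\ne q$, $E_{pq}^2=0$ and only the cross term $-2E[a]E$ of the second derivative
    -- survives; its sole entry is at $(p,q)$.
    have h1 : elemDer A p q (elemDer A p q (MvPolynomial.X c)) =
        -2 * (if c.1.2.1 = p ∧ c.1.2.2 = q then coordMat A s t d c.1.1 q p else 0) := by
      rw [elemDer_X, map_sub, apply_ite (elemDer A p q), apply_ite (elemDer A p q), map_zero,
        elemDer_coordMat hpq, elemDer_coordMat hpq, if_neg hne, if_neg hne.symm]
      by_cases h1 : c.1.2.1 = p <;> by_cases h2 : c.1.2.2 = q <;> simp [h1, h2]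
      ring
    rw [transvecFamily, MvPolynomial.aeval_X]
    exact derivative_quadratic _ _ _ (hδ _) ((hδ _).trans h1) ((hδ _).trans h0)

/-- The vector field is the linear coefficient of its one-parameter group, which can be extracted
modulo `W` because the field is infinite. -/
theorem elemDer_mem_of_transvection [Infinite K]
    {p q : Idx d} (hpq : p.1 = q.1) (hne : p ≠ q)
    (W : Submodule K (MvPolynomial (Coord s t d) A)) (f : MvPolynomial (Coord s t d) A)
    (g : K → GLd K d) (hg : ∀ u, glMat (g u) = 1 + Matrix.single p q u)
    (hg' : ∀ u, glMat (g u)⁻¹ = 1 - Matrix.single p q u)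
    (h : ∀ u, glAct A s t (g u) f - f ∈ W) : elemDer A p q f ∈ W := by
  have h1 := coeff_transvecFamily_succ hpq hne f 0
  rw [coeff_transvecFamily_zero, Nat.cast_zero, zero_add, one_mul] at h1
  rw [← h1]
  refine coeff_one_mem_of_eval_mem W _ fun u => ?_
  rw [eval_transvecFamily (g u) u (hg u) (hg' u), coeff_transvecFamily_zero]
  exact h u

/-- The flow equation determines each coefficient from the previous one up to the invertible factor
$n+1$, so the family is constant once its linear coefficient vanishes. -/
theorem glAct_eq_of_transvection [CharZero K] {p q : Idx d} (hpq : p.1 = q.1) (hne : p ≠ q)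
    (f : MvPolynomial (Coord s t d) A) (g : GLd K d) (u : K)
    (hg : glMat g = 1 + Matrix.single p q u) (hg' : glMat g⁻¹ = 1 - Matrix.single p q u)
    (h : elemDer A p q f = 0) : glAct A s t g f = f := by
  have h1 : ∀ n, (transvecFamily A s t p q f).coeff (n + 1) = 0 := by
    have hn : ∀ (n : ℕ) x, ((n : MvPolynomial (Coord s t d) A) + 1) * x = 0 → x = 0 := by
      intro n x hx
      have h2 : ((n : K) + 1) • x = 0 := by
        rw [Algebra.smul_def, map_add, map_natCast, map_one, hx]
      exact (smul_eq_zero_iff_right (Nat.cast_add_one_ne_zero n)).1 h2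
    intro n
    refine hn n _ ?_
    rw [coeff_transvecFamily_succ hpq hne]
    induction n with
    | zero => rw [coeff_transvecFamily_zero, h]
    | succ n ih => rw [hn n _ ((coeff_transvecFamily_succ hpq hne f n).trans ih), map_zero]
  rw [← eval_transvecFamily g u hg hg', ← Polynomial.divX_mul_X_add (transvecFamily A s t p q f)]
  have h2 : (transvecFamily A s t p q f).divX = 0 := by
    ext1 n
    rw [Polynomial.coeff_divX, h1, Polynomial.coeff_zero]
  rw [h2, zero_mul, zero_add, Polynomial.eval_C, coeff_transvecFamily_zero]

end Transvection

/-! #### Tori -/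

section Torus

/-- The weight of a coordinate. -/
def coordWeight (p : Idx d) (c : Coord s t d) : ℤ :=
  (if c.1.2.2 = p then 1 else 0) - if c.1.2.1 = p then 1 else 0

/-- The weight of a monomial. -/
def monoWeight (p : Idx d) (α : Coord s t d →₀ ℕ) : ℤ :=
  ∑ c, (α c : ℤ) * coordWeight p c

theorem elemVec_self (p : Idx d) (c c' : Coord s t d) [Decidable (c = c')] :
    elemVec p p c c' = if c = c' then coordWeight p c else 0 := by
  classical
  obtain ⟨⟨a, i, j⟩, h⟩ := c
  obtain ⟨⟨a', i', j'⟩, h'⟩ := c'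
  simp only [elemVec, coordWeight]
  by_cases hc : (a, i, j) = (a', i', j')
  · rw [if_pos (Subtype.ext hc)]
    simp only [Prod.mk.injEq] at hc
    obtain ⟨rfl, rfl, rfl⟩ := hc
    congr 1
    · refine if_congr ?_ rfl rfl
      constructor
      · exact fun h => h.2
      · rintro rfl; simp
    · refine if_congr ?_ rfl rfl
      constructor
      · exact fun h => h.2
      · rintro rfl; simp
  · rw [if_neg (fun h => hc (congrArg Subtype.val h)), if_neg, if_neg, sub_zero]
    · rintro ⟨h1, h2⟩; exact hc (by rw [h1, h2])
    · rintro ⟨h1, h2⟩; exact hc (by rw [h1, h2])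

/-- $E_{pp}$ is diagonal in the coordinates. Its eigenvalue on a monomial is the exponent of the
torus character in `glAct_monomial`. -/
theorem elemDer_self_monomial (p : Idx d) (α : Coord s t d →₀ ℕ) (a : A) :
    elemDer A p p (MvPolynomial.monomial α a) =
      (monoWeight p α : A) • MvPolynomial.monomial α a := by
  classical
  rw [linDer_apply, monoWeight, Int.cast_sum, Finset.sum_smul]
  refine Finset.sum_congr rfl fun c' _ => ?_
  rw [Finset.sum_eq_single c']
  · rw [MvPolynomial.X_mul_pderiv_monomial, elemVec_self, if_pos rfl, ← Nat.cast_smul_eq_nsmul A,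
      smul_smul]
    push_cast
    rw [mul_comm]
  · intro b _ hb
    rw [elemVec_self, if_neg hb, Int.cast_zero, zero_smul]
  · simp

theorem glAct_X_of_diagonal (g : GLd K d) (l : Idx d → Kˣ)
    (hg : glMat g = Matrix.diagonal fun i => (l i : K))
    (hg' : glMat g⁻¹ = Matrix.diagonal fun i => (((l i)⁻¹ : Kˣ) : K)) (c : Coord s t d) :
    glAct A s t g (MvPolynomial.X c) =
      ((∏ p, l p ^ coordWeight p c : Kˣ) : K) • MvPolynomial.X c := by
  have h : ∏ p, l p ^ coordWeight p c = (l c.1.2.1)⁻¹ * l c.1.2.2 := by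
    simp only [coordWeight, zpow_sub, Finset.prod_mul_distrib, Finset.prod_inv_distrib]
    rw [Finset.prod_eq_single c.1.2.2 (fun b _ hb => by rw [if_neg hb.symm, zpow_zero]) (by simp),
      Finset.prod_eq_single c.1.2.1 (fun b _ hb => by rw [if_neg hb.symm, zpow_zero]) (by simp),
      if_pos rfl, if_pos rfl, zpow_one, zpow_one, mul_comm]
  have hd : ∀ l : Idx d → K, (scalarMat (Matrix.diagonal l) :
      Matrix (Idx d) (Idx d) (MvPolynomial (Coord s t d) A)) =
        Matrix.diagonal fun i => algebraMap K _ (l i) := fun l => Matrix.diagonal_map (map_zero _)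
  rw [glAct_X, conjMat, hg, hg', hd, hd, Matrix.mul_diagonal, Matrix.diagonal_mul, coordMat_coord,
    h, Algebra.smul_def, Units.val_mul, map_mul]
  ring

theorem glAct_monomial (g : GLd K d) (l : Idx d → Kˣ)
    (hg : glMat g = Matrix.diagonal fun i => (l i : K))
    (hg' : glMat g⁻¹ = Matrix.diagonal fun i => (((l i)⁻¹ : Kˣ) : K))
    (α : Coord s t d →₀ ℕ) (a : A) :
    glAct A s t g (MvPolynomial.monomial α a) =
      ((∏ p, l p ^ monoWeight p α : Kˣ) : K) • MvPolynomial.monomial α a := by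
  have h : ∏ p, l p ^ monoWeight p α = ∏ c, (∏ p, l p ^ coordWeight p c) ^ α c := by
    simp only [monoWeight, ← Finset.prod_pow]
    rw [Finset.prod_comm]
    refine Finset.prod_congr rfl fun p _ => ?_
    have : ∀ c, (l p ^ coordWeight p c) ^ α c = l p ^ ((α c : ℤ) * coordWeight p c) := fun c => by
      rw [mul_comm, zpow_mul, zpow_natCast]
    simp only [this]
    exact zpow_finset_sum _ _ _
  rw [MvPolynomial.monomial_eq, Finsupp.prod_fintype _ _ (fun _ => pow_zero _), map_mul, map_prod,
    h, Units.coe_prod]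
  simp only [map_pow, glAct_X_of_diagonal g l hg hg', smul_pow, Finset.prod_smul]
  rw [← MvPolynomial.algebraMap_eq, AlgHom.commutes, mul_smul_comm]
  simp only [Units.val_pow_eq_pow_val]

/-- The torus orbit of `f` is a Laurent polynomial in $u$ with the weights as exponents; its
derivative at $1$ is $E_{pp}f$. -/
theorem elemDer_mem_of_torus [Infinite K] (p : Idx d)
    (W : Submodule K (MvPolynomial (Coord s t d) A)) (f : MvPolynomial (Coord s t d) A)
    (g : Kˣ → GLd K d)
    (hg : ∀ u, glMat (g u) = Matrix.diagonal fun i => ((if i = p then u else 1 : Kˣ) : K))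
    (hg' : ∀ u, glMat (g u)⁻¹ =
      Matrix.diagonal fun i => (((if i = p then u else 1 : Kˣ)⁻¹ : Kˣ) : K))
    (h : ∀ u, glAct A s t (g u) f - f ∈ W) : elemDer A p p f ∈ W := by
  have hf : f = ∑ α ∈ f.support, MvPolynomial.monomial α (f.coeff α) :=
    (MvPolynomial.support_sum_monomial_coeff f).symm
  have h1 := coeff_mem_of_eval_mem W f.support (monoWeight p)
    (fun α => MvPolynomial.monomial α (f.coeff α)) (fun u => by
      rw [Finset.sum_sub_distrib, ← hf]
      convert h u using 2
      conv_rhs => rw [hf, map_sum]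
      refine Finset.sum_congr rfl fun α _ => ?_
      rw [glAct_monomial (g u) _ (hg u) (hg' u)]
      congr 1
      rw [Finset.prod_eq_single p (fun b _ hb => by rw [if_neg hb, one_zpow]) (by simp), if_pos rfl,
        Units.val_zpow_eq_zpow_val])
  convert h1 using 1
  conv_lhs => rw [hf, map_sum]
  refine Finset.sum_congr rfl fun α _ => ?_
  rw [elemDer_self_monomial, Int.cast_smul_eq_zsmul, Int.cast_smul_eq_zsmul]

/-- In characteristic zero all $E_{pp}$ kill `f` only if every monomial of `f` has weight zero, and
such monomials are fixed by the torus. -/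
theorem glAct_eq_of_torus [CharZero K] (f : MvPolynomial (Coord s t d) A) (g : GLd K d)
    (l : Idx d → Kˣ) (hg : glMat g = Matrix.diagonal fun i => (l i : K))
    (hg' : glMat g⁻¹ = Matrix.diagonal fun i => (((l i)⁻¹ : Kˣ) : K))
    (h : ∀ p, elemDer A p p f = 0) : glAct A s t g f = f := by
  have hf : f = ∑ α ∈ f.support, MvPolynomial.monomial α (f.coeff α) :=
    (MvPolynomial.support_sum_monomial_coeff f).symm
  have hw : ∀ α ∈ f.support, ∀ p, monoWeight p α = 0 := by
    intro α hα p
    have h1 := congrArg (MvPolynomial.coeff α) (h p)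
    have h2 : MvPolynomial.coeff α (elemDer A p p f) = (monoWeight p α : A) * f.coeff α := by
      conv_lhs => rw [hf, map_sum, MvPolynomial.coeff_sum]
      classical
      simp only [elemDer_self_monomial, MvPolynomial.coeff_smul, MvPolynomial.coeff_monomial]
      rw [Finset.sum_eq_single α (fun b _ hb => by rw [if_neg hb, smul_zero])
        (fun h => absurd hα h), if_pos rfl, smul_eq_mul]
    rw [h2, MvPolynomial.coeff_zero] at h1
    have h3 : (monoWeight p α : K) • f.coeff α = 0 := by
      rw [Algebra.smul_def, map_intCast, h1]
    rcases smul_eq_zero.1 h3 with h4 | h4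
    · exact_mod_cast h4
    · exact absurd h4 (MvPolynomial.mem_support_iff.1 hα)
  conv_lhs => rw [hf, map_sum]
  conv_rhs => rw [hf]
  refine Finset.sum_congr rfl fun α hα => ?_
  rw [glAct_monomial g l hg hg']
  simp [hw α hα]

end Torus

end LinearAction

/-! ### Comparison of group and Lie algebra invariants; lifting of invariants -/

section Reynolds

variable {K : Type u} [Field K] {V : Type v} {E : Type w}
  {A : Type*} [CommRing A] [Algebra K A] {s t : E → V} {d : V → ℕ} [DecidableEq V] [Fintype V]

/-- Diagonal matrices as elements of `GL_d`. -/
def torusElt (l : Idx d → Kˣ) : GLd K d := fun k =>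
  ⟨Matrix.diagonal fun i => (l ⟨k, i⟩ : K), Matrix.diagonal fun i => (((l ⟨k, i⟩)⁻¹ : Kˣ) : K),
    by simp [Matrix.diagonal_mul_diagonal], by simp [Matrix.diagonal_mul_diagonal]⟩

theorem glMat_torusElt (l : Idx d → Kˣ) :
    glMat (torusElt l) = Matrix.diagonal fun i => (l i : K) :=
  Matrix.blockDiagonal'_diagonal _

theorem glMat_torusElt_inv (l : Idx d → Kˣ) :
    glMat (torusElt l)⁻¹ = Matrix.diagonal fun i => (((l i)⁻¹ : Kˣ) : K) :=
  Matrix.blockDiagonal'_diagonal _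

/-- Transvections as elements of `GL_d`. -/
def transvecElt {k : V} {i j : Fin (d k)} (hij : i ≠ j) (u : K) : GLd K d :=
  Pi.mulSingle k ⟨1 + Matrix.single i j u, 1 - Matrix.single i j u,
    by rw [add_mul, mul_sub, mul_sub, Matrix.single_mul_single_of_ne _ _ _ _ hij.symm]; simp,
    by rw [sub_mul, mul_add, mul_add, Matrix.single_mul_single_of_ne _ _ _ _ hij.symm]; simp⟩

theorem glMat_mulSingle {k : V} (x : GL (Fin (d k)) K) (i j : Fin (d k)) (u : K)
    (hx : (x : Matrix (Fin (d k)) (Fin (d k)) K) = 1 + Matrix.single i j u) :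
    glMat (Pi.mulSingle k x : GLd K d) = 1 + Matrix.single (⟨k, i⟩ : Idx d) ⟨k, j⟩ u := by
  ext1 ⟨k₁, a⟩ ⟨k₂, b⟩
  rw [glMat, Matrix.add_apply]
  by_cases h : k₁ = k₂
  · subst h
    rw [Matrix.blockDiagonal'_apply_eq]
    by_cases hk : k₁ = k
    · subst hk
      rw [Pi.mulSingle_eq_same, hx]
      simp [Matrix.one_apply, Matrix.single_apply]
    · rw [Pi.mulSingle_eq_of_ne hk, Matrix.single_apply_of_row_ne (by
        intro h; exact hk (congrArg Sigma.fst h).symm)]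
      simp [Matrix.one_apply]
  · rw [Matrix.blockDiagonal'_apply_ne _ _ _ h, Matrix.one_apply_ne (by
      intro h'; exact h (congrArg Sigma.fst h')), Matrix.single_apply, if_neg, add_zero]
    rintro ⟨h1, h2⟩
    exact h ((congrArg Sigma.fst h1).symm.trans (congrArg Sigma.fst h2))

theorem glMat_transvecElt {k : V} {i j : Fin (d k)} (hij : i ≠ j) (u : K) :
    glMat (transvecElt (d := d) hij u) = 1 + Matrix.single (⟨k, i⟩ : Idx d) ⟨k, j⟩ u :=
  glMat_mulSingle _ i j u rfl

theorem glMat_transvecElt_inv {k : V} {i j : Fin (d k)} (hij : i ≠ j) (u : K) :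
    glMat (transvecElt (d := d) hij u)⁻¹ = 1 - Matrix.single (⟨k, i⟩ : Idx d) ⟨k, j⟩ u := by
  have h : (1 : Matrix (Idx d) (Idx d) K) - Matrix.single (⟨k, i⟩ : Idx d) (⟨k, j⟩ : Idx d) u =
      1 + Matrix.single (⟨k, i⟩ : Idx d) (⟨k, j⟩ : Idx d) (-u) := by
    rw [sub_eq_add_neg, Matrix.single_neg]
  rw [h, transvecElt, ← Pi.mulSingle_inv]
  refine glMat_mulSingle _ i j (-u) ?_
  change 1 - Matrix.single i j u = 1 + Matrix.single i j (-u)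
  rw [sub_eq_add_neg, Matrix.single_neg]

variable [Fintype E]

/-- Invariance under the group modulo a subspace implies invariance under the Lie algebra. -/
theorem elemDer_mem_of_glAct [Infinite K] {p q : Idx d} (hpq : p.1 = q.1)
    (W : Submodule K (MvPolynomial (Coord s t d) A)) (f : MvPolynomial (Coord s t d) A)
    (h : ∀ g : GLd K d, glAct A s t g f - f ∈ W) : elemDer A p q f ∈ W := by
  by_cases hne : p = q
  · subst hne
    exact elemDer_mem_of_torus p W f (fun u => torusElt fun i => if i = p then u else 1)
      (fun u => glMat_torusElt _) (fun u => glMat_torusElt_inv _) fun u => h _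
  · obtain ⟨k, i⟩ := p
    obtain ⟨k', j⟩ := q
    obtain rfl : k = k' := hpq
    have hij : i ≠ j := fun h => hne (by rw [h])
    exact elemDer_mem_of_transvection (p := ⟨k, i⟩) (q := ⟨k, j⟩) rfl hne W f
      (fun u => transvecElt (d := d) hij u)
      (fun u => glMat_transvecElt (d := d) hij u)
      (fun u => glMat_transvecElt_inv (d := d) hij u) (fun u => h _)

/-- The stabilizer of a function in `GL_d`. -/
def glStab (f : MvPolynomial (Coord s t d) A) : Subgroup (GLd K d) where
  carrier := {g | glAct A s t g f = f}
  mul_mem' := by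
    intro a b (ha : glAct A s t a f = f) (hb : glAct A s t b f = f)
    change glAct A s t (a * b) f = f
    rw [← glAct_comp, AlgHom.comp_apply, hb, ha]
  one_mem' := by
    change glAct A s t 1 f = f
    rw [glAct_one]; rfl
  inv_mem' := by
    intro a (ha : glAct A s t a f = f)
    change glAct A s t a⁻¹ f = f
    conv_lhs => rw [← ha]
    rw [← AlgHom.comp_apply, glAct_comp, inv_mul_cancel, glAct_one]
    rfl

theorem mulSingle_mem_of_diagonal {k : V} (H : Subgroup (GLd K d))
    (hH : ∀ l : Idx d → Kˣ, torusElt l ∈ H) (D : Fin (d k) → K)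
    (hD' : ∀ i, D i ≠ 0) (x : GL (Fin (d k)) K)
    (hx : (x : Matrix (Fin (d k)) (Fin (d k)) K) = Matrix.diagonal D) :
    (Pi.mulSingle k x : GLd K d) ∈ H := by
  let l : Idx d → Kˣ := fun p => (Pi.mulSingle k (fun i => Units.mk0 (D i) (hD' i)) :
    (k : V) → Fin (d k) → Kˣ) p.1 p.2
  have hl : (Pi.mulSingle k x : GLd K d) = torusElt l := by
    funext k'
    by_cases hk : k' = k
    · subst hk
      rw [Pi.mulSingle_eq_same]
      ext1
      rw [hx]
      simp [torusElt, l]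
    · rw [Pi.mulSingle_eq_of_ne hk]
      ext1
      simp [torusElt, l, Pi.mulSingle_eq_of_ne hk]
  rw [hl]
  exact hH l

theorem mulSingle_mem_of_transvection {k : V} (H : Subgroup (GLd K d))
    (hT : ∀ (i j : Fin (d k)) (hij : i ≠ j) (u : K), transvecElt hij u ∈ H)
    (T : Matrix.TransvectionStruct (Fin (d k)) K) (x : GL (Fin (d k)) K)
    (hx : (x : Matrix (Fin (d k)) (Fin (d k)) K) = T.toMatrix) :
    (Pi.mulSingle k x : GLd K d) ∈ H := by
  have hT' : (Pi.mulSingle k x : GLd K d) = transvecElt T.hij T.c := by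
    rw [transvecElt]
    congr 1
    ext1
    exact hx
  rw [hT']
  exact hT _ _ _ _

/-- A subgroup of `GL_d` that contains the torus and the transvections is everything. -/
theorem mem_of_torus_transvection (H : Subgroup (GLd K d))
    (hH : ∀ l : Idx d → Kˣ, torusElt l ∈ H)
    (hT : ∀ (k : V) (i j : Fin (d k)) (hij : i ≠ j) (u : K), transvecElt hij u ∈ H)
    (g : GLd K d) : g ∈ H := by
  refine Subgroup.pi_mem_of_mulSingle_mem (H := H) g fun k => ?_
  suffices h' : ∀ M : Matrix (Fin (d k)) (Fin (d k)) K, ∀ x : GL (Fin (d k)) K,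
      (x : Matrix (Fin (d k)) (Fin (d k)) K) = M → Pi.mulSingle k x ∈ H from h' _ (g k) rfl
  intro M x hx
  have hM : M.det ≠ 0 := by
    rw [← hx]
    exact ((Matrix.isUnit_iff_isUnit_det _).1 x.isUnit).ne_zero
  refine Matrix.diagonal_transvection_induction_of_det_ne_zero
    (fun M => ∀ x : GL (Fin (d k)) K, (x : Matrix (Fin (d k)) (Fin (d k)) K) = M →
      Pi.mulSingle k x ∈ H) M hM ?_ ?_ ?_ x hx
  · intro D hD x hx
    rw [Matrix.det_diagonal, Finset.prod_ne_zero_iff] at hD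
    exact mulSingle_mem_of_diagonal H hH D (fun i => hD i (Finset.mem_univ i)) x hx
  · exact fun T x hx => mulSingle_mem_of_transvection H (hT k) T x hx
  · intro M N hM hN h1 h2 x hx
    obtain ⟨y, hy⟩ := (Matrix.isUnit_iff_isUnit_det M).2 (isUnit_iff_ne_zero.2 hM)
    obtain ⟨z, hz⟩ := (Matrix.isUnit_iff_isUnit_det N).2 (isUnit_iff_ne_zero.2 hN)
    have : x = y * z := by
      ext1
      rw [hx, Units.val_mul, hy, hz]
    rw [this, Pi.mulSingle_mul]
    exact H.mul_mem (h1 y hy) (h2 z hz)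

/-- Invariance under the Lie algebra implies invariance under the group. -/
theorem glAct_eq_of_elemDer [CharZero K] (f : MvPolynomial (Coord s t d) A)
    (h : ∀ p q : Idx d, p.1 = q.1 → elemDer A p q f = 0) (g : GLd K d) : glAct A s t g f = f := by
  refine mem_of_torus_transvection (glStab f) (fun l => ?_) (fun k i j hij u => ?_) g
  · exact glAct_eq_of_torus f _ l (glMat_torusElt l) (glMat_torusElt_inv l) fun p => h p p rfl
  · exact glAct_eq_of_transvection (p := ⟨k, i⟩) (q := ⟨k, j⟩) rfl
      (fun h => hij (eq_of_heq (Sigma.mk.inj h).2)) f _ u (glMat_transvecElt _ _)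
      (glMat_transvecElt_inv _ _) (h _ _ rfl)

/-- Invariants modulo an invariant subspace lift to invariants. -/
theorem exists_invariant_lift [CharZero K] (W : Submodule K (MvPolynomial (Coord s t d) A))
    (hW : ∀ (g : GLd K d), ∀ x ∈ W, glAct A s t g x ∈ W) (f : MvPolynomial (Coord s t d) A)
    (h : ∀ g : GLd K d, glAct A s t g f - f ∈ W) :
    ∃ f₀, (∀ g : GLd K d, glAct A s t g f₀ = f₀) ∧ f₀ - f ∈ W := by
  classical
  -- Only pairs of indices in a common block belong to $\mathfrak{gl}_{\mathbf d}$.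
  let m : {pq : Idx d × Idx d // pq.1.1 = pq.2.1} → Coord s t d → Coord s t d → ℤ :=
    fun pq => elemVec pq.1.1 pq.1.2
  obtain ⟨r, hr, hf⟩ := exists_invariant_projection (k := K) m f
  refine ⟨Polynomial.aeval (casimir K A m) r f, glAct_eq_of_elemDer _ fun p q hpq =>
    hf ⟨(p, q), hpq⟩, ?_⟩
  have hδ : ∀ p q : Idx d, p.1 = q.1 → ∀ x ∈ W, elemDer A p q x ∈ W := fun p q hpq x hx =>
    elemDer_mem_of_glAct hpq W x fun g => W.sub_mem (hW g x hx) hx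
  have hT : ∀ pq : {pq : Idx d × Idx d // pq.1.1 = pq.2.1},
      linDer A (fun c c' => m pq c' c) = elemDer A (s := s) (t := t) pq.1.2 pq.1.1 := by
    intro pq
    congr 1
    funext c c'
    exact elemVec_transpose _ _ _ _
  have hC : ∀ x ∈ W, casimir K A m x ∈ W := by
    intro x hx
    rw [casimir_apply]
    refine W.sum_mem fun pq _ => ?_
    rw [hT]
    exact hδ _ _ pq.2.symm _ (hδ _ _ pq.2 _ hx)
  -- Modulo `W` the function is invariant, hence killed by the Casimir operator. As the constant
  -- term of `r` is $1$, $r(C)f-f$ is a polynomial in $C$ applied to $Cf$ and stays in `W`.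
  have hCf : casimir K A m f ∈ W := by
    rw [casimir_apply]
    refine W.sum_mem fun pq _ => ?_
    rw [hT]
    exact hδ _ _ pq.2.symm _ (elemDer_mem_of_glAct pq.2 W f h)
  have hP : ∀ (P : K[X]), ∀ x ∈ W, Polynomial.aeval (casimir K A m) P x ∈ W := by
    intro P x hx
    induction P using Polynomial.induction_on' with
    | add p q hp hq => rw [map_add]; exact W.add_mem hp hq
    | monomial n a =>
      rw [Polynomial.aeval_monomial, Module.End.mul_apply, Module.algebraMap_end_apply]
      refine W.smul_mem _ ?_
      clear h hf hCf
      induction n with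
      | zero => simpa using hx
      | succ n ih => rw [pow_succ', Module.End.mul_apply]; exact hC _ ih
  have hr' : r = r.divX * Polynomial.X + 1 := by
    conv_lhs => rw [← Polynomial.divX_mul_X_add r, hr, map_one]
  rw [hr', map_add, map_mul, LinearMap.add_apply, Module.End.mul_apply, Polynomial.aeval_X, map_one,
    Module.End.one_apply, add_sub_cancel_right]
  exact hP _ _ hCf

end Reynolds

/-! ### Equivariance of normal ordering and of the symbol -/

section Equivariance

variable {K : Type u} [Field K] {V : Type v} [Quiver.{w} V] [Fintype V] [DecidableEq V]
  [∀ i j : V, Fintype (i ⟶ j)] {d : V → ℕ}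

variable (K d) in
/-- Scalars as differential operators. -/
def scalHom : K →+* DRep (V := V) K d := (algebraMap K[X] (DRep (V := V) K d)).comp Polynomial.C

theorem scalHom_comm (r : K) (D : DRep (V := V) K d) : scalHom K d r * D = D * scalHom K d r :=
  Algebra.commutes (Polynomial.C r) D

theorem ofFun_C (r : K) :
    DiffOp.ofFun K (MvPolynomial.C r : FunRep (V := V) K d) = scalHom K d r :=
  DiffOp.ofFun_algebraMap r

theorem opMat_inl_coord (c : Coord (Arr.src (V := V)) Arr.tgt d) :
    opMat K d (Sum.inl c.1.1) c.1.2.1 c.1.2.2 = opX c := by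
  simp [opMat, genMat, c.2]

theorem opMat_inr_coord (c : Coord (Arr.src (V := V)) Arr.tgt d) :
    opMat K d (Sum.inr c.1.1) c.1.2.2 c.1.2.1 = opD c := by
  simp [opMat, c.2]

theorem opMat_eq_zero {a : DArr V} {i j : Idx d} (h : ¬ (i.1 = DArr.tgt a ∧ j.1 = DArr.src a)) :
    opMat K d a i j = 0 := by
  rcases a with a | a
  · simp only [DArr.src, DArr.tgt, Sum.elim_inl] at h
    simp [opMat, genMat, h, DiffOp.ofFun_zero]
  · simp only [DArr.src, DArr.tgt, Sum.elim_inr] at h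
    simp only [opMat, Matrix.of_apply]
    rw [dif_neg (fun h' => h h'.symm)]

/-- The sum over all coordinates as a sum over all entries. -/
theorem sum_coord {E : Type*} [Fintype E] {s t : E → V} {M : Type*} [AddCommMonoid M]
    (F : E → Idx d → Idx d → M)
    (hF : ∀ a i j, ¬ (i.1 = t a ∧ j.1 = s a) → F a i j = 0) :
    ∑ c : Coord s t d, F c.1.1 c.1.2.1 c.1.2.2 = ∑ a, ∑ i, ∑ j, F a i j := by
  classical
  rw [← Finset.sum_subtype (p := fun c : E × Idx d × Idx d => c.2.1.1 = t c.1 ∧ c.2.2.1 = s c.1)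
    (Finset.univ.filter fun c => c.2.1.1 = t c.1 ∧ c.2.2.1 = s c.1) (by simp)
    (fun c => F c.1 c.2.1 c.2.2), Finset.sum_filter_of_ne]
  · simp only [Fintype.sum_prod_type]
  · intro c _ hc
    by_contra h
    exact hc (hF _ _ _ h)

theorem opMat_conj_eq_zero (g : GLd K d) {a : DArr V} {i j : Idx d}
    (h : ¬ (i.1 = DArr.tgt a ∧ j.1 = DArr.src a)) :
    ((glMat g⁻¹).map (scalHom K d) * opMat K d a * (glMat g).map (scalHom K d)) i j = 0 := by
  rw [Matrix.mul_apply]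
  refine Finset.sum_eq_zero fun l _ => ?_
  rw [Matrix.mul_apply, Finset.sum_mul]
  refine Finset.sum_eq_zero fun k _ => ?_
  by_cases hi : i.1 = k.1
  · by_cases hj : l.1 = j.1
    · rw [opMat_eq_zero (by rw [← hi, hj]; exact h)]; simp
    · have : glMat g l j = 0 := Matrix.blockDiagonal'_apply_ne _ _ _ hj
      simp [this]
  · have : glMat g⁻¹ i k = 0 := Matrix.blockDiagonal'_apply_ne _ _ _ hi
    simp [this]

theorem pderiv_genMat (c : Coord (Arr.src (V := V)) Arr.tgt d) (a : Arr V) (i j : Idx d)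
    [Decidable ((a, i, j) = c.1)] :
    MvPolynomial.pderiv c (genMat K Arr.src Arr.tgt d a i j) = if (a, i, j) = c.1 then 1 else 0 := by
  classical
  by_cases h : i.1 = Arr.tgt a ∧ j.1 = Arr.src a
  · have : genMat K Arr.src Arr.tgt d a i j = MvPolynomial.X ⟨(a, i, j), h⟩ := by simp [genMat, h]
    rw [this, MvPolynomial.pderiv_X, Pi.single_apply]
    refine if_congr ?_ rfl rfl
    rw [Subtype.ext_iff, eq_comm]
  · have : genMat K Arr.src Arr.tgt d a i j = 0 := by simp [genMat, h]
    rw [this, map_zero, if_neg]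
    intro h'
    have := c.2
    rw [← h'] at this
    exact h this

theorem pderiv_repAct_inv (g : GLd K d) (c c' : Coord (Arr.src (V := V)) Arr.tgt d)
    [Decidable (c'.1.1 = c.1.1)] :
    MvPolynomial.pderiv c (repAct Arr.src Arr.tgt g⁻¹ (MvPolynomial.X c')) =
      if c'.1.1 = c.1.1 then
        MvPolynomial.C (glMat g c'.1.2.1 c.1.2.1 * glMat g⁻¹ c.1.2.2 c'.1.2.2) else 0 := by
  classical
  rw [repAct, MvPolynomial.aeval_X, inv_inv, Matrix.mul_apply, map_sum]
  simp only [Matrix.mul_apply, Finset.sum_mul, map_sum, Matrix.map_apply, Derivation.leibniz,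
    MvPolynomial.derivation_C, smul_eq_mul, pderiv_genMat]
  split_ifs with h
  · rw [Finset.sum_eq_single c.1.2.2, Finset.sum_eq_single c.1.2.1]
    · rw [if_pos (by rw [h]), map_mul]; ring
    · intro b _ hb
      rw [if_neg fun h' => hb (congrArg (fun x => x.2.1) h')]; ring
    · simp
    · intro b _ hb
      refine Finset.sum_eq_zero fun k _ => ?_
      rw [if_neg fun h' => hb (congrArg (fun x => x.2.2) h')]; ring
    · simp
  · refine Finset.sum_eq_zero fun l _ => Finset.sum_eq_zero fun k _ => ?_
    rw [if_neg fun h' => h (congrArg (fun x => x.1) h')]; ring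

/-- Partial derivatives transform contragrediently to the coordinates. Because the indices of
$[a^*]$ are transposed, this is again conjugation of a matrix. -/
theorem conj_opD (g : GLd K d) (c : Coord (Arr.src (V := V)) Arr.tgt d) :
    DiffOp.conj (repActEquiv Arr.src Arr.tgt g) (opD c) =
      ∑ i, ∑ j, scalHom K d (glMat g i c.1.2.1 * glMat g⁻¹ c.1.2.2 j) *
        opMat K d (Sum.inr c.1.1) j i := by
  classical
  rw [DiffOp.conj_ofDer, DiffOp.ofDer_eq_sum]
  have : ∀ c', DiffOp.ofFun K (conjDer (repActEquiv Arr.src Arr.tgt g)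
      (MvPolynomial.pderiv c) (MvPolynomial.X c')) * DiffOp.ofDer (MvPolynomial.pderiv c') =
      if c'.1.1 = c.1.1 then scalHom K d (glMat g c'.1.2.1 c.1.2.1 * glMat g⁻¹ c.1.2.2 c'.1.2.2) *
        opMat K d (Sum.inr c'.1.1) c'.1.2.2 c'.1.2.1 else 0 := by
    intro c'
    rw [conjDer_apply, opMat_inr_coord]
    change DiffOp.ofFun K (repAct Arr.src Arr.tgt g (MvPolynomial.pderiv c
      (repAct Arr.src Arr.tgt g⁻¹ (MvPolynomial.X c')))) * _ = _
    rw [pderiv_repAct_inv]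
    split_ifs
    · rw [← MvPolynomial.algebraMap_eq, AlgHom.commutes, DiffOp.ofFun_algebraMap]; rfl
    · rw [map_zero, DiffOp.ofFun_zero, zero_mul]
  rw [Finset.sum_congr rfl fun c' _ => this c', sum_coord (s := Arr.src (V := V)) (t := Arr.tgt) (fun a i j =>
    if a = c.1.1 then scalHom K d (glMat g i c.1.2.1 * glMat g⁻¹ c.1.2.2 j) *
        opMat K d (Sum.inr a) j i else 0), Finset.sum_eq_single c.1.1]
  · simp
  · intro b _ hb; simp [hb]
  · simp
  · intro a i j h
    rw [opMat_eq_zero (fun h' => h h'.symm), mul_zero, ite_self]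

/-- Arrows and reversed arrows transform by the same rule, so the double quiver can be treated
uniformly. -/
theorem map_conj_opMat (g : GLd K d) (a : DArr V) :
    (opMat K d a).map (DiffOp.conj (repActEquiv Arr.src Arr.tgt g)) =
      (glMat g⁻¹).map (scalHom K d) * opMat K d a * (glMat g).map (scalHom K d) := by
  rcases a with a | a
  · have hC : ∀ M : Matrix (Idx d) (Idx d) K, (M.map MvPolynomial.C).map
        (DiffOp.ofFunHom K (FunRep (V := V) K d)) = M.map (scalHom K d) := by
      intro M; ext1 i j; exact ofFun_C _
    have h : opMat K d (Sum.inl a) = (genMat K Arr.src Arr.tgt d a).map (DiffOp.ofFunHom K _) := rfl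
    rw [h, ← hC, ← hC, ← Matrix.map_mul, ← Matrix.map_mul, ← map_repAct_genMat]
    ext1 i j
    exact DiffOp.conj_ofFun _ _
  · ext1 i j
    by_cases h : i.1 = Arr.src a ∧ j.1 = Arr.tgt a
    · have h1 := opMat_inr_coord (K := K) (d := d) ⟨(a, j, i), h.symm⟩
      rw [Matrix.map_apply, h1, conj_opD, Matrix.mul_apply]
      refine Finset.sum_congr rfl fun l _ => ?_
      rw [Matrix.mul_apply, Finset.sum_mul]
      refine Finset.sum_congr rfl fun k _ => ?_
      simp only [Matrix.map_apply]
      rw [mul_comm (glMat g l j), map_mul, mul_assoc, mul_assoc, scalHom_comm (glMat g l j)]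
    · rw [opMat_conj_eq_zero (a := Sum.inr a) g h, Matrix.map_apply,
        opMat_eq_zero (a := Sum.inr a) h, map_zero]

theorem normalOrder_coordMat_inl (a : Arr V) (i j : Idx d) (f : HCot (V := V) K d) :
    normalOrder K d (coordMat K[X] DArr.src DArr.tgt d (Sum.inl a) i j * f) =
      opMat K d (Sum.inl a) i j * normalOrder K d f := by
  by_cases h : i.1 = Arr.tgt a ∧ j.1 = Arr.src a
  · have h1 := opMat_inl_coord (K := K) (d := d) ⟨(a, i, j), h⟩
    have h2 := coordMat_coord (A := K[X]) (posCoord (⟨(a, i, j), h⟩ : Coord Arr.src Arr.tgt d))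
    rw [h1, ← normalOrder_pos, ← h2]
    rfl
  · rw [coordMat_eq_zero (a := Sum.inl a) h, opMat_eq_zero (a := Sum.inl a) h, zero_mul, zero_mul,
      map_zero]

theorem normalOrder_coordMat_inr (a : Arr V) (i j : Idx d) (f : HCot (V := V) K d) :
    normalOrder K d (coordMat K[X] DArr.src DArr.tgt d (Sum.inr a) i j * f) =
      normalOrder K d f * opMat K d (Sum.inr a) i j := by
  by_cases h : i.1 = Arr.src a ∧ j.1 = Arr.tgt a
  · have h1 := opMat_inr_coord (K := K) (d := d) ⟨(a, j, i), h.symm⟩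
    have h2 := coordMat_coord (A := K[X])
      (momCoord (⟨(a, j, i), h.symm⟩ : Coord Arr.src Arr.tgt d))
    rw [h1, ← normalOrder_mom, ← h2]
    rfl
  · rw [coordMat_eq_zero (a := Sum.inr a) h, opMat_eq_zero (a := Sum.inr a) h, zero_mul, mul_zero,
      map_zero]

theorem normalOrder_scalar_mul (r : K) (f : HCot (V := V) K d) :
    normalOrder K d (algebraMap K _ r * f) = scalHom K d r * normalOrder K d f := by
  have : algebraMap K (HCot (V := V) K d) r * f = Polynomial.C r • f := by
    rw [MvPolynomial.smul_eq_C_mul]; rfl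
  rw [this, map_smul, Algebra.smul_def]; rfl

theorem normalOrder_conjMat_inl (g : GLd K d) (a : Arr V) (i j : Idx d) (f : HCot (V := V) K d) :
    normalOrder K d (conjMat K[X] DArr.src DArr.tgt g (Sum.inl a) i j * f) =
      ((glMat g⁻¹).map (scalHom K d) * opMat K d (Sum.inl a) * (glMat g).map (scalHom K d)) i j *
        normalOrder K d f := by
  simp only [conjMat, Matrix.mul_apply, Finset.sum_mul, map_sum, Matrix.map_apply]
  refine Finset.sum_congr rfl fun l _ => Finset.sum_congr rfl fun k _ => ?_
  rw [mul_assoc, mul_assoc, normalOrder_scalar_mul, normalOrder_coordMat_inl,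
    normalOrder_scalar_mul]
  simp only [mul_assoc]

theorem normalOrder_conjMat_inr (g : GLd K d) (a : Arr V) (i j : Idx d) (f : HCot (V := V) K d) :
    normalOrder K d (conjMat K[X] DArr.src DArr.tgt g (Sum.inr a) i j * f) =
      normalOrder K d f *
      ((glMat g⁻¹).map (scalHom K d) * opMat K d (Sum.inr a) * (glMat g).map (scalHom K d)) i j := by
  simp only [conjMat, Matrix.mul_apply, Finset.sum_mul, Finset.mul_sum, map_sum, Matrix.map_apply]
  refine Finset.sum_congr rfl fun l _ => Finset.sum_congr rfl fun k _ => ?_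
  rw [mul_assoc, mul_assoc, normalOrder_scalar_mul, normalOrder_coordMat_inr,
    normalOrder_scalar_mul, scalHom_comm (glMat g l j) (normalOrder K d f),
    mul_assoc (normalOrder K d f) _ _, scalHom_comm (glMat g l j), ← mul_assoc (scalHom K d _),
    scalHom_comm (glMat g⁻¹ i k), mul_assoc, mul_assoc (scalHom K d _)]

/-- Normal ordering is equivariant. -/
theorem conj_normalOrder (g : GLd K d) (f : HCot (V := V) K d) :
    DiffOp.conj (repActEquiv Arr.src Arr.tgt g) (normalOrder K d f) =
      normalOrder K d (glAct K[X] DArr.src DArr.tgt g f) := by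
  -- The action maps positions to combinations of positions and momenta to combinations of momenta,
  -- so it does not disturb the normal order.
  induction f using hCot_induction with
  | h1 => simp only [map_one, normalOrder_one]
  | hadd f g hf hg => simp only [map_add, hf, hg]
  | hsmul r f hf => simp only [map_smul, hf]
  | hpos c f hf =>
    rw [normalOrder_pos, map_mul, hf, map_mul, glAct_X]
    have h1 := congrFun (congrFun (map_conj_opMat g (Sum.inl c.1.1)) c.1.2.1) c.1.2.2
    rw [Matrix.map_apply, opMat_inl_coord] at h1
    rw [h1, ← normalOrder_conjMat_inl]
    rfl
  | hmom c f hf =>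
    rw [normalOrder_mom, map_mul, hf, map_mul, glAct_X]
    have h1 := congrFun (congrFun (map_conj_opMat g (Sum.inr c.1.1)) c.1.2.2) c.1.2.1
    rw [Matrix.map_apply, opMat_inr_coord] at h1
    rw [h1, ← normalOrder_conjMat_inr]
    rfl

theorem hbarZero_glAct (g : GLd K d) (f : HCot (V := V) K d) :
    hbarZero K d (glAct K[X] DArr.src DArr.tgt g f) =
      repAct DArr.src DArr.tgt g (hbarZero K d f) := by
  suffices h : (hbarZero K d).comp (glAct K[X] (DArr.src (V := V)) DArr.tgt g).toRingHom =
      (repAct DArr.src DArr.tgt g).toRingHom.comp (hbarZero K d) from RingHom.congr_fun h f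
  refine MvPolynomial.ringHom_ext (fun r => ?_) (fun c => ?_)
  · change hbarZero K d (glAct K[X] DArr.src DArr.tgt g (MvPolynomial.C r)) =
      repAct DArr.src DArr.tgt g (hbarZero K d (MvPolynomial.C r))
    rw [← MvPolynomial.algebraMap_eq, AlgHom.commutes, MvPolynomial.algebraMap_eq, hbarZero,
      MvPolynomial.map_C, ← MvPolynomial.algebraMap_eq, AlgHom.commutes]
  · change hbarZero K d (glAct K[X] DArr.src DArr.tgt g (MvPolynomial.X c)) =
      repAct DArr.src DArr.tgt g (hbarZero K d (MvPolynomial.X c))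
    have h1 : ∀ M : Matrix (Idx d) (Idx d) K,
        (scalarMat M : Matrix (Idx d) (Idx d) (HCot (V := V) K d)).map (hbarZero K d) =
          M.map MvPolynomial.C := by
      intro M; ext1 i j
      change hbarZero K d (MvPolynomial.C (Polynomial.C (M i j))) = _
      simp [hbarZero]
    have h2 : (coordMat K[X] (DArr.src (V := V)) DArr.tgt d c.1.1).map (hbarZero K d) =
        genMat K DArr.src DArr.tgt d c.1.1 := by
      ext1 i j
      simp only [coordMat, genMat, Matrix.map_apply, Matrix.of_apply]
      split_ifs <;> simp [hbarZero]
    have h3 : hbarZero (V := V) K d (MvPolynomial.X c) = MvPolynomial.X c := by simp [hbarZero]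
    rw [glAct_X, h3, repAct, MvPolynomial.aeval_X, ← h1, ← h1, ← h2, ← Matrix.map_mul,
      ← Matrix.map_mul]
    rfl

theorem symbol_conj (g : GLd K d) (D : DRep (V := V) K d) :
    symbol K d (DiffOp.conj (repActEquiv Arr.src Arr.tgt g) D) =
      repAct DArr.src DArr.tgt g (symbol K d D) := by
  obtain ⟨f, rfl⟩ := normalOrder_surjective D
  rw [conj_normalOrder, symbol_normalOrder, symbol_normalOrder, hbarZero_glAct]

theorem symbol_opMat (a : DArr V) (i j : Idx d) :
    symbol K d (opMat K d a i j) = genMat K DArr.src DArr.tgt d a i j := by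
  by_cases h : i.1 = DArr.tgt a ∧ j.1 = DArr.src a
  · have h2 : genMat K DArr.src DArr.tgt d a i j = MvPolynomial.X ⟨(a, i, j), h⟩ := by
      simp [genMat, h]
    rw [h2]
    rcases a with a | a
    · exact (congrArg _ (opMat_inl_coord (K := K) ⟨(a, i, j), h⟩)).trans (symbol_opX _)
    · exact (congrArg _ (opMat_inr_coord (K := K) ⟨(a, j, i), h.symm⟩)).trans (symbol_opD _)
  · rw [opMat_eq_zero h, map_zero]
    simp [genMat, h]

theorem mem_DInv {D : DRep (V := V) K d} : D ∈ DInv K d ↔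
    ∀ g : GLd K d, DiffOp.conj (repActEquiv Arr.src Arr.tgt g) D = D := by
  simp only [DInv, Algebra.mem_iInf]
  rfl

theorem mem_FunVariety {f : FunFibre (V := V) K d} : f ∈ FunVariety K d ↔
    ∀ g : GLd K d, fibreAct g f = f := by
  simp only [FunVariety, Algebra.mem_iInf]
  rfl

theorem normalOrder_mem_DInv {f : HCot (V := V) K d} : normalOrder K d f ∈ DInv K d ↔
    ∀ g : GLd K d, glAct K[X] DArr.src DArr.tgt g f = f := by
  rw [mem_DInv]
  refine forall_congr' fun g => ?_
  rw [conj_normalOrder, normalOrder_injective.eq_iff]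

end Equivariance

/-! ### The quantum moment map and the left ideal it generates -/

section MomentOperators

variable {K : Type u} [Field K] {V : Type v} [Quiver.{w} V] [Fintype V] [DecidableEq V]
  [∀ i j : V, Fintype (i ⟶ j)] {d : V → ℕ}

theorem pairing_inl_inl (a b : Arr V) : pairing K (Sum.inl a) (Sum.inl b) = 0 := rfl

theorem pairing_inr_inr (a b : Arr V) : pairing K (Sum.inr a) (Sum.inr b) = 0 := rfl

open Classical in
/-- The canonical commutation relations. -/
theorem opMat_commutator (a b : DArr V) (i j k l : Idx d) :
    opMat K d a i j * opMat K d b k l - opMat K d b k l * opMat K d a i j =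
      if (i.1 = DArr.tgt a ∧ j.1 = DArr.src a) ∧ k = j ∧ l = i then
        algebraMap K[X] (DRep K d) (Polynomial.X * Polynomial.C (pairing K a b)) else 0 := by
  by_cases ha : i.1 = DArr.tgt a ∧ j.1 = DArr.src a
  swap
  · rw [opMat_eq_zero ha, zero_mul, mul_zero, sub_zero, if_neg fun h => ha h.1]
  by_cases hb : k.1 = DArr.tgt b ∧ l.1 = DArr.src b
  swap
  · rw [opMat_eq_zero hb, zero_mul, mul_zero, sub_zero]
    split_ifs with h
    · obtain ⟨h1, rfl, rfl⟩ := h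
      -- If the indices match but `b` has no entry there, then `b` is not the reverse of `a`.
      have : pairing K a b = 0 := by
        rcases a with a | a <;> rcases b with b | b <;> simp only [pairing] <;>
        rw [if_neg] <;> rintro rfl <;> exact hb h1.symm
      rw [this]; simp
    · rfl
  rcases a with a | a <;> rcases b with b | b
  · have h1 := opMat_inl_coord (K := K) ⟨(a, i, j), ha⟩
    have h2 := opMat_inl_coord (K := K) ⟨(b, k, l), hb⟩
    rw [h1, h2, DiffOp.ofFun_comm, sub_self, pairing_inl_inl]
    simp
  · have h1 := opMat_inl_coord (K := K) ⟨(a, i, j), ha⟩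
    have h2 := opMat_inr_coord (K := K) ⟨(b, l, k), hb.symm⟩
    have e : (⟨(b, l, k), hb.symm⟩ : Coord (Arr.src (V := V)) Arr.tgt d) = ⟨(a, i, j), ha⟩ ↔
        b = a ∧ l = i ∧ k = j := Subtype.ext_iff.trans (by simp)
    rw [h1, h2, opD_mul_opX, sub_add_cancel_left, if_congr e rfl rfl]
    by_cases hab : a = b
    · subst hab
      by_cases h : l = i ∧ k = j
      · rw [if_pos ⟨rfl, h⟩, if_pos ⟨ha, h.symm⟩]
        simp [pairing]
      · rw [if_neg (fun h' => h h'.2), if_neg (fun h' => h h'.2.symm), neg_zero]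
    · simp [pairing, hab, Ne.symm hab]
  · have h1 := opMat_inr_coord (K := K) ⟨(a, j, i), ha.symm⟩
    have h2 := opMat_inl_coord (K := K) ⟨(b, k, l), hb⟩
    have e : (⟨(a, j, i), ha.symm⟩ : Coord (Arr.src (V := V)) Arr.tgt d) = ⟨(b, k, l), hb⟩ ↔
        a = b ∧ j = k ∧ i = l := Subtype.ext_iff.trans (by simp)
    rw [h1, h2, opD_mul_opX, add_sub_cancel_left, if_congr e rfl rfl]
    by_cases hab : a = b
    · subst hab
      by_cases h : j = k ∧ i = l
      · rw [if_pos ⟨rfl, h⟩, if_pos ⟨ha, h.1.symm, h.2.symm⟩]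
        simp [pairing]
      · rw [if_neg (fun h' => h h'.2), if_neg (fun h' => h ⟨h'.2.1.symm, h'.2.2.symm⟩)]
    · simp [pairing, hab]
  · have h1 := opMat_inr_coord (K := K) ⟨(a, j, i), ha.symm⟩
    have h2 := opMat_inr_coord (K := K) ⟨(b, l, k), hb.symm⟩
    rw [h1, h2, DiffOp.ofDer_pderiv_comm, sub_self, pairing_inr_inr]
    simp

variable (K d) in
/-- The quantum moment map `∑ ([a][a*] - [a*][a])`. -/
def momentOp : Matrix (Idx d) (Idx d) (DRep (V := V) K d) :=
  ∑ a : Arr V, (opMat K d (Sum.inl a) * opMat K d (Sum.inr a)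
    - opMat K d (Sum.inr a) * opMat K d (Sum.inl a))

theorem opMat_mul_eq_zero {a : Arr V} {i j : Idx d} (h : i.1 ≠ j.1) :
    (opMat K d (Sum.inl a) * opMat K d (Sum.inr a)) i j = 0 ∧
      (opMat K d (Sum.inr a) * opMat K d (Sum.inl a)) i j = 0 := by
  constructor <;> rw [Matrix.mul_apply] <;> refine Finset.sum_eq_zero fun k _ => ?_
  · by_cases hi : i.1 = Arr.tgt a
    · rw [opMat_eq_zero (a := Sum.inr a) (i := k) (j := j) (fun h' => h (hi.trans h'.2.symm)),
        mul_zero]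
    · rw [opMat_eq_zero (a := Sum.inl a) (i := i) (j := k) (fun h' => hi h'.1), zero_mul]
  · by_cases hi : i.1 = Arr.src a
    · rw [opMat_eq_zero (a := Sum.inl a) (i := k) (j := j) (fun h' => h (hi.trans h'.2.symm)),
        mul_zero]
    · rw [opMat_eq_zero (a := Sum.inr a) (i := i) (j := k) (fun h' => hi h'.1), zero_mul]

theorem momentOp_apply (i j : Idx d) : momentOp K d i j =
    ∑ a : Arr V, ((opMat K d (Sum.inl a) * opMat K d (Sum.inr a)) i j
      - (opMat K d (Sum.inr a) * opMat K d (Sum.inl a)) i j) := by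
  rw [momentOp, Matrix.sum_apply]; rfl

theorem momentOp_eq_zero {i j : Idx d} (h : i.1 ≠ j.1) : momentOp (V := V) K d i j = 0 := by
  rw [momentOp_apply]
  refine Finset.sum_eq_zero fun a _ => ?_
  rw [(opMat_mul_eq_zero h).1, (opMat_mul_eq_zero h).2, sub_zero]

theorem symbol_momentOp (i j : Idx d) :
    symbol K d (momentOp (V := V) K d i j) = momentMat K d i j := by
  rw [momentOp_apply, map_sum, momentMat, Matrix.sum_apply]
  refine Finset.sum_congr rfl fun a _ => ?_
  simp only [map_sub, Matrix.mul_apply, map_sum, map_mul, symbol_opMat, Matrix.sub_apply]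

theorem map_conj_momentOp (g : GLd K d) :
    (momentOp (V := V) K d).map (DiffOp.conj (repActEquiv Arr.src Arr.tgt g)) =
      (glMat g⁻¹).map (scalHom K d) * momentOp K d * (glMat g).map (scalHom K d) := by
  have hg : (glMat g).map (scalHom (V := V) K d) * (glMat g⁻¹).map (scalHom K d) = 1 := by
    rw [← Matrix.map_mul, ← glMat_mul, mul_inv_cancel, glMat_one]
    exact Matrix.map_one _ (map_zero _) (map_one _)
  have hp : ∀ a b : DArr V,
      (opMat K d a * opMat K d b).map (DiffOp.conj (repActEquiv Arr.src Arr.tgt g)) =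
        (glMat g⁻¹).map (scalHom K d) * (opMat K d a * opMat K d b) *
          (glMat g).map (scalHom K d) := by
    intro a b
    rw [Matrix.map_mul, map_conj_opMat, map_conj_opMat]
    calc _ = (glMat g⁻¹).map (scalHom K d) * opMat K d a *
          ((glMat g).map (scalHom K d) * (glMat g⁻¹).map (scalHom K d)) *
          opMat K d b * (glMat g).map (scalHom K d) := by simp only [Matrix.mul_assoc]
      _ = _ := by rw [hg]; simp only [Matrix.mul_assoc, Matrix.one_mul]
  change (DiffOp.conj (repActEquiv Arr.src Arr.tgt g)).toRingHom.mapMatrix (momentOp K d) = _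
  rw [momentOp, map_sum, Matrix.mul_sum, Matrix.sum_mul]
  refine Finset.sum_congr rfl fun a _ => ?_
  rw [map_sub, Matrix.mul_sub, Matrix.sub_mul]
  exact congrArg₂ _ (hp _ _) (hp _ _)

/-- The commutator as a derivation. -/
theorem mul_commutator {R : Type*} [Ring R] (x y z : R) :
    x * y * z - z * (x * y) = x * (y * z - z * y) + (x * z - z * x) * y := by
  noncomm_ring

/-- By the Leibniz rule both factors contribute, and in each sum over the inner index the canonical
relations leave a single term. -/
theorem opMat_mul_commutator (a b : DArr V) (i j k l : Idx d) :
    (opMat K d a * opMat K d a.swap) i j * opMat K d b k l -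
        opMat K d b k l * (opMat K d a * opMat K d a.swap) i j =
      (if j.1 = DArr.src a.swap ∧ k = j then algebraMap K[X] (DRep K d)
        (Polynomial.X * Polynomial.C (pairing K a.swap b)) * opMat K d a i l else 0) +
      (if i.1 = DArr.tgt a ∧ l = i then algebraMap K[X] (DRep K d)
        (Polynomial.X * Polynomial.C (pairing K a b)) * opMat K d a.swap k j else 0) := by
  classical
  have hst : DArr.tgt a.swap = DArr.src a := by rcases a with a | a <;> rfl
  rw [Matrix.mul_apply, Finset.sum_mul, Finset.mul_sum, ← Finset.sum_sub_distrib]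
  simp only [mul_commutator, opMat_commutator, Finset.sum_add_distrib]
  congr 1
  · rw [Finset.sum_eq_single l]
    · by_cases hl : l.1 = DArr.src a
      · by_cases h : j.1 = DArr.src a.swap ∧ k = j
        · rw [if_pos ⟨⟨hl.trans hst.symm, h.1⟩, h.2, rfl⟩, if_pos h, ← Algebra.commutes]
        · rw [if_neg (fun h' => h ⟨h'.1.2, h'.2.1⟩), if_neg h, mul_zero]
      · rw [opMat_eq_zero (a := a) (fun h' => hl h'.2)]; simp
    · intro m _ hm
      rw [if_neg (fun h' => hm h'.2.2.symm), mul_zero]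
    · simp
  · rw [Finset.sum_eq_single k]
    · by_cases hk : k.1 = DArr.tgt a.swap
      · by_cases h : i.1 = DArr.tgt a ∧ l = i
        · rw [if_pos ⟨⟨h.1, hk.trans hst⟩, rfl, h.2⟩, if_pos h]
        · rw [if_neg (fun h' => h ⟨h'.1.1, h'.2.2⟩), if_neg h, zero_mul]
      · rw [opMat_eq_zero (a := a.swap) (fun h' => hk h'.1)]; simp
    · intro m _ hm
      rw [if_neg (fun h' => hm h'.2.1.symm), zero_mul]
    · simp

theorem ite_and_eq_of_eq_zero {R : Type*} [Ring R] {P Q : Prop} [Decidable P] [Decidable Q]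
    (c x : R) (h : ¬ P → x = 0) :
    (if P ∧ Q then c * x else 0) = c * if Q then x else 0 := by
  by_cases hP : P <;> by_cases hQ : Q <;> simp [hP, hQ]
  rw [h hP, mul_zero]

/-- Only the arrow underlying `b` contributes. The sign of the pairing compensates the sign between
$[a][a^*]$ and $[a^*][a]$, so the result is the same commutator with an elementary matrix for arrows
and for reversed arrows. -/
theorem momentOp_commutator_opMat {i j : Idx d} (hij : i.1 = j.1) (b : DArr V) (k l : Idx d) :
    momentOp K d i j * opMat K d b k l - opMat K d b k l * momentOp K d i j =
      - algebraMap K[X] (DRep K d) Polynomial.X *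
        ((if l = i then opMat K d b k j else 0) - if k = j then opMat K d b i l else 0) := by
  classical
  have h1 : ∀ a : Arr V, ∀ z : DRep (V := V) K d,
      ((opMat K d (Sum.inl a) * opMat K d (Sum.inr a)) i j -
        (opMat K d (Sum.inr a) * opMat K d (Sum.inl a)) i j) * z -
      z * ((opMat K d (Sum.inl a) * opMat K d (Sum.inr a)) i j -
        (opMat K d (Sum.inr a) * opMat K d (Sum.inl a)) i j) =
      ((opMat K d (Sum.inl a) * opMat K d (Sum.inr a)) i j * z -
        z * (opMat K d (Sum.inl a) * opMat K d (Sum.inr a)) i j) -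
      ((opMat K d (Sum.inr a) * opMat K d (Sum.inl a)) i j * z -
        z * (opMat K d (Sum.inr a) * opMat K d (Sum.inl a)) i j) := by
    intro a z; noncomm_ring
  have h2 := fun a : Arr V => opMat_mul_commutator (K := K) (Sum.inl a) b i j k l
  have h3 := fun a : Arr V => opMat_mul_commutator (K := K) (Sum.inr a) b i j k l
  simp only [Sum.swap_inl, Sum.swap_inr] at h2 h3
  have h5 : ¬ (j.1 = DArr.tgt b) → opMat K d b i l = 0 := fun h =>
    opMat_eq_zero fun h' => h (hij.symm.trans h'.1)
  have h6 : ¬ (i.1 = DArr.src b) → opMat K d b k j = 0 := fun h =>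
    opMat_eq_zero fun h' => h (hij.trans h'.2)
  rw [momentOp_apply, Finset.sum_mul, Finset.mul_sum, ← Finset.sum_sub_distrib]
  simp only [h1, h2, h3]
  rcases b with b | b
  · rw [Finset.sum_eq_single b]
    · simp only [pairing, if_true, map_one, mul_one, map_zero, mul_zero, zero_mul, ite_self,
        add_zero, zero_add]
      rw [ite_and_eq_of_eq_zero (P := j.1 = DArr.src (Sum.inr b)) _ _ h5,
        ite_and_eq_of_eq_zero (P := i.1 = DArr.tgt (Sum.inr b)) _ _ h6]
      noncomm_ring
    · intro a _ ha
      simp [pairing, ha]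
    · simp
  · rw [Finset.sum_eq_single b]
    · simp only [pairing, if_true, map_one, mul_one, map_zero, mul_zero, zero_mul, ite_self,
        add_zero, zero_add, map_neg, mul_neg]
      rw [ite_and_eq_of_eq_zero (P := j.1 = DArr.src (Sum.inl b)) _ _ h5,
        ite_and_eq_of_eq_zero (P := i.1 = DArr.tgt (Sum.inl b)) _ _ h6]
      noncomm_ring
    · intro a _ ha
      simp [pairing, ha]
    · simp

/-- The quantum moment map generates the infinitesimal action. -/
theorem momentOp_commutator {i j : Idx d} (hij : i.1 = j.1) (f : HCot (V := V) K d) :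
    momentOp K d i j * normalOrder K d f - normalOrder K d f * momentOp K d i j =
      - ((Polynomial.X : K[X]) • normalOrder K d (elemDer K[X] j i f)) := by
  have hX : ∀ c : Coord (DArr.src (V := V)) DArr.tgt d, elemDer K[X] j i (MvPolynomial.X c) =
      (if c.1.2.2 = i then coordMat K[X] DArr.src DArr.tgt d c.1.1 c.1.2.1 j else 0) -
      if c.1.2.1 = j then coordMat K[X] DArr.src DArr.tgt d c.1.1 i c.1.2.2 else 0 := elemDer_X j i
  induction f using hCot_induction with
  | h1 => simp [normalOrder_one]
  | hadd f g hf hg =>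
    rw [map_add, map_add, map_add, mul_add, add_mul, smul_add, neg_add, ← hf, ← hg]
    abel
  | hsmul r f hf =>
    rw [Derivation.map_smul, map_smul, map_smul, mul_smul_comm, smul_mul_assoc, ← smul_sub, hf,
      smul_neg, smul_comm]
  | hpos c f hf =>
    have h := momentOp_commutator_opMat (K := K) hij (Sum.inl c.1.1) c.1.2.1 c.1.2.2
    rw [opMat_inl_coord] at h
    have h1 : normalOrder K d (elemDer K[X] j i (MvPolynomial.X (posCoord c)) * f) =
        ((if c.1.2.2 = i then opMat K d (Sum.inl c.1.1) c.1.2.1 j else 0) -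
          if c.1.2.1 = j then opMat K d (Sum.inl c.1.1) i c.1.2.2 else 0) * normalOrder K d f := by
      rw [hX]
      change normalOrder K d (((if c.1.2.2 = i then
        coordMat K[X] DArr.src DArr.tgt d (Sum.inl c.1.1) c.1.2.1 j else 0) -
        if c.1.2.1 = j then coordMat K[X] DArr.src DArr.tgt d (Sum.inl c.1.1) i c.1.2.2 else 0) * f)
          = _
      rw [sub_mul, sub_mul, map_sub]
      congr 1 <;> split_ifs <;> simp [normalOrder_coordMat_inl]
    rw [Derivation.leibniz, smul_eq_mul, smul_eq_mul, mul_comm f, map_add, normalOrder_pos,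
      normalOrder_pos, h1, smul_add, neg_add, ← mul_smul_comm, ← mul_neg, ← hf, ← smul_mul_assoc,
      Algebra.smul_def, ← neg_mul, ← neg_mul, ← h]
    noncomm_ring
  | hmom c f hf =>
    have h := momentOp_commutator_opMat (K := K) hij (Sum.inr c.1.1) c.1.2.2 c.1.2.1
    rw [opMat_inr_coord] at h
    have h1 : normalOrder K d (elemDer K[X] j i (MvPolynomial.X (momCoord c)) * f) =
        normalOrder K d f * ((if c.1.2.1 = i then opMat K d (Sum.inr c.1.1) c.1.2.2 j else 0) -
          if c.1.2.2 = j then opMat K d (Sum.inr c.1.1) i c.1.2.1 else 0) := by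
      rw [hX]
      change normalOrder K d (((if c.1.2.1 = i then
        coordMat K[X] DArr.src DArr.tgt d (Sum.inr c.1.1) c.1.2.2 j else 0) -
        if c.1.2.2 = j then coordMat K[X] DArr.src DArr.tgt d (Sum.inr c.1.1) i c.1.2.1 else 0) * f)
          = _
      rw [sub_mul, mul_sub, map_sub]
      congr 1 <;> split_ifs <;> simp [normalOrder_coordMat_inr]
    rw [Derivation.leibniz, smul_eq_mul, smul_eq_mul, mul_comm f, map_add, normalOrder_mom,
      normalOrder_mom, h1, smul_add, neg_add, ← smul_mul_assoc, ← neg_mul, ← hf, ← mul_smul_comm,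
      Algebra.smul_def, ← mul_neg, ← neg_mul, ← h]
    noncomm_ring

theorem infAct_X (ξ : (k : V) → Matrix (Fin (d k)) (Fin (d k)) K)
    (c : Coord (Arr.src (V := V)) Arr.tgt d) :
    DiffOp.ofFun K (infAct ξ (MvPolynomial.X c)) =
      (opMat K d (Sum.inl c.1.1) * (Matrix.blockDiagonal' ξ).map (scalHom K d) -
        (Matrix.blockDiagonal' ξ).map (scalHom K d) * opMat K d (Sum.inl c.1.1))
          c.1.2.1 c.1.2.2 := by
  have h : opMat K d (Sum.inl c.1.1) =
    (genMat K Arr.src Arr.tgt d c.1.1).map (DiffOp.ofFunHom K _) := rfl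
  have hC : (Matrix.blockDiagonal' ξ).map (scalHom (V := V) K d) =
      ((Matrix.blockDiagonal' ξ).map MvPolynomial.C).map (DiffOp.ofFunHom K _) := by
    ext1 i j; exact (ofFun_C _).symm
  rw [infAct, MvPolynomial.mkDerivation_X, h, hC, ← Matrix.map_mul, ← Matrix.map_mul,
    Matrix.sub_apply, DiffOp.ofFun_sub]
  rfl

theorem ofDer_infAct (ξ : (k : V) → Matrix (Fin (d k)) (Fin (d k)) K) :
    DiffOp.ofDer (infAct ξ) = ∑ a : Arr V, ∑ i, ∑ j,
      (opMat K d (Sum.inl a) * (Matrix.blockDiagonal' ξ).map (scalHom K d) -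
        (Matrix.blockDiagonal' ξ).map (scalHom K d) * opMat K d (Sum.inl a)) i j *
        opMat K d (Sum.inr a) j i := by
  rw [DiffOp.ofDer_eq_sum, ← sum_coord (s := Arr.src (V := V)) (t := Arr.tgt) (fun a i j =>
    (opMat K d (Sum.inl a) * (Matrix.blockDiagonal' ξ).map (scalHom K d) -
        (Matrix.blockDiagonal' ξ).map (scalHom K d) * opMat K d (Sum.inl a)) i j *
        opMat K d (Sum.inr a) j i)]
  · refine Finset.sum_congr rfl fun c _ => ?_
    rw [infAct_X, opMat_inr_coord]
  · intro a i j h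
    rw [opMat_eq_zero (fun h' => h h'.symm), mul_zero]

/-- Each arrow contributes the trace of $\xi$ at its source once for every index at its target.
These are the index pairs over which the reordering scalars are summed in `sum_infAct_arrow`. -/
theorem chiZero_eq (ξ : (k : V) → Matrix (Fin (d k)) (Fin (d k)) K) :
    chiZero ξ = ∑ a : Arr V, ∑ i : Idx d, ∑ m : Idx d,
      if i.1 = Arr.tgt a ∧ m.1 = Arr.src a then - Matrix.blockDiagonal' ξ m m else 0 := by
  have h1 : ∀ a : Arr V, (∑ i : Idx d, ∑ m : Idx d,
      if i.1 = Arr.tgt a ∧ m.1 = Arr.src a then - Matrix.blockDiagonal' ξ m m else 0) =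
      - ((d (Arr.tgt a) : K) * (ξ (Arr.src a)).trace) := by
    intro a
    have h2 : (∑ m : Idx d, if m.1 = Arr.src a then - Matrix.blockDiagonal' ξ m m else 0) =
        - (ξ (Arr.src a)).trace := by
      rw [Fintype.sum_sigma, Finset.sum_eq_single (Arr.src a)]
      · simp [Matrix.trace, Matrix.blockDiagonal'_apply_eq]
      · intro b _ hb; simp [hb]
      · simp
    have h3 : ∀ i : Idx d, (∑ m : Idx d,
        if i.1 = Arr.tgt a ∧ m.1 = Arr.src a then - Matrix.blockDiagonal' ξ m m else 0) =
        if i.1 = Arr.tgt a then - (ξ (Arr.src a)).trace else 0 := by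
      intro i
      by_cases hi : i.1 = Arr.tgt a
      · simp only [hi, true_and, if_true, h2]
      · simp [hi]
    rw [Finset.sum_congr rfl fun i _ => h3 i, Fintype.sum_sigma, Finset.sum_eq_single (Arr.tgt a)]
    · simp
    · intro b _ hb; simp [hb]
    · simp
  rw [Finset.sum_congr rfl fun a _ => h1 a, chiZero, Finset.sum_neg_distrib]
  simp only [Finset.sum_mul]
  congr 1
  rw [Finset.sum_congr rfl fun k _ => Finset.sum_filter (fun a : Arr V => Arr.src a = k) _,
    Finset.sum_comm]
  refine Finset.sum_congr rfl fun a _ => ?_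
  simp

/-- The vector field has its functions on the left. The part with $\xi[a]$ is already ordered as
$[a][a^*]$. In the part with $[a]\xi$ the operator $[a]$ must be moved behind $[a^*]$, and each such
exchange with a dual entry costs $-\hbar$ times a diagonal entry of $\xi$. These scalars are the
origin of $\chi_0$. -/
theorem sum_infAct_arrow (a : Arr V) (S : Matrix (Idx d) (Idx d) K) :
    ∑ i, ∑ j, (opMat K d (Sum.inl a) * S.map (scalHom K d) -
        S.map (scalHom K d) * opMat K d (Sum.inl a)) i j * opMat K d (Sum.inr a) j i =
    (∑ i : Idx d, ∑ m : Idx d, algebraMap K[X] (DRep (V := V) K d) Polynomial.X *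
      scalHom K d (if i.1 = Arr.tgt a ∧ m.1 = Arr.src a then - S m m else 0)) -
    ∑ i, ∑ j, scalHom K d (S j i) *
      ((opMat K d (Sum.inl a) * opMat K d (Sum.inr a)) i j -
        (opMat K d (Sum.inr a) * opMat K d (Sum.inl a)) i j) := by
  classical
  have h1 : ∀ i j m, opMat K d (Sum.inl a) i m * scalHom K d (S m j) * opMat K d (Sum.inr a) j i =
      scalHom K d (S m j) * (opMat K d (Sum.inr a) j i * opMat K d (Sum.inl a) i m) +
      if j = m then algebraMap K[X] (DRep (V := V) K d) Polynomial.X *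
        scalHom K d (if i.1 = Arr.tgt a ∧ m.1 = Arr.src a then - S m m else 0) else 0 := by
    intro i j m
    rw [← scalHom_comm, mul_assoc]
    have h := opMat_commutator (K := K) (Sum.inl a) (Sum.inr a) i m j i
    rw [sub_eq_iff_eq_add'] at h
    rw [h, mul_add]
    congr 1
    by_cases hjm : j = m
    · subst hjm
      by_cases hv : i.1 = Arr.tgt a ∧ j.1 = Arr.src a
      · rw [if_pos ⟨hv, rfl, rfl⟩, if_pos rfl, if_pos hv, pairing, if_pos rfl, map_mul]
        change scalHom K d (S j j) * (_ * scalHom K d (-1)) = _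
        rw [scalHom_comm, mul_assoc, ← map_mul, neg_one_mul]
      · rw [if_neg (fun h' => hv h'.1), if_pos rfl, if_neg hv, map_zero, mul_zero, mul_zero]
    · rw [if_neg (fun h' => hjm h'.2.1), if_neg hjm, mul_zero]
  simp only [Matrix.sub_apply, sub_mul, Finset.sum_sub_distrib, mul_sub]
  have h2 : ∑ i, ∑ j, (opMat K d (Sum.inl a) * S.map (scalHom K d)) i j *
      opMat K d (Sum.inr a) j i = (∑ i, ∑ j, scalHom K d (S j i) *
        (opMat K d (Sum.inr a) * opMat K d (Sum.inl a)) i j) +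
      ∑ i : Idx d, ∑ m : Idx d, algebraMap K[X] (DRep (V := V) K d) Polynomial.X *
        scalHom K d (if i.1 = Arr.tgt a ∧ m.1 = Arr.src a then - S m m else 0) := by
    simp only [Matrix.mul_apply, Finset.sum_mul, Matrix.map_apply, h1, Finset.sum_add_distrib,
      Finset.mul_sum]
    congr 1
    · rw [Finset.sum_comm]
      refine Finset.sum_congr rfl fun j _ => ?_
      rw [Finset.sum_comm]
    · refine Finset.sum_congr rfl fun i _ => ?_
      rw [Finset.sum_comm]
      refine Finset.sum_congr rfl fun j _ => ?_
      rw [Finset.sum_ite_eq']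
      simp
  have h3 : ∑ i, ∑ j, (S.map (scalHom K d) * opMat K d (Sum.inl a)) i j *
      opMat K d (Sum.inr a) j i = ∑ i, ∑ j, scalHom K d (S j i) *
        (opMat K d (Sum.inl a) * opMat K d (Sum.inr a)) i j := by
    simp only [Matrix.mul_apply, Finset.sum_mul, Matrix.map_apply, Finset.mul_sum, mul_assoc]
    rw [Finset.sum_comm]
    rw [Finset.sum_congr rfl fun j _ => Finset.sum_comm, Finset.sum_comm]
    refine Finset.sum_congr rfl fun m _ => ?_
    rw [Finset.sum_comm]
  rw [h2, h3]
  abel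

/-- The shifted infinitesimal action in terms of the quantum moment map. -/
theorem ofDer_infAct_sub (ξ : (k : V) → Matrix (Fin (d k)) (Fin (d k)) K) :
    DiffOp.ofDer (infAct ξ) - algebraMap K[X] (DRep (V := V) K d)
      (Polynomial.X * Polynomial.C (chiZero ξ)) =
    - ∑ i, ∑ j, scalHom K d (Matrix.blockDiagonal' ξ j i) * momentOp K d i j := by
  have h : algebraMap K[X] (DRep (V := V) K d) (Polynomial.X * Polynomial.C (chiZero ξ)) =
      algebraMap K[X] (DRep (V := V) K d) Polynomial.X * scalHom K d (chiZero ξ) := map_mul _ _ _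
  rw [ofDer_infAct, Finset.sum_congr rfl fun a _ => sum_infAct_arrow a _, h, chiZero_eq]
  simp only [map_sum, Finset.mul_sum, Finset.sum_sub_distrib, sub_sub_cancel_left, momentOp_apply]
  congr 1
  rw [Finset.sum_comm]
  refine Finset.sum_congr rfl fun i _ => ?_
  rw [Finset.sum_comm]
  refine Finset.sum_congr rfl fun j _ => ?_
  rw [← Finset.sum_sub_distrib, Finset.mul_sum]

/-- The shifted generators are, up to sign, the pairings of $\xi$ with the quantum moment map.
Elementary matrices isolate its entries within the blocks, and the other entries vanish. -/
theorem momentLeftIdeal_eq : momentLeftIdeal (V := V) K d =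
    Ideal.span (Set.range fun p : Idx d × Idx d => momentOp (V := V) K d p.1 p.2) := by
  classical
  apply le_antisymm
  · rw [momentLeftIdeal, Ideal.span_le]
    rintro _ ⟨ξ, rfl⟩
    change DiffOp.ofDer (infAct ξ) - algebraMap K[X] (DRep (V := V) K d)
      (Polynomial.X * Polynomial.C (chiZero ξ)) ∈ _
    rw [ofDer_infAct_sub]
    exact neg_mem (sum_mem fun i _ => sum_mem fun j _ =>
      Ideal.mul_mem_left _ _ (Ideal.subset_span ⟨(i, j), rfl⟩))
  · rw [Ideal.span_le]
    rintro _ ⟨⟨⟨k, i⟩, ⟨k', j⟩⟩, rfl⟩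
    change momentOp K d ⟨k, i⟩ ⟨k', j⟩ ∈ momentLeftIdeal K d
    by_cases hk : k = k'
    · subst hk
      -- The trace pairing transposes indices, so the elementary matrix at $(j,i)$ singles out the
      -- entry $(i,j)$.
      have h : -(DiffOp.ofDer (infAct (Pi.single k (Matrix.single j i (1 : K)))) -
          algebraMap K[X] (DRep (V := V) K d) (Polynomial.X *
            Polynomial.C (chiZero (V := V) (Pi.single k (Matrix.single j i (1 : K)))))) ∈
          momentLeftIdeal K d := neg_mem (Ideal.subset_span ⟨_, rfl⟩)
      rw [ofDer_infAct_sub, neg_neg, Finset.sum_eq_single (⟨k, i⟩ : Idx d),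
        Finset.sum_eq_single (⟨k, j⟩ : Idx d)] at h
      · simpa [Matrix.blockDiagonal'_apply_eq] using h
      · rintro ⟨l, b⟩ _ hb
        by_cases hl : l = k
        · subst hl
          rw [Matrix.blockDiagonal'_apply_eq, Pi.single_eq_same, Matrix.single_apply, if_neg,
            map_zero, zero_mul]
          rintro ⟨rfl, -⟩
          exact hb rfl
        · rw [Matrix.blockDiagonal'_apply_ne _ _ _ hl, map_zero, zero_mul]
      · simp
      · rintro ⟨l, b⟩ _ hb
        refine Finset.sum_eq_zero ?_
        rintro ⟨l', b'⟩ _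
        by_cases hl : l' = l
        · subst hl
          rw [Matrix.blockDiagonal'_apply_eq]
          by_cases hl' : l' = k
          · subst hl'
            rw [Pi.single_eq_same, Matrix.single_apply, if_neg, map_zero, zero_mul]
            rintro ⟨-, rfl⟩
            exact hb rfl
          · rw [Pi.single_eq_of_ne hl']
            simp
        · rw [Matrix.blockDiagonal'_apply_ne _ _ _ hl, map_zero, zero_mul]
      · simp
    · rw [momentOp_eq_zero hk]
      exact zero_mem _

theorem momentOp_mem (i j : Idx d) : momentOp (V := V) K d i j ∈ momentLeftIdeal K d := by
  rw [momentLeftIdeal_eq]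
  exact Ideal.subset_span ⟨(i, j), rfl⟩

theorem conj_momentLeftIdeal (g : GLd K d) {D : DRep (V := V) K d}
    (hD : D ∈ momentLeftIdeal K d) :
    DiffOp.conj (repActEquiv Arr.src Arr.tgt g) D ∈ momentLeftIdeal K d := by
  rw [momentLeftIdeal_eq] at hD
  induction hD using Submodule.span_induction with
  | mem x hx =>
    obtain ⟨⟨i, j⟩, rfl⟩ := hx
    have h := congrFun (congrFun (map_conj_momentOp (V := V) g) i) j
    rw [Matrix.map_apply] at h
    rw [h, Matrix.mul_apply]
    refine sum_mem fun l _ => ?_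
    rw [Matrix.map_apply, ← scalHom_comm, Matrix.mul_apply]
    exact Ideal.mul_mem_left _ _ (sum_mem fun k _ => Ideal.mul_mem_left _ _ (momentOp_mem _ _))
  | zero => rw [map_zero]; exact zero_mem _
  | add x y _ _ hx hy => rw [map_add]; exact add_mem hx hy
  | smul a x _ hx => rw [smul_eq_mul, map_mul]; exact Ideal.mul_mem_left _ _ hx

theorem symbol_momentLeftIdeal {D : DRep (V := V) K d} (hD : D ∈ momentLeftIdeal K d) :
    symbol K d D ∈ momentIdeal K d := by
  rw [momentLeftIdeal_eq] at hD
  induction hD using Submodule.span_induction with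
  | mem x hx =>
    obtain ⟨⟨i, j⟩, rfl⟩ := hx
    rw [symbol_momentOp]
    exact Ideal.subset_span ⟨i, j, rfl⟩
  | zero => rw [map_zero]; exact zero_mem _
  | add x y _ _ hx hy => rw [map_add]; exact add_mem hx hy
  | smul a x _ hx => rw [smul_eq_mul, map_mul]; exact Ideal.mul_mem_left _ _ hx

/-- Generators lift to entries of the quantum moment map, and coefficients lift because the symbol
map is surjective. With `symbol_momentLeftIdeal`, the symbols of the left ideal are exactly the
moment ideal. -/
theorem exists_symbol_eq {f : FunCot (V := V) K d} (hf : f ∈ momentIdeal K d) :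
    ∃ D ∈ momentLeftIdeal K d, symbol K d D = f := by
  rw [momentIdeal] at hf
  induction hf using Submodule.span_induction with
  | mem x hx =>
    obtain ⟨i, j, rfl⟩ := hx
    exact ⟨_, momentOp_mem i j, symbol_momentOp i j⟩
  | zero => exact ⟨0, zero_mem _, map_zero _⟩
  | add x y _ _ hx hy =>
    obtain ⟨D, hD, rfl⟩ := hx
    obtain ⟨D', hD', rfl⟩ := hy
    exact ⟨D + D', add_mem hD hD', map_add _ _ _⟩
  | smul a x _ hx =>
    obtain ⟨D, hD, rfl⟩ := hx
    obtain ⟨A, rfl⟩ := symbol_surjective a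
    exact ⟨A * D, Ideal.mul_mem_left _ _ hD, map_mul _ _ _⟩

end MomentOperators

/-! ### Quantum Hamiltonian reduction and its classical limit -/

section QuantumReduction

variable {K : Type u} [Field K] {V : Type v} [Quiver.{w} V] [Fintype V] [DecidableEq V]
  [∀ i j : V, Fintype (i ⟶ j)] {d : V → ℕ}

theorem toFibre_eq_zero {f : FunCot (V := V) K d} : toFibre K d f = 0 ↔ f ∈ momentIdeal K d :=
  Ideal.Quotient.eq_zero_iff_mem

theorem toFibre_surjective : Function.Surjective (toFibre (V := V) K d) :=
  Ideal.Quotient.mk_surjective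

theorem fibreAct_toFibre (g : GLd K d) (f : FunCot (V := V) K d) :
    fibreAct g (toFibre K d f) = toFibre K d (repAct DArr.src DArr.tgt g f) := rfl

theorem symbol_mem_FunVariety (D : DInv (V := V) K d) :
    toFibre K d (symbol K d D) ∈ FunVariety K d := by
  rw [mem_FunVariety]
  intro g
  rw [fibreAct_toFibre, ← symbol_conj, mem_DInv.1 D.2 g]

/-- Conjugation is $\mathbb K[\hbar]$-linear and $\hbar$ can be cancelled. -/
theorem hbar_smul_mem_DInv {D : DRep (V := V) K d}
    (h : (Polynomial.X : K[X]) • D ∈ DInv K d) : D ∈ DInv K d := by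
  rw [mem_DInv] at h ⊢
  intro g
  apply hbar_smul_injective
  rw [← map_smul, h g]

variable (K d) in
/-- Functions whose value at `ħ = 0` vanishes on the zero fibre. -/
def fibreKer : Submodule K (HCot (V := V) K d) where
  carrier := {f | toFibre K d (hbarZero K d f) = 0}
  zero_mem' := by
    change toFibre K d (hbarZero K d 0) = 0
    rw [map_zero, map_zero]
  add_mem' := by
    intro a b (ha : toFibre K d (hbarZero K d a) = 0) (hb : toFibre K d (hbarZero K d b) = 0)
    change toFibre K d (hbarZero K d (a + b)) = 0
    rw [map_add, map_add, ha, hb, add_zero]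
  smul_mem' := by
    intro r a (ha : toFibre K d (hbarZero K d a) = 0)
    change toFibre K d (hbarZero K d (r • a)) = 0
    rw [Algebra.smul_def, map_mul, map_mul, ha, mul_zero]

theorem mem_fibreKer {f : HCot (V := V) K d} :
    f ∈ fibreKer K d ↔ toFibre K d (hbarZero K d f) = 0 := Iff.rfl

theorem glAct_sub_mem_fibreKer {f : FunCot (V := V) K d} (hf : toFibre K d f ∈ FunVariety K d)
    (g : GLd K d) : glAct K[X] DArr.src DArr.tgt g (MvPolynomial.map Polynomial.C f) -
      MvPolynomial.map Polynomial.C f ∈ fibreKer K d := by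
  rw [mem_fibreKer, map_sub, hbarZero_glAct, hbarZero_map_C, map_sub, ← fibreAct_toFibre,
    mem_FunVariety.1 hf g, sub_self]

/-- Functions on the quiver variety are symbols of invariant differential operators. -/
theorem exists_symbol_eq_toFibre [CharZero K] {f : FunCot (V := V) K d}
    (hf : toFibre K d f ∈ FunVariety K d) :
    ∃ D : DInv K d, toFibre K d (symbol K d D) = toFibre K d f := by
  -- Only the restriction of `f` to the fibre is invariant, so `f`, taken constant in $\hbar$, is
  -- invariant modulo `fibreKer` and has to be corrected inside it.
  obtain ⟨f₀, h1, h2⟩ := exists_invariant_lift (fibreKer K d) (fun g x hx => by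
    rw [mem_fibreKer] at hx ⊢
    rw [hbarZero_glAct, ← fibreAct_toFibre, hx, map_zero]) _ (glAct_sub_mem_fibreKer hf)
  refine ⟨⟨normalOrder K d f₀, normalOrder_mem_DInv.2 h1⟩, ?_⟩
  rw [mem_fibreKer, map_sub, map_sub, hbarZero_map_C, sub_eq_zero] at h2
  change toFibre K d (symbol K d (normalOrder K d f₀)) = _
  rw [symbol_normalOrder, h2]

variable (K d) in
/-- Normally ordered symbols of elements of `ħ D ∩ J`. -/
def hbarIdeal : Submodule K (HCot (V := V) K d) where
  carrier := {f | normalOrder K d f ∈ momentLeftIdeal K d ∧ hbarZero K d f = 0}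
  zero_mem' := by
    refine ⟨?_, map_zero _⟩
    rw [map_zero]
    exact zero_mem _
  add_mem' := by
    rintro a b ⟨ha, ha'⟩ ⟨hb, hb'⟩
    refine ⟨?_, ?_⟩
    · rw [map_add]; exact add_mem ha hb
    · rw [map_add, ha', hb', add_zero]
  smul_mem' := by
    rintro r a ⟨ha, ha'⟩
    refine ⟨?_, ?_⟩
    · rw [Algebra.smul_def, normalOrder_scalar_mul]; exact Ideal.mul_mem_left _ _ ha
    · rw [Algebra.smul_def, map_mul, ha', mul_zero]

/-- Invariant operators whose symbol vanishes on the zero fibre. -/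
theorem exists_eq_add_hbar_smul [CharZero K] (D : DInv (V := V) K d)
    (hD : toFibre K d (symbol K d D) = 0) :
    ∃ L E : DInv K d, (L : DRep K d) ∈ momentLeftIdeal K d ∧
      D = L + (Polynomial.X : K[X]) • E := by
  obtain ⟨L, hL, hLD⟩ := exists_symbol_eq (toFibre_eq_zero.1 hD)
  obtain ⟨f, rfl⟩ := normalOrder_surjective L
  rw [symbol_normalOrder] at hLD
  -- The element of the left ideal with the symbol of `D` need not be invariant. Its symbol is, and
  -- the ideal is stable under conjugation, so it is invariant modulo elements of the ideal of
  -- symbol zero. The correction thus changes neither the symbol nor membership in the ideal.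
  obtain ⟨f₀, h1, h2⟩ := exists_invariant_lift (hbarIdeal (V := V) K d) (by
    rintro g x ⟨hx, hx'⟩
    refine ⟨?_, ?_⟩
    · rw [← conj_normalOrder]; exact conj_momentLeftIdeal g hx
    · rw [hbarZero_glAct, hx', map_zero]) f (by
    intro g
    refine ⟨?_, ?_⟩
    · rw [map_sub, ← conj_normalOrder]; exact sub_mem (conj_momentLeftIdeal g hL) hL
    · rw [map_sub, hbarZero_glAct, hLD, ← symbol_conj, mem_DInv.1 D.2 g, sub_self])
  obtain ⟨h3, h4⟩ := h2
  rw [map_sub] at h3 h4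
  rw [hLD, sub_eq_zero] at h4
  have h5 : normalOrder K d f₀ ∈ DInv K d := normalOrder_mem_DInv.2 h1
  obtain ⟨E, hE⟩ := symbol_eq_zero ((D : DRep K d) - normalOrder K d f₀) (by
    rw [map_sub, symbol_normalOrder, h4, sub_self])
  have hE' : E ∈ DInv K d := hbar_smul_mem_DInv (by rw [← hE]; exact sub_mem D.2 h5)
  refine ⟨⟨_, h5⟩, ⟨E, hE'⟩, ?_, ?_⟩
  · have := add_mem h3 hL
    rwa [sub_add_cancel] at this
  · ext1
    change (D : DRep K d) = normalOrder K d f₀ + (Polynomial.X : K[X]) • E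
    rw [← hE]; abel

/-! #### The bracket -/

/-- The bracket with an entry of the moment map is, up to sign, the infinitesimal action, as the
limit of `momentOp_commutator`. A function invariant modulo the moment ideal is mapped into that
ideal. -/
theorem poisson_moment_mem [CharZero K] (i j : Idx d) {g : FunCot (V := V) K d}
    (hg : toFibre K d g ∈ FunVariety K d) : poisson (momentMat K d i j) g ∈ momentIdeal K d := by
  by_cases hij : i.1 = j.1
  · have h1 : elemDer K[X] j i (MvPolynomial.map Polynomial.C g) ∈ fibreKer K d :=
      elemDer_mem_of_glAct hij.symm (fibreKer K d) _ (glAct_sub_mem_fibreKer hg)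
    have h2 := symbol_of_commutator _ _ _
      ((smul_neg _ _).trans (momentOp_commutator hij (MvPolynomial.map Polynomial.C g)).symm)
    rw [map_neg, symbol_normalOrder, symbol_momentOp, symbol_normalOrder, hbarZero_map_C] at h2
    rw [← h2]
    exact neg_mem (toFibre_eq_zero.1 h1)
  · rw [← symbol_momentOp, momentOp_eq_zero hij, map_zero]
    simp [poisson]

theorem poisson_mem_left [CharZero K] {f g : FunCot (V := V) K d} (hf : f ∈ momentIdeal K d)
    (hg : toFibre K d g ∈ FunVariety K d) : poisson f g ∈ momentIdeal K d := by
  rw [momentIdeal] at hf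
  induction hf using Submodule.span_induction with
  | mem x hx =>
    obtain ⟨i, j, rfl⟩ := hx
    exact poisson_moment_mem i j hg
  | zero => simp [poisson]
  | add x y _ _ hx hy => rw [poisson_add_left]; exact add_mem hx hy
  | smul a x hx' hx =>
    rw [smul_eq_mul, poisson_mul_left]
    exact add_mem (Ideal.mul_mem_left _ _ hx) (Ideal.mul_mem_left _ _ hx')

theorem poisson_sub_left (f g h : FunCot (V := V) K d) :
    poisson (f - g) h = poisson f h - poisson g h := by
  rw [eq_sub_iff_add_eq, ← poisson_add_left, sub_add_cancel]

/-- The two functions are replaced one after the other. Each replacement needs only that the other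
function is invariant on the fibre; the second uses skew symmetry. -/
theorem toFibre_poisson_congr [CharZero K] {f f' g g' : FunCot (V := V) K d}
    (hf : toFibre K d f ∈ FunVariety K d) (hg : toFibre K d g ∈ FunVariety K d)
    (hff : toFibre K d f = toFibre K d f') (hgg : toFibre K d g = toFibre K d g') :
    toFibre K d (poisson f g) = toFibre K d (poisson f' g') := by
  have key : ∀ {f f' g : FunCot (V := V) K d}, toFibre K d g ∈ FunVariety K d →
      toFibre K d f = toFibre K d f' →
      toFibre K d (poisson f g) = toFibre K d (poisson f' g) := by
    intro f f' g hg hff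
    rw [← sub_eq_zero, ← map_sub, ← poisson_sub_left]
    exact toFibre_eq_zero.2 (poisson_mem_left
      (toFibre_eq_zero.1 (by rw [map_sub, hff, sub_self])) hg)
  rw [key hg hff, poisson_skew, map_neg, key (hff ▸ hf) hgg, ← map_neg, ← poisson_skew]

/-- Both functions may be replaced by symbols of invariant operators. Their bracket is then the
symbol of a commutator divided by $\hbar$, which is an invariant operator. -/
theorem poisson_mem_FunVariety [CharZero K] {f g : FunCot (V := V) K d}
    (hf : toFibre K d f ∈ FunVariety K d) (hg : toFibre K d g ∈ FunVariety K d) :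
    toFibre K d (poisson f g) ∈ FunVariety K d := by
  obtain ⟨A, hA⟩ := exists_symbol_eq_toFibre hf
  obtain ⟨B, hB⟩ := exists_symbol_eq_toFibre hg
  obtain ⟨C, hC, hC'⟩ := hasLimit (A : DRep K d) B
  rw [toFibre_poisson_congr hf hg hA.symm hB.symm, ← hC']
  have : C ∈ DInv K d := hbar_smul_mem_DInv (by
    rw [hC]; exact sub_mem (mul_mem A.2 B.2) (mul_mem B.2 A.2))
  exact symbol_mem_FunVariety ⟨C, this⟩

variable (K d) in
/-- A section of the restriction to the zero fibre. -/
def fibreLift (F : FunFibre (V := V) K d) : FunCot K d := Function.surjInv toFibre_surjective F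

theorem toFibre_fibreLift (F : FunFibre (V := V) K d) : toFibre K d (fibreLift K d F) = F :=
  Function.surjInv_eq toFibre_surjective F

/-- The bracket of two functions on the quiver variety. -/
def reducedBracketFun [CharZero K] (F G : FunVariety (V := V) K d) : FunVariety K d :=
  ⟨toFibre K d (poisson (fibreLift K d F) (fibreLift K d G)), poisson_mem_FunVariety
    (by rw [toFibre_fibreLift]; exact F.2) (by rw [toFibre_fibreLift]; exact G.2)⟩

theorem reducedBracketFun_eq [CharZero K] {F G : FunVariety (V := V) K d} {f g : FunCot K d}
    (hf : toFibre K d f = F) (hg : toFibre K d g = G) :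
    (reducedBracketFun F G : FunFibre K d) = toFibre K d (poisson f g) :=
  toFibre_poisson_congr (by rw [toFibre_fibreLift]; exact F.2)
    (by rw [toFibre_fibreLift]; exact G.2) (by rw [toFibre_fibreLift, hf])
    (by rw [toFibre_fibreLift, hg])

theorem reducedBracketFun_add_left [CharZero K] (F F' G : FunVariety (V := V) K d) :
    reducedBracketFun (F + F') G = reducedBracketFun F G + reducedBracketFun F' G := by
  ext1
  have h : toFibre K d (fibreLift K d F + fibreLift K d F') = (F + F' : FunVariety K d) := by
    rw [map_add, toFibre_fibreLift, toFibre_fibreLift]; rfl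
  rw [reducedBracketFun_eq h (toFibre_fibreLift _), poisson_add_left, map_add]
  rfl

theorem reducedBracketFun_smul_left [CharZero K] (c : K) (F G : FunVariety (V := V) K d) :
    reducedBracketFun (c • F) G = c • reducedBracketFun F G := by
  ext1
  have h : toFibre K d (MvPolynomial.C c * fibreLift K d F) = (c • F : FunVariety K d) := by
    rw [← MvPolynomial.smul_eq_C_mul, map_smul, toFibre_fibreLift]; rfl
  rw [reducedBracketFun_eq h (toFibre_fibreLift _), poisson_C_mul_left,
    ← MvPolynomial.smul_eq_C_mul, map_smul]
  rfl

theorem reducedBracketFun_skew [CharZero K] (F G : FunVariety (V := V) K d) :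
    reducedBracketFun F G = - reducedBracketFun G F := by
  ext1
  change toFibre K d _ = - toFibre K d _
  rw [poisson_skew, map_neg]

variable (K d) in
/-- The Poisson bracket of the quiver variety. -/
def reducedBracket [CharZero K] :
    FunVariety (V := V) K d →ₗ[K] FunVariety (V := V) K d →ₗ[K] FunVariety (V := V) K d :=
  LinearMap.mk₂ K reducedBracketFun reducedBracketFun_add_left reducedBracketFun_smul_left
    (fun F G G' => by
      rw [reducedBracketFun_skew, reducedBracketFun_add_left, reducedBracketFun_skew F G,
        reducedBracketFun_skew F G', neg_add])
    (fun c F G => by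
      rw [reducedBracketFun_skew, reducedBracketFun_smul_left, reducedBracketFun_skew F G,
        smul_neg])

theorem isReducedBracket [CharZero K] : IsReducedBracket K d (reducedBracket (V := V) K d) :=
  fun _ _ _ _ => reducedBracketFun_eq rfl rfl

/-! #### The quotient by the moment ideal -/

/-- The normally ordered symbol of an invariant operator is killed by the Lie algebra, and the
commutator is $\hbar$ times that derivative. -/
theorem momentOp_comm_of_mem_DInv [CharZero K] (i j : Idx d) (D : DInv (V := V) K d) :
    momentOp K d i j * D = D * momentOp K d i j := by
  by_cases hij : i.1 = j.1
  · obtain ⟨D, hD⟩ := D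
    obtain ⟨f, rfl⟩ := normalOrder_surjective D
    have h1 := elemDer_mem_of_glAct (K := K) hij.symm ⊥ f fun g => by
      rw [normalOrder_mem_DInv.1 hD g, sub_self]; exact zero_mem _
    rw [Submodule.mem_bot] at h1
    have h2 := momentOp_commutator hij f
    rwa [h1, map_zero, smul_zero, neg_zero, sub_eq_zero] at h2
  · rw [momentOp_eq_zero hij, zero_mul, mul_zero]

/-- Right multiplication by an invariant operator passes the generators of the left ideal, with
which it commutes. -/
theorem mul_mem_momentLeftIdeal [CharZero K] {L : DRep (V := V) K d}
    (hL : L ∈ momentLeftIdeal K d) (D : DInv (V := V) K d) :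
    L * D ∈ momentLeftIdeal K d := by
  rw [momentLeftIdeal_eq] at hL
  induction hL using Submodule.span_induction with
  | mem x hx =>
    obtain ⟨⟨i, j⟩, rfl⟩ := hx
    change momentOp K d i j * _ ∈ _
    rw [momentOp_comm_of_mem_DInv]
    exact Ideal.mul_mem_left _ _ (momentOp_mem i j)
  | zero => rw [zero_mul]; exact zero_mem _
  | add x y _ _ hx hy => rw [add_mul]; exact add_mem hx hy
  | smul a x _ hx => rw [smul_eq_mul, mul_assoc]; exact Ideal.mul_mem_left _ _ hx

variable (K d) in
/-- The invariant part of the moment ideal. -/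
def momentInvIdeal : Ideal (DInv (V := V) K d) :=
  (momentLeftIdeal K d).comap (DInv (V := V) K d).val.toRingHom

instance [CharZero K] : (momentInvIdeal (V := V) K d).IsTwoSided :=
  ⟨fun D hL => mul_mem_momentLeftIdeal hL D⟩

/-- A quotient by relations could kill more than the listed elements. As the invariants of the left
ideal form a two-sided ideal, the map to the quotient ring by it shows that nothing else vanishes.
-/
theorem hamMk_eq_zero [CharZero K] (D : DInv (V := V) K d) :
    HamReduction.mk K d D = 0 ↔ (D : DRep K d) ∈ momentLeftIdeal K d := by
  constructor
  · intro h
    let q : HamReduction (V := V) K d →+* (DInv (V := V) K d ⧸ momentInvIdeal K d) :=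
      RingQuot.lift ⟨Ideal.Quotient.mk (momentInvIdeal K d), by
        rintro x y ⟨hx, rfl⟩
        rw [map_zero]
        exact Ideal.Quotient.eq_zero_iff_mem.2 hx⟩
    have hq : q (HamReduction.mk K d D) = Ideal.Quotient.mk (momentInvIdeal K d) D := by
      have : HamReduction.mk K d D = RingQuot.mkRingHom (HamRel K d) D := by
        rw [← RingQuot.mkAlgHom_coe K[X]]; rfl
      rw [this]
      exact RingQuot.lift_mkRingHom_apply _ _ _
    rw [h, map_zero] at hq
    exact (Ideal.Quotient.eq_zero_iff_mem (I := momentInvIdeal K d)).1 hq.symm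
  · intro h
    exact (RingQuot.mkAlgHom_rel K[X] (show HamRel K d D 0 from ⟨h, rfl⟩)).trans (map_zero _)

theorem hamMk_surjective : Function.Surjective (HamReduction.mk (V := V) K d) :=
  RingQuot.mkAlgHom_surjective K[X] _

theorem hamZeroMk_surjective : Function.Surjective (HamReductionZero.mk (V := V) K d) :=
  RingQuot.mkAlgHom_surjective K _

theorem hamZeroMk_hbar_smul (D : HamReduction (V := V) K d) :
    HamReductionZero.mk K d ((Polynomial.X : K[X]) • D) = 0 := by
  have h : HamReductionZero.mk K d (algebraMap K[X] (HamReduction (V := V) K d) Polynomial.X) = 0 :=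
    (RingQuot.mkAlgHom_rel K (show HamZeroRel (V := V) K d _ 0 from ⟨rfl, rfl⟩)).trans (map_zero _)
  rw [Algebra.smul_def, map_mul, h, zero_mul]

variable (K d) in
/-- The symbol of an invariant differential operator as a function on the quiver variety. -/
def invSymbol : DInv (V := V) K d →+* FunVariety (V := V) K d :=
  (((toFibre K d : FunCot K d →+* FunFibre K d).comp (symbol K d)).comp
    (DInv (V := V) K d).val.toRingHom).codRestrict (FunVariety K d) symbol_mem_FunVariety

theorem invSymbol_apply (D : DInv (V := V) K d) :
    (invSymbol K d D : FunFibre K d) = toFibre K d (symbol K d D) := rfl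

variable (K d) in
/-- The symbol map on the quantum Hamiltonian reduction. -/
def hamSymbolHom : HamReduction (V := V) K d →+* FunVariety (V := V) K d :=
  RingQuot.lift ⟨invSymbol K d, by
    rintro x y ⟨hx, rfl⟩
    rw [map_zero]
    ext1
    exact toFibre_eq_zero.2 (symbol_momentLeftIdeal hx)⟩

theorem hamSymbolHom_mk (D : DInv (V := V) K d) :
    hamSymbolHom K d (HamReduction.mk K d D) = invSymbol K d D := by
  have : HamReduction.mk K d D = RingQuot.mkRingHom (HamRel K d) D := by
    rw [← RingQuot.mkAlgHom_coe K[X]]; rfl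
  rw [this]
  exact RingQuot.lift_mkRingHom_apply _ _ _

theorem hamSymbolHom_algebraMap (r : K[X]) :
    hamSymbolHom K d (algebraMap K[X] (HamReduction (V := V) K d) r) =
      algebraMap K _ (r.eval 0) := by
  rw [← AlgHom.commutes (HamReduction.mk K d), hamSymbolHom_mk]
  ext1
  rw [invSymbol_apply]
  change toFibre K d (symbol K d (algebraMap K[X] (DRep K d) r)) = _
  rw [symbol_algebraMap, ← MvPolynomial.algebraMap_eq, AlgHom.commutes]
  rfl

variable (K d) in
/-- The symbol map as a homomorphism of algebras. -/
def hamSymbol : HamReduction (V := V) K d →ₐ[K] FunVariety (V := V) K d :=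
  { hamSymbolHom K d with
    commutes' := fun c => by
      refine (hamSymbolHom_algebraMap (Polynomial.C c)).trans ?_
      rw [Polynomial.eval_C] }

variable (K d) in
/-- The symbol map on the quantum Hamiltonian reduction modulo `ħ`. -/
def hamZeroSymbol : HamReductionZero (V := V) K d →ₐ[K] FunVariety (V := V) K d :=
  RingQuot.liftAlgHom K ⟨hamSymbol K d, by
    rintro x y ⟨rfl, rfl⟩
    rw [map_zero]
    refine (hamSymbolHom_algebraMap Polynomial.X).trans ?_
    rw [Polynomial.eval_X, map_zero]⟩

theorem hamZeroSymbol_mk (D : DInv (V := V) K d) :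
    hamZeroSymbol K d (HamReductionZero.mk K d (HamReduction.mk K d D)) = invSymbol K d D :=
  (RingQuot.liftAlgHom_mkAlgHom_apply K _ _ _).trans (hamSymbolHom_mk D)

/-- An invariant operator whose symbol vanishes on the fibre is an invariant element of the left
ideal plus $\hbar$ times an invariant operator, and both summands die in the quotient. -/
theorem hamZeroSymbol_injective [CharZero K] :
    Function.Injective (hamZeroSymbol (V := V) K d) := by
  rw [injective_iff_map_eq_zero]
  intro x hx
  obtain ⟨y, rfl⟩ := hamZeroMk_surjective x
  obtain ⟨D, rfl⟩ := hamMk_surjective y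
  rw [hamZeroSymbol_mk] at hx
  have hx' := congrArg Subtype.val hx
  obtain ⟨L, E, hL, hD⟩ := exists_eq_add_hbar_smul D hx'
  rw [hD, map_add, (hamMk_eq_zero L).2 hL, zero_add, map_smul, hamZeroMk_hbar_smul]

theorem hamZeroSymbol_surjective [CharZero K] :
    Function.Surjective (hamZeroSymbol (V := V) K d) := by
  rintro ⟨F, hF⟩
  obtain ⟨f, rfl⟩ := toFibre_surjective F
  obtain ⟨D, hD⟩ := exists_symbol_eq_toFibre hF
  refine ⟨HamReductionZero.mk K d (HamReduction.mk K d D), ?_⟩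
  rw [hamZeroSymbol_mk]
  exact Subtype.ext hD

variable (K V d) in
/-- The quantum Hamiltonian reduction is a quantization of the quiver variety. -/
def hamZeroEquiv [CharZero K] : HamReductionZero (V := V) K d ≃ₐ[K] FunVariety (V := V) K d :=
  AlgEquiv.ofBijective (hamZeroSymbol K d) ⟨hamZeroSymbol_injective, hamZeroSymbol_surjective⟩

theorem hamZeroEquiv_mk [CharZero K] (D : DInv (V := V) K d) :
    hamZeroEquiv K V d (HamReductionZero.mk K d (HamReduction.mk K d D)) = invSymbol K d D :=
  hamZeroSymbol_mk D

theorem hamZeroEquiv_commutator [CharZero K] (A B C : DInv (V := V) K d)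
    (h : (Polynomial.X : K[X]) • C = A * B - B * A) :
    hamZeroEquiv K V d (HamReductionZero.mk K d (HamReduction.mk K d C)) =
      reducedBracket K d
        (hamZeroEquiv K V d (HamReductionZero.mk K d (HamReduction.mk K d A)))
        (hamZeroEquiv K V d (HamReductionZero.mk K d (HamReduction.mk K d B))) := by
  simp only [hamZeroEquiv_mk]
  ext1
  refine Eq.trans ?_ (isReducedBracket (symbol K d A) (symbol K d B) (symbol_mem_FunVariety A)
    (symbol_mem_FunVariety B)).symm
  rw [invSymbol_apply, symbol_of_commutator (A : DRep K d) B C (congrArg Subtype.val h)]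

end QuantumReduction

/-! ### Replacing commuting variables by operators ordered by height -/

section HeightOrdering

variable {R : Type*} [CommRing R] {σ : Type*} {D : Type*} [Ring D] [Algebra R D]
  (ht : σ → ℕ) (op : σ → D)

/-- The elements of a finite set, sorted by height. -/
def heightSort (t : Finset σ) : List σ := t.toList.mergeSort fun a b => decide (ht a ≤ ht b)

theorem exists_perm_pairwise (l : List σ) (hl : (l.map ht).Nodup) :
    ∃ l' : List σ, l'.Perm l ∧ l'.Pairwise (fun a b => ht a < ht b) := by
  refine ⟨l.mergeSort fun a b => decide (ht a ≤ ht b), List.mergeSort_perm _ _, ?_⟩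
  have h1 : (l.mergeSort fun a b => decide (ht a ≤ ht b)).Pairwise
      (fun a b => decide (ht a ≤ ht b) = true) :=
    List.pairwise_mergeSort (fun a b c h h' => by
      simp only [decide_eq_true_eq] at h h' ⊢; exact h.trans h')
      (fun a b => by simp only [Bool.or_eq_true, decide_eq_true_eq]; exact le_total _ _) l
  have h2 : (l.mergeSort fun a b => decide (ht a ≤ ht b)).Pairwise (fun a b => ht a ≠ ht b) := by
    rw [← List.pairwise_map (f := ht) (R := (· ≠ ·))]
    exact ((List.mergeSort_perm l _).map ht).nodup_iff.2 hl
  refine (h1.and h2).imp fun h => ?_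
  simp only [decide_eq_true_eq] at h
  exact lt_of_le_of_ne h.1 h.2

theorem nodup_of_pairwise_lt {l : List σ} (hl : l.Pairwise (fun a b => ht a < ht b)) : l.Nodup :=
  hl.imp fun h => by rintro rfl; exact lt_irrefl _ h

theorem map_nodup_of_pairwise_lt {l : List σ} (hl : l.Pairwise (fun a b => ht a < ht b)) :
    (l.map ht).Nodup := by
  rw [List.Nodup, List.pairwise_map]
  exact hl.imp fun h => h.ne

theorem heightSort_toFinset [DecidableEq σ] {l : List σ}
    (hl : l.Pairwise (fun a b => ht a < ht b)) : heightSort ht l.toFinset = l := by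
  have hp : l.toFinset.toList.Perm l := List.toFinset_toList (nodup_of_pairwise_lt ht hl)
  have hm : (heightSort ht l.toFinset).Perm l := (List.mergeSort_perm _ _).trans hp
  have h1 : (heightSort ht l.toFinset).Pairwise (fun a b => ht a ≤ ht b) := by
    refine List.Pairwise.imp (R := fun a b => decide (ht a ≤ ht b) = true)
      (fun h => by simpa using h) (List.pairwise_mergeSort (fun a b c h h' => by
      simp only [decide_eq_true_eq] at h h' ⊢; exact h.trans h')
      (fun a b => by simp only [Bool.or_eq_true, decide_eq_true_eq]; exact le_total _ _) _)
  refine List.Perm.eq_of_pairwise (le := fun a b => ht a ≤ ht b) (fun a b ha hb h h' => ?_) h1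
    (hl.imp fun h => h.le) hm
  exact List.inj_on_of_nodup_map (map_nodup_of_pairwise_lt ht hl) (hm.mem_iff.1 ha) hb
    (le_antisymm h h')

theorem prod_map_X_eq_monomial [DecidableEq σ] (l : List σ) :
    ∃ e : σ →₀ ℕ, (l.map (MvPolynomial.X : σ → MvPolynomial σ R)).prod =
      MvPolynomial.monomial e 1 ∧ e.support = l.toFinset := by
  induction l with
  | nil => exact ⟨0, rfl, rfl⟩
  | cons a l ih =>
    obtain ⟨e, h1, h2⟩ := ih
    refine ⟨Finsupp.single a 1 + e, ?_, ?_⟩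
    · rw [List.map_cons, List.prod_cons, h1, MvPolynomial.X, MvPolynomial.monomial_mul, one_mul]
    · rw [List.toFinset_cons, ← h2]
      ext x
      simp only [Finsupp.mem_support_iff, Finsupp.add_apply, Finset.mem_insert,
        Finsupp.single_apply]
      split_ifs with h
      · simp [h]
      · simp [Ne.symm h]

/-- The linear map that sends a product of variables to the product of the operators attached to
them, in the order of increasing heights. -/
def heightOrder : MvPolynomial σ R →ₗ[R] D :=
  -- Only the support of the exponent enters. Repeated variables or equal heights give arbitrary
  -- values, so the map is used on `multilin` only.
  (MvPolynomial.basisMonomials σ R).constr R fun e => ((heightSort ht e.support).map op).prod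

theorem heightOrder_prod {l : List σ} (hl : l.Pairwise (fun a b => ht a < ht b)) :
    heightOrder (R := R) ht op (l.map MvPolynomial.X).prod = (l.map op).prod := by
  classical
  obtain ⟨e, h1, h2⟩ := prod_map_X_eq_monomial (R := R) l
  have h3 := (MvPolynomial.basisMonomials σ R).constr_basis R
    (fun e => ((heightSort ht e.support).map op).prod) e
  rw [MvPolynomial.coe_basisMonomials, h2, heightSort_toFinset ht hl] at h3
  rw [h1]
  exact h3

variable (R) in
/-- The span of the products of variables whose heights are pairwise distinct and form the
set `S`. -/
def multilin (S : Finset ℕ) : Submodule R (MvPolynomial σ R) :=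
  Submodule.span R {f | ∃ l : List σ, l.Pairwise (fun a b => ht a < ht b) ∧
    (l.map ht).toFinset = S ∧ f = (l.map MvPolynomial.X).prod}

theorem prod_mem_multilin {l : List σ} (hl : (l.map ht).Nodup) :
    (l.map MvPolynomial.X).prod ∈ multilin R ht (l.map ht).toFinset := by
  obtain ⟨l', h1, h2⟩ := exists_perm_pairwise ht l hl
  refine Submodule.subset_span ⟨l', h2, List.toFinset_eq_of_perm _ _ (h1.map ht),
    ((h1.map _).prod_eq).symm⟩

theorem one_mem_multilin : (1 : MvPolynomial σ R) ∈ multilin R ht ∅ :=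
  prod_mem_multilin ht (l := []) List.nodup_nil

theorem X_mem_multilin (c : σ) : MvPolynomial.X c ∈ multilin R ht {ht c} := by
  simpa using prod_mem_multilin (R := R) ht (l := [c]) (List.nodup_singleton _)

theorem mul_mem_multilin {S S' : Finset ℕ} (hS : Disjoint S S') {f g : MvPolynomial σ R}
    (hf : f ∈ multilin R ht S) (hg : g ∈ multilin R ht S') : f * g ∈ multilin R ht (S ∪ S') := by
  rw [multilin] at hf hg
  induction hf using Submodule.span_induction with
  | mem f hf =>
    obtain ⟨l, hl, rfl, rfl⟩ := hf
    induction hg using Submodule.span_induction with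
    | mem g hg =>
      obtain ⟨l', hl', rfl, rfl⟩ := hg
      rw [← List.prod_append, ← List.map_append, ← List.toFinset_append, ← List.map_append]
      refine prod_mem_multilin ht ?_
      rw [List.map_append, List.nodup_append]
      refine ⟨map_nodup_of_pairwise_lt ht hl, map_nodup_of_pairwise_lt ht hl', ?_⟩
      rintro a ha b hb rfl
      exact Finset.disjoint_left.1 hS (List.mem_toFinset.2 ha) (List.mem_toFinset.2 hb)
    | zero => rw [mul_zero]; exact zero_mem _
    | add x y _ _ hx hy => rw [mul_add]; exact add_mem hx hy
    | smul a x _ hx => rw [mul_smul_comm]; exact Submodule.smul_mem _ _ hx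
  | zero => rw [zero_mul]; exact zero_mem _
  | add x y _ _ hx hy => rw [add_mul]; exact add_mem hx hy
  | smul a x _ hx => rw [smul_mul_assoc]; exact Submodule.smul_mem _ _ hx

/-- Two lists sorted by height, the first entirely below the second, concatenate to a sorted list.
-/
theorem heightOrder_mul {S S' : Finset ℕ} (hS : ∀ m ∈ S, ∀ n ∈ S', m < n)
    {f g : MvPolynomial σ R} (hf : f ∈ multilin R ht S) (hg : g ∈ multilin R ht S') :
    heightOrder ht op (f * g) = heightOrder ht op f * heightOrder ht op g := by
  rw [multilin] at hf hg
  induction hf using Submodule.span_induction with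
  | mem f hf =>
    obtain ⟨l, hl, rfl, rfl⟩ := hf
    induction hg using Submodule.span_induction with
    | mem g hg =>
      obtain ⟨l', hl', rfl, rfl⟩ := hg
      rw [← List.prod_append, ← List.map_append, heightOrder_prod ht op hl,
        heightOrder_prod ht op hl', heightOrder_prod, List.map_append, List.prod_append]
      rw [List.pairwise_append]
      refine ⟨hl, hl', fun a ha b hb => hS _ ?_ _ ?_⟩
      · exact List.mem_toFinset.2 (List.mem_map_of_mem ha)
      · exact List.mem_toFinset.2 (List.mem_map_of_mem hb)
    | zero => simp
    | add x y _ _ hx hy => rw [mul_add, map_add, hx, hy, map_add, mul_add]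
    | smul a x _ hx => rw [mul_smul_comm, map_smul, hx, map_smul, mul_smul_comm]
  | zero => simp
  | add x y _ _ hx hy => rw [add_mul, map_add, hx, hy, map_add, add_mul]
  | smul a x _ hx => rw [smul_mul_assoc, map_smul, hx, map_smul, smul_mul_assoc]

theorem heightOrder_one : heightOrder (R := R) ht op 1 = 1 := by
  simpa using heightOrder_prod (R := R) ht op (l := []) List.Pairwise.nil

theorem heightOrder_X (c : σ) : heightOrder (R := R) ht op (MvPolynomial.X c) = op c := by
  simpa using heightOrder_prod (R := R) ht op (l := [c]) (List.pairwise_singleton _ _)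

/-- Exchanging neighbouring operators whose commutator is a scalar. -/
theorem heightOrder_exchange {S : Finset ℕ} {m n : ℕ} (hmn : m < n)
    (hS : ∀ k ∈ S, k < m ∨ n < k) {f w w' : MvPolynomial σ R} (hf : f ∈ multilin R ht S)
    (hw : w ∈ multilin R ht {m, n}) (hw' : w' ∈ multilin R ht {m, n}) (r : R)
    (h : heightOrder ht op w = heightOrder ht op w' + algebraMap R D r) :
    heightOrder ht op (f * w) = heightOrder ht op (f * w') + r • heightOrder ht op f := by
  rw [multilin] at hf
  induction hf using Submodule.span_induction with
  | mem f hf =>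
    obtain ⟨l, hl, rfl, rfl⟩ := hf
    -- No other height lies between `m` and `n`, so the sorted list splits and the pair stands
    -- between the two halves in the operator product. The scalar commutator can then be pulled out.
    obtain ⟨l₁, l₂, rfl, h1, h2⟩ : ∃ l₁ l₂, l = l₁ ++ l₂ ∧ (∀ a ∈ l₁, ht a < m) ∧
        ∀ a ∈ l₂, n < ht a := by
      clear h hw hw'
      induction l with
      | nil => exact ⟨[], [], rfl, by simp, by simp⟩
      | cons a l ih =>
        rw [List.pairwise_cons] at hl
        rcases hS (ht a) (by simp) with ha | ha
        · obtain ⟨l₁, l₂, rfl, h1, h2⟩ := ih hl.2 (fun k hk => hS k (by simp at hk ⊢; tauto))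
          exact ⟨a :: l₁, l₂, rfl, by simpa using ⟨ha, h1⟩, h2⟩
        · refine ⟨[], a :: l, rfl, by simp, ?_⟩
          simpa using ⟨ha, fun b hb => ha.trans (hl.1 b hb)⟩
    have hl' := List.pairwise_append.1 hl
    have m1 := prod_mem_multilin (R := R) ht (map_nodup_of_pairwise_lt ht hl'.1)
    have m2 := prod_mem_multilin (R := R) ht (map_nodup_of_pairwise_lt ht hl'.2.1)
    have key : ∀ w ∈ multilin R ht {m, n}, heightOrder ht op
        (((l₁ ++ l₂).map MvPolynomial.X).prod * w) =
        (l₁.map op).prod * heightOrder ht op w * (l₂.map op).prod := by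
      intro w hw
      have e1 : ∀ x ∈ (l₁.map ht).toFinset, ∀ y ∈ ({m, n} : Finset ℕ), x < y := by
        intro x hx y hy
        simp only [List.mem_toFinset, List.mem_map] at hx
        obtain ⟨a, ha, rfl⟩ := hx
        have := h1 a ha
        simp only [Finset.mem_insert, Finset.mem_singleton] at hy
        omega
      have e2 : ∀ x ∈ (l₁.map ht).toFinset ∪ {m, n}, ∀ y ∈ (l₂.map ht).toFinset, x < y := by
        intro x hx y hy
        simp only [List.mem_toFinset, List.mem_map] at hy
        obtain ⟨b, hb, rfl⟩ := hy
        have := h2 b hb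
        rcases Finset.mem_union.1 hx with hx | hx
        · have := e1 x hx m (by simp)
          omega
        · simp only [Finset.mem_insert, Finset.mem_singleton] at hx
          omega
      have e3 : Disjoint (l₁.map ht).toFinset {m, n} := by
        rw [Finset.disjoint_left]
        intro x hx hy
        exact lt_irrefl x (e1 x hx x hy)
      rw [List.map_append, List.prod_append, mul_right_comm,
        heightOrder_mul ht op e2 (mul_mem_multilin ht e3 m1 hw) m2,
        heightOrder_mul ht op e1 m1 hw, heightOrder_prod ht op hl'.1, heightOrder_prod ht op hl'.2.1]
    rw [key w hw, key w' hw', h, heightOrder_prod ht op hl, List.map_append, List.prod_append,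
      mul_add, add_mul, ← Algebra.commutes, mul_assoc (algebraMap R D r), ← Algebra.smul_def]
  | zero => simp
  | add x y _ _ hx hy =>
    rw [add_mul, map_add, hx, hy, add_mul, map_add, map_add, smul_add]; abel
  | smul a x _ hx =>
    rw [smul_mul_assoc, map_smul, hx, smul_mul_assoc, map_smul, map_smul, smul_add, smul_comm]

/-- Compatibility of the ordering with homomorphisms that preserve the order of the heights. -/
theorem heightOrder_map {D' : Type*} [Ring D'] [Algebra R D'] {σ' : Type*} {ht' : σ' → ℕ}
    {op' : σ' → D'} (φ : ℕ → ℕ) (hφ : StrictMono φ) (ρ : MvPolynomial σ R →ₐ[R] MvPolynomial σ' R)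
    (θ : D →ₐ[R] D') (h1 : ∀ c, ρ (MvPolynomial.X c) ∈ multilin R ht' {φ (ht c)})
    (h2 : ∀ c, heightOrder ht' op' (ρ (MvPolynomial.X c)) = θ (op c)) {S : Finset ℕ}
    {f : MvPolynomial σ R} (hf : f ∈ multilin R ht S) :
    heightOrder ht' op' (ρ f) = θ (heightOrder ht op f) := by
  rw [multilin] at hf
  induction hf using Submodule.span_induction with
  | mem f hf =>
    obtain ⟨l, hl, rfl, rfl⟩ := hf
    suffices h : ρ (l.map MvPolynomial.X).prod ∈ multilin R ht' ((l.map ht).toFinset.image φ) ∧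
        heightOrder ht' op' (ρ (l.map MvPolynomial.X).prod) =
          θ (heightOrder ht op (l.map MvPolynomial.X).prod) from h.2
    rw [heightOrder_prod ht op hl]
    induction l with
    | nil =>
      simp only [List.map_nil, List.prod_nil, map_one, List.toFinset_nil, Finset.image_empty]
      exact ⟨one_mem_multilin ht', heightOrder_one ht' op'⟩
    | cons a l ih =>
      rw [List.pairwise_cons] at hl
      obtain ⟨ih1, ih2⟩ := ih hl.2
      simp only [List.map_cons, List.prod_cons, map_mul, List.toFinset_cons, Finset.image_insert]
      have hlt : ∀ x ∈ ({φ (ht a)} : Finset ℕ), ∀ y ∈ (l.map ht).toFinset.image φ, x < y := by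
        intro x hx y hy
        simp only [Finset.mem_singleton] at hx
        simp only [Finset.mem_image, List.mem_toFinset, List.mem_map] at hy
        obtain ⟨_, ⟨b, hb, rfl⟩, rfl⟩ := hy
        rw [hx]
        exact hφ (hl.1 b hb)
      refine ⟨?_, ?_⟩
      · rw [Finset.insert_eq]
        refine mul_mem_multilin ht' ?_ (h1 a) ih1
        rw [Finset.disjoint_left]
        intro x hx hx'
        exact lt_irrefl x (hlt x hx x hx')
      · rw [heightOrder_mul ht' op' hlt (h1 a) ih1, h2, ih2]
  | zero => simp
  | add x y _ _ hx hy => rw [map_add, map_add, hx, hy, map_add, map_add]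
  | smul a x _ hx => rw [map_smul, map_smul, hx, map_smul, map_smul]

/-- In a commutative quotient the ordering is irrelevant. -/
theorem map_heightOrder {A : Type*} [CommRing A] (θ : D →+* A) (ev : MvPolynomial σ R →+* A)
    (h1 : ∀ r, ev (MvPolynomial.C r) = θ (algebraMap R D r))
    (h2 : ∀ c, ev (MvPolynomial.X c) = θ (op c)) {S : Finset ℕ} {f : MvPolynomial σ R}
    (hf : f ∈ multilin R ht S) : θ (heightOrder ht op f) = ev f := by
  rw [multilin] at hf
  induction hf using Submodule.span_induction with
  | mem f hf =>
    obtain ⟨l, hl, rfl, rfl⟩ := hf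
    rw [heightOrder_prod ht op hl, map_list_prod, map_list_prod, List.map_map, List.map_map]
    congr 1
    exact List.map_congr_left fun c _ => (h2 c).symm
  | zero => simp
  | add x y _ _ hx hy => rw [map_add, map_add, hx, hy, map_add]
  | smul a x _ hx =>
    rw [map_smul, Algebra.smul_def, map_mul, hx, MvPolynomial.smul_eq_C_mul, map_mul, h1]

end HeightOrdering

/-! ### Paths, heights and admissible monomials -/

section Words

variable {V : Type v} [Quiver.{w} V]

/-- A word is a path from `v` to `u` (the paths are composed like maps). -/
def IsPath : V → List (DArr V × ℕ) → V → Prop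
  | u, [], v => u = v
  | u, p :: l, v => DArr.tgt p.1 = u ∧ IsPath (DArr.src p.1) l v

theorem isPath_append {u w : V} {l l' : List (DArr V × ℕ)} :
    IsPath u (l ++ l') w ↔ ∃ v, IsPath u l v ∧ IsPath v l' w := by
  induction l generalizing u with
  | nil => simp [IsPath]
  | cons p l ih => simp [IsPath, ih, and_assoc]

theorem isChain_iff_isPath (p q : DArr V × ℕ) (l : List (DArr V × ℕ)) :
    List.IsChain (fun p q : DArr V × ℕ => DArr.src p.1 = DArr.tgt q.1) (p :: (l ++ [q])) ↔
      IsPath (DArr.src p.1) l (DArr.tgt q.1) := by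
  induction l generalizing p with
  | nil => simp [IsPath]
  | cons r l ih => rw [List.cons_append, List.isChain_cons_cons, ih, IsPath, eq_comm]

theorem chain_iff_isPath (p : DArr V × ℕ) (l : List (DArr V × ℕ)) :
    Cycle.Chain (fun p q : DArr V × ℕ => DArr.src p.1 = DArr.tgt q.1)
      ((p :: l : List (DArr V × ℕ)) : Cycle (DArr V × ℕ)) ↔
      IsPath (DArr.src p.1) l (DArr.tgt p.1) := by
  rw [Cycle.chain_coe_cons, isChain_iff_isPath]

namespace HeightMonomial

theorem heights_mk (C : Multiset (Cycle (DArr V × ℕ))) (W : Multiset V) :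
    (⟨C, W⟩ : HeightMonomial V).heights = C.bind fun c => c.toMultiset.map Prod.snd := rfl

theorem heights_empty : (empty : HeightMonomial V).heights = 0 := rfl

theorem heights_addCycle (X : HeightMonomial V) (l : List (DArr V × ℕ)) :
    (X.addCycle l).heights = (l.map Prod.snd : List ℕ) + X.heights := by
  simp [addCycle, heights]

theorem heights_addWord (X : HeightMonomial V) (i : V) (l : List (DArr V × ℕ)) :
    (X.addWord i l).heights = (l.map Prod.snd : List ℕ) + X.heights := by
  cases l <;> simp [addWord, heights]

theorem heights_diff (X : HeightMonomial V) (p q : DArr V × ℕ) (r s : List (DArr V × ℕ)) :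
    ((X.addCycle (p :: r)).addCycle (q :: s)).heights = q.2 ::ₘ p.2 ::ₘ
      (((s.map Prod.snd : List ℕ) : Multiset ℕ) + ((r.map Prod.snd : List ℕ) + X.heights)) := by
  rw [heights_addCycle, heights_addCycle, List.map_cons, List.map_cons, ← Multiset.cons_coe,
    ← Multiset.cons_coe, Multiset.cons_add, Multiset.cons_add, Multiset.add_cons]

theorem heights_same (X : HeightMonomial V) (p q : DArr V × ℕ) (r s : List (DArr V × ℕ)) :
    (X.addCycle (p :: r ++ q :: s)).heights = q.2 ::ₘ p.2 ::ₘ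
      (((s.map Prod.snd : List ℕ) : Multiset ℕ) + ((r.map Prod.snd : List ℕ) + X.heights)) := by
  rw [heights_addCycle, List.map_append, List.map_cons, List.map_cons, ← Multiset.coe_add,
    ← Multiset.cons_coe, ← Multiset.cons_coe, Multiset.cons_add, Multiset.add_cons,
    Multiset.cons_add, Multiset.cons_add, Multiset.cons_swap, add_comm (Multiset.ofList _) (Multiset.ofList _),
    add_assoc]

theorem heights_mul (X Y : HeightMonomial V) : (X.mul Y).heights = X.heights + Y.heights := by
  simp [mul, heights]

theorem heights_mapHeights (f : ℕ → ℕ) (X : HeightMonomial V) :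
    (X.mapHeights f).heights = X.heights.map f := by
  simp only [mapHeights, heights, Multiset.bind_map, Multiset.map_bind, Multiset.map_map]
  refine Multiset.bind_congr fun c _ => ?_
  induction c using Quotient.inductionOn with
  | _ l =>
    change (((l.map fun p => (p.1, f p.2)).map Prod.snd : List ℕ) : Multiset ℕ) =
      ((l.map (f ∘ Prod.snd) : List ℕ) : Multiset ℕ)
    rw [List.map_map]; rfl

theorem valid_mul {X Y : HeightMonomial V} (hX : X.Valid) (hY : Y.Valid)
    (h : ∀ m ∈ X.heights, ∀ n ∈ Y.heights, m < n) : (X.mul Y).Valid := by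
  refine ⟨fun c hc => ?_, ?_⟩
  · rcases Multiset.mem_add.1 hc with hc | hc
    exacts [hX.1 c hc, hY.1 c hc]
  · rw [heights_mul, Multiset.nodup_add]
    refine ⟨hX.2, hY.2, Multiset.disjoint_left.2 fun {a} ha ha' => lt_irrefl _ (h a ha a ha')⟩

theorem valid_mapHeights {f : ℕ → ℕ} (hf : Function.Injective f) {X : HeightMonomial V}
    (hX : X.Valid) : (X.mapHeights f).Valid := by
  refine ⟨fun c hc => ?_, ?_⟩
  · obtain ⟨c, hc', rfl⟩ := Multiset.mem_map.1 hc
    refine ⟨fun h => (hX.1 c hc').1 ((Cycle.map_eq_nil _ _).1 h), ?_⟩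
    rw [Cycle.chain_map]
    exact (hX.1 c hc').2
  · rw [heights_mapHeights]
    exact hX.2.map hf

theorem valid_addCycle_cons {X : HeightMonomial V} {p : DArr V × ℕ} {l : List (DArr V × ℕ)} :
    (X.addCycle (p :: l)).Valid ↔
      IsPath (DArr.src p.1) l (DArr.tgt p.1) ∧
      (∀ c ∈ X.cycles, c ≠ Cycle.nil ∧ c.Chain fun p q => DArr.src p.1 = DArr.tgt q.1) ∧
      (((p :: l).map Prod.snd : List ℕ) + X.heights : Multiset ℕ).Nodup := by
  rw [Valid, heights_addCycle]
  simp only [addCycle, Multiset.mem_cons, forall_eq_or_imp, chain_iff_isPath]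
  have : ((p :: l : List (DArr V × ℕ)) : Cycle (DArr V × ℕ)) ≠ Cycle.nil := by
    rw [Ne, ← Cycle.coe_nil, Cycle.coe_eq_coe]
    intro h
    simpa using h.perm.length_eq
  tauto

theorem valid_addWord {X : HeightMonomial V} {i : V} {l : List (DArr V × ℕ)}
    (hl : IsPath i l i)
    (hX : ∀ c ∈ X.cycles, c ≠ Cycle.nil ∧ c.Chain fun p q => DArr.src p.1 = DArr.tgt q.1)
    (hh : ((l.map Prod.snd : List ℕ) + X.heights : Multiset ℕ).Nodup) :
    (X.addWord i l).Valid := by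
  cases l with
  | nil => exact ⟨hX, by simpa [addWord, heights] using hh⟩
  | cons p l => exact valid_addCycle_cons.2 ⟨by rw [hl.1]; exact hl.2, hX, hh⟩

end HeightMonomial

end Words

/-! ### The quantum trace of a monomial -/

section QuantumTrace

variable {K : Type u} [Field K] {V : Type v} [Quiver.{w} V] [Fintype V] [DecidableEq V]
  [∀ i j : V, Fintype (i ⟶ j)] {d : V → ℕ}

/-- The source of an arrow with a height. -/
def hSrc (p : DArr V × ℕ) : V := DArr.src p.1

/-- The target of an arrow with a height. -/
def hTgt (p : DArr V × ℕ) : V := DArr.tgt p.1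

variable (K d) in
/-- Polynomials in the matrix entries of the arrows with heights. -/
abbrev HRing : Type (max u v w) := MvPolynomial (Coord (hSrc (V := V)) hTgt d) K[X]

/-- The height of a coordinate. -/
def coordHt (c : Coord (hSrc (V := V)) hTgt d) : ℕ := c.1.1.2

variable (K) in
/-- The operator attached to a coordinate. -/
def coordOp (c : Coord (hSrc (V := V)) hTgt d) : DRep (V := V) K d :=
  opMat K d c.1.1.1 c.1.2.1 c.1.2.2

variable (K d) in
/-- The matrix of an arrow with a height. -/
abbrev hMat (p : DArr V × ℕ) : Matrix (Idx d) (Idx d) (HRing (V := V) K d) :=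
  coordMat K[X] hSrc hTgt d p

variable (K V d) in
/-- Ordering by heights. -/
abbrev hOrder : HRing (V := V) K d →ₗ[K[X]] DRep (V := V) K d := heightOrder coordHt (coordOp K)

variable (K V d) in
/-- Polynomials that are multilinear with a given set of heights. -/
abbrev hMultilin (S : Finset ℕ) : Submodule K[X] (HRing (V := V) K d) := multilin K[X] coordHt S

theorem hMat_apply {p : DArr V × ℕ} {i j : Idx d} (h : i.1 = DArr.tgt p.1 ∧ j.1 = DArr.src p.1) :
    hMat K d p i j = MvPolynomial.X ⟨(p, i, j), h⟩ :=
  dif_pos h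

theorem hMat_eq_zero {p : DArr V × ℕ} {i j : Idx d}
    (h : ¬ (i.1 = DArr.tgt p.1 ∧ j.1 = DArr.src p.1)) : hMat K d p i j = 0 :=
  dif_neg h

theorem hMat_mem (p : DArr V × ℕ) (i j : Idx d) : hMat K d p i j ∈ hMultilin K V d {p.2} := by
  by_cases h : i.1 = DArr.tgt p.1 ∧ j.1 = DArr.src p.1
  · rw [hMat_apply h]
    exact X_mem_multilin coordHt (⟨(p, i, j), h⟩ : Coord (hSrc (V := V)) hTgt d)
  · rw [hMat_eq_zero h]
    exact zero_mem _

theorem hOrder_hMat (p : DArr V × ℕ) (i j : Idx d) :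
    hOrder K V d (hMat K d p i j) = opMat K d p.1 i j := by
  by_cases h : i.1 = DArr.tgt p.1 ∧ j.1 = DArr.src p.1
  · rw [hMat_apply h]
    exact heightOrder_X coordHt (coordOp K) (⟨(p, i, j), h⟩ : Coord (hSrc (V := V)) hTgt d)
  · rw [hMat_eq_zero h, map_zero, opMat_eq_zero h]

variable (K d) in
/-- The matrix of a word. -/
def wordMat (l : List (DArr V × ℕ)) : Matrix (Idx d) (Idx d) (HRing (V := V) K d) :=
  (l.map (hMat K d)).prod

theorem wordMat_nil : wordMat (V := V) K d [] = 1 := rfl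

theorem wordMat_cons (p : DArr V × ℕ) (l : List (DArr V × ℕ)) :
    wordMat K d (p :: l) = hMat K d p * wordMat K d l := by
  simp [wordMat]

theorem wordMat_append (l l' : List (DArr V × ℕ)) :
    wordMat K d (l ++ l') = wordMat K d l * wordMat K d l' := by
  simp [wordMat]

theorem wordMat_mem {l : List (DArr V × ℕ)} (hl : (l.map Prod.snd).Nodup) (i j : Idx d) :
    wordMat K d l i j ∈ hMultilin K V d (l.map Prod.snd).toFinset := by
  induction l generalizing i with
  | nil =>
    rw [wordMat_nil, Matrix.one_apply]
    split_ifs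
    · exact one_mem_multilin _
    · exact zero_mem _
  | cons p l ih =>
    rw [List.map_cons, List.nodup_cons] at hl
    rw [wordMat_cons, Matrix.mul_apply, List.map_cons, List.toFinset_cons, Finset.insert_eq]
    refine sum_mem fun k _ => mul_mem_multilin _ ?_ (hMat_mem p i k) (ih hl.2 k)
    rw [Finset.disjoint_singleton_left, List.mem_toFinset]
    exact hl.1

variable (K d) in
/-- The identity matrix of the block of a vertex. -/
def blockOne (k : V) : Matrix (Idx d) (Idx d) (HRing (V := V) K d) :=
  Matrix.diagonal fun i => if i.1 = k then 1 else 0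

theorem blockOne_mul_hMat (p : DArr V × ℕ) :
    blockOne K d (DArr.tgt p.1) * hMat K d p = hMat K d p := by
  ext1 i j
  rw [blockOne, Matrix.diagonal_mul]
  split_ifs with h
  · rw [one_mul]
  · rw [hMat_eq_zero (fun h' => h h'.1), mul_zero]

theorem hMat_mul_blockOne (p : DArr V × ℕ) :
    hMat K d p * blockOne K d (DArr.src p.1) = hMat K d p := by
  ext1 i j
  rw [blockOne, Matrix.mul_diagonal]
  split_ifs with h
  · rw [mul_one]
  · rw [hMat_eq_zero (fun h' => h h'.2), zero_mul]

theorem blockOne_mul_self (k : V) : blockOne K d k * blockOne K d k = blockOne (V := V) K d k := by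
  rw [blockOne, Matrix.diagonal_mul_diagonal]
  congr 1
  ext1 i
  split_ifs <;> simp

theorem blockOne_mul_wordMat {a b : V} {l : List (DArr V × ℕ)} (hl : IsPath a l b) :
    blockOne K d a * wordMat K d l = wordMat K d l * blockOne K d b := by
  induction l generalizing a with
  | nil => rw [show a = b from hl, wordMat_nil, mul_one, one_mul]
  | cons p l ih =>
    rw [wordMat_cons, ← mul_assoc, ← hl.1, blockOne_mul_hMat, mul_assoc, ← ih hl.2, ← mul_assoc,
      hMat_mul_blockOne]

theorem trace_blockOne (k : V) :
    Matrix.trace (blockOne (V := V) K d k) = (d k : HRing (V := V) K d) := by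
  rw [blockOne, Matrix.trace_diagonal, Fintype.sum_sigma, Finset.sum_eq_single k]
  · simp
  · intro b _ hb; simp [hb]
  · simp

variable (K d) in
/-- The trace of a cyclic word. -/
def cycTrace (c : Cycle (DArr V × ℕ)) : HRing (V := V) K d :=
  Quotient.lift (fun l => Matrix.trace (wordMat K d l)) (by
    rintro l l' ⟨n, rfl⟩
    rw [List.rotate_eq_drop_append_take_mod, wordMat_append, Matrix.trace_mul_comm,
      ← wordMat_append, List.take_append_drop]) c

theorem cycTrace_coe (l : List (DArr V × ℕ)) :
    cycTrace K d (l : Cycle (DArr V × ℕ)) = Matrix.trace (wordMat K d l) := rfl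

variable (K d) in
/-- The trace of a word, where the empty word is read as a vertex. -/
def wordTrace (k : V) : List (DArr V × ℕ) → HRing (V := V) K d
  | [] => (d k : HRing (V := V) K d)
  | p :: l => Matrix.trace (wordMat K d (p :: l))

/-- The matrix product of the empty word is the full identity, whereas the vertex must count only
its own block. Inserting the block identity covers empty and nonempty words at once. -/
theorem wordTrace_eq {k : V} {l : List (DArr V × ℕ)} (hl : IsPath k l k) :
    wordTrace K d k l = Matrix.trace (blockOne K d k * wordMat K d l) := by
  cases l with
  | nil => rw [wordTrace, wordMat_nil, mul_one, trace_blockOne]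
  | cons p l => rw [wordTrace, wordMat_cons, ← mul_assoc, ← hl.1, blockOne_mul_hMat]

variable (K d) in
/-- The commutative polynomial of a monomial. -/
def monoPoly (X : HeightMonomial V) : HRing (V := V) K d :=
  (((X.verts.map d).prod : ℕ) : HRing (V := V) K d) * (X.cycles.map (cycTrace K d)).prod

open HeightMonomial

theorem monoPoly_empty : monoPoly K d (HeightMonomial.empty : HeightMonomial V) = 1 := by
  simp [monoPoly, HeightMonomial.empty]

theorem monoPoly_mul (X Y : HeightMonomial V) :
    monoPoly K d (X.mul Y) = monoPoly K d X * monoPoly K d Y := by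
  simp only [monoPoly, HeightMonomial.mul, Multiset.map_add, Multiset.prod_add, Nat.cast_mul]
  ring

theorem monoPoly_addCycle (X : HeightMonomial V) (l : List (DArr V × ℕ)) :
    monoPoly K d (X.addCycle l) = monoPoly K d X * Matrix.trace (wordMat K d l) := by
  simp only [monoPoly, addCycle, Multiset.map_cons, Multiset.prod_cons, cycTrace_coe]
  ring

theorem monoPoly_addWord (X : HeightMonomial V) (k : V) (l : List (DArr V × ℕ)) :
    monoPoly K d (X.addWord k l) = monoPoly K d X * wordTrace K d k l := by
  cases l with
  | nil =>
    simp only [monoPoly, addWord, Multiset.map_cons, Multiset.prod_cons, wordTrace, Nat.cast_mul]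
    ring
  | cons p l => exact monoPoly_addCycle X (p :: l)

theorem natCast_mul_mem {S : Finset ℕ} {f : HRing (V := V) K d} (hf : f ∈ hMultilin K V d S)
    (n : ℕ) : (n : HRing (V := V) K d) * f ∈ hMultilin K V d S := by
  rw [← nsmul_eq_mul]
  exact nsmul_mem hf n

theorem monoPoly_mem {X : HeightMonomial V} (hX : X.heights.Nodup) :
    monoPoly K d X ∈ hMultilin K V d X.heights.toFinset := by
  obtain ⟨C, W⟩ := X
  refine natCast_mul_mem ?_ _
  rw [heights_mk] at hX ⊢
  induction C using Multiset.induction_on with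
  | empty => exact one_mem_multilin _
  | cons c C ih =>
    rw [Multiset.cons_bind] at hX ⊢
    rw [Multiset.nodup_add] at hX
    rw [Multiset.map_cons, Multiset.prod_cons, Multiset.toFinset_add]
    refine mul_mem_multilin _ ?_ ?_ (ih hX.2.1)
    · rw [Multiset.disjoint_toFinset]; exact hX.2.2
    · induction c using Quotient.inductionOn with
      | _ l => exact sum_mem fun i _ => wordMat_mem hX.1 i i

variable (K d) in
/-- The quantum trace of a monomial. -/
def quantTrace (X : HeightMonomial V) : DRep (V := V) K d := hOrder K V d (monoPoly K d X)

theorem quantTrace_empty : quantTrace K d (HeightMonomial.empty : HeightMonomial V) = 1 := by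
  rw [quantTrace, monoPoly_empty, heightOrder_one]

theorem quantTrace_mul {X Y : HeightMonomial V} (hX : X.Valid) (hY : Y.Valid)
    (h : ∀ m ∈ X.heights, ∀ n ∈ Y.heights, m < n) :
    quantTrace K d (X.mul Y) = quantTrace K d X * quantTrace K d Y := by
  rw [quantTrace, monoPoly_mul, heightOrder_mul _ _ ?_ (monoPoly_mem hX.2) (monoPoly_mem hY.2)]
  · rfl
  · intro m hm n hn
    exact h m (Multiset.mem_toFinset.1 hm) n (Multiset.mem_toFinset.1 hn)

/-- Relabelling of heights. -/
def relabelCoord (f : ℕ → ℕ) (c : Coord (hSrc (V := V)) hTgt d) : Coord (hSrc (V := V)) hTgt d :=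
  ⟨((c.1.1.1, f c.1.1.2), c.1.2.1, c.1.2.2), c.2⟩

theorem map_relabel_wordMat (f : ℕ → ℕ) (l : List (DArr V × ℕ)) :
    (wordMat K d l).map (MvPolynomial.rename (relabelCoord f)) =
      wordMat K d (l.map fun p => (p.1, f p.2)) := by
  have h : ∀ p : DArr V × ℕ, (hMat K d p).map (MvPolynomial.rename (R := K[X]) (relabelCoord f)) =
      hMat K d (p.1, f p.2) := by
    intro p
    ext1 i j
    rw [Matrix.map_apply]
    by_cases h : i.1 = DArr.tgt p.1 ∧ j.1 = DArr.src p.1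
    · rw [hMat_apply h, MvPolynomial.rename_X, hMat_apply (p := (p.1, f p.2)) h]
      rfl
    · rw [hMat_eq_zero h, map_zero, hMat_eq_zero (p := (p.1, f p.2)) h]
  induction l with
  | nil =>
    rw [wordMat_nil, List.map_nil, wordMat_nil]
    exact Matrix.map_one _ (map_zero _) (map_one _)
  | cons p l ih => rw [wordMat_cons, Matrix.map_mul, ih, h, List.map_cons, wordMat_cons]

theorem monoPoly_mapHeights (f : ℕ → ℕ) (X : HeightMonomial V) :
    monoPoly K d (X.mapHeights f) = MvPolynomial.rename (relabelCoord f) (monoPoly K d X) := by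
  rw [monoPoly, monoPoly, map_mul, map_natCast, map_multiset_prod, Multiset.map_map]
  congr 1
  rw [mapHeights, Multiset.map_map]
  congr 1
  refine Multiset.map_congr rfl fun c _ => ?_
  induction c using Quotient.inductionOn with
  | _ l =>
    change Matrix.trace (wordMat K d (l.map fun p => (p.1, f p.2))) =
      MvPolynomial.rename (relabelCoord f) (Matrix.trace (wordMat K d l))
    rw [← map_relabel_wordMat]
    exact (AddMonoidHom.map_trace (MvPolynomial.rename (R := K[X]) (relabelCoord f)) _).symm

/-- The operator of an entry ignores its height; only the order of the factors depends on heights,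
and a strictly monotone map keeps it. -/
theorem quantTrace_mapHeights {f : ℕ → ℕ} (hf : StrictMono f) {X : HeightMonomial V}
    (hX : X.Valid) : quantTrace K d (X.mapHeights f) = quantTrace K d X := by
  rw [quantTrace, monoPoly_mapHeights]
  refine heightOrder_map (ht' := coordHt) (op' := coordOp K) coordHt (coordOp K) f hf
    (MvPolynomial.rename (relabelCoord f)) (AlgHom.id K[X] _) (fun c => ?_) (fun c => ?_)
    (monoPoly_mem hX.2)
  · rw [MvPolynomial.rename_X]
    exact X_mem_multilin coordHt (relabelCoord f c)
  · rw [MvPolynomial.rename_X, heightOrder_X]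
    rfl

end QuantumTrace

/-! ### Skein relations for the quantum trace -/

section Skein

variable {K : Type u} [Field K] {V : Type v} [Quiver.{w} V] [Fintype V] [DecidableEq V]
  [∀ i j : V, Fintype (i ⟶ j)] {d : V → ℕ}

open HeightMonomial

theorem pairing_ne_zero {a b : DArr V} (h : pairing K a b ≠ 0) :
    DArr.src b = DArr.tgt a ∧ DArr.tgt b = DArr.src a := by
  rcases a with a | a <;> rcases b with b | b <;> simp only [pairing, ne_eq, not_true_eq_false,
    ite_eq_right_iff, Classical.not_imp] at h
  · rw [h.1]; exact ⟨rfl, rfl⟩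
  · rw [h.1]; exact ⟨rfl, rfl⟩

open Classical in
theorem hOrder_exchange {S : Finset ℕ} {m n : ℕ} (hmn : m < n) (hS : ∀ k ∈ S, k < m ∨ n < k)
    {f : HRing (V := V) K d} (hf : f ∈ hMultilin K V d S) (a b : DArr V) (x y : Idx d × Idx d) :
    hOrder K V d (f * (hMat K d (a, m) x.1 x.2 * hMat K d (b, n) y.1 y.2)) =
      hOrder K V d (f * (hMat K d (a, n) x.1 x.2 * hMat K d (b, m) y.1 y.2)) +
      (if (x.1.1 = DArr.tgt a ∧ x.2.1 = DArr.src a) ∧ y.1 = x.2 ∧ y.2 = x.1 then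
        Polynomial.X * Polynomial.C (pairing K a b) else 0 : K[X]) • hOrder K V d f := by
  have hd : Disjoint ({m} : Finset ℕ) {n} := by simpa using hmn.ne
  have hlt : ∀ k ∈ ({m} : Finset ℕ), ∀ l ∈ ({n} : Finset ℕ), k < l := by simpa using hmn
  have h1 : hMat K d (a, m) x.1 x.2 * hMat K d (b, n) y.1 y.2 ∈ hMultilin K V d {m, n} := by
    rw [Finset.insert_eq]
    exact mul_mem_multilin _ hd (hMat_mem (a, m) _ _) (hMat_mem (b, n) _ _)
  have h2 : hMat K d (b, m) y.1 y.2 * hMat K d (a, n) x.1 x.2 ∈ hMultilin K V d {m, n} := by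
    rw [Finset.insert_eq]
    exact mul_mem_multilin _ hd (hMat_mem (b, m) _ _) (hMat_mem (a, n) _ _)
  rw [mul_comm (hMat K d (a, n) _ _)]
  refine heightOrder_exchange coordHt (coordOp K) hmn hS hf h1 h2 _ ?_
  rw [heightOrder_mul coordHt (coordOp K) hlt (hMat_mem (a, m) _ _) (hMat_mem (b, n) _ _),
    heightOrder_mul coordHt (coordOp K) hlt (hMat_mem (b, m) _ _) (hMat_mem (a, n) _ _)]
  have h3 := opMat_commutator (K := K) a b x.1 x.2 y.1 y.2
  rw [sub_eq_iff_eq_add'] at h3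
  simp only [hOrder_hMat, h3]
  congr 1
  split_ifs
  · rfl
  · rw [map_zero]

open Classical in
theorem hOrder_exchange_sum {S : Finset ℕ} {m n : ℕ} (hmn : m < n) (hS : ∀ k ∈ S, k < m ∨ n < k)
    (F : Idx d × Idx d → Idx d × Idx d → HRing (V := V) K d)
    (hF : ∀ x y, F x y ∈ hMultilin K V d S) (a b : DArr V) :
    hOrder K V d (∑ x, ∑ y, F x y * (hMat K d (a, m) x.1 x.2 * hMat K d (b, n) y.1 y.2)) =
      hOrder K V d (∑ x, ∑ y, F x y * (hMat K d (a, n) x.1 x.2 * hMat K d (b, m) y.1 y.2)) +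
      (Polynomial.X * Polynomial.C (pairing K a b) : K[X]) • hOrder K V d (∑ x, ∑ y,
        if (x.1.1 = DArr.tgt a ∧ x.2.1 = DArr.src a) ∧ y.1 = x.2 ∧ y.2 = x.1 then F x y else 0) := by
  simp only [map_sum, hOrder_exchange hmn hS (hF _ _), Finset.sum_add_distrib, Finset.smul_sum]
  congr 1
  refine Finset.sum_congr rfl fun x _ => Finset.sum_congr rfl fun y _ => ?_
  split_ifs
  · rfl
  · rw [map_zero, smul_zero, zero_smul]

theorem trace_mul_eq_sum {A : Type*} [CommRing A] {n : Type*} [Fintype n] (M N : Matrix n n A) :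
    Matrix.trace (M * N) = ∑ x : n × n, M x.1 x.2 * N x.2 x.1 := by
  rw [Fintype.sum_prod_type]; rfl

/-- Isolates the entries of the two arrows to be exchanged; everything else becomes a coefficient
that does not involve them. -/
theorem trace_diff_eq_sum {A : Type*} [CommRing A] {n : Type*} [Fintype n] (p : A)
    (M R N S : Matrix n n A) : p * Matrix.trace (M * R) * Matrix.trace (N * S) =
      ∑ x : n × n, ∑ y : n × n, p * R x.2 x.1 * S y.2 y.1 * (M x.1 x.2 * N y.1 y.2) := by
  rw [trace_mul_eq_sum, trace_mul_eq_sum, mul_assoc, Finset.sum_mul_sum, Finset.mul_sum]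
  refine Finset.sum_congr rfl fun x _ => ?_
  rw [Finset.mul_sum]
  exact Finset.sum_congr rfl fun y _ => by ring

theorem trace_same_eq_sum {A : Type*} [CommRing A] {n : Type*} [Fintype n] (p : A)
    (M R N S : Matrix n n A) : p * Matrix.trace (M * (R * (N * S))) =
      ∑ x : n × n, ∑ y : n × n, p * R x.2 y.1 * S y.2 x.1 * (M x.1 x.2 * N y.1 y.2) := by
  rw [trace_mul_eq_sum, Finset.mul_sum]
  refine Finset.sum_congr rfl fun x _ => ?_
  rw [Matrix.mul_apply, Fintype.sum_prod_type, Finset.mul_sum, Finset.mul_sum]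
  refine Finset.sum_congr rfl fun k _ => ?_
  rw [Matrix.mul_apply, Finset.mul_sum, Finset.mul_sum, Finset.mul_sum]
  exact Finset.sum_congr rfl fun y _ => by ring

open Classical in
-- A nonzero commutator forces the two index pairs to be transposes of each other, which joins the
-- remaining words `R` and `S` of two cycles into one. The block conditions become block identities
-- between them.
theorem sum_diff_eq (p : HRing (V := V) K d) (R S : Matrix (Idx d) (Idx d) (HRing (V := V) K d))
    (a b : V) : (∑ x : Idx d × Idx d, ∑ y : Idx d × Idx d,
      if (x.1.1 = a ∧ x.2.1 = b) ∧ y.1 = x.2 ∧ y.2 = x.1 then p * R x.2 x.1 * S y.2 y.1 else 0) =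
    p * Matrix.trace (blockOne K d b * R * (blockOne K d a * S)) := by
  rw [Matrix.trace_mul_comm, trace_mul_eq_sum, Finset.mul_sum]
  refine Finset.sum_congr rfl fun x _ => ?_
  rw [Finset.sum_eq_single (x.2, x.1)]
  · rw [blockOne, blockOne, Matrix.diagonal_mul, Matrix.diagonal_mul]
    by_cases h1 : x.1.1 = a <;> by_cases h2 : x.2.1 = b <;> simp [h1, h2]
    ring
  · intro y _ hy
    rw [if_neg fun h => hy (Prod.ext h.2.1 h.2.2)]
  · simp

open Classical in
-- Here the same index condition closes up `R` and `S` separately, so one cycle is cut into two.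
theorem sum_same_eq (p : HRing (V := V) K d) (R S : Matrix (Idx d) (Idx d) (HRing (V := V) K d))
    (a b : V) : (∑ x : Idx d × Idx d, ∑ y : Idx d × Idx d,
      if (x.1.1 = a ∧ x.2.1 = b) ∧ y.1 = x.2 ∧ y.2 = x.1 then p * R x.2 y.1 * S y.2 x.1 else 0) =
    p * Matrix.trace (blockOne K d a * S) * Matrix.trace (blockOne K d b * R) := by
  have h : ∀ x : Idx d × Idx d, (∑ y : Idx d × Idx d,
      if (x.1.1 = a ∧ x.2.1 = b) ∧ y.1 = x.2 ∧ y.2 = x.1 then p * R x.2 y.1 * S y.2 x.1 else 0) =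
      p * ((blockOne K d a * S) x.1 x.1 * (blockOne K d b * R) x.2 x.2) := by
    intro x
    rw [Finset.sum_eq_single (x.2, x.1)]
    · rw [blockOne, blockOne, Matrix.diagonal_mul, Matrix.diagonal_mul]
      by_cases h1 : x.1.1 = a <;> by_cases h2 : x.2.1 = b <;> simp [h1, h2]
      ring
    · intro y _ hy
      rw [if_neg fun h => hy (Prod.ext h.2.1 h.2.2)]
    · simp
  rw [Finset.sum_congr rfl fun x _ => h x, ← Finset.mul_sum, Fintype.sum_prod_type, mul_assoc]
  congr 1
  simp only [Matrix.trace, Matrix.diag_apply]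
  rw [Finset.sum_mul_sum]

theorem mul_mul_mem {A B C : Multiset ℕ} (h : (A + (B + C)).Nodup) {f g k : HRing (V := V) K d}
    (hf : f ∈ hMultilin K V d C.toFinset) (hg : g ∈ hMultilin K V d B.toFinset)
    (hk : k ∈ hMultilin K V d A.toFinset) :
    f * g * k ∈ hMultilin K V d (A + (B + C)).toFinset := by
  rw [Multiset.nodup_add, Multiset.nodup_add] at h
  have e : (A + (B + C)).toFinset = C.toFinset ∪ B.toFinset ∪ A.toFinset := by
    rw [Multiset.toFinset_add, Multiset.toFinset_add, Finset.union_comm B.toFinset,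
      Finset.union_comm]
  rw [e]
  refine mul_mem_multilin _ ?_ (mul_mem_multilin _ ?_ hf hg) hk
  · have := h.2.2
    rw [Multiset.disjoint_add_right] at this
    rw [Finset.disjoint_union_left, Multiset.disjoint_toFinset, Multiset.disjoint_toFinset]
    exact ⟨this.2.symm, this.1.symm⟩
  · rw [Multiset.disjoint_toFinset]
    exact h.2.1.2.2.symm

theorem lt_or_gt_of_noneBetween {m n : ℕ} {A : Multiset ℕ} (h : (n ::ₘ m ::ₘ A).Nodup)
    (hA : ∀ k ∈ n ::ₘ m ::ₘ A, ¬ (m < k ∧ k < n)) : ∀ k ∈ A.toFinset, k < m ∨ n < k := by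
  intro k hk
  rw [Multiset.mem_toFinset] at hk
  rw [Multiset.nodup_cons, Multiset.nodup_cons] at h
  have h1 := hA k (Multiset.mem_cons_of_mem (Multiset.mem_cons_of_mem hk))
  have h2 : k ≠ m := by rintro rfl; exact h.2.1 hk
  have h3 : k ≠ n := by rintro rfl; exact h.1 (Multiset.mem_cons_of_mem hk)
  omega

theorem quantTrace_skein_diff (X : HeightMonomial V) (a b : DArr V) {m n : ℕ}
    (r s : List (DArr V × ℕ)) (hmn : m < n)
    (hX : ((X.addCycle ((a, m) :: r)).addCycle ((b, n) :: s)).Valid)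
    (hN : ((X.addCycle ((a, m) :: r)).addCycle ((b, n) :: s)).NoneBetween m n) :
    quantTrace K d ((X.addCycle ((a, m) :: r)).addCycle ((b, n) :: s)) =
      quantTrace K d ((X.addCycle ((a, n) :: r)).addCycle ((b, m) :: s)) +
        (Polynomial.X * Polynomial.C (pairing K a b) : K[X]) •
          quantTrace K d (X.addWord (DArr.src a) (r ++ s)) := by
  have hn := hX.2
  rw [NoneBetween, heights_diff] at hN
  rw [heights_diff] at hn
  have hS := lt_or_gt_of_noneBetween hn hN
  rw [Multiset.nodup_cons, Multiset.nodup_cons] at hn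
  have hn' := hn.2.2
  rw [Multiset.nodup_add, Multiset.nodup_add] at hn'
  simp only [quantTrace, monoPoly_addCycle, monoPoly_addWord, wordMat_cons, trace_diff_eq_sum]
  rw [hOrder_exchange_sum hmn hS _ (fun x y => mul_mul_mem hn.2.2 (monoPoly_mem hn'.2.1.2.1)
    (wordMat_mem hn'.2.1.1 _ _) (wordMat_mem hn'.1 _ _))]
  congr 1
  -- With zero pairing the joined word need not be a path, but its coefficient vanishes. Otherwise
  -- `b` is the reverse of `a` and the endpoints fit.
  by_cases hp : pairing K a b = 0
  · rw [hp]; simp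
  obtain ⟨h1, h2⟩ := pairing_ne_zero hp
  have hs := (valid_addCycle_cons.1 hX).1
  have hr := (chain_iff_isPath (a, m) r).1
    (hX.1 _ (Multiset.mem_cons_of_mem (Multiset.mem_cons_self _ _))).2
  dsimp only at hs hr
  rw [h1, h2] at hs
  rw [sum_diff_eq, wordTrace_eq (isPath_append.2 ⟨_, hr, hs⟩), wordMat_append,
    blockOne_mul_wordMat hr, mul_assoc, ← mul_assoc (blockOne K d _), blockOne_mul_self,
    ← mul_assoc, ← blockOne_mul_wordMat hr, mul_assoc]

theorem quantTrace_skein_same (X : HeightMonomial V) (a b : DArr V) {m n : ℕ}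
    (r s : List (DArr V × ℕ)) (hmn : m < n)
    (hX : (X.addCycle ((a, m) :: r ++ (b, n) :: s)).Valid)
    (hN : (X.addCycle ((a, m) :: r ++ (b, n) :: s)).NoneBetween m n) :
    quantTrace K d (X.addCycle ((a, m) :: r ++ (b, n) :: s)) =
      quantTrace K d (X.addCycle ((a, n) :: r ++ (b, m) :: s)) +
        (Polynomial.X * Polynomial.C (pairing K a b) : K[X]) •
          quantTrace K d ((X.addWord (DArr.src b) s).addWord (DArr.src a) r) := by
  have hn := hX.2
  rw [NoneBetween, heights_same] at hN
  rw [heights_same] at hn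
  have hS := lt_or_gt_of_noneBetween hn hN
  rw [Multiset.nodup_cons, Multiset.nodup_cons] at hn
  have hn' := hn.2.2
  rw [Multiset.nodup_add, Multiset.nodup_add] at hn'
  simp only [quantTrace, monoPoly_addCycle, monoPoly_addWord, wordMat_cons, List.cons_append,
    wordMat_append, trace_same_eq_sum]
  rw [hOrder_exchange_sum hmn hS _ (fun x y => mul_mul_mem hn.2.2 (monoPoly_mem hn'.2.1.2.1)
    (wordMat_mem hn'.2.1.1 _ _) (wordMat_mem hn'.1 _ _))]
  congr 1
  by_cases hp : pairing K a b = 0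
  · rw [hp]; simp
  obtain ⟨h1, h2⟩ := pairing_ne_zero hp
  have hrs := (valid_addCycle_cons.1 hX).1
  obtain ⟨c, hr, hs⟩ := isPath_append.1 hrs
  obtain ⟨rfl, hs⟩ := hs
  dsimp only at hs hr
  rw [h2] at hr
  rw [h1] at hs
  rw [sum_same_eq, h1, wordTrace_eq hr, wordTrace_eq hs]

/-- The joined monomial is claimed to be admissible only for nonzero pairing, which is all that is
needed since the pairing is its coefficient. -/
theorem valid_skein_diff {X : HeightMonomial V} {a b : DArr V} {m n : ℕ}
    {r s : List (DArr V × ℕ)}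
    (hX : ((X.addCycle ((a, m) :: r)).addCycle ((b, n) :: s)).Valid) :
    ((X.addCycle ((a, n) :: r)).addCycle ((b, m) :: s)).Valid ∧
      (pairing K a b ≠ 0 → (X.addWord (DArr.src a) (r ++ s)).Valid) := by
  have hn := hX.2
  rw [heights_diff] at hn
  have hs := (valid_addCycle_cons.1 hX).1
  have hC := (valid_addCycle_cons.1 hX).2.1
  have hr := (chain_iff_isPath (a, m) r).1 (hC _ (Multiset.mem_cons_self _ _)).2
  refine ⟨valid_addCycle_cons.2 ⟨hs, ?_, ?_⟩, fun hp => ?_⟩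
  · intro c hc
    rcases Multiset.mem_cons.1 hc with rfl | hc
    · refine ⟨fun h => ?_, (chain_iff_isPath (a, n) r).2 hr⟩
      rw [← Cycle.coe_nil, Cycle.coe_eq_coe] at h
      simpa using h.perm.length_eq
    · exact hC c (Multiset.mem_cons_of_mem hc)
  · rw [← heights_addCycle, heights_diff, Multiset.cons_swap]
    exact hn
  · obtain ⟨h1, h2⟩ := pairing_ne_zero hp
    dsimp only at hs hr
    rw [h1, h2] at hs
    refine valid_addWord (isPath_append.2 ⟨_, hr, hs⟩)
      (fun c hc => hC c (Multiset.mem_cons_of_mem hc)) ?_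
    rw [Multiset.nodup_cons, Multiset.nodup_cons] at hn
    rw [List.map_append, ← Multiset.coe_add, add_comm (Multiset.ofList _), add_assoc]
    exact hn.2.2

theorem valid_skein_same {X : HeightMonomial V} {a b : DArr V} {m n : ℕ}
    {r s : List (DArr V × ℕ)} (hX : (X.addCycle ((a, m) :: r ++ (b, n) :: s)).Valid) :
    (X.addCycle ((a, n) :: r ++ (b, m) :: s)).Valid ∧ (pairing K a b ≠ 0 →
      ((X.addWord (DArr.src b) s).addWord (DArr.src a) r).Valid) := by
  have hn := hX.2
  rw [heights_same] at hn
  have hrs := (valid_addCycle_cons.1 hX).1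
  have hC := (valid_addCycle_cons.1 hX).2.1
  obtain ⟨c, hr, hs⟩ := isPath_append.1 hrs
  obtain ⟨rfl, hs⟩ := hs
  refine ⟨valid_addCycle_cons.2 ⟨isPath_append.2 ⟨_, hr, rfl, hs⟩, hC, ?_⟩, fun hp => ?_⟩
  · have h := heights_same X (a, n) (b, m) r s
    rw [heights_addCycle] at h
    refine (congrArg Multiset.Nodup h).mpr ?_
    rw [Multiset.cons_swap]
    exact hn
  · obtain ⟨h1, h2⟩ := pairing_ne_zero hp
    dsimp only at hs hr
    rw [h2] at hr
    rw [Multiset.nodup_cons, Multiset.nodup_cons] at hn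
    have hn' := hn.2.2
    have h3 : (X.addWord (DArr.src b) s).Valid := by
      refine valid_addWord (by rw [h1] at hs ⊢; exact hs) hC ?_
      rw [add_left_comm, Multiset.nodup_add] at hn'
      exact hn'.2.1
    refine valid_addWord hr h3.1 ?_
    rw [heights_addWord, add_left_comm]
    exact hn'

end Skein

/-! ### The quantum trace as a homomorphism to invariants -/

section TraceHom

variable {K : Type u} [Field K] {V : Type v} [Quiver.{w} V] [Fintype V] [DecidableEq V]
  [∀ i j : V, Fintype (i ⟶ j)] {d : V → ℕ}

open HeightMonomial

theorem algebraMap_mul_eq_smul (r : K) (f : HRing (V := V) K d) :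
    algebraMap K (HRing (V := V) K d) r * f = (Polynomial.C r : K[X]) • f := by
  rw [MvPolynomial.smul_eq_C_mul]; rfl

theorem map_glAct_wordMat (g : GLd K d) (l : List (DArr V × ℕ)) :
    (wordMat K d l).map (glAct K[X] hSrc hTgt g) =
      scalarMat (glMat g⁻¹) * wordMat K d l * scalarMat (glMat g) := by
  have h1 : (scalarMat (glMat g) : Matrix (Idx d) (Idx d) (HRing (V := V) K d)) *
      scalarMat (glMat g⁻¹) = 1 := by
    rw [← scalarMat_mul, ← glMat_mul, mul_inv_cancel, glMat_one, scalarMat_one]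
  induction l with
  | nil =>
    rw [wordMat_nil, mul_one, ← scalarMat_mul, ← glMat_mul, inv_mul_cancel, glMat_one,
      scalarMat_one]
    exact Matrix.map_one _ (map_zero _) (map_one _)
  | cons p l ih =>
    rw [wordMat_cons, Matrix.map_mul, map_glAct_coordMat, ih, conjMat]
    calc _ = scalarMat (glMat g⁻¹) * hMat K d p *
          (scalarMat (glMat g) * scalarMat (glMat g⁻¹)) * wordMat K d l *
            scalarMat (glMat g) := by simp only [mul_assoc]
      _ = _ := by rw [h1]; simp only [mul_assoc, one_mul]

theorem glAct_monoPoly (g : GLd K d) (X : HeightMonomial V) :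
    glAct K[X] hSrc hTgt g (monoPoly K d X) = monoPoly K d X := by
  rw [monoPoly, map_mul, map_natCast, map_multiset_prod, Multiset.map_map]
  congr 2
  refine Multiset.map_congr rfl fun c _ => ?_
  induction c using Quotient.inductionOn with
  | _ l =>
    change glAct K[X] hSrc hTgt g (Matrix.trace (wordMat K d l)) = Matrix.trace (wordMat K d l)
    have h : glAct K[X] hSrc hTgt g (Matrix.trace (wordMat K d l)) =
        Matrix.trace ((wordMat K d l).map (glAct K[X] hSrc hTgt g)) :=
      AddMonoidHom.map_trace (glAct K[X] hSrc hTgt g) _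
    rw [h, map_glAct_wordMat, Matrix.trace_mul_comm, ← mul_assoc, ← scalarMat_mul, ← glMat_mul,
      mul_inv_cancel, glMat_one, scalarMat_one, one_mul]

/-- The group mixes matrix indices but leaves heights alone, so ordering is equivariant. Invariance
of the quantum trace reduces to that of commutative traces. -/
theorem hOrder_glAct (g : GLd K d) {S : Finset ℕ} {f : HRing (V := V) K d}
    (hf : f ∈ hMultilin K V d S) : hOrder K V d (glAct K[X] hSrc hTgt g f) =
      DiffOp.conj (repActEquiv Arr.src Arr.tgt g) (hOrder K V d f) := by
  have hc : ∀ c : Coord (hSrc (V := V)) hTgt d, conjMat K[X] hSrc hTgt g c.1.1 c.1.2.1 c.1.2.2 =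
      ∑ l, ∑ k, (Polynomial.C (glMat g l c.1.2.2 * glMat g⁻¹ c.1.2.1 k) : K[X]) •
        hMat K d c.1.1 k l := by
    intro c
    simp only [conjMat, Matrix.mul_apply, Finset.sum_mul, Matrix.map_apply]
    refine Finset.sum_congr rfl fun l _ => Finset.sum_congr rfl fun k _ => ?_
    rw [mul_right_comm, ← map_mul, algebraMap_mul_eq_smul, mul_comm (glMat g l _)]
  refine heightOrder_map (ht' := coordHt) (op' := coordOp K) coordHt (coordOp K) id strictMono_id
    (glAct K[X] hSrc hTgt g) (DiffOp.conj (repActEquiv Arr.src Arr.tgt g)) (fun c => ?_)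
    (fun c => ?_) hf
  · rw [glAct_X, hc]
    exact sum_mem fun l _ => sum_mem fun k _ => Submodule.smul_mem _ _ (hMat_mem _ _ _)
  · rw [glAct_X, hc]
    have h := congrFun (congrFun (map_conj_opMat g c.1.1.1) c.1.2.1) c.1.2.2
    rw [Matrix.map_apply] at h
    refine Eq.trans ?_ h.symm
    simp only [map_sum, map_smul, Matrix.mul_apply, Finset.sum_mul, Matrix.map_apply]
    refine Finset.sum_congr rfl fun l _ => Finset.sum_congr rfl fun k _ => ?_
    have h2 := hOrder_hMat (K := K) (d := d) c.1.1 k l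
    rw [hOrder] at h2
    rw [h2, mul_assoc, scalHom_comm (glMat g⁻¹ _ _), ← scalHom_comm (glMat g l _), mul_assoc,
      ← scalHom_comm, ← mul_assoc, ← map_mul, Algebra.smul_def]
    rfl

theorem quantTrace_mem_DInv {X : HeightMonomial V} (hX : X.Valid) : quantTrace K d X ∈ DInv K d := by
  rw [mem_DInv]
  intro g
  rw [quantTrace, ← hOrder_glAct g (monoPoly_mem hX.2), glAct_monoPoly]

variable (K d) in
/-- The quantum trace on the free algebra on all monomials. -/
def freeTrace : FreeAlgebra K[X] {X : HeightMonomial V // X.Valid} →ₐ[K[X]] DInv (V := V) K d :=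
  FreeAlgebra.lift K[X] fun X => ⟨quantTrace K d X.1, quantTrace_mem_DInv X.2⟩

theorem freeTrace_preSym {X : HeightMonomial V} (hX : X.Valid) :
    (freeTrace K d (preSym K X) : DRep K d) = quantTrace K d X := by
  rw [preSym, dif_pos hX, freeTrace, FreeAlgebra.lift_ι_apply]

theorem valid_empty : (HeightMonomial.empty : HeightMonomial V).Valid :=
  ⟨fun _ h => absurd h (Multiset.notMem_zero _), Multiset.nodup_zero⟩

theorem freeTrace_rel {x y : FreeAlgebra K[X] {X : HeightMonomial V // X.Valid}}
    (h : NecklaceRel K x y) : freeTrace K d x = freeTrace K d y := by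
  ext1
  -- On an inadmissible monomial `preSym` is zero by convention while `quantTrace` need not be;
  -- there the coefficient `c` vanishes.
  have hp : ∀ (c : K) (X : HeightMonomial V), (c ≠ 0 → X.Valid) →
      ((freeTrace K d ((Polynomial.X * Polynomial.C c : K[X]) • preSym K X) : DInv K d) :
        DRep K d) = (Polynomial.X * Polynomial.C c : K[X]) • quantTrace K d X := by
    intro c X hX
    by_cases hc : c = 0
    · simp [hc]
    · rw [map_smul, Subalgebra.coe_smul, freeTrace_preSym (hX hc)]
  cases h with
  | one => rw [freeTrace_preSym valid_empty, map_one, quantTrace_empty]; rfl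
  | mul X Y hX hY h =>
    rw [map_mul, freeTrace_preSym (valid_mul hX hY h), quantTrace_mul hX hY h, MulMemClass.coe_mul,
      freeTrace_preSym hX, freeTrace_preSym hY]
  | relabel X f hX hf =>
    rw [freeTrace_preSym hX, freeTrace_preSym (valid_mapHeights hf.injective hX),
      quantTrace_mapHeights hf hX]
  | skein_diff X a b m n r s hmn hX hN =>
    obtain ⟨h1, h2⟩ := valid_skein_diff (K := K) hX
    rw [map_add, AddMemClass.coe_add, hp _ _ h2, freeTrace_preSym hX, freeTrace_preSym h1,
      quantTrace_skein_diff X a b r s hmn hX hN]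
  | skein_same X a b m n r s hmn hX hN =>
    obtain ⟨h1, h2⟩ := valid_skein_same (K := K) hX
    rw [map_add, AddMemClass.coe_add, hp _ _ h2, freeTrace_preSym hX, freeTrace_preSym h1,
      quantTrace_skein_same X a b r s hmn hX hN]

variable (K V d) in
/-- The quantum trace. -/
def necklaceTrace : Necklace V K →ₐ[K[X]] DInv (V := V) K d :=
  RingQuot.liftAlgHom K[X] ⟨freeTrace K d, fun _ _ => freeTrace_rel⟩

theorem necklaceTrace_sym {X : HeightMonomial V} (hX : X.Valid) :
    (necklaceTrace K V d (sym K X) : DRep K d) = quantTrace K d X :=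
  (congrArg Subtype.val (RingQuot.liftAlgHom_mkAlgHom_apply K[X] _ _ _)).trans (freeTrace_preSym hX)

theorem sym_eq_zero {X : HeightMonomial V} (hX : ¬ X.Valid) : sym K X = 0 := by
  rw [sym, preSym, dif_neg hX]
  exact map_zero _

/-! #### Symbols of quantum traces -/

variable (K V d) in
/-- Forgetting the heights and `ħ`. -/
def forgetHeights : HRing (V := V) K d →+* FunCot (V := V) K d :=
  MvPolynomial.eval₂Hom (MvPolynomial.C.comp (Polynomial.evalRingHom 0))
    fun c => genMat K DArr.src DArr.tgt d c.1.1.1 c.1.2.1 c.1.2.2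

/-- Symbols commute, so the symbol of an ordered product forgets the order and with it the heights.
-/
theorem symbol_hOrder {S : Finset ℕ} {f : HRing (V := V) K d} (hf : f ∈ hMultilin K V d S) :
    symbol K d (hOrder K V d f) = forgetHeights K V d f := by
  refine map_heightOrder coordHt (coordOp K) (symbol K d) (forgetHeights K V d) (fun r => ?_)
    (fun c => ?_) hf
  · rw [forgetHeights, MvPolynomial.eval₂Hom_C, symbol_algebraMap]
    rfl
  · rw [forgetHeights, MvPolynomial.eval₂Hom_X', coordOp, symbol_opMat]

theorem map_forgetHeights_wordMat (l : List (DArr V × ℕ)) :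
    (wordMat K d l).map (forgetHeights K V d) =
      (l.map fun p => genMat K DArr.src DArr.tgt d p.1).prod := by
  induction l with
  | nil => exact Matrix.map_one _ (map_zero _) (map_one _)
  | cons p l ih =>
    rw [wordMat_cons, Matrix.map_mul, ih, List.map_cons, List.prod_cons]
    congr 1
    ext1 i j
    rw [Matrix.map_apply]
    by_cases h : i.1 = DArr.tgt p.1 ∧ j.1 = DArr.src p.1
    · rw [hMat_apply h, forgetHeights, MvPolynomial.eval₂Hom_X']
    · rw [hMat_eq_zero h, map_zero]
      simp [genMat, h]

theorem symbol_quantTrace_cycle {l : List (DArr V × ℕ)}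
    (hl : (HeightMonomial.empty.addCycle l).Valid) :
    symbol K d (quantTrace K d (HeightMonomial.empty.addCycle l)) =
      Matrix.trace (univRep K d (l.map fun p => arrowElt K p.1).prod) := by
  rw [quantTrace, symbol_hOrder (monoPoly_mem hl.2), monoPoly_addCycle, monoPoly_empty, one_mul,
    map_list_prod, List.map_map]
  have h : forgetHeights K V d (Matrix.trace (wordMat K d l)) =
      Matrix.trace ((wordMat K d l).map (forgetHeights K V d)) :=
    AddMonoidHom.map_trace (forgetHeights K V d) _
  rw [h, map_forgetHeights_wordMat]
  congr 2
  exact List.map_congr_left fun p _ => (univRep_arrow K d p.1).symm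

theorem symbol_quantTrace_vertex (i : V) :
    symbol K d (quantTrace K d ⟨0, {i}⟩) = Matrix.trace (univRep K d (vertexElt K i)) := by
  have h : monoPoly K d (⟨0, {i}⟩ : HeightMonomial V) = (d i : HRing (V := V) K d) := by
    simp [monoPoly]
  have h2 : hOrder K V d ((d i : HRing (V := V) K d)) = (d i : DRep (V := V) K d) := by
    rw [← nsmul_one, map_nsmul, heightOrder_one, nsmul_one]
  rw [quantTrace, h, h2, map_natCast, univRep_vertex, Matrix.trace_diagonal, Fintype.sum_sigma,
    Finset.sum_eq_single i]
  · simp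
  · intro b _ hb; simp [hb]
  · simp

end TraceHom

/-! ### Compatibility of the quantum trace with reduction -/

section ReducedTrace

variable {K : Type u} [Field K] {V : Type v} [Quiver.{w} V] [Fintype V] [DecidableEq V]
  [∀ i j : V, Fintype (i ⟶ j)] {d : V → ℕ}

open HeightMonomial

theorem tgt_swap (x : DArr V) : DArr.tgt x.swap = DArr.src x := by cases x <;> rfl

theorem src_swap (x : DArr V) : DArr.src x.swap = DArr.tgt x := by cases x <;> rfl

theorem map_snd_zipIdx_nodup (l : List (DArr V)) : (l.zipIdx.map Prod.snd).Nodup := by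
  rw [List.zipIdx_map_snd]
  exact List.nodup_range'

theorem addCycle_append_comm (X : HeightMonomial V) (l l' : List (DArr V × ℕ)) :
    X.addCycle (l ++ l') = X.addCycle (l' ++ l) := by
  rw [addCycle, addCycle, (Cycle.coe_eq_coe.2 List.isRotated_append : ((l ++ l' :
    List (DArr V × ℕ)) : Cycle (DArr V × ℕ)) = (l' ++ l : List (DArr V × ℕ)))]

theorem zipIdx_append_pair (l : List (DArr V)) (x y : DArr V) :
    (l ++ [x, y]).zipIdx = l.zipIdx ++ [(x, l.length), (y, l.length + 1)] := by
  rw [List.zipIdx_append]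
  simp

theorem valid_append_swap (l : List (DArr V)) (x : DArr V) :
    (HeightMonomial.empty.addCycle (l ++ [x, x.swap]).zipIdx).Valid ↔
      IsPath (DArr.tgt x) l.zipIdx (DArr.tgt x) := by
  have h := map_snd_zipIdx_nodup (l ++ [x, x.swap])
  rw [zipIdx_append_pair] at h ⊢
  rw [addCycle_append_comm, List.cons_append, valid_addCycle_cons, List.cons_append, IsPath,
    heights_empty, add_zero, List.nil_append]
  dsimp only
  rw [tgt_swap, src_swap]
  have h2 : ((((x, l.length) :: (x.swap, l.length + 1) :: l.zipIdx).map Prod.snd : List ℕ) :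
      Multiset ℕ).Nodup := by
    rw [Multiset.coe_nodup]
    have : (((x, l.length) :: (x.swap, l.length + 1) :: l.zipIdx).map Prod.snd).Perm
        ((l.zipIdx ++ [(x, l.length), (x.swap, l.length + 1)]).map Prod.snd) :=
      (List.perm_append_comm (l₁ := [(x, l.length), (x.swap, l.length + 1)])).map _
    exact this.nodup_iff.2 h
  exact ⟨fun h => h.1.2, fun h => ⟨⟨rfl, h⟩, fun c hc => absurd hc (Multiset.notMem_zero _), h2⟩⟩

/-- The last two letters carry the greatest heights, so their operators stand on the far right. This
is the position in which a left ideal absorbs them. -/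
theorem necklaceTrace_append_swap (l : List (DArr V)) (x : DArr V)
    (hl : IsPath (DArr.tgt x) l.zipIdx (DArr.tgt x)) :
    (necklaceTrace K V d (wordLift K (l ++ [x, x.swap])) : DRep K d) =
      ∑ i, ∑ j, hOrder K V d (wordMat K d l.zipIdx i j) *
        (opMat K d x * opMat K d x.swap) j i := by
  rw [wordLift, necklaceTrace_sym ((valid_append_swap l x).2 hl), quantTrace, monoPoly_addCycle,
    monoPoly_empty, one_mul, zipIdx_append_pair, wordMat_append, wordMat_cons, wordMat_cons,
    wordMat_nil, mul_one, Matrix.trace, map_sum]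
  refine Finset.sum_congr rfl fun i _ => ?_
  rw [Matrix.diag_apply, Matrix.mul_apply, map_sum]
  refine Finset.sum_congr rfl fun j _ => ?_
  rw [Matrix.mul_apply, Matrix.mul_apply, Finset.mul_sum, Finset.mul_sum, map_sum]
  refine Finset.sum_congr rfl fun k _ => ?_
  have hlt : ∀ m ∈ ({l.length} : Finset ℕ), ∀ n ∈ ({l.length + 1} : Finset ℕ), m < n := by simp
  have hlt' : ∀ m ∈ (l.zipIdx.map Prod.snd).toFinset,
      ∀ n ∈ ({l.length} ∪ {l.length + 1} : Finset ℕ), m < n := by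
    intro m hm n hn
    rw [List.zipIdx_map_snd, List.mem_toFinset, List.mem_range'_1] at hm
    simp only [Finset.mem_union, Finset.mem_singleton] at hn
    omega
  rw [heightOrder_mul _ _ hlt' (wordMat_mem (map_snd_zipIdx_nodup l) i j)
    (mul_mem_multilin _ (by simp) (hMat_mem (x, l.length) j k)
      (hMat_mem (x.swap, l.length + 1) k i)),
    heightOrder_mul _ _ hlt (hMat_mem (x, l.length) j k) (hMat_mem (x.swap, l.length + 1) k i),
    ← hOrder, hOrder_hMat, hOrder_hMat]

theorem opMat_mul_apply_eq_zero {x y : DArr V} {i j : Idx d} (h : i.1 ≠ DArr.tgt x) :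
    (opMat K d x * opMat K d y) i j = 0 := by
  rw [Matrix.mul_apply]
  exact Finset.sum_eq_zero fun k _ => by rw [opMat_eq_zero (fun h' => h h'.1), zero_mul]

/-- The words ending in $aa^*$ and $a^*a$ with all arrows at `k` add up to the rows of the quantum
moment map in block `k`; arrows that do not meet `k` contribute nothing to those rows. -/
theorem necklaceTrace_momentLift (k : V) (l : List (DArr V)) (hl : IsPath k l.zipIdx k) :
    (necklaceTrace K V d (momentLift K k l) : DRep K d) =
      ∑ i, ∑ j, hOrder K V d (wordMat K d l.zipIdx i j) *
        if j.1 = k then momentOp K d j i else 0 := by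
  have key : ∀ x : Arr V → DArr V, (necklaceTrace K V d
      (∑ a : Arr V with DArr.tgt (x a) = k, wordLift K (l ++ [x a, (x a).swap])) : DRep K d) =
      ∑ i, ∑ j, hOrder K V d (wordMat K d l.zipIdx i j) *
        if j.1 = k then ∑ a : Arr V, (opMat K d (x a) * opMat K d (x a).swap) j i else 0 := by
    intro x
    rw [map_sum, AddSubmonoidClass.coe_finsetSum]
    have h1 : ∀ a ∈ Finset.univ.filter (fun a => DArr.tgt (x a) = k),
        (necklaceTrace K V d (wordLift K (l ++ [x a, (x a).swap])) : DRep K d) =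
        ∑ i, ∑ j, hOrder K V d (wordMat K d l.zipIdx i j) *
          (opMat K d (x a) * opMat K d (x a).swap) j i := by
      intro a ha
      refine necklaceTrace_append_swap l (x a) ?_
      rw [(Finset.mem_filter.1 ha).2]
      exact hl
    rw [Finset.sum_congr rfl h1, Finset.sum_comm]
    refine Finset.sum_congr rfl fun i _ => ?_
    rw [Finset.sum_comm]
    refine Finset.sum_congr rfl fun j _ => ?_
    rw [Finset.sum_filter]
    split_ifs with hj
    · rw [Finset.mul_sum]
      refine Finset.sum_congr rfl fun a _ => ?_
      split_ifs with ha
      · rfl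
      · rw [opMat_mul_apply_eq_zero (fun h => ha (h.symm.trans hj)), mul_zero]
    · rw [mul_zero]
      refine Finset.sum_eq_zero fun a _ => ?_
      split_ifs with ha
      · rw [opMat_mul_apply_eq_zero (fun h => hj (h.trans ha)), mul_zero]
      · rfl
  rw [momentLift, map_sub, AddSubgroupClass.coe_sub]
  have h1 := key Sum.inl
  have h2 := key Sum.inr
  simp only [Sum.swap_inl, Sum.swap_inr] at h1 h2
  refine (congrArg₂ (· - ·) h1 h2).trans ?_
  simp only [← Finset.sum_sub_distrib, ← mul_sub]
  refine Finset.sum_congr rfl fun i _ => Finset.sum_congr rfl fun j _ => ?_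
  split_ifs
  · rw [momentOp_apply, Finset.sum_sub_distrib]
  · rw [sub_zero]

/-- The defining relations run over all lists, also those that are not closed paths at `k`; for
these every word is inadmissible and the relation is trivial. -/
theorem momentLift_eq_zero (k : V) (l : List (DArr V)) (hl : ¬ IsPath k l.zipIdx k) :
    momentLift K k l = 0 := by
  have key : ∀ x : DArr V, DArr.tgt x = k → wordLift K (l ++ [x, x.swap]) = 0 := by
    rintro x rfl
    exact sym_eq_zero fun h => hl ((valid_append_swap l x).1 h)
  rw [momentLift, Finset.sum_eq_zero, Finset.sum_eq_zero, sub_zero]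
  · intro a ha
    exact key (Sum.inr a) (Finset.mem_filter.1 ha).2
  · intro a ha
    exact key (Sum.inl a) (Finset.mem_filter.1 ha).2

theorem necklaceTrace_momentLift_mem (k : V) (l : List (DArr V)) :
    (necklaceTrace K V d (momentLift K k l) : DRep K d) ∈ momentLeftIdeal K d := by
  by_cases hl : IsPath k l.zipIdx k
  · rw [necklaceTrace_momentLift k l hl]
    refine sum_mem fun i _ => sum_mem fun j _ => Ideal.mul_mem_left _ _ ?_
    split_ifs
    · exact momentOp_mem j i
    · exact zero_mem _
  · rw [momentLift_eq_zero k l hl, map_zero]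
    exact zero_mem _

variable (K V d) in
/-- The quantum trace after reduction. -/
def reducedTrace [CharZero K] : QReduction V K →ₐ[K[X]] HamReduction (V := V) K d :=
  RingQuot.liftAlgHom K[X] ⟨(HamReduction.mk K d).comp (necklaceTrace K V d), by
    rintro _ _ ⟨⟨k, l, rfl⟩, rfl⟩
    rw [map_zero, AlgHom.comp_apply, hamMk_eq_zero]
    exact necklaceTrace_momentLift_mem k l⟩

theorem reducedTrace_mk [CharZero K] (X : Necklace V K) :
    reducedTrace K V d (QReduction.mk V K X) = HamReduction.mk K d (necklaceTrace K V d X) :=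
  RingQuot.liftAlgHom_mkAlgHom_apply K[X] _ _ _

theorem classicalTrace_toCyc (z : DoublePathAlg K V) :
    (classicalTrace K d (toCyc K V z) : FunFibre (V := V) K d) =
      toFibre K d (Matrix.trace (univRep K d z)) := by
  have h : fibreTrace K d (toCyc K V z) = toFibre K d (Matrix.trace (univRep K d z)) := by
    simp only [fibreTrace, toCyc, Submodule.mkQ_apply, Submodule.liftQ_apply,
      LinearMap.comp_apply, AlgHom.toLinearMap_apply, univRepPreproj_mk]
    exact (AddMonoidHom.map_trace (toFibre K d) _).symm
  exact h

theorem hamZeroEquiv_reducedTrace_sym [CharZero K] {X : HeightMonomial V} (hX : X.Valid)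
    {z : DoublePathAlg K V}
    (h : symbol K d (quantTrace K d X) = Matrix.trace (univRep K d z)) :
    hamZeroEquiv K V d (HamReductionZero.mk K d (reducedTrace K V d
      (QReduction.mk V K (sym K X)))) = classicalTrace K d (toCyc K V z) := by
  rw [reducedTrace_mk, hamZeroEquiv_mk]
  ext1
  rw [invSymbol_apply, necklaceTrace_sym hX, classicalTrace_toCyc, h]

theorem valid_vertex (i : V) : (⟨0, {i}⟩ : HeightMonomial V).Valid :=
  ⟨fun _ h => absurd h (Multiset.notMem_zero _), Multiset.nodup_zero⟩

/-- The symbol of the quantum trace of a closed path is its classical trace whatever the heights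
are, and both sides are linear. -/
theorem hamZeroEquiv_of_isLifting [CharZero K] {ξ : QReduction V K} {x : PreprojCyc K V}
    (h : IsLifting K ξ x) :
    hamZeroEquiv K V d (HamReductionZero.mk K d (reducedTrace K V d ξ)) =
      classicalTrace K d x := by
  induction h with
  | zero => simp only [map_zero]
  | vertex i => exact hamZeroEquiv_reducedTrace_sym (valid_vertex i) (symbol_quantTrace_vertex i)
  | word l hl => exact hamZeroEquiv_reducedTrace_sym hl (symbol_quantTrace_cycle hl)
  | add ξ η x y _ _ hx hy => rw [map_add, map_add, map_add, hx, hy, map_add]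
  | smul c ξ x _ hx =>
    have h : reducedTrace K V d ((Polynomial.C c : K[X]) • ξ) = c • reducedTrace K V d ξ :=
      map_smul _ _ _
    rw [h, map_smul, map_smul, hx, map_smul]

end ReducedTrace

/-! ### Commutativity of the necklace algebra modulo $\hbar$ -/

section CommutativeModHbar

variable {K : Type u} [Field K] {V : Type v} [Quiver.{w} V]

open HeightMonomial

namespace HeightMonomial

theorem mapHeights_congr {X : HeightMonomial V} {f g : ℕ → ℕ} (h : ∀ m ∈ X.heights, f m = g m) :
    X.mapHeights f = X.mapHeights g := by
  rw [mapHeights, mapHeights, HeightMonomial.mk.injEq]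
  refine ⟨Multiset.map_congr rfl fun c hc => ?_, rfl⟩
  have hc' : ∀ p ∈ c.toMultiset, f p.2 = g p.2 := fun p hp =>
    h _ (Multiset.mem_bind.2 ⟨c, hc, Multiset.mem_map_of_mem _ hp⟩)
  clear hc
  induction c using Quotient.inductionOn with
  | _ l =>
    change ((l.map _ : List (DArr V × ℕ)) : Cycle (DArr V × ℕ)) = (l.map _ : List (DArr V × ℕ))
    rw [List.map_congr_left fun p hp => by rw [hc' p hp]]

theorem mapHeights_mapHeights (X : HeightMonomial V) (f g : ℕ → ℕ) :
    (X.mapHeights f).mapHeights g = X.mapHeights (g ∘ f) := by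
  rw [mapHeights, mapHeights, mapHeights, HeightMonomial.mk.injEq, Multiset.map_map]
  refine ⟨Multiset.map_congr rfl fun c _ => ?_, rfl⟩
  induction c using Quotient.inductionOn with
  | _ l =>
    change (((l.map _).map _ : List (DArr V × ℕ)) : Cycle (DArr V × ℕ)) =
      (l.map _ : List (DArr V × ℕ))
    rw [List.map_map]; rfl

theorem mapHeights_id (X : HeightMonomial V) : X.mapHeights id = X := by
  rw [mapHeights]
  obtain ⟨C, W⟩ := X
  rw [HeightMonomial.mk.injEq]
  refine ⟨(Multiset.map_congr rfl fun c _ => ?_).trans (Multiset.map_id C), rfl⟩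
  induction c using Quotient.inductionOn with
  | _ l =>
    change ((l.map _ : List (DArr V × ℕ)) : Cycle (DArr V × ℕ)) = (l : Cycle (DArr V × ℕ))
    rw [show (fun p : DArr V × ℕ => (p.1, id p.2)) = id from rfl, List.map_id]

theorem mapHeights_addCycle (X : HeightMonomial V) (l : List (DArr V × ℕ)) (f : ℕ → ℕ) :
    (X.addCycle l).mapHeights f = (X.mapHeights f).addCycle (l.map fun p => (p.1, f p.2)) := by
  rw [mapHeights, addCycle, addCycle, mapHeights, Multiset.map_cons]
  rfl

theorem mapHeights_mul (X Y : HeightMonomial V) (f : ℕ → ℕ) :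
    (X.mul Y).mapHeights f = (X.mapHeights f).mul (Y.mapHeights f) := by
  rw [mul, mapHeights, mapHeights, mapHeights, mul, Multiset.map_add]

theorem mul_swap (X Y : HeightMonomial V) : X.mul Y = Y.mul X := by
  rw [mul, mul, add_comm, add_comm Y.verts]

theorem exists_addCycle {X : HeightMonomial V} {m : ℕ} (hm : m ∈ X.heights) :
    ∃ (Y : HeightMonomial V) (a : DArr V) (r : List (DArr V × ℕ)), X = Y.addCycle ((a, m) :: r) := by
  obtain ⟨c, hc, hm⟩ := Multiset.mem_bind.1 hm
  obtain ⟨⟨a, m⟩, hp, rfl⟩ := Multiset.mem_map.1 hm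
  obtain ⟨C, hC⟩ := Multiset.exists_cons_of_mem hc
  induction c using Quotient.inductionOn with
  | _ l =>
    obtain ⟨r, r', rfl⟩ := List.append_of_mem (show (a, m) ∈ l from hp)
    refine ⟨⟨C, X.verts⟩, a, r' ++ r, ?_⟩
    ext1
    · rw [hC, addCycle]
      congr 1
      exact Cycle.coe_eq_coe.2 (List.isRotated_append (l := r) (l' := (a, m) :: r'))
    · rfl

end HeightMonomial

variable (K V) in
/-- The multiples of `ħ` in the quantized necklace algebra. -/
def hbarMultiples : Submodule K[X] (Necklace V K) :=
  LinearMap.range (LinearMap.lsmul K[X] (Necklace V K) Polynomial.X)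

theorem hbar_smul_mem (c : K) (z : Necklace V K) :
    (Polynomial.X * Polynomial.C c : K[X]) • z ∈ hbarMultiples K V :=
  ⟨(Polynomial.C c : K[X]) • z, (mul_smul _ _ _).symm⟩

theorem mul_mem_hbarMultiples_left (y : Necklace V K) {x : Necklace V K}
    (hx : x ∈ hbarMultiples K V) : y * x ∈ hbarMultiples K V := by
  obtain ⟨z, rfl⟩ := hx
  exact ⟨y * z, (mul_smul_comm _ _ _).symm⟩

theorem mul_mem_hbarMultiples_right (y : Necklace V K) {x : Necklace V K}
    (hx : x ∈ hbarMultiples K V) : x * y ∈ hbarMultiples K V := by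
  obtain ⟨z, rfl⟩ := hx
  exact ⟨z * y, (smul_mul_assoc _ _ _).symm⟩

theorem sym_mul {X Y : HeightMonomial V} (hX : X.Valid) (hY : Y.Valid)
    (h : ∀ m ∈ X.heights, ∀ n ∈ Y.heights, m < n) :
    sym K X * sym K Y = sym K (X.mul Y) :=
  (map_mul (RingQuot.mkAlgHom K[X] (NecklaceRel K)) _ _).symm.trans
    (RingQuot.mkAlgHom_rel K[X] (NecklaceRel.mul X Y hX hY h))

theorem sym_mapHeights {X : HeightMonomial V} {f : ℕ → ℕ} (hX : X.Valid) (hf : StrictMono f) :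
    sym K (X.mapHeights f) = sym K X :=
  (RingQuot.mkAlgHom_rel K[X] (NecklaceRel.relabel X f hX hf)).symm

theorem sym_skein_diff {X : HeightMonomial V} {a b : DArr V} {m n : ℕ} {r s : List (DArr V × ℕ)}
    (hmn : m < n) (hX : ((X.addCycle ((a, m) :: r)).addCycle ((b, n) :: s)).Valid)
    (hN : ((X.addCycle ((a, m) :: r)).addCycle ((b, n) :: s)).NoneBetween m n) :
    sym K ((X.addCycle ((a, n) :: r)).addCycle ((b, m) :: s)) -
      sym K ((X.addCycle ((a, m) :: r)).addCycle ((b, n) :: s)) ∈ hbarMultiples K V := by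
  have h := RingQuot.mkAlgHom_rel K[X] (NecklaceRel.skein_diff (K := K) X a b m n r s hmn hX hN)
  rw [map_add, map_smul] at h
  have h2 : sym K ((X.addCycle ((a, m) :: r)).addCycle ((b, n) :: s)) =
    sym K ((X.addCycle ((a, n) :: r)).addCycle ((b, m) :: s)) + (Polynomial.X * Polynomial.C (pairing K a b) : K[X]) • sym K (X.addWord (DArr.src a) (r ++ s)) := h
  rw [h2, sub_add_cancel_left]
  exact neg_mem (hbar_smul_mem _ _)

theorem sym_skein_same {X : HeightMonomial V} {a b : DArr V} {m n : ℕ} {r s : List (DArr V × ℕ)}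
    (hmn : m < n) (hX : (X.addCycle ((a, m) :: r ++ (b, n) :: s)).Valid)
    (hN : (X.addCycle ((a, m) :: r ++ (b, n) :: s)).NoneBetween m n) :
    sym K (X.addCycle ((a, n) :: r ++ (b, m) :: s)) -
      sym K (X.addCycle ((a, m) :: r ++ (b, n) :: s)) ∈ hbarMultiples K V := by
  have h := RingQuot.mkAlgHom_rel K[X] (NecklaceRel.skein_same (K := K) X a b m n r s hmn hX hN)
  rw [map_add, map_smul] at h
  have h2 : sym K (X.addCycle ((a, m) :: r ++ (b, n) :: s)) =
    sym K (X.addCycle ((a, n) :: r ++ (b, m) :: s)) + (Polynomial.X * Polynomial.C (pairing K a b) : K[X]) • sym K ((X.addWord (DArr.src b) s).addWord (DArr.src a) r) := h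
  rw [h2, sub_add_cancel_left]
  exact neg_mem (hbar_smul_mem _ _)

theorem swap_succ_of_ne {m h : ℕ} (h1 : h ≠ m) (h2 : h ≠ m + 1) : Equiv.swap m (m + 1) h = h :=
  Equiv.swap_apply_of_ne_of_ne h1 h2

theorem sym_swap_eq {X : HeightMonomial V} (hX : X.Valid) {m : ℕ} (hm : m + 1 ∉ X.heights) :
    sym K (X.mapHeights (Equiv.swap m (m + 1))) = sym K X := by
  -- Relabelling requires a map strictly monotone on all of $\mathbb N$, which a transposition is
  -- not. Both monomials are therefore relabelled to a common third one: the map `h1` opens a gap at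
  -- `m`, and `h2` opens one above `m + 1`.
  have h1 : StrictMono fun h => if h < m then h else h + 1 := by
    intro a b hab; dsimp only; split_ifs <;> omega
  have h2 : StrictMono fun h => if h ≤ m + 1 then h else h + 1 := by
    intro a b hab; dsimp only; split_ifs <;> omega
  rw [← sym_mapHeights (valid_mapHeights (Equiv.injective _) hX) h2, ← sym_mapHeights hX h1,
    mapHeights_mapHeights]
  refine congrArg (sym K) (mapHeights_congr fun h hh => ?_)
  have hne : h ≠ m + 1 := by rintro rfl; exact hm hh
  dsimp only [Function.comp]
  by_cases h0 : h = m
  · subst h0; simp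
  · rw [swap_succ_of_ne h0 hne]
    split_ifs <;> omega

theorem map_swap_eq_self {m : ℕ} {l : List (DArr V × ℕ)} (h1 : m ∉ l.map Prod.snd)
    (h2 : m + 1 ∉ l.map Prod.snd) : (l.map fun p => (p.1, Equiv.swap m (m + 1) p.2)) = l := by
  conv_rhs => rw [← List.map_id l]
  refine List.map_congr_left fun p hp => ?_
  rw [swap_succ_of_ne]
  · rfl
  · rintro rfl; exact h1 (List.mem_map_of_mem hp)
  · intro h; rw [← h] at h2; exact h2 (List.mem_map_of_mem hp)

theorem mapHeights_swap_eq_self {m : ℕ} {X : HeightMonomial V} (h1 : m ∉ X.heights)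
    (h2 : m + 1 ∉ X.heights) : X.mapHeights (Equiv.swap m (m + 1)) = X := by
  conv_rhs => rw [← mapHeights_id X]
  refine mapHeights_congr fun h hh => swap_succ_of_ne ?_ ?_
  · rintro rfl; exact h1 hh
  · rintro rfl; exact h2 hh

theorem noneBetween_succ (X : HeightMonomial V) (m : ℕ) : X.NoneBetween m (m + 1) :=
  fun _ _ => by omega

/-- If at most one of the two heights occurs, the exchange preserves the order and changes nothing.
If both occur, it is a skein relation on one component or on two, whose third term is a multiple of
$\hbar$. -/
theorem sym_swap_sub_mem {X : HeightMonomial V} (hX : X.Valid) (m : ℕ) :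
    sym K (X.mapHeights (Equiv.swap m (m + 1))) - sym K X ∈ hbarMultiples K V := by
  by_cases hm' : m + 1 ∈ X.heights
  swap
  · rw [sym_swap_eq hX hm', sub_self]; exact zero_mem _
  by_cases hm : m ∈ X.heights
  swap
  · have h1 : m + 1 ∉ (X.mapHeights (Equiv.swap m (m + 1))).heights := by
      rw [heights_mapHeights, Multiset.mem_map]
      rintro ⟨h, hh, he⟩
      rw [Equiv.swap_apply_eq_iff, Equiv.swap_apply_right] at he
      exact hm (he ▸ hh)
    have h2 := sym_swap_eq (K := K) (valid_mapHeights (Equiv.injective (Equiv.swap m (m + 1))) hX) h1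
    rw [mapHeights_mapHeights, ← Equiv.coe_trans, Equiv.swap_swap, Equiv.coe_refl,
      mapHeights_id] at h2
    rw [h2, sub_self]; exact zero_mem _
  obtain ⟨Y, a, r, rfl⟩ := exists_addCycle hm
  rw [heights_addCycle, List.map_cons, Multiset.mem_add, Multiset.mem_coe, List.mem_cons] at hm'
  rcases hm' with (h | h) | h
  · exact absurd h (Nat.succ_ne_self m)
  · obtain ⟨⟨b, _⟩, hp, rfl⟩ := List.mem_map.1 h
    obtain ⟨r, s, rfl⟩ := List.append_of_mem hp
    have hn := hX.2
    rw [← List.cons_append, heights_same] at hn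
    simp only [Multiset.nodup_cons, Multiset.mem_cons, Multiset.mem_add, Multiset.mem_coe,
      not_or] at hn
    have h1 := sym_skein_same (K := K) (Nat.lt_succ_self m) hX (noneBetween_succ _ m)
    have h2 : (Y.addCycle ((a, m) :: (r ++ (b, m + 1) :: s))).mapHeights (Equiv.swap m (m + 1)) =
        Y.addCycle ((a, m + 1) :: r ++ (b, m) :: s) := by
      rw [mapHeights_addCycle, mapHeights_swap_eq_self hn.2.1.2.2 hn.1.2.2.2, List.map_cons,
        List.map_append, List.map_cons, map_swap_eq_self hn.2.1.2.1 hn.1.2.2.1,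
        map_swap_eq_self hn.2.1.1 hn.1.2.1, Equiv.swap_apply_left, Equiv.swap_apply_right,
        List.cons_append]
    rw [h2]
    exact h1
  · obtain ⟨Z, b, s, rfl⟩ := exists_addCycle h
    have hc : (Z.addCycle ((b, m + 1) :: s)).addCycle ((a, m) :: r) =
        (Z.addCycle ((a, m) :: r)).addCycle ((b, m + 1) :: s) := by
      simp only [addCycle]
      rw [Multiset.cons_swap]
    rw [hc] at hX ⊢
    have hn := hX.2
    rw [heights_diff] at hn
    simp only [Multiset.nodup_cons, Multiset.mem_cons, Multiset.mem_add, Multiset.mem_coe,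
      not_or] at hn
    have h1 := sym_skein_diff (K := K) (Nat.lt_succ_self m) hX (noneBetween_succ _ m)
    have h2 : ((Z.addCycle ((a, m) :: r)).addCycle ((b, m + 1) :: s)).mapHeights
        (Equiv.swap m (m + 1)) = (Z.addCycle ((a, m + 1) :: r)).addCycle ((b, m) :: s) := by
      rw [mapHeights_addCycle, mapHeights_addCycle,
        mapHeights_swap_eq_self hn.2.1.2.2 hn.1.2.2.2, List.map_cons,
        List.map_cons, map_swap_eq_self hn.2.1.2.1 hn.1.2.2.1,
        map_swap_eq_self hn.2.1.1 hn.1.2.1, Equiv.swap_apply_left, Equiv.swap_apply_right]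
    rw [h2]
    exact h1

variable (K V) in
/-- The permutations of the heights that act trivially modulo `ħ`. -/
def heightPerms : Subgroup (Equiv.Perm ℕ) where
  carrier := {e | ∀ X : HeightMonomial V, X.Valid →
    sym K (X.mapHeights e) - sym K X ∈ hbarMultiples K V}
  one_mem' := fun X _ => by
    rw [Equiv.Perm.coe_one, mapHeights_id, sub_self]; exact zero_mem _
  mul_mem' := fun {e e'} he he' X hX => by
    have h := add_mem (he _ (valid_mapHeights e'.injective hX)) (he' X hX)
    rwa [sub_add_sub_cancel, mapHeights_mapHeights] at h
  inv_mem' := fun {e} he X hX => by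
    have h := neg_mem (he _ (valid_mapHeights (e⁻¹ : Equiv.Perm ℕ).injective hX))
    rwa [mapHeights_mapHeights, neg_sub, ← Equiv.Perm.coe_mul, mul_inv_cancel, Equiv.Perm.coe_one,
      mapHeights_id] at h

theorem swap_succ_mem (m : ℕ) : Equiv.swap m (m + 1) ∈ heightPerms K V :=
  fun _ hX => sym_swap_sub_mem hX m

/-- A longer transposition is obtained from a shorter one by conjugating with an adjacent
transposition. -/
theorem swap_add_mem (m k : ℕ) : Equiv.swap m (m + 1 + k) ∈ heightPerms K V := by
  induction k with
  | zero => exact swap_succ_mem m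
  | succ k ih =>
    have h := Equiv.swap_mul_swap_mul_swap (x := m) (y := m + 1 + k) (z := m + 1 + k + 1)
      (by omega) (by omega)
    rw [← add_assoc, Equiv.swap_comm, ← h]
    exact mul_mem (mul_mem (swap_succ_mem _) ih) (swap_succ_mem _)

theorem mem_heightPerms {e : Equiv.Perm ℕ} (he : (Set.Finite {m | e m ≠ m})) :
    e ∈ heightPerms K V := by
  have h : Subgroup.closure {σ : Equiv.Perm ℕ | σ.IsSwap} ≤ heightPerms K V := by
    rw [Subgroup.closure_le]
    rintro _ ⟨m, n, hmn, rfl⟩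
    rcases lt_or_gt_of_ne hmn with h | h
    · obtain ⟨k, rfl⟩ := Nat.exists_eq_add_of_lt h
      rw [add_right_comm]; exact swap_add_mem m k
    · obtain ⟨k, rfl⟩ := Nat.exists_eq_add_of_lt h
      rw [add_right_comm, Equiv.swap_comm]; exact swap_add_mem n k
  refine h (mem_closure_isSwap'.2 ?_)
  refine he.subset fun m hm => ?_
  simpa using hm

/-- The permutation that exchanges an initial segment of length `M` with the following segment
of length `N`. -/
def blockSwap (M N : ℕ) : Equiv.Perm ℕ where
  toFun h := if h < M then h + N else if h < M + N then h - M else h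
  invFun h := if h < N then h + M else if h < M + N then h - N else h
  left_inv h := by dsimp only; split_ifs <;> omega
  right_inv h := by dsimp only; split_ifs <;> omega

theorem blockSwap_apply (M N h : ℕ) :
    blockSwap M N h = if h < M then h + N else if h < M + N then h - M else h := rfl

theorem blockSwap_mem (M N : ℕ) : blockSwap M N ∈ heightPerms K V := by
  refine mem_heightPerms ((Set.finite_lt_nat (M + N)).subset fun h hh => ?_)
  by_contra hlt
  rw [Set.mem_ofPred_eq] at hh hlt
  exact hh (by rw [blockSwap_apply, if_neg (by omega), if_neg hlt])

theorem exists_height_bound (X : HeightMonomial V) : ∃ N, ∀ m ∈ X.heights, m < N :=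
  ⟨X.heights.sup + 1, fun _ hm => Nat.lt_succ_of_le (Multiset.le_sup hm)⟩

/-- The two products are the same symmetric product with different heights: `X` below `Y` or `Y`
below `X`. Exchanging the two blocks of heights is a finitely supported permutation, hence trivial
modulo $\hbar$. -/
theorem sym_commutator_mem {X Y : HeightMonomial V} (hX : X.Valid) (hY : Y.Valid) :
    sym K X * sym K Y - sym K Y * sym K X ∈ hbarMultiples K V := by
  obtain ⟨M, hM⟩ := exists_height_bound X
  obtain ⟨N, hN⟩ := exists_height_bound Y
  have hm : ∀ M : ℕ, StrictMono fun h => h + M := fun M a b hab => by dsimp only; omega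
  have e1 : sym K X * sym K Y = sym K (X.mul (Y.mapHeights fun h => h + M)) := by
    rw [← sym_mapHeights hY (hm M), sym_mul hX (valid_mapHeights (hm M).injective hY)]
    intro m hm n hn
    rw [heights_mapHeights, Multiset.mem_map] at hn
    obtain ⟨n, _, rfl⟩ := hn
    have := hM m hm
    omega
  have e2 : sym K Y * sym K X = sym K ((X.mapHeights fun h => h + N).mul Y) := by
    rw [← sym_mapHeights hX (hm N), sym_mul hY (valid_mapHeights (hm N).injective hX), mul_swap]
    intro m hm n hn
    rw [heights_mapHeights, Multiset.mem_map] at hn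
    obtain ⟨n, _, rfl⟩ := hn
    have := hN m hm
    omega
  have hv : (X.mul (Y.mapHeights fun h => h + M)).Valid := by
    refine valid_mul hX (valid_mapHeights (hm M).injective hY) fun m hm n hn => ?_
    rw [heights_mapHeights, Multiset.mem_map] at hn
    obtain ⟨n, _, rfl⟩ := hn
    have := hM m hm
    omega
  have h := neg_mem (blockSwap_mem (K := K) (V := V) M N _ hv)
  have e3 : (X.mul (Y.mapHeights fun h => h + M)).mapHeights (blockSwap M N) =
      (X.mapHeights fun h => h + N).mul Y := by
    rw [mapHeights_mul, mapHeights_mapHeights]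
    congr 1
    · refine mapHeights_congr fun h hh => ?_
      rw [blockSwap_apply, if_pos (hM h hh)]
    · refine (mapHeights_congr fun h hh => ?_).trans (mapHeights_id Y)
      have := hN h hh
      rw [Function.comp, blockSwap_apply, if_neg (by omega), if_pos (by omega), id]
      omega
  rw [e3, neg_sub, ← e1, ← e2] at h
  exact h

theorem necklace_induction {P : Necklace V K → Prop}
    (halg : ∀ r : K[X], P (algebraMap K[X] (Necklace V K) r))
    (hsym : ∀ X : HeightMonomial V, X.Valid → P (sym K X))
    (hadd : ∀ x y, P x → P y → P (x + y)) (hmul : ∀ x y, P x → P y → P (x * y))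
    (x : Necklace V K) : P x := by
  obtain ⟨z, rfl⟩ := RingQuot.mkAlgHom_surjective K[X] (NecklaceRel (V := V) K) x
  induction z using FreeAlgebra.induction with
  | grade0 r =>
    rw [AlgHom.commutes]; exact halg r
  | grade1 X =>
    have h := hsym X.1 X.2
    rwa [sym, preSym, dif_pos X.2] at h
  | mul a b ha hb => rw [map_mul]; exact hmul _ _ ha hb
  | add a b ha hb => rw [map_add]; exact hadd _ _ ha hb

theorem commutator_mem_hbarMultiples (x y : Necklace V K) :
    x * y - y * x ∈ hbarMultiples K V := by
  have hmul : ∀ a b y : Necklace V K, a * y - y * a ∈ hbarMultiples K V →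
      b * y - y * b ∈ hbarMultiples K V → a * b * y - y * (a * b) ∈ hbarMultiples K V := by
    intro a b y ha hb
    have h : a * b * y - y * (a * b) = a * (b * y - y * b) + (a * y - y * a) * b := by
      noncomm_ring
    rw [h]
    exact add_mem (mul_mem_hbarMultiples_left _ hb) (mul_mem_hbarMultiples_right _ ha)
  have hadd : ∀ a b y : Necklace V K, a * y - y * a ∈ hbarMultiples K V →
      b * y - y * b ∈ hbarMultiples K V → (a + b) * y - y * (a + b) ∈ hbarMultiples K V := by
    intro a b y ha hb
    have h : (a + b) * y - y * (a + b) = (a * y - y * a) + (b * y - y * b) := by noncomm_ring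
    rw [h]
    exact add_mem ha hb
  have halg : ∀ (r : K[X]) (y : Necklace V K), algebraMap K[X] (Necklace V K) r * y -
      y * algebraMap K[X] (Necklace V K) r ∈ hbarMultiples K V := by
    intro r y
    rw [Algebra.commutes, sub_self]
    exact zero_mem _
  have key : ∀ X : HeightMonomial V, X.Valid → ∀ y : Necklace V K,
      sym K X * y - y * sym K X ∈ hbarMultiples K V := by
    intro X hX y
    rw [← neg_mem_iff, neg_sub]
    induction y using necklace_induction with
    | halg r => exact halg r _
    | hsym Y hY => exact sym_commutator_mem hY hX
    | hadd a b ha hb => exact hadd a b _ ha hb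
    | hmul a b ha hb => exact hmul a b _ ha hb
  induction x using necklace_induction with
  | halg r => exact halg r y
  | hsym X hX => exact key X hX y
  | hadd a b ha hb => exact hadd a b y ha hb
  | hmul a b ha hb => exact hmul a b y ha hb

end CommutativeModHbar

/-! ### Existence of liftings -/

section Liftings

variable {K : Type u} [Field K] {V : Type v} [Quiver.{w} V] [Fintype V]

open HeightMonomial

theorem vertexElt_mul_self (i : V) : vertexElt K i * vertexElt K i = vertexElt K i :=
  (map_mul (RingQuot.mkAlgHom K (PathRel K V)) _ _).symm.trans
    (RingQuot.mkAlgHom_rel K (PathRel.idem i))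

theorem vertexElt_mul_of_ne {i j : V} (h : i ≠ j) : vertexElt K i * vertexElt K j = 0 :=
  (map_mul (RingQuot.mkAlgHom K (PathRel K V)) _ _).symm.trans
    ((RingQuot.mkAlgHom_rel K (PathRel.orth i j h)).trans (map_zero _))

theorem sum_vertexElt : ∑ i : V, vertexElt K i = 1 :=
  (map_sum (RingQuot.mkAlgHom K (PathRel K V)) _ _).symm.trans
    ((RingQuot.mkAlgHom_rel K PathRel.unit).trans (map_one _))

theorem vertexElt_tgt_mul (a : DArr V) :
    vertexElt K (DArr.tgt a) * arrowElt K a = arrowElt K a :=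
  (map_mul (RingQuot.mkAlgHom K (PathRel K V)) _ _).symm.trans
    (RingQuot.mkAlgHom_rel K (PathRel.tgt a))

theorem mul_vertexElt_src (a : DArr V) :
    arrowElt K a * vertexElt K (DArr.src a) = arrowElt K a :=
  (map_mul (RingQuot.mkAlgHom K (PathRel K V)) _ _).symm.trans
    (RingQuot.mkAlgHom_rel K (PathRel.src a))

variable (K) in
/-- The product of the arrows of a word. -/
def arrowProd (l : List (DArr V × ℕ)) : DoublePathAlg K V := (l.map fun p => arrowElt K p.1).prod

theorem arrowProd_cons (p : DArr V × ℕ) (l : List (DArr V × ℕ)) :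
    arrowProd K (p :: l) = arrowElt K p.1 * arrowProd K l := by
  rw [arrowProd, List.map_cons, List.prod_cons]; rfl

theorem vertexElt_mul_arrowProd {u v : V} {l : List (DArr V × ℕ)} (hl : IsPath u l v) :
    vertexElt K u * arrowProd K l = arrowProd K l * vertexElt K v := by
  induction l generalizing u with
  | nil => rw [show u = v from hl, arrowProd, List.map_nil, List.prod_nil, mul_one, one_mul]
  | cons p l ih =>
    rw [arrowProd_cons, ← mul_assoc, ← hl.1, vertexElt_tgt_mul, mul_assoc, ← ih hl.2, ← mul_assoc,
      mul_vertexElt_src]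

variable (K V) in
/-- The span of the paths. -/
def pathSpan : Submodule K (DoublePathAlg K V) :=
  Submodule.span K {z | ∃ u l v, IsPath u l v ∧ z = vertexElt K u * arrowProd K l}

variable (K V) in
/-- The path algebra as a quotient of a free algebra. -/
def freeToPath : FreeAlgebra K (V ⊕ DArr V) →ₐ[K] DoublePathAlg K V :=
  RingQuot.mkAlgHom K (PathRel K V)

theorem freeToPath_surjective : Function.Surjective (freeToPath K V) :=
  RingQuot.mkAlgHom_surjective K _

/-- Left multiplication by a generator sends a path to a path or to zero. As $1$ is the sum of the
trivial paths, the paths span the path algebra. -/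
theorem freeToPath_mul_mem_pathSpan (w : FreeAlgebra K (V ⊕ DArr V)) {z : DoublePathAlg K V}
    (hz : z ∈ pathSpan K V) : freeToPath K V w * z ∈ pathSpan K V := by
  induction w using FreeAlgebra.induction generalizing z with
  | grade0 r =>
    rw [AlgHom.commutes, ← Algebra.smul_def]
    exact Submodule.smul_mem _ _ hz
  | grade1 x =>
    rw [pathSpan] at hz
    induction hz using Submodule.span_induction with
    | mem z hz =>
      obtain ⟨u, l, v, hl, rfl⟩ := hz
      rcases x with i | a
      · change vertexElt K i * (vertexElt K u * arrowProd K l) ∈ _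
        rw [← mul_assoc]
        by_cases h : i = u
        · rw [h, vertexElt_mul_self]
          exact Submodule.subset_span ⟨u, l, v, hl, rfl⟩
        · rw [vertexElt_mul_of_ne h, zero_mul]
          exact zero_mem _
      · change arrowElt K a * (vertexElt K u * arrowProd K l) ∈ _
        rw [← mul_assoc]
        by_cases h : DArr.src a = u
        · subst h
          -- The height $0$ is a dummy; neither `IsPath` nor `arrowProd` looks at heights.
          refine Submodule.subset_span ⟨DArr.tgt a, (a, 0) :: l, v, ⟨rfl, hl⟩, ?_⟩
          rw [mul_vertexElt_src, arrowProd_cons, ← mul_assoc, vertexElt_tgt_mul]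
        · rw [← mul_vertexElt_src a, mul_assoc (arrowElt K a), vertexElt_mul_of_ne h, mul_zero,
            zero_mul]
          exact zero_mem _
    | zero => rw [mul_zero]; exact zero_mem _
    | add x y _ _ hx hy => rw [mul_add]; exact add_mem hx hy
    | smul c x _ hx => rw [mul_smul_comm]; exact Submodule.smul_mem _ _ hx
  | mul a b ha hb => rw [map_mul, mul_assoc]; exact ha (hb hz)
  | add a b ha hb => rw [map_add, add_mul]; exact add_mem (ha hz) (hb hz)

theorem pathSpan_eq_top : pathSpan K V = ⊤ := by
  rw [eq_top_iff]
  rintro z -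
  obtain ⟨w, rfl⟩ := freeToPath_surjective z
  have h1 : (1 : DoublePathAlg K V) ∈ pathSpan K V := by
    rw [← sum_vertexElt]
    refine sum_mem fun i _ => Submodule.subset_span ⟨i, [], i, rfl, ?_⟩
    rw [arrowProd, List.map_nil, List.prod_nil, mul_one]
  rw [← mul_one (freeToPath K V w)]
  exact freeToPath_mul_mem_pathSpan w h1

theorem isPath_zipIdx (u v : V) (l : List (DArr V × ℕ)) (n : ℕ) :
    IsPath u ((l.map Prod.fst).zipIdx n) v ↔ IsPath u l v := by
  induction l generalizing u n with
  | nil => rfl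
  | cons p l ih => rw [List.map_cons, List.zipIdx_cons, IsPath, ih, IsPath]

theorem arrowProd_zipIdx (l : List (DArr V × ℕ)) (n : ℕ) :
    arrowProd K ((l.map Prod.fst).zipIdx n) = arrowProd K l := by
  induction l generalizing n with
  | nil => rfl
  | cons p l ih => rw [List.map_cons, List.zipIdx_cons, arrowProd_cons, ih, arrowProd_cons]

variable [DecidableEq V] [∀ i j : V, Fintype (i ⟶ j)]

theorem toCyc_mul_comm (x y : DoublePathAlg K V) : toCyc K V (x * y) = toCyc K V (y * x) := by
  rw [← sub_eq_zero, ← map_sub]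
  refine (Submodule.Quotient.mk_eq_zero _).2 (Submodule.subset_span
    ⟨Preproj.mk K V x, Preproj.mk K V y, ?_⟩)
  rw [AlgHom.toLinearMap_apply, map_sub, map_mul, map_mul]

theorem valid_zipIdx_of_isPath {u : V} {p : DArr V × ℕ} {l : List (DArr V × ℕ)}
    (hl : IsPath u (p :: l) u) :
    (HeightMonomial.empty.addCycle ((p :: l).map Prod.fst).zipIdx).Valid := by
  have hn := map_snd_zipIdx_nodup ((p :: l).map Prod.fst)
  rw [List.map_cons, List.zipIdx_cons] at hn ⊢
  rw [valid_addCycle_cons, heights_empty, add_zero, Multiset.coe_nodup]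
  refine ⟨?_, fun _ h => absurd h (Multiset.notMem_zero _), hn⟩
  rw [isPath_zipIdx, hl.1]
  exact hl.2

variable (K V) in
/-- The elements that have a lifting. -/
def liftable : Submodule K (PreprojCyc K V) where
  carrier := {x | ∃ X : Necklace V K, IsLifting K (QReduction.mk V K X) x}
  zero_mem' := ⟨0, by rw [map_zero]; exact IsLifting.zero⟩
  add_mem' := by
    rintro x y ⟨X, hX⟩ ⟨Y, hY⟩
    exact ⟨X + Y, by rw [map_add]; exact IsLifting.add _ _ _ _ hX hY⟩
  smul_mem' := by
    rintro c x ⟨X, hX⟩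
    exact ⟨(Polynomial.C c : K[X]) • X, by rw [map_smul]; exact IsLifting.smul _ _ _ hX⟩

theorem toCyc_path_mem_liftable {u v : V} {l : List (DArr V × ℕ)} (hl : IsPath u l v) :
    toCyc K V (vertexElt K u * arrowProd K l) ∈ liftable K V := by
  cases l with
  | nil =>
    rw [arrowProd, List.map_nil, List.prod_nil, mul_one]
    exact ⟨_, IsLifting.vertex u⟩
  | cons p l =>
    by_cases h : u = v
    · subst h
      have h := IsLifting.word (K := K) _ (valid_zipIdx_of_isPath hl)
      have h2 := arrowProd_zipIdx (K := K) (p :: l) 0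
      rw [arrowProd] at h2
      rw [h2] at h
      rw [arrowProd_cons, ← mul_assoc, ← hl.1, vertexElt_tgt_mul, ← arrowProd_cons]
      exact ⟨_, h⟩
    -- A path `p` from `v` to `u` with `u ≠ v` vanishes modulo commutators: $e_up=e_u\,p\,e_v\sim
    -- p\,e_ve_u=0$.
    · rw [← vertexElt_mul_self, mul_assoc, vertexElt_mul_arrowProd hl, toCyc_mul_comm, mul_assoc,
        vertexElt_mul_of_ne (Ne.symm h), mul_zero, map_zero]
      exact zero_mem _

theorem exists_isLifting (x : PreprojCyc K V) :
    ∃ X : Necklace V K, IsLifting K (QReduction.mk V K X) x := by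
  obtain ⟨y, rfl⟩ := (commutatorSpan K V).mkQ_surjective x
  obtain ⟨z, rfl⟩ := RingQuot.mkAlgHom_surjective K _ y
  have h : z ∈ pathSpan K V := by rw [pathSpan_eq_top]; exact Submodule.mem_top
  change toCyc K V z ∈ liftable K V
  rw [pathSpan] at h
  induction h using Submodule.span_induction with
  | mem z hz =>
    obtain ⟨u, l, v, hl, rfl⟩ := hz
    exact toCyc_path_mem_liftable hl
  | zero => rw [map_zero]; exact zero_mem _
  | add x y _ _ hx hy => rw [map_add]; exact add_mem hx hy
  | smul c x _ hx => rw [map_smul]; exact Submodule.smul_mem _ _ hx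

end Liftings

/-! ### Expanding products of traces over matrix indices -/

section TraceExpansion

theorem ofFn_prod_apply {R : Type*} [CommRing R] {n : Type*} [Fintype n] [DecidableEq n] {k : ℕ}
    (M : Fin (k + 1) → Matrix n n R) (i j : n) :
    (List.ofFn M).prod i j = ∑ κ : Fin k → n, ∏ p : Fin (k + 1),
      M p ((Fin.cons i κ : Fin (k + 1) → n) p) ((Fin.snoc κ j : Fin (k + 1) → n) p) := by
  induction k generalizing i with
  | zero =>
    simp only [List.ofFn_succ, List.ofFn_zero, List.prod_cons, List.prod_nil, mul_one,
      Fintype.sum_unique, Fin.prod_univ_succ, Fin.prod_univ_zero]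
    rfl
  | succ k ih =>
    rw [List.ofFn_succ, List.prod_cons, Matrix.mul_apply,
      ← (Fin.consEquiv fun _ : Fin (k + 1) => n).sum_comp, Fintype.sum_prod_type]
    refine Finset.sum_congr rfl fun a _ => ?_
    rw [ih, Finset.mul_sum]
    refine Finset.sum_congr rfl fun κ _ => ?_
    have h : (Fin.snoc (Fin.cons a κ : Fin (k + 1) → n) j : Fin (k + 2) → n) =
        Fin.cons a (Fin.snoc κ j : Fin (k + 1) → n) := (Fin.cons_snoc_eq_snoc_cons _ _ _).symm
    refine Eq.trans ?_ (Fin.prod_univ_succ _).symm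
    change _ = M 0 _ ((Fin.snoc (Fin.cons a κ : Fin (k + 1) → n) j : Fin (k + 2) → n) 0) *
      ∏ p : Fin (k + 1), M p.succ _
        ((Fin.snoc (Fin.cons a κ : Fin (k + 1) → n) j : Fin (k + 2) → n) p.succ)
    rw [h]
    simp only [Fin.cons_zero, Fin.cons_succ]
    rfl

/-- Closing up the chain of summation indices makes the column index of each factor the row index of
the next one, cyclically. -/
theorem trace_ofFn_prod {R : Type*} [CommRing R] {n : Type*} [Fintype n] [DecidableEq n] {k : ℕ}
    (M : Fin (k + 1) → Matrix n n R) : Matrix.trace (List.ofFn M).prod =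
      ∑ κ : Fin (k + 1) → n, ∏ p, M p (κ p) (κ (finRotate _ p)) := by
  rw [← (Fin.consEquiv fun _ : Fin (k + 1) => n).sum_comp, Fintype.sum_prod_type]
  refine Finset.sum_congr rfl fun i _ => ?_
  rw [Matrix.diag_apply, ofFn_prod_apply]
  refine Finset.sum_congr rfl fun κ _ => Finset.prod_congr rfl fun p _ => ?_
  rw [Fin.snoc_eq_cons_rotate]
  rfl

/-- The words `w` partition `η` into the cycles of `nxt`, so independent choices of indices on the
cycles amount to a single function on `η`. -/
theorem prod_trace_eq_sum {R : Type*} [CommRing R] {n : Type*} [Fintype n] [DecidableEq n]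
    {η ι : Type*} [Fintype η] [DecidableEq η] [Fintype ι] (M : η → Matrix n n R) (nxt : η → η) (k : ι → ℕ)
    (w : ∀ i, Fin (k i + 1) → η) (hw : ∀ i p, nxt (w i p) = w i (finRotate _ p))
    (hb : Function.Bijective fun q : Σ i, Fin (k i + 1) => w q.1 q.2) :
    ∏ i, Matrix.trace (List.ofFn fun p => M (w i p)).prod =
      ∑ κ : η → n, ∏ h, M h (κ h) (κ (nxt h)) := by
  classical
  simp only [trace_ofFn_prod]
  rw [Finset.prod_univ_sum, Fintype.piFinset_univ]
  symm
  refine Fintype.sum_equiv (((Equiv.ofBijective _ hb).symm.arrowCongr (Equiv.refl n)).trans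
    (Equiv.piCurry fun _ _ => n)) _ _ fun κ => ?_
  rw [← Function.Bijective.prod_comp hb, Fintype.prod_sigma]
  refine Finset.prod_congr rfl fun i _ => Finset.prod_congr rfl fun p _ => ?_
  rw [hw]
  rfl

/-- The labels of a cyclic word can be chosen along the chain. Injectivity of `e` then forces `nxt`
to advance by one position. -/
theorem exists_index_of_chain {α η : Type*} {e : η → α} (he : Function.Injective e) {nxt : η → η}
    {c : Cycle α} (hc : c ≠ Cycle.nil)
    (h : c.Chain fun p q => ∃ h, p = e h ∧ q = e (nxt h)) :
    ∃ (k : ℕ) (w : Fin (k + 1) → η), c = (List.ofFn fun p => e (w p) : List α) ∧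
      ∀ p, nxt (w p) = w (finRotate _ p) := by
  induction c using Quotient.inductionOn with
  | _ l =>
    cases l with
    | nil => exact absurd rfl hc
    | cons a l =>
      -- The cyclic chain unrolls to a list that repeats its first letter at the end, so the last
      -- step is the return to the start that `finRotate` describes.
      have h' := (Cycle.chain_coe_cons _ a l).1 h
      rw [List.isChain_iff_getElem] at h'
      have h2 : ∀ p : Fin (l.length + 1), ∃ x, (a :: l)[p] = e x ∧
          (a :: l)[(finRotate _ p)] = e (nxt x) := by
        intro p
        have hp := p.2
        obtain ⟨x, hx, hx'⟩ := h' p.1 (by simp; omega)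
        have e1 : (a :: (l ++ [a]))[p.1]'(by simp) = (a :: l)[p] := by
          have : (a :: (l ++ [a])) = (a :: l) ++ [a] := rfl
          simp only [this]
          rw [List.getElem_append_left]
          rfl
        have e2 : (a :: (l ++ [a]))[p.1 + 1]'(by simp; omega) = (a :: l)[(finRotate _ p)] := by
          rw [List.getElem_cons_succ]
          by_cases hp : p = Fin.last _
          · subst hp
            simp
          · have hlt : p.1 < l.length := by
              have := p.2
              have := Fin.val_ne_of_ne hp
              simp only [Fin.val_last] at this
              omega
            rw [List.getElem_append_left hlt]
            simp only [Fin.getElem_fin, coe_finRotate_of_ne_last hp, List.getElem_cons_succ]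
        exact ⟨x, e1.symm.trans hx, e2.symm.trans hx'⟩
      choose w hw1 hw2 using h2
      refine ⟨l.length, w, ?_, fun p => he ((hw2 p).symm.trans (hw1 _))⟩
      change ((a :: l : List α) : Cycle α) = _
      congr 1
      refine List.ext_getElem (by simp) fun i h1 h2 => ?_
      rw [List.getElem_ofFn]
      exact hw1 ⟨i, h1⟩

end TraceExpansion

/-! ### The explicit formula for the quantum trace -/

section IsQuantumTrace

variable {K : Type u} [Field K] {V : Type v} [Quiver.{w} V] [Fintype V] [DecidableEq V]
  [∀ i j : V, Fintype (i ⟶ j)] {d : V → ℕ}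

theorem hOrder_prod_hMat {N : ℕ} (arr : Fin N → DArr V) (i j : Fin N → Idx d) :
    (∏ h, hMat K d (arr h, (h : ℕ)) (i h) (j h)) ∈ hMultilin K V d (Finset.range N) ∧
    hOrder K V d (∏ h, hMat K d (arr h, (h : ℕ)) (i h) (j h)) =
      (List.ofFn fun h => opMat K d (arr h) (i h) (j h)).prod := by
  induction N with
  | zero =>
    rw [Fin.prod_univ_zero, heightOrder_one]
    exact ⟨one_mem_multilin _, rfl⟩
  | succ N ih =>
    obtain ⟨h1, h2⟩ := ih (fun h => arr h.castSucc) (fun h => i h.castSucc) fun h => j h.castSucc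
    have h3 := hMat_mem (K := K) (d := d) (arr (Fin.last N), N) (i (Fin.last N)) (j (Fin.last N))
    rw [Fin.prod_univ_castSucc]
    refine ⟨?_, ?_⟩
    · rw [Finset.range_add_one, Finset.insert_eq, Finset.union_comm]
      exact mul_mem_multilin _ (by simp) h1 h3
    · refine (heightOrder_mul coordHt (coordOp K) (by simp) h1 h3).trans ?_
      rw [List.ofFn_succ', List.concat_eq_append, List.prod_append, List.prod_singleton,
        ← hOrder_hMat (arr (Fin.last N), N), ← h2]

theorem exists_eq_map_univ {α : Type*} (S : Multiset α) :
    ∃ (m : ℕ) (C : Fin m → α), S = (Finset.univ : Finset (Fin m)).val.map C := by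
  induction S using Quotient.inductionOn with
  | _ l => exact ⟨l.length, l.get, by rw [Fin.univ_val_map, List.ofFn_get]; rfl⟩

theorem monoPoly_eq_sum {X : HeightMonomial V} {N : ℕ} {arr : Fin N → DArr V}
    {nxt : Fin N → Fin N} (hX : X.Valid) (hN : X.heights = Multiset.range N)
    (hc : ∀ c ∈ X.cycles, c.Chain fun p q => ∃ h : Fin N,
      p = (arr h, (h : ℕ)) ∧ q = (arr (nxt h), (nxt h : ℕ))) :
    monoPoly K d X = (((X.verts.map d).prod : ℕ) : HRing (V := V) K d) *
      ∑ κ : Fin N → Idx d, ∏ h, hMat K d (arr h, (h : ℕ)) (κ h) (κ (nxt h)) := by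
  obtain ⟨m, C, hC⟩ := exists_eq_map_univ X.cycles
  have hmem : ∀ i, C i ∈ X.cycles := fun i => by
    rw [hC]; exact Multiset.mem_map_of_mem _ (Finset.mem_univ i)
  have he : Function.Injective fun h : Fin N => (arr h, (h : ℕ)) := fun a b hab =>
    Fin.ext (congrArg Prod.snd hab)
  choose k w hw hrot using fun i => exists_index_of_chain he (hX.1 _ (hmem i)).1 (hc _ (hmem i))
  have hsurj : Function.Surjective fun q : Σ i, Fin (k i + 1) => w q.1 q.2 := by
    intro h
    have hh : (h : ℕ) ∈ X.heights := by rw [hN, Multiset.mem_range]; exact h.2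
    obtain ⟨c, hcX, hp⟩ := Multiset.mem_bind.1 hh
    rw [hC, Multiset.mem_map] at hcX
    obtain ⟨i, _, rfl⟩ := hcX
    rw [hw i, Multiset.mem_map] at hp
    obtain ⟨p, hp, hp2⟩ := hp
    obtain ⟨q, rfl⟩ := List.mem_ofFn.1 (show p ∈ List.ofFn _ from hp)
    exact ⟨⟨i, q⟩, Fin.ext hp2⟩
  have hcard : Fintype.card (Σ i, Fin (k i + 1)) = Fintype.card (Fin N) := by
    have h1 := congrArg Multiset.card hN
    rw [Multiset.card_range, HeightMonomial.heights, Multiset.card_bind, hC, Multiset.map_map] at h1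
    rw [Fintype.card_sigma, Fintype.card_fin, ← h1]
    refine congrArg Multiset.sum (Multiset.map_congr rfl fun i _ => ?_)
    rw [Function.comp, Function.comp, Multiset.card_map, hw i]
    change _ = Multiset.card ((List.ofFn _ : List (DArr V × ℕ)) : Multiset (DArr V × ℕ))
    rw [Multiset.coe_card, List.length_ofFn, Fintype.card_fin]
  -- Every height below `N` occurs in some cycle, and the cycles have `N` letters in total, so each
  -- height is met exactly once.
  have hb := (Fintype.bijective_iff_surjective_and_card _).2 ⟨hsurj, hcard⟩
  rw [monoPoly, ← prod_trace_eq_sum (fun h : Fin N => hMat K d (arr h, (h : ℕ))) nxt k w hrot hb,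
    hC, Multiset.map_map]
  congr 1
  refine Finset.prod_congr rfl fun i _ => ?_
  rw [Function.comp, hw i, cycTrace_coe, wordMat, List.map_ofFn]
  rfl

theorem isQuantumTrace_necklaceTrace :
    IsQuantumTrace (fun X : Necklace V K => (necklaceTrace K V d X : DRep K d)) := by
  intro X N arr nxt hX hN hc
  dsimp only
  rw [necklaceTrace_sym hX, quantTrace, monoPoly_eq_sum hX hN hc, ← nsmul_eq_mul, map_nsmul,
    map_sum, nsmul_eq_mul]
  congr 1
  exact Finset.sum_congr rfl fun κ _ => (hOrder_prod_hMat arr _ _).2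

end IsQuantumTrace

end QuiverQuantization

end

open QuiverQuantization in
theorem mainTheorem7 {K : Type*} [Field K] [IsAlgClosed K] [CharZero K]
    {V : Type*} [Quiver V] [Fintype V] [DecidableEq V] [∀ i j : V, Fintype (i ⟶ j)]
    (d : V → ℕ) (hflat : MomentFlat K d) :
    ∃ Trq : Necklace V K →ₐ[K[X]] DInv K d,
      IsQuantumTrace (fun X => (Trq X : DRep K d)) ∧
    ∃ TrqRed : QReduction V K →ₐ[K[X]] HamReduction K d,
      (∀ X, TrqRed (QReduction.mk V K X) = HamReduction.mk K d (Trq X)) ∧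
    ∃ br : FunVariety K d →ₗ[K] FunVariety K d →ₗ[K] FunVariety K d,
      IsReducedBracket K d br ∧
    ∃ Φ : HamReductionZero K d ≃ₐ[K] FunVariety K d,
      (∀ D : DInv K d, (Φ (HamReductionZero.mk K d (HamReduction.mk K d D)) : FunFibre K d) =
        toFibre K d (symbol K d D)) ∧
      (∀ A B C : DInv K d, (Polynomial.X : K[X]) • C = A * B - B * A →
        Φ (HamReductionZero.mk K d (HamReduction.mk K d C)) =
          br (Φ (HamReductionZero.mk K d (HamReduction.mk K d A)))
            (Φ (HamReductionZero.mk K d (HamReduction.mk K d B)))) ∧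
      (∀ D : DInv K d, HamReduction.mk K d D = 0 ↔ (D : DRep K d) ∈ momentLeftIdeal K d) ∧
      (∀ x : PreprojCyc K V, ∃ X : Necklace V K, IsLifting K (QReduction.mk V K X) x) ∧
      ∀ (x y : PreprojCyc K V) (X Y : Necklace V K),
        IsLifting K (QReduction.mk V K X) x → IsLifting K (QReduction.mk V K Y) y →
        Φ (HamReductionZero.mk K d (TrqRed (QReduction.mk V K X))) = classicalTrace K d x ∧
        (∃ Z : Necklace V K, (Polynomial.X : K[X]) • Z = X * Y - Y * X) ∧
        ∀ Z : Necklace V K, (Polynomial.X : K[X]) • Z = X * Y - Y * X →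
          Φ (HamReductionZero.mk K d (TrqRed (QReduction.mk V K Z))) =
            br (classicalTrace K d x) (classicalTrace K d y) := by
  refine ⟨necklaceTrace K V d, isQuantumTrace_necklaceTrace, reducedTrace K V d, reducedTrace_mk,
    reducedBracket K d, isReducedBracket, hamZeroEquiv K V d,
    fun D => (congrArg Subtype.val (hamZeroEquiv_mk D)).trans (invSymbol_apply D),
    hamZeroEquiv_commutator, hamMk_eq_zero, exists_isLifting, fun x y X Y hX hY => ?_⟩
  refine ⟨hamZeroEquiv_of_isLifting hX, commutator_mem_hbarMultiples X Y, fun Z hZ => ?_⟩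
  rw [← hamZeroEquiv_of_isLifting hX, ← hamZeroEquiv_of_isLifting hY]
  simp only [reducedTrace_mk]
  -- No cancellation of $\hbar$ in the necklace algebra is needed. The trace carries the equation
  -- for `Z` into the invariant operators, where it determines the symbol.
  refine hamZeroEquiv_commutator _ _ _ ?_
  rw [← map_mul, ← map_mul, ← map_sub, ← hZ, map_smul]
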